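/- Let $K$ be an algebraically closed field and let $G$ be a classical group over $K$, that is, either a general linear group $\mathrm{GL}_{n+1}$ or an almost simple algebraic group (of any isogeny type) whose root system is of type $A_n$, $B_n$, $C_n$ or $D_n$. Assume that $\operatorname{char} K=0$ or $\operatorname{char} K>h_G$, the Coxeter number of $G$ ($h_G=n+1$ for $\mathrm{GL}_{n+1}$). Fix a maximal torus $T$ and a Borel subgroup $B=TU\supset T$ with unipotent radical $U$, let $\alpha_1,\dots,\alpha_n$ be the simple roots in their usual ordering (so that $\alpha_n=\chi_n$, $2\chi_n$, $\chi_{n-1}+\chi_n$ in types $B$, $C$, $D$ and $\alpha_i=\chi_i-\chi_{i+1}$ otherwise), and let $\mathrm{ht}$ denote the height of roots. Let $M\supseteq T$ be an admissible Levi subgroup, that is, the standard Levi subgroup with set of simple roots $\Delta_M=\{\alpha_{n-m+1},\dots,\alpha_n\}$, where $1\le m\le n$, and moreover $3\le m$ if $G$ is of type $D_n$. Let $\Phi_M$ be the root system of $M$, and let $d=h_M$ be its Coxeter number. Let $\mathfrak g=\operatorname{Lie}G$ and let $\mathfrak g_1$ (resp. $\mathfrak m_1$) be the sum of the root spaces $\mathfrak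 g_\alpha$ with $\alpha$ a root of $G$ (resp. of $M$) such that $\mathrm{ht}(\alpha)\equiv 1 \pmod d$. Let $G_0\subseteq G$ be the connected subgroup generated by $T$ and the root subgroups of the roots $\alpha$ with $d\mid\mathrm{ht}(\alpha)$; it acts on $\mathfrak g_1$ by the adjoint action. Put $U_0=U\cap G_0$. Let $\phi\in\mathfrak m_1^*$ be any generic functional, i.e. one that does not vanish on any root space contained in $\mathfrak m_1$; regard $\phi$ as an element of $\mathfrak g_1^*$ through the $T$-equivariant projection $\mathfrak g_1\to\mathfrak m_1$. Let $T_\phi$ and $U_\phi$ be the neutral components of the stabilizers of $\phi$ in $T$ and in $U_0$. Then the pair $(G,M)$ is toric: conjugation by $T_\phi$ preserves $U_0$ and $U_\phi$, and the resulting action of the torus $T_\phi$ on the variety $U_0/U_\phi$ has an open dense orbit whose stabilizer in $T_\phi$ is finite modulo the center $Z_G$ of $G$. -/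

import Mathlib

noncomputable section

namespace ToricPairs

open Matrix

section LieAlgebras

attribute [local instance 100] LieRing.ofAssociativeRing

/-- Labels for the vectors `χ_i - χ_j`, `χ_i + χ_j`, `-χ_i - χ_j`, `χ_i`, `-χ_i` of `ℤ^r`, where
`χ_0, …, χ_{r-1}` is the standard basis. The roots of the classical root systems are of this form. -/
inductive Root (r : ℕ) : Type
  | sub (i j : Fin r) : Root r
  | add (i j : Fin r) : Root r
  | negAdd (i j : Fin r) : Root r
  | pos (i : Fin r) : Root r
  | neg (i : Fin r) : Root r

/-- The vector of `ℤ^r` with a given label. -/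
def Root.vec {r : ℕ} : Root r → (Fin r → ℤ)
  | .sub i j => Pi.single i 1 - Pi.single j 1
  | .add i j => Pi.single i 1 + Pi.single j 1
  | .negAdd i j => -Pi.single i 1 - Pi.single j 1
  | .pos i => Pi.single i 1
  | .neg i => -Pi.single i 1

/-- A split reductive Lie algebra of matrices over `ℚ` (with the diagonal matrices in it as Cartan
subalgebra), together with its roots, its positive and simple roots, and a choice of root vectors.
This is a container of data only; it is filled in for each classical type below. -/
structure RootedLieAlgebra where
  /-- index type of the matrices -/
  I : Type
  [instFintype : Fintype I]
  [instDecEq : DecidableEq I]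
  /-- the Lie algebra -/
  L : LieSubalgebra ℚ (Matrix I I ℚ)
  /-- the number of coordinates `χ_i` -/
  r : ℕ
  /-- the number of simple roots -/
  n : ℕ
  /-- the set of roots -/
  roots : Set (Root r)
  /-- the set of positive roots -/
  posRoots : Set (Root r)
  /-- the simple roots `α_1, …, α_n` in their usual order (indexed from `0`) -/
  simple : Fin n → Root r
  /-- the coordinates of `2ρ^∨`, the sum of the positive coroots -/
  twoRho : Fin r → ℤ
  /-- the root vectors (only the values on `roots` matter) -/
  X : Root r → Matrix I I ℚ
  X_mem : ∀ α ∈ roots, X α ∈ L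

attribute [instance] RootedLieAlgebra.instFintype RootedLieAlgebra.instDecEq

/-! ### Type A -/

/-- Roots `χ_i - χ_j`, `i ≠ j`. -/
def IsRootA {r : ℕ} : Root r → Prop
  | .sub i j => i ≠ j
  | _ => False

/-- Positive roots `χ_i - χ_j`, `i < j`. -/
def IsPosRootA {r : ℕ} : Root r → Prop
  | .sub i j => i < j
  | _ => False

/-- The elementary matrix `E_{ij}` spans the root space of `χ_i - χ_j`. -/
def rootVecA {r : ℕ} : Root r → Matrix (Fin r) (Fin r) ℚ
  | .sub i j => Matrix.single i j 1
  | _ => 0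

/-- `α_i = χ_i - χ_{i+1}`. -/
def simpleA (n : ℕ) (k : Fin n) : Root (n + 1) := .sub k.castSucc k.succ

/-- `𝔤𝔩_{n+1}`. -/
def lieGL (n : ℕ) : RootedLieAlgebra where
  I := Fin (n + 1)
  L := ⊤
  r := n + 1
  n := n
  roots := {α | IsRootA α}
  posRoots := {α | IsPosRootA α}
  simple := simpleA n
  twoRho i := (n : ℤ) - 2 * (i : ℕ)
  X := rootVecA
  X_mem _ _ := LieSubalgebra.mem_top _

/-- `𝔰𝔩_{n+1}`. -/
def lieA (n : ℕ) : RootedLieAlgebra where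
  I := Fin (n + 1)
  L := LieAlgebra.SpecialLinear.sl (Fin (n + 1)) ℚ
  r := n + 1
  n := n
  roots := {α | IsRootA α}
  posRoots := {α | IsPosRootA α}
  simple := simpleA n
  twoRho i := (n : ℤ) - 2 * (i : ℕ)
  X := rootVecA
  X_mem := by
    rintro (⟨i, j⟩ | _ | _ | _ | _) h
    · exact LinearMap.mem_ker.2 (Matrix.trace_single_eq_of_ne i j 1 h)
    all_goals exact h.elim

/-! ### Type B -/

/-- Roots `±χ_i` and `±χ_i ± χ_j`, `i ≠ j` (each listed once). -/
def IsRootB {r : ℕ} : Root r → Prop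
  | .sub i j => i ≠ j
  | .add i j => i < j
  | .negAdd i j => i < j
  | .pos _ => True
  | .neg _ => True

/-- Positive roots `χ_i` and `χ_i ± χ_j`, `i < j`. -/
def IsPosRootB {r : ℕ} : Root r → Prop
  | .sub i j => i < j
  | .add i j => i < j
  | .negAdd _ _ => False
  | .pos _ => True
  | .neg _ => False

/-- Root vectors in `𝔰𝔬_{2n+1}`, the orthogonal Lie algebra of the form
`2 x₀² + 2 ∑ x_i x_{i'}`. -/
def rootVecB {n : ℕ} : Root n → Matrix (Unit ⊕ (Fin n ⊕ Fin n)) (Unit ⊕ (Fin n ⊕ Fin n)) ℚ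
  | .sub i j => Matrix.single (.inr (.inl i)) (.inr (.inl j)) 1
      - Matrix.single (.inr (.inr j)) (.inr (.inr i)) 1
  | .add i j => Matrix.single (.inr (.inl i)) (.inr (.inr j)) 1
      - Matrix.single (.inr (.inl j)) (.inr (.inr i)) 1
  | .negAdd i j => Matrix.single (.inr (.inr j)) (.inr (.inl i)) 1
      - Matrix.single (.inr (.inr i)) (.inr (.inl j)) 1
  | .pos i => Matrix.single (.inr (.inl i)) (.inl ()) 2
      - Matrix.single (.inl ()) (.inr (.inr i)) 1
  | .neg i => Matrix.single (.inl ()) (.inr (.inl i)) 1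
      - Matrix.single (.inr (.inr i)) (.inl ()) 2

/-- `α_i = χ_i - χ_{i+1}` for `i < n` and `α_n = χ_n`. -/
def simpleB (n : ℕ) (k : Fin n) : Root n :=
  if h : (k : ℕ) + 1 < n then .sub k ⟨k + 1, h⟩ else .pos k

/-- `𝔰𝔬_{2n+1}`. -/
def lieB (n : ℕ) : RootedLieAlgebra where
  I := Unit ⊕ (Fin n ⊕ Fin n)
  L := LieAlgebra.Orthogonal.typeB (Fin n) ℚ
  r := n
  n := n
  roots := {α | IsRootB α}
  posRoots := {α | IsPosRootB α}
  simple := simpleB n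
  twoRho i := 2 * ((n : ℤ) - (i : ℕ))
  X := rootVecB
  X_mem := by
    rintro (⟨i, j⟩ | ⟨i, j⟩ | ⟨i, j⟩ | i | i) - <;>
    · rw [LieAlgebra.Orthogonal.typeB, mem_skewAdjointMatricesLieSubalgebra, mem_skewAdjointMatricesSubmodule,
        Matrix.IsSkewAdjoint, Matrix.IsAdjointPair]
      ext (⟨⟩ | a | a) (⟨⟩ | b | b) <;>
      simp [rootVecB, LieAlgebra.Orthogonal.JB, LieAlgebra.Orthogonal.JD, Matrix.mul_apply,
        Matrix.single_apply, Matrix.one_apply, Finset.sum_ite_eq, ite_and] <;>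
      (try split_ifs) <;> simp_all

/-! ### Type C -/

/-- Roots `±χ_i ± χ_j`, `i ≠ j`, and `±2χ_i` (each listed once). -/
def IsRootC {r : ℕ} : Root r → Prop
  | .sub i j => i ≠ j
  | .add i j => i ≤ j
  | .negAdd i j => i ≤ j
  | _ => False

/-- Positive roots `χ_i - χ_j`, `i < j`, and `χ_i + χ_j`, `i ≤ j`. -/
def IsPosRootC {r : ℕ} : Root r → Prop
  | .sub i j => i < j
  | .add i j => i ≤ j
  | _ => False

/-- Root vectors in `𝔰𝔭_{2n}`. -/
def rootVecC {n : ℕ} : Root n → Matrix (Fin n ⊕ Fin n) (Fin n ⊕ Fin n) ℚ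
  | .sub i j => Matrix.single (.inl i) (.inl j) 1 - Matrix.single (.inr j) (.inr i) 1
  | .add i j => if i = j then Matrix.single (.inl i) (.inr i) 1
      else Matrix.single (.inl i) (.inr j) 1 + Matrix.single (.inl j) (.inr i) 1
  | .negAdd i j => if i = j then Matrix.single (.inr i) (.inl i) 1
      else Matrix.single (.inr j) (.inl i) 1 + Matrix.single (.inr i) (.inl j) 1
  | _ => 0

/-- `α_i = χ_i - χ_{i+1}` for `i < n` and `α_n = 2χ_n`. -/
def simpleC (n : ℕ) (k : Fin n) : Root n :=
  if h : (k : ℕ) + 1 < n then .sub k ⟨k + 1, h⟩ else .add k k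

/-- `𝔰𝔭_{2n}`. -/
def lieC (n : ℕ) : RootedLieAlgebra where
  I := Fin n ⊕ Fin n
  L := LieAlgebra.Symplectic.sp (Fin n) ℚ
  r := n
  n := n
  roots := {α | IsRootC α}
  posRoots := {α | IsPosRootC α}
  simple := simpleC n
  twoRho i := 2 * ((n : ℤ) - (i : ℕ)) - 1
  X := rootVecC
  X_mem := by
    rintro (⟨i, j⟩ | ⟨i, j⟩ | ⟨i, j⟩ | i | i) - <;>
    · rw [LieAlgebra.Symplectic.sp, mem_skewAdjointMatricesLieSubalgebra,
        mem_skewAdjointMatricesSubmodule, Matrix.IsSkewAdjoint, Matrix.IsAdjointPair]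
      simp only [rootVecC]
      try split_ifs
      all_goals
        ext (a | a) (b | b) <;>
        simp [Matrix.J, Matrix.mul_apply, Matrix.single_apply, Matrix.one_apply, ite_and] <;>
        grind

/-! ### Type D -/

/-- Roots `±χ_i ± χ_j`, `i ≠ j` (each listed once). -/
def IsRootD {r : ℕ} : Root r → Prop
  | .sub i j => i ≠ j
  | .add i j => i < j
  | .negAdd i j => i < j
  | _ => False

/-- Positive roots `χ_i ± χ_j`, `i < j`. -/
def IsPosRootD {r : ℕ} : Root r → Prop
  | .sub i j => i < j
  | .add i j => i < j
  | _ => False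

/-- Root vectors in `𝔰𝔬_{2n}`, the orthogonal Lie algebra of the form `2 ∑ x_i x_{i'}`. -/
def rootVecD {n : ℕ} : Root n → Matrix (Fin n ⊕ Fin n) (Fin n ⊕ Fin n) ℚ
  | .sub i j => Matrix.single (.inl i) (.inl j) 1 - Matrix.single (.inr j) (.inr i) 1
  | .add i j => Matrix.single (.inl i) (.inr j) 1 - Matrix.single (.inl j) (.inr i) 1
  | .negAdd i j => Matrix.single (.inr j) (.inl i) 1 - Matrix.single (.inr i) (.inl j) 1
  | _ => 0

/-- `α_i = χ_i - χ_{i+1}` for `i < n` and `α_n = χ_{n-1} + χ_n`. -/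
def simpleD (n : ℕ) (k : Fin n) : Root n :=
  if h : (k : ℕ) + 1 < n then .sub k ⟨k + 1, h⟩
  else .add ⟨(k : ℕ) - 1, lt_of_le_of_lt (Nat.sub_le _ _) k.2⟩ k

/-- `𝔰𝔬_{2n}`. -/
def lieD (n : ℕ) : RootedLieAlgebra where
  I := Fin n ⊕ Fin n
  L := LieAlgebra.Orthogonal.typeD (Fin n) ℚ
  r := n
  n := n
  roots := {α | IsRootD α}
  posRoots := {α | IsPosRootD α}
  simple := simpleD n
  twoRho i := 2 * ((n : ℤ) - 1 - (i : ℕ))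
  X := rootVecD
  X_mem := by
    rintro (⟨i, j⟩ | ⟨i, j⟩ | ⟨i, j⟩ | i | i) - <;>
    · rw [LieAlgebra.Orthogonal.typeD, mem_skewAdjointMatricesLieSubalgebra, mem_skewAdjointMatricesSubmodule,
        Matrix.IsSkewAdjoint, Matrix.IsAdjointPair]
      ext (a | a) (b | b) <;>
      simp [rootVecD, LieAlgebra.Orthogonal.JD, Matrix.mul_apply, Matrix.single_apply,
        Matrix.one_apply, Finset.sum_ite_eq, ite_and] <;>
      (try split_ifs) <;> simp_all

/-- The kinds of classical groups: `GL` stands for general linear groups, and `A`, `B`, `C`, `D`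
for almost simple groups with root system of that type. -/
inductive Kind : Type
  | GL | A | B | C | D

/-- The split Lie algebra over `ℚ` of a given kind, whose root system has rank `n`. -/
def Kind.lie : Kind → ℕ → RootedLieAlgebra
  | .GL, n => lieGL n
  | .A, n => lieA n
  | .B, n => lieB n
  | .C, n => lieC n
  | .D, n => lieD n

/-! ### Root combinatorics -/

namespace RootedLieAlgebra

variable (𝔤 : RootedLieAlgebra)

/-- The height `⟨ρ^∨, α⟩` of a root (the sum of its coefficients in the basis of simple roots). The
division by `2` is exact on roots. -/
def ht (α : Root 𝔤.r) : ℤ := (∑ i, 𝔤.twoRho i * α.vec i) / 2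

/-- The roots of the standard Levi subgroup whose simple roots are the `α_k`, `k ∈ S`. -/
def leviRoots (S : Set (Fin 𝔤.n)) : Set (Root 𝔤.r) :=
  {α | α ∈ 𝔤.roots ∧ α.vec ∈ Submodule.span ℤ ((fun k => (𝔤.simple k).vec) '' S)}

/-- The Coxeter number of a (nonempty, irreducible) set of roots: one more than the height of the
highest root. -/
def coxeter (R : Set (Root 𝔤.r)) : ℕ := sSup ((fun α => (𝔤.ht α).toNat) '' R) + 1

/-- The Coxeter number `h_M` of the standard Levi `M` with simple roots `α_k`, `k ∈ S`. -/
def leviCoxeter (S : Set (Fin 𝔤.n)) : ℕ := 𝔤.coxeter (𝔤.leviRoots S)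

end RootedLieAlgebra

/-! ### Chevalley's construction of split reductive groups -/

/-- A faithful finite-dimensional representation of `𝔤` over `ℚ`, written in a basis of weight
vectors of an admissible lattice, i.e. a lattice stable under all divided powers `X_α ^ k / k!`
of the root vectors. (Every admissible lattice is the sum of its intersections with the weight
spaces, so it always has such a basis.) -/
structure ChevalleyModule (𝔤 : RootedLieAlgebra) where
  /-- the rank of the lattice -/
  N : ℕ
  /-- the representation -/
  ρ : 𝔤.L →ₗ⁅ℚ⁆ Matrix (Fin N) (Fin N) ℚ
  faithful : Function.Injective ρ
  /-- the basis consists of weight vectors for the diagonal Cartan subalgebra -/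
  weightBasis : ∀ H : 𝔤.L, (H : Matrix 𝔤.I 𝔤.I ℚ).IsDiag → (ρ H).IsDiag
  /-- the matrix of the divided power `X_α ^ k / k!` on the lattice -/
  dp : Root 𝔤.r → ℕ → Matrix (Fin N) (Fin N) ℤ
  dp_spec : ∀ (α : Root 𝔤.r) (hα : α ∈ 𝔤.roots) (k : ℕ),
    (dp α k).map (Int.cast : ℤ → ℚ) = ((k.factorial : ℚ)⁻¹) • (ρ ⟨𝔤.X α, 𝔤.X_mem α hα⟩) ^ k

end LieAlgebras

/-! ### The Zariski topology -/

section Zariski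

variable {K : Type*} [Field K] {N : ℕ}

/-- The Zariski topology on `GL_N(K)`: a basis of open sets is given by the loci where a polynomial
in the matrix entries does not vanish. -/
@[reducible]
def zariski (K : Type*) [Field K] (N : ℕ) : TopologicalSpace (GL (Fin N) K) :=
  TopologicalSpace.generateFrom (Set.range fun f : MvPolynomial (Fin N × Fin N) K =>
    {g : GL (Fin N) K | MvPolynomial.eval (fun p => (g : Matrix (Fin N) (Fin N) K) p.1 p.2) f ≠ 0})

attribute [local instance] zariski

lemma continuous_mulLeft (a : GL (Fin N) K) : Continuous fun g : GL (Fin N) K => a * g := by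
  refine continuous_generateFrom_iff.2 ?_
  rintro _ ⟨f, rfl⟩
  refine TopologicalSpace.isOpen_generateFrom_of_mem ⟨MvPolynomial.bind₁ (fun p : Fin N × Fin N =>
    ∑ k, MvPolynomial.C ((a : Matrix (Fin N) (Fin N) K) p.1 k) *
      (MvPolynomial.X (k, p.2) : MvPolynomial (Fin N × Fin N) K)) f, ?_⟩
  ext g
  simp only [Set.mem_ofPred_eq, Set.mem_preimage, MvPolynomial.eval, MvPolynomial.eval₂Hom_bind₁]
  simp [Matrix.mul_apply]

/-- The neutral component `H°` of a subgroup `H` of `GL_N(K)` for the Zariski topology. -/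
def neutralComponent (H : Subgroup (GL (Fin N) K)) : Subgroup (GL (Fin N) K) where
  carrier := connectedComponentIn (H : Set (GL (Fin N) K)) 1
  one_mem' := mem_connectedComponentIn H.one_mem
  mul_mem' := by
    intro a b ha hb
    have haH : a ∈ H := connectedComponentIn_subset _ _ ha
    have h : (fun g => a * g) '' connectedComponentIn (H : Set (GL (Fin N) K)) 1 ⊆
        connectedComponentIn (H : Set (GL (Fin N) K)) a := by
      refine (isPreconnected_connectedComponentIn.image _
        (continuous_mulLeft a).continuousOn).subset_connectedComponentIn
          ⟨1, mem_connectedComponentIn H.one_mem, mul_one a⟩ ?_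
      rintro _ ⟨g, hg, rfl⟩
      exact H.mul_mem haH (connectedComponentIn_subset _ _ hg)
    rw [connectedComponentIn_eq ha]
    exact h ⟨b, hb, rfl⟩
  inv_mem' := by
    intro a ha
    have haH : a ∈ H := connectedComponentIn_subset _ _ ha
    have h : (fun g => a⁻¹ * g) '' connectedComponentIn (H : Set (GL (Fin N) K)) 1 ⊆
        connectedComponentIn (H : Set (GL (Fin N) K)) 1 := by
      refine (isPreconnected_connectedComponentIn.image _
        (continuous_mulLeft a⁻¹).continuousOn).subset_connectedComponentIn
          ⟨a, ha, inv_mul_cancel a⟩ ?_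
      rintro _ ⟨g, hg, rfl⟩
      exact H.mul_mem (H.inv_mem haH) (connectedComponentIn_subset _ _ hg)
    exact h ⟨1, mem_connectedComponentIn H.one_mem, mul_one _⟩

end Zariski

/-! ### The group of a Chevalley module and its subgroups -/

namespace ChevalleyModule

variable {𝔤 : RootedLieAlgebra} (V : ChevalleyModule 𝔤) (K : Type*) [Field K]

/-- The integral linear relations `∑ c_i μ_i = 0` among the weights `μ_i` of the basis vectors. -/
def WeightRelation (c : Fin V.N → ℤ) : Prop :=
  ∀ H : 𝔤.L, (H : Matrix 𝔤.I 𝔤.I ℚ).IsDiag → ∑ i, (c i : ℚ) * V.ρ H i i = 0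

/-- `Hom(Λ, Kˣ)`, where `Λ` is the lattice spanned by the weights `μ_i`: a homomorphism is recorded
by its values on the `μ_i`. -/
def weightChars : Subgroup (Fin V.N → Kˣ) where
  carrier := {d | ∀ c : Fin V.N → ℤ, V.WeightRelation c → ∏ i, d i ^ c i = 1}
  one_mem' := by intro c _; simp
  mul_mem' := by
    intro a b ha hb c hc
    simp [mul_zpow, Finset.prod_mul_distrib, ha c hc, hb c hc]
  inv_mem' := by
    intro a ha c hc
    simp [Finset.prod_inv_distrib, ha c hc]

/-- The split maximal torus `T`: the elements of `Hom(Λ, Kˣ)`, acting diagonally on the weight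
vectors. -/
def T : Subgroup (GL (Fin V.N) K) :=
  (V.weightChars K).map ((Units.map (Matrix.diagonalRingHom (Fin V.N) K).toMonoidHom).comp
    (MulEquiv.piUnits (M := fun _ : Fin V.N => K)).symm.toMonoidHom)

/-- The matrix `x_α(t) = exp(t X_α) = ∑ t^k X_α^k / k!` over `K` (`X_α` is nilpotent, so
`X_α ^ N = 0` and `x_α(t)` is unipotent, with inverse `x_α(-t)`). -/
def rootMatrix (α : Root 𝔤.r) (t : K) : Matrix (Fin V.N) (Fin V.N) K :=
  ∑ k ∈ Finset.range V.N, t ^ k • (V.dp α k).map (Int.cast : ℤ → K)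

/-- The subgroup generated by the root subgroups `{x_α(t) | t ∈ K}`, `α ∈ R`. -/
def rootGroup (R : Set (Root 𝔤.r)) : Subgroup (GL (Fin V.N) K) :=
  Subgroup.closure {g | ∃ α ∈ R, ∃ t : K, (g : Matrix (Fin V.N) (Fin V.N) K) = V.rootMatrix K α t}

/-- The split connected reductive group `G` (on `K`-points). -/
def G : Subgroup (GL (Fin V.N) K) := V.T K ⊔ V.rootGroup K 𝔤.roots

/-- The center `Z_G`. -/
def Z : Subgroup (GL (Fin V.N) K) :=
  V.G K ⊓ Subgroup.centralizer (V.G K : Set (GL (Fin V.N) K))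

/-- The unipotent radical `U` of the Borel subgroup `B = TU` of positive roots. -/
def U : Subgroup (GL (Fin V.N) K) := V.rootGroup K 𝔤.posRoots

/-- The connected subgroup `G_0` with Lie algebra `𝔤_0`, the sum of the Cartan subalgebra and of the
root spaces of height divisible by `d`. -/
def G₀ (d : ℕ) : Subgroup (GL (Fin V.N) K) :=
  V.T K ⊔ V.rootGroup K {α | α ∈ 𝔤.roots ∧ 𝔤.ht α ≡ 0 [ZMOD d]}

/-- `U_0 = U ∩ G_0`. -/
def U₀ (d : ℕ) : Subgroup (GL (Fin V.N) K) := V.U K ⊓ V.G₀ K d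

/-- The root vector `X_α` over `K`. -/
def rootVector (α : Root 𝔤.r) : Matrix (Fin V.N) (Fin V.N) K :=
  (V.dp α 1).map (Int.cast : ℤ → K)

/-- `𝔤_1`, the sum of the root spaces of height congruent to `1` modulo `d` (for `d ≥ 2`). -/
def g₁ (d : ℕ) : Submodule K (Matrix (Fin V.N) (Fin V.N) K) :=
  Submodule.span K (V.rootVector K '' {α | α ∈ 𝔤.roots ∧ 𝔤.ht α ≡ 1 [ZMOD d]})

variable {K}

/-- The functional `φ` on `𝔤_1` is obtained from a generic functional on `𝔪_1` through the
`T`-equivariant projection `𝔤_1 → 𝔪_1`, where `d` is the Coxeter number of `M`: it is nonzero on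
the root spaces of `𝔤_1` that lie in `𝔪_1`, and zero on the other ones. -/
def IsGeneric (S : Set (Fin 𝔤.n)) {d : ℕ} (φ : Module.Dual K (V.g₁ K d)) : Prop :=
  ∀ (α : Root 𝔤.r) (hα : α ∈ 𝔤.roots ∧ 𝔤.ht α ≡ 1 [ZMOD d]),
    φ ⟨V.rootVector K α, Submodule.subset_span ⟨α, hα, rfl⟩⟩ ≠ 0 ↔ α ∈ 𝔤.leviRoots S

/-- `Ad(g)` maps `𝔤_1` to itself and `φ ∘ Ad(g) = φ` on `𝔤_1`. -/
def Fixes {d : ℕ} (φ : Module.Dual K (V.g₁ K d)) (g : GL (Fin V.N) K) : Prop :=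
  ∀ Y : V.g₁ K d, ∃ Y' : V.g₁ K d, (Y' : Matrix (Fin V.N) (Fin V.N) K) =
    (g : Matrix (Fin V.N) (Fin V.N) K) * (Y : Matrix (Fin V.N) (Fin V.N) K) *
      ((g⁻¹ : GL (Fin V.N) K) : Matrix (Fin V.N) (Fin V.N) K) ∧ φ Y' = φ Y

/-- The stabilizer of `φ` in the normalizer of `𝔤_1`; since `G_0` preserves `𝔤_1`, the stabilizer of
`φ` in a subgroup of `G_0` is the intersection with this group. -/
def stab {d : ℕ} (φ : Module.Dual K (V.g₁ K d)) : Subgroup (GL (Fin V.N) K) where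
  carrier := {g | V.Fixes φ g ∧ V.Fixes φ g⁻¹}
  one_mem' := by
    refine ⟨fun Y => ⟨Y, by simp, rfl⟩, fun Y => ⟨Y, by simp, rfl⟩⟩
  mul_mem' := by
    have key : ∀ a b, V.Fixes φ a → V.Fixes φ b → V.Fixes φ (a * b) := by
      intro a b ha hb Y
      obtain ⟨Y₁, h₁, e₁⟩ := hb Y
      obtain ⟨Y₂, h₂, e₂⟩ := ha Y₁
      refine ⟨Y₂, ?_, e₂.trans e₁⟩
      rw [h₂, h₁, _root_.mul_inv_rev, Units.val_mul, Units.val_mul]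
      simp only [mul_assoc]
    rintro a b ⟨ha, ha'⟩ ⟨hb, hb'⟩
    refine ⟨key a b ha hb, ?_⟩
    rw [_root_.mul_inv_rev]
    exact key _ _ hb' ha'
  inv_mem' := by
    rintro a ⟨ha, ha'⟩
    exact ⟨ha', by rwa [inv_inv]⟩

/-- `T_φ`, the connected stabilizer of `φ` in `T`. -/
def Tφ {d : ℕ} (φ : Module.Dual K (V.g₁ K d)) : Subgroup (GL (Fin V.N) K) :=
  neutralComponent (V.T K ⊓ V.stab φ)

/-- `U_φ`, the connected stabilizer of `φ` in `U_0`. -/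
def Uφ {d : ℕ} (φ : Module.Dual K (V.g₁ K d)) : Subgroup (GL (Fin V.N) K) :=
  neutralComponent (V.U₀ K d ⊓ V.stab φ)

/-- The quotient `U_0 / U_φ`. -/
abbrev Quot₀ {d : ℕ} (φ : Module.Dual K (V.g₁ K d)) : Type _ :=
  V.U₀ K d ⧸ (V.Uφ φ).subgroupOf (V.U₀ K d)

/-- The Zariski topology on `U_0 / U_φ`. It is the quotient of the Zariski topology on `U_0`, because
`U_0 → U_0 / U_φ` is a surjective open morphism. -/
@[reducible]
def zariskiQuot {d : ℕ} (φ : Module.Dual K (V.g₁ K d)) : TopologicalSpace (V.Quot₀ φ) :=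
  letI := zariski K V.N
  inferInstance

/-- The orbit of the class `u U_φ` under the action of `T_φ` on `U_0 / U_φ` by conjugation. -/
def orbit {d : ℕ} (φ : Module.Dual K (V.g₁ K d)) (u : V.U₀ K d) : Set (V.Quot₀ φ) :=
  {x | ∃ t ∈ V.Tφ φ, ∃ w : V.U₀ K d, (w : GL (Fin V.N) K) = t * u * t⁻¹ ∧
    x = (QuotientGroup.mk w : V.Quot₀ φ)}

/-- The stabilizer in `T_φ` of the class `u U_φ`. -/
def orbitStab {d : ℕ} (φ : Module.Dual K (V.g₁ K d)) (u : V.U₀ K d) : Set (GL (Fin V.N) K) :=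
  {t | t ∈ V.Tφ φ ∧ (u : GL (Fin V.N) K)⁻¹ * (t * u * t⁻¹) ∈ V.Uφ φ}

variable (K)

/-- The pair `(G, M)` is toric, where `M` is the standard Levi subgroup with simple roots `α_k`,
`k ∈ S`, and `d` is its Coxeter number: for every generic functional `φ`, conjugation by `T_φ`
preserves `U_0` and `U_φ`, and the resulting action of `T_φ` on `U_0 / U_φ` has an open dense orbit
whose stabilizer is finite modulo the center of `G`. -/
def IsToric (S : Set (Fin 𝔤.n)) : Prop :=
  ∀ φ : Module.Dual K (V.g₁ K (𝔤.leviCoxeter S)), V.IsGeneric S φ →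
    (∀ t ∈ V.Tφ φ, ∀ u ∈ V.U₀ K (𝔤.leviCoxeter S), t * u * t⁻¹ ∈ V.U₀ K (𝔤.leviCoxeter S)) ∧
    (∀ t ∈ V.Tφ φ, ∀ u ∈ V.Uφ φ, t * u * t⁻¹ ∈ V.Uφ φ) ∧
    ∃ u : V.U₀ K (𝔤.leviCoxeter S),
      @IsOpen _ (V.zariskiQuot φ) (V.orbit φ u) ∧
      @Dense _ (V.zariskiQuot φ) (V.orbit φ u) ∧
      ∃ F : Set (GL (Fin V.N) K), F.Finite ∧
        ∀ t ∈ V.orbitStab φ u, ∃ f ∈ F, ∃ z ∈ V.Z K, t = f * z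

end ChevalleyModule

/-- The simple roots `α_{n-m+1}, …, α_n` of the admissible Levi subgroup with `m` simple roots
(the simple root `α_k` has index `k - 1` in `Fin n`). -/
def admissible (𝔤 : RootedLieAlgebra) (m : ℕ) : Set (Fin 𝔤.n) := {k | 𝔤.n ≤ (k : ℕ) + m}

/-- The range of `m`: `1 ≤ m ≤ n`, and `3 ≤ m ≤ n` in type D. -/
def Kind.IsAdmissible : Kind → ℕ → ℕ → Prop
  | .D, n, m => 3 ≤ m ∧ m ≤ n
  | _, n, m => 1 ≤ m ∧ m ≤ n

end ToricPairs

end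

/-! A class u U_φ is determined by the moved functional Y ↦ φ(u⁻¹ Y u) on 𝔤_1, whose values are
written `ell`. The theorem follows once n - m of these values, one for each coordinate χ_c with c <
n - m (the outer coordinates), are shown to determine the functional, and T_φ is shown to rescale
them independently.

Conjugation by U_0 on 𝔤_1 only involves structure constants of root vectors, so it has the same
matrix in every representation (`exists_word_conj`). The functional can therefore be computed in the
defining representation, where φ becomes Y ↦ tr(F Y) with F of degree -1 (`dualMatrix`), and u acts
through a matrix w as w F w⁻¹ (`IntRep.word`, `ell_word`). A weight is inner if its outer
coordinates vanish. Since φ comes from a generic functional on 𝔪_1, the entry F_jk is nonzero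
exactly when j and k are inner and the height of k exceeds that of j by 1 modulo d: F is a cyclic
shift of the residues of the heights. The matrix w preserves these residues and strictly raises the
linear form `lam`, which vanishes on inner weights; so w is the identity on the inner block, and w F
w⁻¹ is determined by w F and F w⁻¹.

In the row of w F of an outer weight χ_c the only possible nonzero columns are the inner ones of one
residue. In types B and D a residue may be shared by two inner weights, but the class preceding or
following it is then a singleton (in type D because m ≥ 3). In all cases one entry of the row
determines the row. The columns of F w⁻¹ with outer weight -χ_c are mirror images of those rows
through the invariant form. This is `LeviData.conj_eq_of`. The chosen entries are the values of the
moved functional on the `Selected` roots, namely an inner weight minus χ_c.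

The cocharacters along outer coordinates kill the roots of M, so they lie in T_φ, and a selected
root has exactly one nonzero outer coordinate, equal to -1. The locus where all selected values are
nonzero is thus a single orbit. It is open because it is given by polynomials; it is nonempty and
dense because U_0 is irreducible (`isPreirreducible_rg`). An element stabilizing a point of it is
trivial on the selected roots and on the simple roots of M, which together generate the root
lattice, so it is central (`mem_Z_of_trivial`).

Two identifications support this. U ∩ G_0 is generated by the root subgroups of positive roots of
height divisible by d (`U₀_eq`), by a comparison of supports of matrices. U_φ is the whole
stabilizer of φ in U_0 (`Uφ_eq`), because a cocharacter of T_φ contracts that stabilizer to 1.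
Relations between root elements over K are proved with exponentials over ℚ[a, b], descended to ℤ[a,
b] and specialised. The facts on weights and heights are collected in `StdData` and `LeviData` and
checked for each type. -/

noncomputable section

namespace ToricPairs
open Matrix

/-! ### Exponentials of nilpotent elements and their commutation. -/

section Exponential

variable {A : Type*} [Ring A] [Algebra ℚ A]

theorem exp_mulLeft_apply {X : A} (hX : IsNilpotent X) (Y : A) :
    IsNilpotent.exp (LinearMap.mulLeft ℚ X) Y = IsNilpotent.exp X * Y := by
  have := IsNilpotent.map_exp hX (Algebra.lmul ℚ A)
  exact (congrArg (fun f : Module.End ℚ A => f Y) this).symm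

theorem exp_mulRight_apply {X : A} (hX : IsNilpotent X) (Y : A) :
    IsNilpotent.exp (LinearMap.mulRight ℚ X) Y = Y * IsNilpotent.exp X := by
  obtain ⟨k, hk⟩ := hX
  have hk' : (LinearMap.mulRight ℚ X) ^ k = 0 := by
    rw [LinearMap.pow_mulRight, hk, LinearMap.mulRight_zero_eq_zero]
  rw [IsNilpotent.exp_eq_sum hk, IsNilpotent.exp_eq_sum hk', Finset.mul_sum, LinearMap.sum_apply]
  refine Finset.sum_congr rfl fun i _ => ?_
  rw [LinearMap.pow_mulRight, LinearMap.smul_apply, LinearMap.mulRight_apply, mul_smul_comm]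

/-- Left and right multiplication by X commute and differ by ad X, so exp(l) = exp(r) exp(ad X). The
hypotheses stop the series of exp(ad X) at Y after the quadratic term, and `Z₂` already contains the
factor 1/2. -/
theorem exp_mul_eq {X Y Z₁ Z₂ : A} (hX : IsNilpotent X) (h₁ : X * Y - Y * X = Z₁)
    (h₂ : X * Z₁ - Z₁ * X = (2 : ℚ) • Z₂) (h₃ : X * Z₂ = Z₂ * X) :
    IsNilpotent.exp X * Y = (Y + Z₁ + Z₂) * IsNilpotent.exp X := by
  set l := LinearMap.mulLeft ℚ X with hl
  set r := LinearMap.mulRight ℚ X with hr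
  have hlr : Commute l r := LinearMap.commute_mulLeft_right X X
  have nl : IsNilpotent l := hX.map (Algebra.lmul ℚ A)
  have nr : IsNilpotent r := by
    obtain ⟨k, hk⟩ := hX
    exact ⟨k, by rw [hr, LinearMap.pow_mulRight, hk, LinearMap.mulRight_zero_eq_zero]⟩
  have nlr : IsNilpotent (l - r) := hlr.isNilpotent_sub nl nr
  have hc : Commute r (l - r) := (hlr.symm).sub_right (Commute.refl r)
  have e1 : (l - r) Y = Z₁ := h₁
  have e2 : (l - r) Z₁ = (2 : ℚ) • Z₂ := h₂
  have e3 : (l - r) Z₂ = 0 := sub_eq_zero.2 h₃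
  have p2 : ((l - r) ^ 2) Y = (2 : ℚ) • Z₂ := by
    rw [pow_two, Module.End.mul_apply, e1, e2]
  have p3 : ((l - r) ^ 3) Y = 0 := by
    rw [pow_succ', Module.End.mul_apply, p2, map_smul, e3, smul_zero]
  have h := IsNilpotent.exp_smul_eq_sum (a := l - r) (m := Y) (k := 3) p3 nlr
  have h' : IsNilpotent.exp (l - r) Y = Y + Z₁ + Z₂ := by
    change IsNilpotent.exp (l - r) • Y = _
    rw [h, Finset.sum_range_succ, Finset.sum_range_succ, Finset.sum_range_one]
    simp only [Module.End.smul_def, pow_one, p2, e1, pow_zero, Module.End.one_apply]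
    rw [smul_smul]
    norm_num
  rw [← exp_mulLeft_apply hX, ← h', ← exp_mulRight_apply hX, ← Module.End.mul_apply,
    ← IsNilpotent.exp_add_of_commute hc nr nlr, add_sub_cancel]

/-- Conjugation by exp X carries each power of Y to the same power of Y + Z₁ + Z₂, so it carries exp
Y to the exponential of that sum, which factors because the three terms commute. -/
theorem exp_mul_exp_eq {X Y Z₁ Z₂ : A} (hX : IsNilpotent X) (hY : IsNilpotent Y)
    (hZ₁ : IsNilpotent Z₁) (hZ₂ : IsNilpotent Z₂) (h₁ : X * Y - Y * X = Z₁)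
    (h₂ : X * Z₁ - Z₁ * X = (2 : ℚ) • Z₂) (h₃ : X * Z₂ = Z₂ * X)
    (c₁ : Commute Y Z₁) (c₂ : Commute Y Z₂) (c₁₂ : Commute Z₁ Z₂) :
    IsNilpotent.exp X * IsNilpotent.exp Y =
      IsNilpotent.exp Y * IsNilpotent.exp Z₁ * IsNilpotent.exp Z₂ * IsNilpotent.exp X := by
  have n₁ : IsNilpotent (Y + Z₁) := c₁.isNilpotent_add hY hZ₁
  have cc : Commute (Y + Z₁) Z₂ := c₂.add_left c₁₂
  have n₂ : IsNilpotent (Y + Z₁ + Z₂) := cc.isNilpotent_add n₁ hZ₂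
  rw [← IsNilpotent.exp_add_of_commute c₁ hY hZ₁, ← IsNilpotent.exp_add_of_commute cc n₁ hZ₂]
  have h := exp_mul_eq hX h₁ h₂ h₃
  obtain ⟨k, hk⟩ := hY
  obtain ⟨l, hl⟩ := n₂
  have hk' : Y ^ (k + l) = 0 := by rw [pow_add, hk, zero_mul]
  have hl' : (Y + Z₁ + Z₂) ^ (k + l) = 0 := by rw [pow_add, hl, mul_zero]
  have hp : ∀ i, IsNilpotent.exp X * Y ^ i = (Y + Z₁ + Z₂) ^ i * IsNilpotent.exp X := by
    intro i
    induction i with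
    | zero => simp
    | succ i ih => rw [pow_succ, ← mul_assoc, ih, mul_assoc, h, ← mul_assoc, ← pow_succ]
  rw [IsNilpotent.exp_eq_sum hk', IsNilpotent.exp_eq_sum hl', Finset.mul_sum, Finset.sum_mul]
  refine Finset.sum_congr rfl fun i _ => ?_
  rw [mul_smul_comm, hp, smul_mul_assoc]

end Exponential

/-! ### The standard representation -/

namespace Root

/-- The label of the opposite root. -/
def opp {r : ℕ} : Root r → Root r
  | .sub i j => .sub j i
  | .add i j => .negAdd i j
  | .negAdd i j => .add i j
  | .pos i => .neg i
  | .neg i => .pos i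

theorem vec_opp {r : ℕ} (α : Root r) : α.opp.vec = -α.vec := by
  cases α <;> simp [opp, vec] <;> abel

theorem opp_opp {r : ℕ} (α : Root r) : α.opp.opp = α := by
  cases α <;> rfl

instance finite (r : ℕ) : Finite (Root r) := by
  let f : (Fin r × Fin r) ⊕ (Fin r × Fin r) ⊕ (Fin r × Fin r) ⊕ Fin r ⊕ Fin r → Root r :=
    fun x => match x with
    | .inl p => .sub p.1 p.2
    | .inr (.inl p) => .add p.1 p.2
    | .inr (.inr (.inl p)) => .negAdd p.1 p.2
    | .inr (.inr (.inr (.inl i))) => .pos i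
    | .inr (.inr (.inr (.inr i))) => .neg i
  refine Finite.of_surjective f ?_
  rintro (⟨i, j⟩ | ⟨i, j⟩ | ⟨i, j⟩ | i | i)
  exacts [⟨.inl (i, j), rfl⟩, ⟨.inr (.inl (i, j)), rfl⟩, ⟨.inr (.inr (.inl (i, j))), rfl⟩,
    ⟨.inr (.inr (.inr (.inl i))), rfl⟩, ⟨.inr (.inr (.inr (.inr i))), rfl⟩]

end Root

/-- The facts about the defining representation of a classical Lie algebra and its root system from
which everything else is deduced. -/
structure StdData (𝔤 : RootedLieAlgebra) where
  wt : 𝔤.I → Fin 𝔤.r → ℤ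
  wt_inj : Function.Injective wt
  X : Root 𝔤.r → Matrix 𝔤.I 𝔤.I ℤ
  map_X : ∀ α ∈ 𝔤.roots, (X α).map (Int.cast : ℤ → ℚ) = 𝔤.X α
  supp : ∀ α ∈ 𝔤.roots, ∀ i j, X α i j ≠ 0 ↔ wt i - wt j = α.vec
  natAbs_le : ∀ α ∈ 𝔤.roots, ∀ i j, (X α i j).natAbs ≤ 2
  unit_entry : ∀ α ∈ 𝔤.roots, ∃ i j, (X α i j).natAbs = 1
  -- The divided square X_α² / 2. Its integrality is what makes the second divided commutators
  -- integral.
  S : Root 𝔤.r → Matrix 𝔤.I 𝔤.I ℤ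
  sq : ∀ α ∈ 𝔤.roots, X α * X α = (2 : ℤ) • S α
  cube : ∀ α ∈ 𝔤.roots, X α * S α = 0
  weight_space : ∀ A ∈ 𝔤.L, ∀ v : Fin 𝔤.r → ℤ, v ≠ 0 → (∀ i j, A i j ≠ 0 → wt i - wt j = v) →
    A = 0 ∨ ∃ α ∈ 𝔤.roots, α.vec = v ∧ ∃ c : ℚ, A = c • 𝔤.X α
  H : Fin 𝔤.r → Matrix 𝔤.I 𝔤.I ℚ
  H_mem : ∀ a, H a ∈ 𝔤.L
  -- The scalar s allows a traceless choice for 𝔰𝔩; commutators, and hence differences of weights,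
  -- do not see it.
  H_apply : ∀ a, ∃ s : ℚ, H a = Matrix.diagonal fun i => (wt i a : ℚ) + s
  H_span : ∀ A ∈ 𝔤.L, A.IsDiag → ∃ η : Fin 𝔤.r → ℚ, A = ∑ a, η a • H a
  -- Squared lengths differ at most by a factor of two. Together with integrality of inner products
  -- this bounds all root strings below.
  norm : (∀ α ∈ 𝔤.roots, α.vec ⬝ᵥ α.vec = 1 ∨ α.vec ⬝ᵥ α.vec = 2) ∨
    (∀ α ∈ 𝔤.roots, α.vec ⬝ᵥ α.vec = 2 ∨ α.vec ⬝ᵥ α.vec = 4)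
  vec_inj : ∀ α ∈ 𝔤.roots, ∀ β ∈ 𝔤.roots, α.vec = β.vec → α = β
  opp_mem : ∀ α ∈ 𝔤.roots, α.opp ∈ 𝔤.roots
  two_mul_ht : ∀ α ∈ 𝔤.roots, 2 * 𝔤.ht α = 𝔤.twoRho ⬝ᵥ α.vec
  mem_pos : ∀ α, α ∈ 𝔤.posRoots ↔ α ∈ 𝔤.roots ∧ 0 < 𝔤.ht α
  trace_ne : ∀ α ∈ 𝔤.roots, (X α * X α.opp).trace ∈ ({1, 2, 4} : Set ℤ)
  sl2 : ∀ α ∈ 𝔤.roots, (X α * X α.opp - X α.opp * X α) * X α -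
    X α * (X α * X α.opp - X α.opp * X α) = (2 : ℤ) • X α

/-! ### Root strings and integral brackets in the defining representation. -/

namespace StdData

variable {𝔤 : RootedLieAlgebra} (D : StdData 𝔤)

include D in
theorem ht_of_vec {α β γ : Root 𝔤.r} (hα : α ∈ 𝔤.roots) (hβ : β ∈ 𝔤.roots) (hγ : γ ∈ 𝔤.roots)
    {k l : ℤ} (h : γ.vec = k • α.vec + l • β.vec) : 𝔤.ht γ = k * 𝔤.ht α + l * 𝔤.ht β := by
  have h₁ := D.two_mul_ht α hα
  have h₂ := D.two_mul_ht β hβ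
  have h₃ := D.two_mul_ht γ hγ
  rw [h, dotProduct_add, dotProduct_smul, dotProduct_smul, smul_eq_mul, smul_eq_mul, ← h₁, ← h₂] at h₃
  linarith

theorem dot_nonneg {r : ℕ} (v : Fin r → ℤ) : 0 ≤ v ⬝ᵥ v := by
  rw [dotProduct]; exact Finset.sum_nonneg fun i _ => mul_self_nonneg _

theorem dot_expand {r : ℕ} (v w : Fin r → ℤ) (k l : ℤ) :
    (k • v + l • w) ⬝ᵥ (k • v + l • w) =
      k * k * (v ⬝ᵥ v) + 2 * (k * l) * (v ⬝ᵥ w) + l * l * (w ⬝ᵥ w) := by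
  simp only [add_dotProduct, dotProduct_add, smul_dotProduct, dotProduct_smul, smul_eq_mul,
    dotProduct_comm w v]
  ring

theorem map_sub' {I : Type*} (A B : Matrix I I ℤ) :
    (A - B).map (Int.cast : ℤ → ℚ) = A.map Int.cast - B.map Int.cast := by
  ext; simp

theorem map_mul' {I R : Type*} [Fintype I] [CommRing R] (A B : Matrix I I ℤ) :
    (A * B).map (Int.cast : ℤ → R) = A.map Int.cast * B.map Int.cast :=
  Matrix.map_mul (f := Int.castRingHom R)

include D in
theorem norm_cases {α β : Root 𝔤.r} (hα : α ∈ 𝔤.roots) (hβ : β ∈ 𝔤.roots) :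
    ((α.vec ⬝ᵥ α.vec = 1 ∨ α.vec ⬝ᵥ α.vec = 2) ∧ (β.vec ⬝ᵥ β.vec = 1 ∨ β.vec ⬝ᵥ β.vec = 2) ∧
      ∀ γ ∈ 𝔤.roots, γ.vec ⬝ᵥ γ.vec = 1 ∨ γ.vec ⬝ᵥ γ.vec = 2) ∨
    ((α.vec ⬝ᵥ α.vec = 2 ∨ α.vec ⬝ᵥ α.vec = 4) ∧ (β.vec ⬝ᵥ β.vec = 2 ∨ β.vec ⬝ᵥ β.vec = 4) ∧
      ∀ γ ∈ 𝔤.roots, γ.vec ⬝ᵥ γ.vec = 2 ∨ γ.vec ⬝ᵥ γ.vec = 4) := by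
  rcases D.norm with h | h
  · exact Or.inl ⟨h α hα, h β hβ, h⟩
  · exact Or.inr ⟨h α hα, h β hβ, h⟩

include D in
theorem dot_pos {α : Root 𝔤.r} (hα : α ∈ 𝔤.roots) : 0 < α.vec ⬝ᵥ α.vec := by
  rcases D.norm_cases hα hα with ⟨h | h, -⟩ | ⟨h | h, -⟩ <;> omega

include D in
theorem vec_ne_zero {α : Root 𝔤.r} (hα : α ∈ 𝔤.roots) : α.vec ≠ 0 := by
  intro h
  have := D.dot_pos hα
  rw [h] at this
  simp at this

/-- A vector of the form `k α + l β`. -/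
def comb (α β : Root 𝔤.r) (k l : ℤ) : Fin 𝔤.r → ℤ := k • α.vec + l • β.vec

theorem dot_add_pos {r : ℕ} {v w : Fin r → ℤ} (h : v + w ≠ 0) :
    0 < v ⬝ᵥ v + 2 * (v ⬝ᵥ w) + w ⬝ᵥ w := by
  have h₁ := dot_expand v w 1 1
  have h₂ := dot_nonneg (v + w)
  have h₃ : (v + w) ⬝ᵥ (v + w) ≠ 0 := fun e => h (dotProduct_self_eq_zero.1 e)
  simp only [one_smul] at h₁
  omega

include D in
/-- For roots `α ≠ -β`, the vectors `2α + β` and `3α + β` are nonzero, and `3α + β` is not a root. -/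
theorem comb_three {α β : Root 𝔤.r} (hα : α ∈ 𝔤.roots) (hβ : β ∈ 𝔤.roots)
    (h : α.vec + β.vec ≠ 0) : comb α β 2 1 ≠ 0 ∧ comb α β 3 1 ≠ 0 ∧
      ∀ γ ∈ 𝔤.roots, γ.vec ≠ comb α β 3 1 := by
  have hp := dot_add_pos h
  have h21 := dot_expand α.vec β.vec 2 1
  have h31 := dot_expand α.vec β.vec 3 1
  set a := α.vec ⬝ᵥ α.vec
  set b := β.vec ⬝ᵥ β.vec
  set c := α.vec ⬝ᵥ β.vec
  have hn21 := dot_nonneg ((2 : ℤ) • α.vec + (1 : ℤ) • β.vec)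
  refine ⟨fun e => ?_, fun e => ?_, fun γ hγ e => ?_⟩
  · have e' : β.vec = (-2 : ℤ) • α.vec := by
      rw [comb] at e
      ext i
      have := congrFun e i
      simp at this ⊢
      omega
    have : b = 4 * a := by
      simp only [a, b, e', smul_dotProduct, dotProduct_smul, smul_eq_mul]
      ring
    rcases D.norm_cases hα hβ with ⟨h1 | h1, h2 | h2, -⟩ | ⟨h1 | h1, h2 | h2, -⟩ <;> omega
  · have e' : β.vec = (-3 : ℤ) • α.vec := by
      rw [comb] at e
      ext i
      have := congrFun e i
      simp at this ⊢
      omega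
    have : b = 9 * a := by
      simp only [a, b, e', smul_dotProduct, dotProduct_smul, smul_eq_mul]
      ring
    rcases D.norm_cases hα hβ with ⟨h1 | h1, h2 | h2, -⟩ | ⟨h1 | h1, h2 | h2, -⟩ <;> omega
  -- Since α + β ≠ 0, |3α + β|² = 3|α + β|² + 6|α|² - 2|β|² exceeds every admissible squared length.
  · rw [comb] at e
    rw [← e] at h31
    rcases D.norm_cases hα hβ with ⟨h1 | h1, h2 | h2, h3⟩ | ⟨h1 | h1, h2 | h2, h3⟩ <;>
      rcases h3 γ hγ with h3 | h3 <;> omega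

include D in
/-- For roots `α ≠ -β`, at most one of `2α + β` and `α + 2β` is a root. -/
theorem comb_two {α β : Root 𝔤.r} (hα : α ∈ 𝔤.roots) (hβ : β ∈ 𝔤.roots)
    (h : α.vec + β.vec ≠ 0) (γ δ : Root 𝔤.r) (hγ : γ ∈ 𝔤.roots) (hδ : δ ∈ 𝔤.roots)
    (eγ : γ.vec = comb α β 2 1) (eδ : δ.vec = comb α β 1 2) : False := by
  have hp := dot_add_pos h
  have h21 := dot_expand α.vec β.vec 2 1
  have h12 := dot_expand α.vec β.vec 1 2
  rw [comb] at eγ eδ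
  rw [← eγ] at h21
  rw [← eδ] at h12
  -- The two squared lengths add up to 4|α + β|² + |α|² + |β|², which is too large for two roots, up
  -- to a borderline case excluded by integrality.
  rcases D.norm_cases hα hβ with ⟨h1 | h1, h2 | h2, h3⟩ | ⟨h1 | h1, h2 | h2, h3⟩ <;>
      rcases h3 γ hγ with h4 | h4 <;> rcases h3 δ hδ with h5 | h5 <;> omega

include D in
/-- For roots `α ≠ -β`, neither `2α + 2β` nor `3α + 2β` is a root. -/
theorem comb_high {α β : Root 𝔤.r} (hα : α ∈ 𝔤.roots) (hβ : β ∈ 𝔤.roots)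
    (h : α.vec + β.vec ≠ 0) (γ : Root 𝔤.r) (hγ : γ ∈ 𝔤.roots) :
    γ.vec ≠ comb α β 2 2 ∧ γ.vec ≠ comb α β 3 2 := by
  have hp := dot_add_pos h
  have h22 := dot_expand α.vec β.vec 2 2
  have h32 := dot_expand α.vec β.vec 3 2
  have h31 := dot_expand α.vec β.vec 3 1
  have h21 := dot_expand α.vec β.vec 2 1
  have n21 := dot_nonneg ((2 : ℤ) • α.vec + (1 : ℤ) • β.vec)
  -- |2α + 2β|² = 4|α + β|² and |3α + 2β|² = 6|α + β|² + 3|α|² - 2|β|². When the lengths are 2 and 4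
  -- the number |α + β|² is even, so both values are too large in either normalization.
  constructor <;> intro e <;> rw [comb] at e
  · rw [← e] at h22
    rcases D.norm_cases hα hβ with ⟨h1 | h1, h2 | h2, h3⟩ | ⟨h1 | h1, h2 | h2, h3⟩ <;>
      rcases h3 γ hγ with h4 | h4 <;> omega
  · rw [← e] at h32
    rcases D.norm_cases hα hβ with ⟨h1 | h1, h2 | h2, h3⟩ | ⟨h1 | h1, h2 | h2, h3⟩ <;>
      rcases h3 γ hγ with h4 | h4 <;> omega

section Bracket

attribute [local instance 100] LieRing.ofAssociativeRing

/-- The commutator of two root matrices is an integral multiple of a root matrix. -/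
theorem bracket {α β : Root 𝔤.r} (hα : α ∈ 𝔤.roots) (hβ : β ∈ 𝔤.roots) (h : α.vec + β.vec ≠ 0) :
    ∃ c : ℤ, ∃ γ ∈ 𝔤.roots, D.X α * D.X β - D.X β * D.X α = c • D.X γ ∧
      (c ≠ 0 → γ.vec = α.vec + β.vec) := by
  set Z := D.X α * D.X β - D.X β * D.X α with hZ
  have hmem : Z.map (Int.cast : ℤ → ℚ) ∈ 𝔤.L := by
    rw [hZ, map_sub', map_mul', map_mul', D.map_X α hα, D.map_X β hβ]
    exact 𝔤.L.lie_mem (𝔤.X_mem α hα) (𝔤.X_mem β hβ)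
  have hs : ∀ i j, Z.map (Int.cast : ℤ → ℚ) i j ≠ 0 → D.wt i - D.wt j = α.vec + β.vec := by
    intro i j hij
    have hij' : Z i j ≠ 0 := by
      intro h0; exact hij (by simp [h0])
    rw [hZ, Matrix.sub_apply, Matrix.mul_apply, Matrix.mul_apply] at hij'
    have : (∑ k, D.X α i k * D.X β k j ≠ 0) ∨ (∑ k, D.X β i k * D.X α k j ≠ 0) := by
      by_contra! hc
      rw [hc.1, hc.2] at hij'
      exact hij' rfl
    rcases this with h1 | h1 <;> obtain ⟨k, -, hk⟩ := Finset.exists_ne_zero_of_sum_ne_zero h1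
    · rw [← (D.supp α hα i k).1 (left_ne_zero_of_mul hk),
        ← (D.supp β hβ k j).1 (right_ne_zero_of_mul hk)]
      abel
    · rw [← (D.supp β hβ i k).1 (left_ne_zero_of_mul hk),
        ← (D.supp α hα k j).1 (right_ne_zero_of_mul hk)]
      abel
  rcases D.weight_space _ hmem _ h hs with h0 | ⟨γ, hγ, hv, q, hq⟩
  · refine ⟨0, α, hα, ?_, fun h => (h rfl).elim⟩
    ext i j
    have := congrFun (congrFun h0 i) j
    simpa using this
  · obtain ⟨i, j, hij⟩ := D.unit_entry γ hγ
    have hent : ∀ i j, (Z i j : ℚ) = q * (D.X γ i j : ℚ) := by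
      intro i j
      have := congrFun (congrFun hq i) j
      rw [← D.map_X γ hγ] at this
      simpa using this
    have hc : ∃ c : ℤ, q = c := by
      have h1 := hent i j
      rcases Int.natAbs_eq (D.X γ i j) with h2 | h2 <;> rw [hij] at h2 <;> rw [h2] at h1
      · exact ⟨Z i j, by simpa using h1.symm⟩
      · exact ⟨-Z i j, by push_cast; rw [h1]; simp⟩
    obtain ⟨c, rfl⟩ := hc
    refine ⟨c, γ, hγ, ?_, fun _ => hv⟩
    ext i j
    have := hent i j
    rw [Matrix.smul_apply, smul_eq_mul]
    exact_mod_cast this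

end Bracket

/-- The first commutators of `X α` with `X β`. -/
structure String (α β β₁ β₂ : Root 𝔤.r) (c₁ c₂ : ℤ) : Prop where
  mem₁ : β₁ ∈ 𝔤.roots
  mem₂ : β₂ ∈ 𝔤.roots
  eq₁ : D.X α * D.X β - D.X β * D.X α = c₁ • D.X β₁
  -- The scalars c₁, c₂ stay on the left because β₁ and β₂ are mere placeholders when these vanish.
  -- The coefficient 2c₂ records that the second divided power of ad X_α is integral.
  eq₂ : c₁ • (D.X α * D.X β₁ - D.X β₁ * D.X α) = (2 * c₂) • D.X β₂
  eq₃ : c₂ • (D.X α * D.X β₂ - D.X β₂ * D.X α) = 0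
  vec₁ : c₁ ≠ 0 → β₁.vec = comb α β 1 1
  vec₂ : c₂ ≠ 0 → β₂.vec = comb α β 2 1

/-- The string through β stops after 2α + β because 3α + β is never a root. The second commutator is
even because X_α² is twice an integral matrix. -/
theorem exists_string {α β : Root 𝔤.r} (hα : α ∈ 𝔤.roots) (hβ : β ∈ 𝔤.roots)
    (h : α.vec + β.vec ≠ 0) : ∃ (β₁ β₂ : Root 𝔤.r) (c₁ c₂ : ℤ), D.String α β β₁ β₂ c₁ c₂ := by
  obtain ⟨c₁, β₁, m₁, e₁, v₁⟩ := D.bracket hα hβ h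
  have v₁' : c₁ ≠ 0 → β₁.vec = comb α β 1 1 := fun h => by rw [v₁ h, comb, one_smul, one_smul]
  by_cases hc₁ : c₁ = 0
  · exact ⟨β₁, β, c₁, 0, m₁, hβ, e₁, by simp [hc₁], by simp, v₁', fun h => (h rfl).elim⟩
  obtain ⟨n2, n3, nr⟩ := D.comb_three hα hβ h
  have e21 : α.vec + β₁.vec = comb α β 2 1 := by
    rw [v₁' hc₁, comb, comb]; module
  obtain ⟨c, β₂, m₂, e₂, v₂⟩ := D.bracket hα m₁ (by rwa [e21])
  -- (ad X)² Y = X²Y - 2XYX + YX², and X² = 2S.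
  have key : (c₁ * c) • D.X β₂ =
      (2 : ℤ) • (D.S α * D.X β - D.X α * D.X β * D.X α + D.X β * D.S α) := by
    rw [mul_smul, ← e₂, smul_sub, ← mul_smul_comm, ← smul_mul_assoc, ← e₁]
    have h2 := D.sq α hα
    have h3 : (2 : ℤ) • (D.S α * D.X β) = D.X α * D.X α * D.X β := by rw [h2, smul_mul_assoc]
    have h4 : (2 : ℤ) • (D.X β * D.S α) = D.X β * (D.X α * D.X α) := by rw [h2, mul_smul_comm]
    rw [smul_add, smul_sub, h3, h4]
    noncomm_ring
  have h2 : ∃ c₂, c₁ * c = 2 * c₂ := by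
    obtain ⟨i, j, hij⟩ := D.unit_entry β₂ m₂
    have := congrFun (congrFun key i) j
    rw [Matrix.smul_apply, Matrix.smul_apply, smul_eq_mul, smul_eq_mul] at this
    rcases Int.natAbs_eq (D.X β₂ i j) with h2 | h2 <;> rw [hij] at h2 <;> rw [h2] at this
    · exact ⟨_, by simpa using this⟩
    · exact ⟨-(D.S α * D.X β - D.X α * D.X β * D.X α + D.X β * D.S α) i j,
        by rw [mul_neg, ← this]; simp⟩
  obtain ⟨c₂, hc₂⟩ := h2
  have v₂' : c₂ ≠ 0 → β₂.vec = comb α β 2 1 := by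
    intro h0
    rw [v₂ (by rintro rfl; simp at hc₂; omega), e21]
  refine ⟨β₁, β₂, c₁, c₂, m₁, m₂, e₁, by rw [e₂, smul_smul, hc₂], ?_, v₁', v₂'⟩
  by_cases h0 : c₂ = 0
  · simp [h0]
  have e31 : α.vec + β₂.vec = comb α β 3 1 := by
    rw [v₂' h0, comb, comb]; module
  obtain ⟨c', β₃, m₃, e₃, v₃⟩ := D.bracket hα m₂ (by rwa [e31])
  rw [e₃]
  by_cases h0' : c' = 0
  · simp [h0']
  · exact (nr β₃ m₃ ((v₃ h0').trans e31)).elim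

/-- The root matrices of two roots whose sum is not a root commute. -/
theorem commute_of {α β : Root 𝔤.r} (hα : α ∈ 𝔤.roots) (hβ : β ∈ 𝔤.roots)
    (h : α.vec + β.vec ≠ 0) (h' : ∀ γ ∈ 𝔤.roots, γ.vec ≠ α.vec + β.vec) :
    D.X α * D.X β - D.X β * D.X α = 0 := by
  obtain ⟨c, γ, hγ, e, v⟩ := D.bracket hα hβ h
  by_cases hc : c = 0
  · rw [e, hc, zero_smul]
  · exact (h' γ hγ (v hc)).elim

include D in
theorem three_two_ne {α β : Root 𝔤.r} (hα : α ∈ 𝔤.roots) (hβ : β ∈ 𝔤.roots) :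
    comb α β 3 2 ≠ 0 := by
  intro e
  have h32 := dot_expand α.vec β.vec 3 2
  rw [comb] at e
  rw [e, zero_dotProduct] at h32
  rcases D.norm_cases hα hβ with ⟨h1 | h1, h2 | h2, -⟩ | ⟨h1 | h1, h2 | h2, -⟩ <;> omega

theorem two_two_ne {α β : Root 𝔤.r} (h : α.vec + β.vec ≠ 0) : comb α β 2 2 ≠ 0 := by
  intro e
  apply h
  ext i
  have := congrFun e i
  simp [comb] at this ⊢
  omega

end StdData
end ToricPairs

/-! ### Integral representations and Chevalley's commutator formula. -/

namespace ToricPairs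
open Matrix

attribute [local instance 100] LieRing.ofAssociativeRing

/-- A representation with an integral structure and a weight basis. -/
structure IntRep (𝔤 : RootedLieAlgebra) (J : Type) [Fintype J] [DecidableEq J] where
  ρ : 𝔤.L →ₗ⁅ℚ⁆ Matrix J J ℚ
  dp : Root 𝔤.r → ℕ → Matrix J J ℤ
  dp_spec : ∀ (α : Root 𝔤.r) (hα : α ∈ 𝔤.roots) (k : ℕ),
    (dp α k).map (Int.cast : ℤ → ℚ) = ((k.factorial : ℚ)⁻¹) • (ρ ⟨𝔤.X α, 𝔤.X_mem α hα⟩) ^ k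
  μ : J → Fin 𝔤.r → ℚ
  faithful : Function.Injective ρ
  supp : ∀ α ∈ 𝔤.roots, ∀ i j, dp α 1 i j ≠ 0 → μ i - μ j = fun a => (α.vec a : ℚ)

namespace IntRep

variable {𝔤 : RootedLieAlgebra} {J : Type} [Fintype J] [DecidableEq J] (E : IntRep 𝔤 J)
  (D : StdData 𝔤)

/-- The matrix `∑ t ^ k X_α ^ k / k!`. -/
def x (R : Type*) [CommRing R] (α : Root 𝔤.r) (t : R) : Matrix J J R :=
  ∑ k ∈ Finset.range (Fintype.card J), t ^ k • (E.dp α k).map (Int.cast : ℤ → R)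

/-- The root vector over `R`. -/
def e (R : Type*) [CommRing R] (α : Root 𝔤.r) : Matrix J J R :=
  (E.dp α 1).map (Int.cast : ℤ → R)

/-- The vector of a root with rational coordinates. -/
abbrev qvec (α : Root 𝔤.r) : Fin 𝔤.r → ℚ := fun a => (α.vec a : ℚ)

theorem intCast_map_injective {I : Type*} :
    Function.Injective fun A : Matrix I I ℤ => A.map (Int.cast : ℤ → ℚ) := by
  intro A B h
  ext i j
  have := congrFun (congrFun h i) j
  simpa using this

theorem map_zsmul' {I R : Type*} [CommRing R] (c : ℤ) (A : Matrix I I ℤ) :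
    (c • A).map (Int.cast : ℤ → R) = (c : R) • A.map Int.cast := by
  ext; simp

theorem map_pow' {I R : Type*} [Fintype I] [DecidableEq I] [CommRing R] (A : Matrix I I ℤ) (k : ℕ) :
    (A ^ k).map (Int.cast : ℤ → R) = (A.map Int.cast) ^ k :=
  map_pow (Int.castRingHom R).mapMatrix A k

theorem map_sub'' {I R : Type*} [CommRing R] (A B : Matrix I I ℤ) :
    (A - B).map (Int.cast : ℤ → R) = A.map Int.cast - B.map Int.cast := by
  ext; simp

theorem e_rat {α : Root 𝔤.r} (hα : α ∈ 𝔤.roots) :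
    E.e ℚ α = E.ρ ⟨𝔤.X α, 𝔤.X_mem α hα⟩ := by
  rw [e, E.dp_spec α hα 1]; simp

theorem factorial_smul_dp {α : Root 𝔤.r} (hα : α ∈ 𝔤.roots) (k : ℕ) :
    (k.factorial : ℤ) • E.dp α k = E.dp α 1 ^ k := by
  apply intCast_map_injective
  change Matrix.map _ _ = Matrix.map _ _
  rw [map_zsmul', map_pow', E.dp_spec α hα k, smul_smul]
  have := E.e_rat hα
  rw [e] at this
  rw [this, Int.cast_natCast, mul_inv_cancel₀ (by positivity), one_smul]

theorem dp_zero {α : Root 𝔤.r} (hα : α ∈ 𝔤.roots) : E.dp α 0 = 1 := by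
  have := E.factorial_smul_dp hα 0
  simpa using this

theorem supp_pow {α : Root 𝔤.r} (hα : α ∈ 𝔤.roots) (k : ℕ) :
    ∀ i j, (E.dp α 1 ^ k) i j ≠ 0 → E.μ i - E.μ j = (k : ℚ) • qvec α := by
  induction k with
  | zero =>
    intro i j h
    rw [pow_zero] at h
    have : i = j := by by_contra hne; exact h (Matrix.one_apply_ne hne)
    simp [this]
  | succ k ih =>
    intro i j h
    rw [pow_succ, Matrix.mul_apply] at h
    obtain ⟨l, -, hl⟩ := Finset.exists_ne_zero_of_sum_ne_zero h
    have h1 := ih i l (left_ne_zero_of_mul hl)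
    have h2 := E.supp α hα l j (right_ne_zero_of_mul hl)
    push_cast
    have h3 : qvec α = E.μ l - E.μ j := h2.symm
    rw [add_smul, one_smul, ← h1, h3]
    abel

theorem supp_dp {α : Root 𝔤.r} (hα : α ∈ 𝔤.roots) {k : ℕ} {i j : J} (h : E.dp α k i j ≠ 0) :
    E.μ i - E.μ j = (k : ℚ) • qvec α := by
  refine E.supp_pow hα k i j ?_
  rw [← E.factorial_smul_dp hα k, Matrix.smul_apply, smul_eq_mul]
  exact mul_ne_zero (by positivity) h

include D in
theorem qvec_ne_zero {α : Root 𝔤.r} (hα : α ∈ 𝔤.roots) : qvec α ≠ 0 := by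
  intro h
  refine D.vec_ne_zero hα ?_
  ext a
  have := congrFun h a
  simpa [qvec] using this

-- A nonzero entry of the k-th power joins two weights whose difference is kα; finitely many index
-- pairs allow only finitely many k, so the matrix is nilpotent. Cayley–Hamilton then gives the
-- exponent `Fintype.card J`, which is where the sum defining `x` is truncated.
include D in
theorem pow_card {α : Root 𝔤.r} (hα : α ∈ 𝔤.roots) : E.dp α 1 ^ Fintype.card J = 0 := by
  have hn : IsNilpotent (E.e ℚ α) := by
    by_contra hn
    have hne : ∀ k : ℕ, ∃ p : J × J, (E.dp α 1 ^ k) p.1 p.2 ≠ 0 := by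
      intro k
      by_contra! hc
      refine hn ⟨k, ?_⟩
      have : E.dp α 1 ^ k = 0 := by ext i j; exact hc (i, j)
      rw [e, ← map_pow', this]; ext; simp
    choose p hp using hne
    have : Function.Injective p := by
      intro k l hkl
      have h1 := E.supp_pow hα k _ _ (hp k)
      have h2 := E.supp_pow hα l _ _ (hp l)
      rw [hkl, h2] at h1
      have := smul_left_injective ℚ (qvec_ne_zero D hα) h1
      exact_mod_cast this.symm
    exact not_injective_infinite_finite p this
  have h := (Matrix.isNilpotent_charpoly_sub_pow_of_isNilpotent hn).eq_zero
  have h' := Matrix.aeval_self_charpoly (E.e ℚ α)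
  rw [sub_eq_zero.1 h] at h'
  apply intCast_map_injective
  change Matrix.map _ _ = Matrix.map _ _
  rw [map_pow']
  simpa [e] using h'

include D in
theorem pow_card_map (R : Type*) [CommRing R] {α : Root 𝔤.r} (hα : α ∈ 𝔤.roots) :
    E.e R α ^ Fintype.card J = 0 := by
  rw [e, ← map_pow', E.pow_card D hα]; ext; simp

theorem smul_bracket {R : Type*} [CommRing R] (p q : R) (A B : Matrix J J R) :
    (p • A) * (q • B) - (q • B) * (p • A) = (p * q) • (A * B - B * A) := by
  rw [smul_mul_assoc, mul_smul_comm, mul_smul_comm, smul_mul_assoc, smul_smul, smul_smul,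
    smul_sub]

include D in
theorem isNilpotent_smul_e (R : Type*) [CommRing R] {α : Root 𝔤.r} (hα : α ∈ 𝔤.roots)
    (t : R) : IsNilpotent (t • E.e R α) :=
  ⟨Fintype.card J, by rw [smul_pow, E.pow_card_map D R hα, smul_zero]⟩

section RatAlgebra

variable (R : Type*) [CommRing R] [Algebra ℚ R]

theorem map_dp_eq {α : Root 𝔤.r} (hα : α ∈ 𝔤.roots) (k : ℕ) :
    (E.dp α k).map (Int.cast : ℤ → R) = ((k.factorial : ℚ)⁻¹) • (E.e R α) ^ k := by
  have h := congrArg (fun A => A.map (Int.cast : ℤ → R)) (E.factorial_smul_dp hα k)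
  simp only [map_zsmul', map_pow'] at h
  rw [e, ← h]
  ext i j
  have h1 : (algebraMap ℚ R (k.factorial : ℚ)⁻¹) * (k.factorial : R) = 1 := by
    rw [← map_natCast (algebraMap ℚ R), ← map_mul, inv_mul_cancel₀ (by positivity), map_one]
  rw [Matrix.smul_apply, Matrix.smul_apply, smul_eq_mul, Algebra.smul_def, ← mul_assoc,
    Int.cast_natCast, h1, one_mul]

include D in
theorem x_eq_exp {α : Root 𝔤.r} (hα : α ∈ 𝔤.roots) (t : R) :
    E.x R α t = IsNilpotent.exp (t • E.e R α) := by
  rw [IsNilpotent.exp_eq_sum (k := Fintype.card J)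
    (by rw [smul_pow, E.pow_card_map D R hα, smul_zero]), x]
  refine Finset.sum_congr rfl fun k _ => ?_
  rw [E.map_dp_eq R hα, smul_pow, smul_comm]

end RatAlgebra

theorem map_x {R S : Type*} [CommRing R] [CommRing S] (f : R →+* S) (α : Root 𝔤.r) (t : R) :
    f.mapMatrix (E.x R α t) = E.x S α (f t) := by
  rw [x, x, map_sum]
  refine Finset.sum_congr rfl fun k _ => ?_
  ext i j
  simp

theorem map_e {R S : Type*} [CommRing R] [CommRing S] (f : R →+* S) (α : Root 𝔤.r) :
    f.mapMatrix (E.e R α) = E.e S α := by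
  ext i j
  simp [e]

/-- An identity of matrices with entries in `ℤ[a, b]` may be checked over `ℚ[a, b]`. -/
theorem eq_of_map_rat {A B : Matrix J J (MvPolynomial (Fin 2) ℤ)}
    (h : (MvPolynomial.map (σ := Fin 2) (Int.castRingHom ℚ)).mapMatrix A =
      (MvPolynomial.map (Int.castRingHom ℚ)).mapMatrix B) : A = B := by
  ext1 i j
  have := congrFun (congrFun h i) j
  exact MvPolynomial.map_injective _ Int.cast_injective this

/-- The homomorphism `ℤ[a, b] → R` with given values. -/
def spec (R : Type*) [CommRing R] (a b : R) : MvPolynomial (Fin 2) ℤ →+* R :=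
  MvPolynomial.eval₂Hom (Int.castRingHom R) ![a, b]

theorem spec_zero {R : Type*} [CommRing R] (a b : R) : spec R a b (MvPolynomial.X 0) = a := by
  simp [spec]

theorem spec_one {R : Type*} [CommRing R] (a b : R) : spec R a b (MvPolynomial.X 1) = b := by
  simp [spec]

-- Exponentials with denominators are meaningless over a general ring. The identity is proved for
-- universal parameters over ℚ[a, b], holds therefore over ℤ[a, b], and specialises to R. The same
-- device serves for `x_mul_e` and `x_mul_x`.
include D in
theorem x_add {R : Type*} [CommRing R] {α : Root 𝔤.r} (hα : α ∈ 𝔤.roots) (a b : R) :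
    E.x R α (a + b) = E.x R α a * E.x R α b := by
  have key : E.x (MvPolynomial (Fin 2) ℤ) α (MvPolynomial.X 0 + MvPolynomial.X 1) =
      E.x _ α (MvPolynomial.X 0) * E.x _ α (MvPolynomial.X 1) := by
    apply eq_of_map_rat
    rw [map_mul, map_x, map_x, map_x, E.x_eq_exp D _ hα, E.x_eq_exp D _ hα, E.x_eq_exp D _ hα,
      map_add, add_smul, IsNilpotent.exp_add_of_commute _ (E.isNilpotent_smul_e D _ hα _)
      (E.isNilpotent_smul_e D _ hα _)]
    exact ((Commute.refl _).smul_left _).smul_right _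
  have := congrArg (spec R a b).mapMatrix key
  rwa [map_mul, map_x, map_x, map_x, map_add, spec_zero, spec_one] at this

theorem x_zero {R : Type*} [CommRing R] {α : Root 𝔤.r} (hα : α ∈ 𝔤.roots) : E.x R α 0 = 1 := by
  rw [x]
  rcases Nat.eq_zero_or_pos (Fintype.card J) with h | h
  · have := Fintype.card_eq_zero_iff.1 h
    exact Subsingleton.elim _ _
  · rw [Finset.sum_eq_single_of_mem 0 (Finset.mem_range.2 h)]
    · rw [E.dp_zero hα]; ext i j; simp [Matrix.one_apply]
    · intro k _ hk; rw [zero_pow hk, zero_smul]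

/-- The bracket relations of the root vectors in any representation. -/
theorem e_string {R : Type*} [CommRing R] {α β β₁ β₂ : Root 𝔤.r} {c₁ c₂ : ℤ}
    (hα : α ∈ 𝔤.roots) (hβ : β ∈ 𝔤.roots) (s : D.String α β β₁ β₂ c₁ c₂) :
    E.e R α * E.e R β - E.e R β * E.e R α = (c₁ : R) • E.e R β₁ ∧
    (c₁ : R) • (E.e R α * E.e R β₁ - E.e R β₁ * E.e R α) = (2 * c₂ : R) • E.e R β₂ ∧
    (c₂ : R) • (E.e R α * E.e R β₂ - E.e R β₂ * E.e R α) = 0 := by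
  -- A relation between root matrices of the defining representation is a relation in the Lie
  -- algebra. The homomorphism ρ carries it to any representation, where it holds between integral
  -- matrices and thus over every R.
  have key : ∀ γ ∈ 𝔤.roots, ∀ δ ∈ 𝔤.roots, ∀ ε ∈ 𝔤.roots, ∀ c d : ℤ,
      c • (D.X γ * D.X δ - D.X δ * D.X γ) = d • D.X ε →
      (c : R) • (E.e R γ * E.e R δ - E.e R δ * E.e R γ) = (d : R) • E.e R ε := by
    intro γ hγ δ hδ ε hε c d h
    have h1 : c • (E.dp γ 1 * E.dp δ 1 - E.dp δ 1 * E.dp γ 1) = d • E.dp ε 1 := by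
      apply intCast_map_injective
      change Matrix.map _ _ = Matrix.map _ _
      rw [map_zsmul', map_zsmul', map_sub'', StdData.map_mul', StdData.map_mul']
      have hg := E.e_rat hγ
      have hd := E.e_rat hδ
      have he := E.e_rat hε
      rw [e] at hg hd he
      rw [hg, hd, he, ← map_smul, ← LieRing.of_associative_ring_bracket, ← LieHom.map_lie,
        ← map_smul]
      congr 1
      apply Subtype.ext
      have h2 := congrArg (fun A : Matrix 𝔤.I 𝔤.I ℤ => A.map (Int.cast : ℤ → ℚ)) h
      simp only [map_zsmul', map_sub'', StdData.map_mul', D.map_X γ hγ, D.map_X δ hδ,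
        D.map_X ε hε] at h2
      exact h2
    have h2 := congrArg (fun A : Matrix J J ℤ => A.map (Int.cast : ℤ → R)) h1
    simp only [map_zsmul', map_sub'', StdData.map_mul'] at h2
    exact h2
  refine ⟨?_, ?_, ?_⟩
  · have := key α hα β hβ β₁ s.mem₁ 1 c₁ (by rw [one_smul]; exact s.eq₁)
    simpa using this
  · have := key α hα β₁ s.mem₁ β₂ s.mem₂ c₁ (2 * c₂) s.eq₂
    simpa using this
  · have := key α hα β₂ s.mem₂ β₂ s.mem₂ c₂ 0 (by rw [zero_smul]; exact s.eq₃)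
    simpa using this

/-- The adjoint action of `x_α(t)` on a root vector. -/
theorem x_mul_e {R : Type*} [CommRing R] {α β β₁ β₂ : Root 𝔤.r} {c₁ c₂ : ℤ}
    (hα : α ∈ 𝔤.roots) (hβ : β ∈ 𝔤.roots) (s : D.String α β β₁ β₂ c₁ c₂) (t : R) :
    E.x R α t * E.e R β =
      (E.e R β + (c₁ * t) • E.e R β₁ + (c₂ * t ^ 2) • E.e R β₂) * E.x R α t := by
  have key : E.x (MvPolynomial (Fin 2) ℤ) α (MvPolynomial.X 0) * E.e _ β =
      (E.e _ β + ((c₁ : MvPolynomial (Fin 2) ℤ) * MvPolynomial.X 0) • E.e _ β₁ +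
        ((c₂ : MvPolynomial (Fin 2) ℤ) * MvPolynomial.X 0 ^ 2) • E.e _ β₂) *
        E.x _ α (MvPolynomial.X 0) := by
    apply eq_of_map_rat
    obtain ⟨s₁, s₂, s₃⟩ := E.e_string D (R := MvPolynomial (Fin 2) ℚ) hα hβ s
    have hs : ∀ (c : MvPolynomial (Fin 2) ℤ) (A : Matrix J J (MvPolynomial (Fin 2) ℤ)),
        (MvPolynomial.map (σ := Fin 2) (Int.castRingHom ℚ)).mapMatrix (c • A) =
        (MvPolynomial.map (Int.castRingHom ℚ) c) •
          (MvPolynomial.map (σ := Fin 2) (Int.castRingHom ℚ)).mapMatrix A := by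
      intro c A; ext1 i j; simp
    rw [map_mul, map_mul, map_x, map_add, map_add, hs, hs, map_e, map_e, map_e,
      E.x_eq_exp D _ hα]
    simp only [MvPolynomial.map_X, map_mul, map_pow, map_intCast]
    refine exp_mul_eq (E.isNilpotent_smul_e D _ hα _) ?_ ?_ ?_
    · rw [smul_mul_assoc, mul_smul_comm, ← smul_sub, s₁, smul_smul, mul_comm]
    · have h2 : (2 : ℚ) • (((c₂ : MvPolynomial (Fin 2) ℚ) * MvPolynomial.X 0 ^ 2) • E.e (MvPolynomial (Fin 2) ℚ) β₂) =
          (MvPolynomial.X 0 ^ 2 : MvPolynomial (Fin 2) ℚ) • ((2 * (c₂ : MvPolynomial (Fin 2) ℚ)) • E.e (MvPolynomial (Fin 2) ℚ) β₂) := by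
        rw [← algebraMap_smul (MvPolynomial (Fin 2) ℚ) (2 : ℚ), smul_smul, smul_smul]
        congr 1
        rw [map_ofNat]; ring
      rw [h2, ← s₂, smul_bracket, smul_smul]
      congr 1
      ring
    · rw [← sub_eq_zero, smul_bracket]
      have h3 := congrArg (fun A => (MvPolynomial.X 0 ^ 3 : MvPolynomial (Fin 2) ℚ) • A) s₃
      simp only [smul_zero, smul_smul] at h3
      rw [← h3]
      congr 1
      ring
  have h := congrArg (spec R t 0).mapMatrix key
  have hs : ∀ (c : MvPolynomial (Fin 2) ℤ) (A : Matrix J J (MvPolynomial (Fin 2) ℤ)),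
      (spec R t 0).mapMatrix (c • A) = (spec R t 0 c) • (spec R t 0).mapMatrix A := by
    intro c A; ext1 i j; simp
  rw [map_mul, map_mul, map_x, map_add, map_add, hs, hs, map_e, map_e, map_e, map_mul, map_mul,
    map_pow, map_intCast, map_intCast, spec_zero] at h
  exact h

/-- Chevalley's commutator formula for positive roots. -/
theorem x_mul_x {R : Type*} [CommRing R] {α β β₁ β₂ : Root 𝔤.r} {c₁ c₂ : ℤ}
    (hα : α ∈ 𝔤.roots) (hβ : β ∈ 𝔤.roots) (h0 : α.vec + β.vec ≠ 0)
    (s : D.String α β β₁ β₂ c₁ c₂)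
    (hn : ∀ γ ∈ 𝔤.roots, γ.vec ≠ StdData.comb α β 1 2) (a b : R) :
    E.x R α a * E.x R β b =
      E.x R β b * E.x R β₁ (c₁ * (a * b)) * E.x R β₂ (c₂ * (a ^ 2 * b)) * E.x R α a := by
  have key : E.x (MvPolynomial (Fin 2) ℤ) α (MvPolynomial.X 0) * E.x _ β (MvPolynomial.X 1) =
      E.x _ β (MvPolynomial.X 1) * E.x _ β₁ ((c₁ : MvPolynomial (Fin 2) ℤ) * (MvPolynomial.X 0 * MvPolynomial.X 1)) *
        E.x _ β₂ ((c₂ : MvPolynomial (Fin 2) ℤ) * (MvPolynomial.X 0 ^ 2 * MvPolynomial.X 1)) * E.x _ α (MvPolynomial.X 0) := by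
    apply eq_of_map_rat
    obtain ⟨s₁, s₂, s₃⟩ := E.e_string D (R := MvPolynomial (Fin 2) ℚ) hα hβ s
    simp only [map_mul, map_x, MvPolynomial.map_X, map_pow, map_intCast]
    rw [E.x_eq_exp D _ hα, E.x_eq_exp D _ hβ, E.x_eq_exp D _ s.mem₁, E.x_eq_exp D _ s.mem₂]
    -- The commutation hypotheses of `exp_mul_exp_eq` hold because α + 2β, 2α + 2β and 3α + 2β are
    -- neither roots nor zero; the first is not a root by `hn`.
    have hcomm : ∀ γ ∈ 𝔤.roots, ∀ δ ∈ 𝔤.roots, γ.vec + δ.vec ≠ 0 →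
        (∀ ε ∈ 𝔤.roots, ε.vec ≠ γ.vec + δ.vec) →
        ∀ p q : MvPolynomial (Fin 2) ℚ, Commute (p • E.e (MvPolynomial (Fin 2) ℚ) γ)
          (q • E.e (MvPolynomial (Fin 2) ℚ) δ) := by
      intro γ hγ δ hδ h1 h2 p q
      refine Commute.smul_left (Commute.smul_right ?_ q) p
      have h3 : D.String γ δ γ γ 0 0 :=
        ⟨hγ, hγ, by rw [D.commute_of hγ hδ h1 h2, zero_smul], by simp, by simp,
          fun h => (h rfl).elim, fun h => (h rfl).elim⟩
      have h4 := (E.e_string D (R := MvPolynomial (Fin 2) ℚ) hγ hδ h3).1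
      rw [Int.cast_zero, zero_smul] at h4
      exact sub_eq_zero.1 h4
    refine exp_mul_exp_eq (E.isNilpotent_smul_e D _ hα _) (E.isNilpotent_smul_e D _ hβ _)
      (E.isNilpotent_smul_e D _ s.mem₁ _) (E.isNilpotent_smul_e D _ s.mem₂ _) ?_ ?_ ?_ ?_ ?_ ?_
    · rw [smul_bracket, s₁, smul_smul]
      congr 1
      ring
    · have h2 : (2 : ℚ) • (((c₂ : MvPolynomial (Fin 2) ℚ) * (MvPolynomial.X 0 ^ 2 * MvPolynomial.X 1)) •
          E.e (MvPolynomial (Fin 2) ℚ) β₂) = (MvPolynomial.X 0 ^ 2 * MvPolynomial.X 1 : MvPolynomial (Fin 2) ℚ) •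
            ((2 * (c₂ : MvPolynomial (Fin 2) ℚ)) • E.e (MvPolynomial (Fin 2) ℚ) β₂) := by
        rw [← algebraMap_smul (MvPolynomial (Fin 2) ℚ) (2 : ℚ), smul_smul, smul_smul]
        congr 1
        rw [map_ofNat]; ring
      rw [h2, ← s₂, smul_bracket, smul_smul]
      congr 1
      ring
    · rw [← sub_eq_zero, smul_bracket]
      have h3 := congrArg (fun A => (MvPolynomial.X 0 ^ 3 * MvPolynomial.X 1 : MvPolynomial (Fin 2) ℚ) • A) s₃
      simp only [smul_zero, smul_smul] at h3
      rw [← h3]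
      congr 1
      ring
    · by_cases hc : c₁ = 0
      · simp [hc]
      have e : β.vec + β₁.vec = StdData.comb α β 1 2 := by
        rw [s.vec₁ hc, StdData.comb, StdData.comb]; module
      by_cases h12 : StdData.comb α β 1 2 = 0
      · have h21 := D.comb_three hβ hα (by rwa [add_comm])
        refine (h21.1 ?_).elim
        rw [← h12, StdData.comb, StdData.comb]; module
      exact hcomm β hβ β₁ s.mem₁ (by rwa [e]) (by rwa [e]) _ _
    · by_cases hc : c₂ = 0
      · simp [hc]
      have e : β.vec + β₂.vec = StdData.comb α β 2 2 := by
        rw [s.vec₂ hc, StdData.comb, StdData.comb]; module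
      exact hcomm β hβ β₂ s.mem₂ (by rw [e]; exact StdData.two_two_ne h0)
        (fun γ hγ => by rw [e]; exact (D.comb_high hα hβ h0 γ hγ).1) _ _
    · by_cases hc : c₂ = 0
      · simp [hc]
      by_cases hc₁ : c₁ = 0
      · simp [hc₁]
      have e : β₁.vec + β₂.vec = StdData.comb α β 3 2 := by
        rw [s.vec₂ hc, s.vec₁ hc₁, StdData.comb, StdData.comb, StdData.comb]; module
      exact hcomm β₁ s.mem₁ β₂ s.mem₂ (by rw [e]; exact D.three_two_ne hα hβ)
        (fun γ hγ => by rw [e]; exact (D.comb_high hα hβ h0 γ hγ).2) _ _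
  have h := congrArg (spec R a b).mapMatrix key
  simpa only [map_mul, map_x, map_pow, map_intCast, spec_zero, spec_one] using h

end IntRep
end ToricPairs

/-! ### Root subgroups over a field and the supports of their elements. -/

namespace ToricPairs
open Matrix

attribute [local instance 100] LieRing.ofAssociativeRing

namespace IntRep

variable {𝔤 : RootedLieAlgebra} {J : Type} [Fintype J] [DecidableEq J] (E : IntRep 𝔤 J)
  (D : StdData 𝔤)

include D in
theorem dp_one_ne_zero {α : Root 𝔤.r} (hα : α ∈ 𝔤.roots) : E.dp α 1 ≠ 0 := by
  intro h
  have h1 := E.e_rat hα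
  rw [e, h, show (0 : Matrix J J ℤ).map (Int.cast : ℤ → ℚ) = 0 by ext; simp] at h1
  have h2 : (⟨𝔤.X α, 𝔤.X_mem α hα⟩ : 𝔤.L) = 0 := E.faithful (by rw [← h1, map_zero])
  have h3 : 𝔤.X α = 0 := congrArg Subtype.val h2
  obtain ⟨i, j, hij⟩ := D.unit_entry α hα
  have h4 := congrFun (congrFun (D.map_X α hα) i) j
  rw [h3] at h4
  simp only [Matrix.map_apply, Matrix.zero_apply, Int.cast_eq_zero] at h4
  simp [h4] at hij

include D in
theorem dp_sl2 {α : Root 𝔤.r} (hα : α ∈ 𝔤.roots) :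
    (E.dp α 1 * E.dp α.opp 1 - E.dp α.opp 1 * E.dp α 1) * E.dp α 1 -
      E.dp α 1 * (E.dp α 1 * E.dp α.opp 1 - E.dp α.opp 1 * E.dp α 1) = (2 : ℤ) • E.dp α 1 := by
  have hα' := D.opp_mem α hα
  apply intCast_map_injective
  change Matrix.map _ _ = Matrix.map _ _
  simp only [map_zsmul', map_sub'', StdData.map_mul']
  have h1 := E.e_rat hα
  have h2 := E.e_rat hα'
  rw [e] at h1 h2
  rw [h1, h2, ← map_smul]
  simp only [← LieRing.of_associative_ring_bracket, ← LieHom.map_lie]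
  congr 1
  apply Subtype.ext
  have h := congrArg (fun A : Matrix 𝔤.I 𝔤.I ℤ => A.map (Int.cast : ℤ → ℚ)) (D.sl2 α hα)
  simp only [map_zsmul', map_sub'', StdData.map_mul', D.map_X α hα, D.map_X _ hα'] at h
  exact h

section Field

variable (K : Type*) [Field K]

include D in
/-- A root vector does not vanish in odd characteristic. -/
theorem exists_e_ne_zero (h2 : ringChar K ≠ 2) {α : Root 𝔤.r} (hα : α ∈ 𝔤.roots) :
    ∃ i j, E.e K α i j ≠ 0 := by
  by_contra! hz
  have hne := E.dp_one_ne_zero D hα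
  set p := ringChar K with hp
  have hdvd : ∀ i j, (p : ℤ) ∣ E.dp α 1 i j := fun i j =>
    (CharP.intCast_eq_zero_iff K p _).1 (hz i j)
  -- Infinite descent: if X = p^(k+1) Y, the relation [[X, X'], X] = 2X, with X' the opposite root
  -- vector, shows that p^(k+1) divides 2Y. As p is odd, p divides Y, so X is divisible by all
  -- powers of p. In characteristic zero p = 0 and the claim is immediate.
  have hall : ∀ k : ℕ, ∃ Y : Matrix J J ℤ, E.dp α 1 = ((p : ℤ) ^ (k + 1)) • Y := by
    intro k
    induction k with
    | zero =>
      choose f hf using hdvd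
      exact ⟨Matrix.of f, by ext i j; simp [hf i j]⟩
    | succ k ih =>
      obtain ⟨Y, hY⟩ := ih
      rcases CharP.char_is_prime_or_zero K p with hpp | hp0
      · have hcop : IsCoprime (2 : ℤ) (p : ℤ) := by
          rw [Int.isCoprime_iff_gcd_eq_one]
          exact_mod_cast (Nat.coprime_primes Nat.prime_two hpp).2 (Ne.symm h2)
        have hs := E.dp_sl2 D hα
        set o := E.dp α.opp 1
        have hp0 : ((p : ℤ) ^ (k + 1)) ≠ 0 := pow_ne_zero _ (by exact_mod_cast hpp.ne_zero)
        rw [hY] at hs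
        have hs' : ((p : ℤ) ^ (k + 1)) • (((p : ℤ) ^ (k + 1)) •
            ((Y * o - o * Y) * Y - Y * (Y * o - o * Y))) = ((p : ℤ) ^ (k + 1)) • ((2 : ℤ) • Y) := by
          rw [smul_comm _ (2 : ℤ), ← hs]
          simp only [smul_sub, sub_mul, mul_sub, smul_mul_assoc, mul_smul_comm]
        have hs'' := smul_right_injective _ hp0 hs'
        have hd : ∀ i j, (p : ℤ) ∣ Y i j := by
          intro i j
          have h3 := congrFun (congrFun hs'' i) j
          simp only [Matrix.smul_apply, smul_eq_mul] at h3
          refine hcop.symm.dvd_of_dvd_mul_left ?_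
          rw [← h3, pow_succ, mul_assoc]
          exact (dvd_mul_right _ _).mul_left _
        choose f hf using hd
        refine ⟨Matrix.of f, ?_⟩
        rw [hY, pow_succ (p : ℤ) (k + 1), mul_smul]
        congr 1
        ext i j; simp [hf i j]
      · refine ⟨Y, ?_⟩
        rw [hY, hp0]; simp
  refine hne ?_
  ext i j
  by_contra hij
  rcases CharP.char_is_prime_or_zero K p with hpp | hp0
  · obtain ⟨k, hk⟩ := pow_unbounded_of_one_lt ((E.dp α 1 i j).natAbs) hpp.one_lt
    obtain ⟨Y, hY⟩ := hall k
    have h3 : ((p : ℤ) ^ (k + 1)) ∣ E.dp α 1 i j := by rw [hY]; exact ⟨Y i j, rfl⟩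
    have h4 := Int.natAbs_dvd_natAbs.2 h3
    rw [Int.natAbs_pow, Int.natAbs_natCast] at h4
    have h5 := Nat.le_of_dvd (Int.natAbs_pos.2 hij) h4
    have h6 : p ^ k ≤ p ^ (k + 1) := Nat.pow_le_pow_right hpp.pos (by omega)
    omega
  · have := hdvd i j
    rw [hp0] at this
    simp at this
    exact hij this

/-- The element `x_α(t)` of the general linear group. -/
def gx (α : Root 𝔤.r) (t : K) : GL J K :=
  -- The default 1 is never taken at a root, since there x_α(-t) is an inverse of x_α(t).
  open Classical in if h : IsUnit (E.x K α t) then h.unit else 1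

variable {K}

include D in
theorem coe_gx {α : Root 𝔤.r} (hα : α ∈ 𝔤.roots) (t : K) :
    (E.gx K α t : Matrix J J K) = E.x K α t := by
  have h : IsUnit (E.x K α t) := by
    refine ⟨⟨E.x K α t, E.x K α (-t), ?_, ?_⟩, rfl⟩
    · rw [← E.x_add D hα, add_neg_cancel, E.x_zero hα]
    · rw [← E.x_add D hα, neg_add_cancel, E.x_zero hα]
  rw [gx, dif_pos h, IsUnit.unit_spec]

include D in
theorem gx_add {α : Root 𝔤.r} (hα : α ∈ 𝔤.roots) (a b : K) :
    E.gx K α (a + b) = E.gx K α a * E.gx K α b := by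
  ext1
  rw [Units.val_mul, E.coe_gx D hα, E.coe_gx D hα, E.coe_gx D hα, E.x_add D hα]

include D in
theorem gx_zero {α : Root 𝔤.r} (hα : α ∈ 𝔤.roots) : E.gx K α 0 = 1 := by
  ext1
  rw [E.coe_gx D hα, E.x_zero hα, Units.val_one]

include D in
theorem gx_neg {α : Root 𝔤.r} (hα : α ∈ 𝔤.roots) (a : K) :
    E.gx K α (-a) = (E.gx K α a)⁻¹ := by
  rw [eq_inv_iff_mul_eq_one, ← E.gx_add D hα, neg_add_cancel, E.gx_zero D hα]

variable (K)

/-- The group generated by the root subgroups of the roots in `R`. -/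
def rg (R : Set (Root 𝔤.r)) : Subgroup (GL J K) :=
  Subgroup.closure {g | ∃ α ∈ R, ∃ t : K, g = E.gx K α t}

variable {K}

theorem gx_mem_rg {R : Set (Root 𝔤.r)} {α : Root 𝔤.r} (h : α ∈ R) (t : K) :
    E.gx K α t ∈ E.rg K R := Subgroup.subset_closure ⟨α, h, t, rfl⟩

theorem rg_mono {R R' : Set (Root 𝔤.r)} (h : R ⊆ R') : E.rg K R ≤ E.rg K R' :=
  Subgroup.closure_mono fun _ ⟨α, hα, t, e⟩ => ⟨α, h hα, t, e⟩

/-! ### Supports -/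

variable {P : (Fin 𝔤.r → ℚ) → Prop} (hP : ∀ v w, P v → P w → P (v + w))

/-- `A - 1` is supported on the entries whose weight satisfies `P`. -/
def Supp (P : (Fin 𝔤.r → ℚ) → Prop) (A : Matrix J J K) : Prop :=
  ∀ i j, (A - 1) i j ≠ 0 → P (E.μ i - E.μ j)

theorem supp_one : E.Supp P (1 : Matrix J J K) := fun i j h => by simp at h

include hP in
theorem Supp.mul {A B : Matrix J J K} (hA : E.Supp P A) (hB : E.Supp P B) : E.Supp P (A * B) := by
  intro i j h
  have e : A * B - 1 = (A - 1) + (B - 1) + (A - 1) * (B - 1) := by noncomm_ring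
  rw [e, Matrix.add_apply, Matrix.add_apply] at h
  by_cases h1 : (A - 1) i j = 0
  · by_cases h2 : (B - 1) i j = 0
    · rw [h1, h2, Matrix.mul_apply, add_zero, zero_add] at h
      obtain ⟨k, -, hk⟩ := Finset.exists_ne_zero_of_sum_ne_zero h
      have := hP _ _ (hA i k (left_ne_zero_of_mul hk)) (hB k j (right_ne_zero_of_mul hk))
      rwa [sub_add_sub_cancel] at this
    · exact hB i j h2
  · exact hA i j h1

/-- The group of matrices `g` such that `g` and `g⁻¹` have support in `P`. -/
def suppGroup (K : Type*) [Field K] : Subgroup (GL J K) where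
  carrier := {g | E.Supp P (g : Matrix J J K) ∧ E.Supp P ((g⁻¹ : GL J K) : Matrix J J K)}
  one_mem' := by
    refine ⟨?_, ?_⟩
    · exact E.supp_one
    · rw [inv_one]; exact E.supp_one
  mul_mem' := by
    rintro a b ⟨ha, ha'⟩ ⟨hb, hb'⟩
    refine ⟨?_, ?_⟩
    · rw [Units.val_mul]; exact Supp.mul E hP ha hb
    · rw [_root_.mul_inv_rev, Units.val_mul]; exact Supp.mul E hP hb' ha'
  inv_mem' := by
    rintro a ⟨ha, ha'⟩
    exact ⟨ha', by rwa [inv_inv]⟩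

theorem x_sub_one_apply {α : Root 𝔤.r} (hα : α ∈ 𝔤.roots) {t : K} {i j : J}
    (h : (E.x K α t - 1) i j ≠ 0) : ∃ k : ℕ, E.μ i - E.μ j = ((k + 1 : ℕ) : ℚ) • qvec α := by
  have hc : 0 < Fintype.card J := Fintype.card_pos_iff.2 ⟨i⟩
  obtain ⟨n, hn⟩ := Nat.exists_eq_succ_of_ne_zero hc.ne'
  rw [x, hn, Finset.sum_range_succ', E.dp_zero hα, pow_zero, one_smul,
    show (1 : Matrix J J ℤ).map (Int.cast : ℤ → K) = 1 by ext i j; simp [Matrix.one_apply],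
    add_sub_cancel_right, Matrix.sum_apply] at h
  obtain ⟨k, -, hk⟩ := Finset.exists_ne_zero_of_sum_ne_zero h
  refine ⟨k, E.supp_dp hα fun h0 => hk ?_⟩
  rw [Matrix.smul_apply, Matrix.map_apply, h0]
  simp

-- Only the linear term of x_α(t) shifts weights by exactly α, so such an entry recovers the
-- parameter t.
include D in
theorem x_apply_of_root {α : Root 𝔤.r} (hα : α ∈ 𝔤.roots) (t : K) {i j : J}
    (h : E.μ i - E.μ j = qvec α) : (E.x K α t - 1) i j = t * E.e K α i j := by
  have hne : i ≠ j := by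
    rintro rfl
    rw [sub_self] at h
    exact qvec_ne_zero D hα h.symm
  have hc : 1 < Fintype.card J := Fintype.one_lt_card_iff.2 ⟨i, j, hne⟩
  rw [Matrix.sub_apply, Matrix.one_apply_ne hne, sub_zero, x, Matrix.sum_apply,
    Finset.sum_eq_single_of_mem 1 (Finset.mem_range.2 hc)]
  · simp [e]
  · intro k _ hk
    have : E.dp α k i j = 0 := by
      by_contra h0
      have h1 := E.supp_dp hα h0
      rw [h] at h1
      have h2 : (1 : ℚ) • qvec α = (k : ℚ) • qvec α := (one_smul ℚ _).trans h1
      have := smul_left_injective ℚ (qvec_ne_zero D hα) h2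
      exact hk (by exact_mod_cast this.symm)
    rw [Matrix.smul_apply, Matrix.map_apply, this]
    simp

include hP in
theorem supp_x {α : Root 𝔤.r} (hα : α ∈ 𝔤.roots) (h : P (qvec α)) (t : K) :
    E.Supp P (E.x K α t) := by
  intro i j hij
  obtain ⟨k, hk⟩ := E.x_sub_one_apply hα hij
  rw [hk]
  clear hk
  induction k with
  | zero => simpa using h
  | succ k ih =>
    have := hP _ _ ih h
    convert this using 1
    push_cast
    module

include D in
theorem gx_mem_suppGroup {α : Root 𝔤.r} (hα : α ∈ 𝔤.roots) (h : P (qvec α)) (t : K) :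
    E.gx K α t ∈ E.suppGroup hP K := by
  refine ⟨?_, ?_⟩
  · rw [E.coe_gx D hα]; exact E.supp_x hP hα h t
  · rw [← E.gx_neg D hα, E.coe_gx D hα]; exact E.supp_x hP hα h _

include D in
theorem rg_le_suppGroup {R : Set (Root 𝔤.r)} (hR : R ⊆ 𝔤.roots) (h : ∀ α ∈ R, P (qvec α)) :
    E.rg K R ≤ E.suppGroup hP K := by
  rw [rg, Subgroup.closure_le]
  rintro _ ⟨α, hα, t, rfl⟩
  exact E.gx_mem_suppGroup D hP (hR hα) (h α hα) t

/-! ### The unipotent group of the positive roots -/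

include D in
theorem vec_add_ne_zero {α β : Root 𝔤.r} (hα : α ∈ 𝔤.posRoots) (hβ : β ∈ 𝔤.posRoots) :
    α.vec + β.vec ≠ 0 := by
  intro h
  have h1 := (D.mem_pos α).1 hα
  have h2 := (D.mem_pos β).1 hβ
  have h3 := D.two_mul_ht α h1.1
  have h4 := D.two_mul_ht β h2.1
  have h5 : 𝔤.twoRho ⬝ᵥ (α.vec + β.vec) = 0 := by rw [h, dotProduct_zero]
  rw [dotProduct_add] at h5
  omega

-- The formula `x_mul_x` needs α + 2β not to be a root. If it is one, then 2α + β is not, and the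
-- formula is applied with the two roots exchanged and a replaced by -a.
include D in
theorem conj_gx_mem {α β : Root 𝔤.r} (hα : α ∈ 𝔤.posRoots) (hβ : β ∈ 𝔤.posRoots) (a b : K) :
    E.gx K α a * E.gx K β b * (E.gx K α a)⁻¹ ∈
      E.rg K ({β} ∪ {γ | γ ∈ 𝔤.posRoots ∧ 𝔤.ht α < 𝔤.ht γ ∧ 𝔤.ht β < 𝔤.ht γ}) := by
  obtain ⟨rα, pα⟩ := (D.mem_pos α).1 hα
  obtain ⟨rβ, pβ⟩ := (D.mem_pos β).1 hβ
  have h0 := vec_add_ne_zero D hα hβ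
  have hz : ∀ (δ ε γ : Root 𝔤.r) (c k l : ℤ) (s : K), δ ∈ 𝔤.posRoots → ε ∈ 𝔤.posRoots →
      γ ∈ 𝔤.roots → (c ≠ 0 → γ.vec = StdData.comb δ ε k l) → 0 < k → 0 < l →
      E.gx K γ (c * s) ∈ E.rg K {γ | γ ∈ 𝔤.posRoots ∧ 𝔤.ht δ < 𝔤.ht γ ∧ 𝔤.ht ε < 𝔤.ht γ} := by
    intro δ ε γ c k l s hδ hε hγ hv hk hl
    by_cases hc : c = 0
    · rw [hc, Int.cast_zero, zero_mul, E.gx_zero D hγ]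
      exact Subgroup.one_mem _
    · obtain ⟨rδ, pδ⟩ := (D.mem_pos δ).1 hδ
      obtain ⟨rε, pε⟩ := (D.mem_pos ε).1 hε
      have h1 := D.ht_of_vec rδ rε hγ (hv hc)
      have h2 : 𝔤.ht δ < 𝔤.ht γ := by nlinarith
      have h3 : 𝔤.ht ε < 𝔤.ht γ := by nlinarith
      have h4 : γ ∈ {γ | γ ∈ 𝔤.posRoots ∧ 𝔤.ht δ < 𝔤.ht γ ∧ 𝔤.ht ε < 𝔤.ht γ} :=
        ⟨(D.mem_pos γ).2 ⟨hγ, by omega⟩, h2, h3⟩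
      exact E.gx_mem_rg h4 _
  by_cases hn : ∀ γ ∈ 𝔤.roots, γ.vec ≠ StdData.comb α β 1 2
  · obtain ⟨β₁, β₂, c₁, c₂, s⟩ := D.exists_string rα rβ h0
    have e : E.gx K α a * E.gx K β b * (E.gx K α a)⁻¹ =
        E.gx K β b * E.gx K β₁ (c₁ * (a * b)) * E.gx K β₂ (c₂ * (a ^ 2 * b)) := by
      rw [mul_inv_eq_iff_eq_mul]
      ext1
      simp only [Units.val_mul, E.coe_gx D rα, E.coe_gx D rβ, E.coe_gx D s.mem₁,
        E.coe_gx D s.mem₂]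
      exact E.x_mul_x D rα rβ h0 s hn a b
    rw [e]
    refine Subgroup.mul_mem _ (Subgroup.mul_mem _ (E.gx_mem_rg (by simp) _) ?_) ?_
    · exact E.rg_mono Set.subset_union_right (hz α β β₁ c₁ 1 1 _ hα hβ s.mem₁ s.vec₁ (by norm_num) (by norm_num))
    · exact E.rg_mono Set.subset_union_right (hz α β β₂ c₂ 2 1 _ hα hβ s.mem₂ s.vec₂ (by norm_num) (by norm_num))
  · push Not at hn
    obtain ⟨δ, hδ, eδ⟩ := hn
    have h0' : β.vec + α.vec ≠ 0 := by rwa [add_comm]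
    obtain ⟨β₁, β₂, c₁, c₂, s⟩ := D.exists_string rβ rα h0'
    have hn' : ∀ γ ∈ 𝔤.roots, γ.vec ≠ StdData.comb β α 1 2 := by
      intro γ hγ eγ
      refine D.comb_two rα rβ h0 γ δ hγ hδ ?_ eδ
      rw [eγ, StdData.comb, StdData.comb, add_comm]
    have e : E.gx K α a * E.gx K β b * (E.gx K α a)⁻¹ =
        E.gx K β₁ (c₁ * (b * -a)) * E.gx K β₂ (c₂ * (b ^ 2 * -a)) * E.gx K β b := by
      rw [← E.gx_neg D rα]
      have h1 : E.gx K β b * E.gx K α (-a) = E.gx K α (-a) * E.gx K β₁ (c₁ * (b * -a)) *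
          E.gx K β₂ (c₂ * (b ^ 2 * -a)) * E.gx K β b := by
        ext1
        simp only [Units.val_mul, E.coe_gx D rα, E.coe_gx D rβ, E.coe_gx D s.mem₁,
          E.coe_gx D s.mem₂]
        exact E.x_mul_x D rβ rα h0' s hn' b (-a)
      rw [mul_assoc, h1, E.gx_neg D rα]
      group
    have hsub : {γ | γ ∈ 𝔤.posRoots ∧ 𝔤.ht β < 𝔤.ht γ ∧ 𝔤.ht α < 𝔤.ht γ} ⊆
      {β} ∪ {γ | γ ∈ 𝔤.posRoots ∧ 𝔤.ht α < 𝔤.ht γ ∧ 𝔤.ht β < 𝔤.ht γ} :=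
      fun γ hγ => Or.inr ⟨hγ.1, hγ.2.2, hγ.2.1⟩
    rw [e]
    refine Subgroup.mul_mem _ (Subgroup.mul_mem _ ?_ ?_) (E.gx_mem_rg (by simp) _)
    · exact E.rg_mono hsub (hz β α β₁ c₁ 1 1 _ hβ hα s.mem₁ s.vec₁ (by norm_num) (by norm_num))
    · exact E.rg_mono hsub (hz β α β₂ c₂ 2 1 _ hβ hα s.mem₂ s.vec₂ (by norm_num) (by norm_num))

/-- Twice the height, as a linear form on `ℚ^r`. -/
def qht (v : Fin 𝔤.r → ℚ) : ℚ := ∑ a, (𝔤.twoRho a : ℚ) * v a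

theorem qht_add (v w : Fin 𝔤.r → ℚ) : qht (v + w) = qht v + qht w := by
  simp [qht, mul_add, Finset.sum_add_distrib]

theorem qht_smul (c : ℚ) (v : Fin 𝔤.r → ℚ) : qht (c • v) = c * qht v := by
  simp only [qht, Finset.mul_sum, Pi.smul_apply, smul_eq_mul]
  exact Finset.sum_congr rfl fun _ _ => by ring

include D in
theorem qht_qvec {α : Root 𝔤.r} (hα : α ∈ 𝔤.roots) : qht (qvec α) = 2 * 𝔤.ht α := by
  have := D.two_mul_ht α hα
  rw [dotProduct] at this
  rw [qht]
  exact_mod_cast this.symm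

include D in
/-- If `S` is a set of positive roots which contains all positive roots of larger height, then an
element of the group of `S` whose support satisfies `P` lies in the group of the roots of `S` which
satisfy `P`. -/
theorem mem_rg_of_supp (h2 : ringChar K ≠ 2) (n : ℕ) : ∀ (S : Finset (Root 𝔤.r)), S.card = n →
    (∀ α ∈ S, α ∈ 𝔤.posRoots) → (∀ α ∈ S, ∀ β ∈ 𝔤.posRoots, 𝔤.ht α < 𝔤.ht β → β ∈ S) →
    ∀ w ∈ E.rg K (S : Set (Root 𝔤.r)), w ∈ E.suppGroup hP K →
      w ∈ E.rg K {γ | γ ∈ S ∧ P (qvec γ)} := by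
  classical
  induction n with
  | zero =>
    intro S hS _ _ w hw _
    rw [Finset.card_eq_zero.1 hS] at hw
    have : E.rg K ((∅ : Finset (Root 𝔤.r)) : Set (Root 𝔤.r)) ≤ ⊥ := by
      rw [rg, Subgroup.closure_le]
      rintro _ ⟨α, hα, -⟩
      simp at hα
    rw [(Subgroup.mem_bot).1 (this hw)]
    exact Subgroup.one_mem _
  | succ n ih =>
    intro S hS hpos hup w hw hwP
    -- With α of least height, commutators with x_α only produce roots of larger height, so x_α
    -- normalizes the group of the remaining roots and can be collected on the left.
    obtain ⟨α, hα, hmin⟩ := S.exists_min_image 𝔤.ht (Finset.card_pos.1 (by omega))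
    have hpα := hpos α hα
    obtain ⟨rα, pα⟩ := (D.mem_pos α).1 hpα
    set S' := S.erase α with hS'
    have hup' : ∀ β ∈ S', ∀ γ ∈ 𝔤.posRoots, 𝔤.ht β < 𝔤.ht γ → γ ∈ S' := by
      intro β hβ γ hγ hlt
      rw [hS', Finset.mem_erase] at hβ ⊢
      refine ⟨?_, hup β hβ.2 γ hγ hlt⟩
      rintro rfl
      have := hmin β hβ.2
      omega
    have hconj : ∀ c : K, ∀ g ∈ E.rg K (S' : Set (Root 𝔤.r)),
        E.gx K α c * g * (E.gx K α c)⁻¹ ∈ E.rg K (S' : Set (Root 𝔤.r)) := by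
      intro c g hg
      have : E.rg K (S' : Set (Root 𝔤.r)) ≤
          (E.rg K (S' : Set (Root 𝔤.r))).comap (MulAut.conj (E.gx K α c)).toMonoidHom := by
        conv_lhs => rw [rg]
        rw [Subgroup.closure_le]
        rintro _ ⟨β, hβ, t, rfl⟩
        rw [Finset.mem_coe, hS', Finset.mem_erase] at hβ
        refine E.rg_mono ?_ (E.conj_gx_mem D hpα (hpos β hβ.2) c t)
        rintro γ (rfl | ⟨h1, h3, -⟩)
        · exact Finset.mem_erase.2 hβ
        · refine Finset.mem_erase.2 ⟨?_, hup α hα γ h1 h3⟩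
          rintro rfl; omega
      exact this hg
    have hdec : ∃ c : K, ∃ v ∈ E.rg K (S' : Set (Root 𝔤.r)), w = E.gx K α c * v := by
      have step : ∀ (β : Root 𝔤.r), β ∈ S → ∀ (t : K) (y : GL J K),
          (∃ c : K, ∃ v ∈ E.rg K (S' : Set (Root 𝔤.r)), y = E.gx K α c * v) →
          ∃ c : K, ∃ v ∈ E.rg K (S' : Set (Root 𝔤.r)), E.gx K β t * y = E.gx K α c * v := by
        rintro β hβ t y ⟨c, v, hv, rfl⟩
        by_cases hβα : β = α
        · subst hβα
          exact ⟨t + c, v, hv, by rw [E.gx_add D rα, mul_assoc]⟩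
        · refine ⟨c, (E.gx K α (-c) * E.gx K β t * (E.gx K α (-c))⁻¹) * v,
            Subgroup.mul_mem _ (hconj _ _ (E.gx_mem_rg (Finset.mem_erase.2 ⟨hβα, hβ⟩) t)) hv, ?_⟩
          rw [E.gx_neg D rα]
          group
      clear hwP
      rw [rg] at hw
      induction hw using Subgroup.closure_induction_left with
      | one => exact ⟨0, 1, Subgroup.one_mem _, by rw [E.gx_zero D rα, mul_one]⟩
      | mul_left x hx y hy ih =>
        obtain ⟨β, hβ, t, rfl⟩ := hx
        exact step β hβ t y ih
      | inv_mul_cancel x hx y hy ih =>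
        obtain ⟨β, hβ, t, rfl⟩ := hx
        rw [← E.gx_neg D ((D.mem_pos β).1 (hpos β hβ)).1]
        exact step β hβ (-t) y ih
    obtain ⟨c, v, hv, rfl⟩ := hdec
    have hcard : S'.card = n := by rw [hS', Finset.card_erase_of_mem hα, hS]; rfl
    have hpos' : ∀ β ∈ S', β ∈ 𝔤.posRoots := fun β hβ => hpos β (Finset.mem_of_mem_erase hβ)
    have hmono : E.rg K {γ | γ ∈ S' ∧ P (qvec γ)} ≤ E.rg K {γ | γ ∈ S ∧ P (qvec γ)} :=
      E.rg_mono fun γ hγ => ⟨Finset.mem_of_mem_erase hγ.1, hγ.2⟩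
    by_cases hPα : P (qvec α)
    · have hα' : α ∈ {γ | γ ∈ S ∧ P (qvec γ)} := ⟨hα, hPα⟩
      refine Subgroup.mul_mem _ (E.gx_mem_rg hα' c) (hmono (ih S' hcard hpos' hup' v hv ?_))
      have := Subgroup.mul_mem _ (Subgroup.inv_mem _ (E.gx_mem_suppGroup D hP rα hPα c)) hwP
      rwa [inv_mul_cancel_left] at this
    -- The parameter c is read off at an entry whose weight difference is α: the other factor
    -- contributes nothing there, so a nonzero c would put α into the support of w.
    · suffices hc : c = 0 by
        subst hc
        rw [E.gx_zero D rα, one_mul] at hwP ⊢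
        exact hmono (ih S' hcard hpos' hup' v hv hwP)
      obtain ⟨i, j, hij⟩ := E.exists_e_ne_zero D K h2 rα
      have hμ : E.μ i - E.μ j = qvec α := E.supp α rα i j fun h0 => hij (by simp [e, h0])
      -- Q is closed under addition because a sum of two such vectors has height larger than that of
      -- α; it confines the support of v - 1 and does not contain α.
      let Q : (Fin 𝔤.r → ℚ) → Prop := fun u => 2 * (𝔤.ht α : ℚ) < qht u ∨ ∃ β ∈ S', u = qvec β
      have hQht : ∀ u, Q u → 2 * (𝔤.ht α : ℚ) ≤ qht u := by
        rintro u (h | ⟨β, hβ, rfl⟩)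
        · exact h.le
        · rw [qht_qvec D ((D.mem_pos β).1 (hpos' β hβ)).1]
          have := hmin β (Finset.mem_of_mem_erase hβ)
          have : (𝔤.ht α : ℚ) ≤ 𝔤.ht β := by exact_mod_cast this
          linarith
      have pα' : (0 : ℚ) < 𝔤.ht α := by exact_mod_cast pα
      have hQ : ∀ u u', Q u → Q u' → Q (u + u') := by
        intro u u' h h'
        left
        rw [qht_add]
        have := hQht u h
        have := hQht u' h'
        linarith
      have hvQ := E.rg_le_suppGroup D (K := K) hQ (R := (S' : Set (Root 𝔤.r)))
        (fun β hβ => ((D.mem_pos β).1 (hpos' β hβ)).1) (fun β hβ => Or.inr ⟨β, hβ, rfl⟩) hv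
      have hent : ((E.gx K α c * v : GL J K) - 1 : Matrix J J K) i j = c * E.e K α i j := by
        have e1 : ((E.gx K α c * v : GL J K) - 1 : Matrix J J K) =
            (E.x K α c - 1) + ((v : Matrix J J K) - 1) +
              (E.x K α c - 1) * ((v : Matrix J J K) - 1) := by
          rw [Units.val_mul, E.coe_gx D rα]; noncomm_ring
        rw [e1, Matrix.add_apply, Matrix.add_apply, E.x_apply_of_root D rα c hμ]
        have z1 : ((v : Matrix J J K) - 1) i j = 0 := by
          by_contra hne
          rcases hvQ.1 i j hne with h | ⟨β, hβ, h⟩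
          · rw [hμ, qht_qvec D rα] at h
            exact lt_irrefl _ h
          · rw [hμ] at h
            have : α = β := D.vec_inj α rα β ((D.mem_pos β).1 (hpos' β hβ)).1 (by
              ext a
              have := congrFun h a
              simpa [qvec] using this)
            rw [this] at hS'
            exact Finset.notMem_erase β S (hS' ▸ hβ)
        have z2 : ((E.x K α c - 1) * ((v : Matrix J J K) - 1)) i j = 0 := by
          rw [Matrix.mul_apply]
          refine Finset.sum_eq_zero fun l _ => ?_
          by_contra hne
          obtain ⟨k, hk⟩ := E.x_sub_one_apply rα (left_ne_zero_of_mul hne)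
          have h3 := hQht _ (hvQ.1 l j (right_ne_zero_of_mul hne))
          have h4 : qht (E.μ i - E.μ j) = qht (E.μ i - E.μ l) + qht (E.μ l - E.μ j) := by
            rw [← qht_add, sub_add_sub_cancel]
          rw [hμ, hk, qht_smul, qht_qvec D rα] at h4
          push_cast at h4
          have h5 : (0 : ℚ) ≤ k * (2 * 𝔤.ht α) := by positivity
          nlinarith
        rw [z1, z2, add_zero, add_zero]
      by_contra hc
      refine hPα ?_
      rw [← hμ]
      exact hwP.1 i j (by rw [hent]; exact mul_ne_zero hc hij)

end Field

end IntRep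
end ToricPairs

/-! ### The defining representation, words in root elements and graded pieces. -/

namespace ToricPairs
open Matrix

attribute [local instance 100] LieRing.ofAssociativeRing

variable {𝔤 : RootedLieAlgebra} (D : StdData 𝔤)

/-- The defining representation as an integral representation. -/
def StdData.std : IntRep 𝔤 𝔤.I where
  ρ := 𝔤.L.incl
  dp α k := match k with
    | 0 => 1
    | 1 => D.X α
    | 2 => D.S α
    | _ => 0
  dp_spec := by
    intro α hα k
    have h1 : (𝔤.L.incl ⟨𝔤.X α, 𝔤.X_mem α hα⟩ : Matrix 𝔤.I 𝔤.I ℚ) = (D.X α).map Int.cast :=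
      (D.map_X α hα).symm
    rw [h1, ← IntRep.map_pow']
    have h2 : D.X α ^ 2 = (2 : ℤ) • D.S α := by rw [pow_two, D.sq α hα]
    match k with
    | 0 => ext i j; simp [Matrix.one_apply]
    | 1 => simp
    | 2 =>
      rw [h2, IntRep.map_zsmul', smul_smul]
      simp
    | k + 3 =>
      have h3 : D.X α ^ (k + 3) = 0 := by
        rw [pow_add, pow_succ', h2, mul_smul_comm, D.cube α hα, smul_zero, mul_zero]
      rw [h3]
      ext i j; simp
  μ i a := D.wt i a
  faithful := Subtype.val_injective
  supp := by
    intro α hα i j h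
    have := (D.supp α hα i j).1 h
    funext a
    have := congrFun this a
    simp only [Pi.sub_apply] at this ⊢
    exact_mod_cast this

theorem StdData.std_e (K : Type*) [CommRing K] (α : Root 𝔤.r) :
    D.std.e K α = (D.X α).map Int.cast := rfl

theorem intCast_ne_zero {K : Type*} [Field K] (h2 : ringChar K ≠ 2) {z : ℤ}
    (h : z.natAbs = 1 ∨ z.natAbs = 2 ∨ z.natAbs = 4) : (z : K) ≠ 0 := by
  have two : (2 : K) ≠ 0 := Ring.two_ne_zero h2
  have four : (4 : K) ≠ 0 := by
    rw [show (4 : K) = 2 * 2 by norm_num]; exact mul_ne_zero two two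
  rcases h with h | h | h <;> rcases Int.natAbs_eq z with e | e <;> rw [h] at e <;> rw [e] <;>
    simp [two, four]

/-- The entries of X α are at most 2 in absolute value, so the nonzero ones stay nonzero when the
characteristic is not 2. -/
theorem StdData.std_e_ne_zero {K : Type*} [Field K] (h2 : ringChar K ≠ 2) {α : Root 𝔤.r}
    (hα : α ∈ 𝔤.roots) {i j : 𝔤.I} : D.std.e K α i j ≠ 0 ↔ D.wt i - D.wt j = α.vec := by
  rw [← D.supp α hα, D.std_e, Matrix.map_apply]
  constructor
  · intro h h'; rw [h', Int.cast_zero] at h; exact h rfl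
  · intro h
    refine intCast_ne_zero h2 ?_
    have h1 := D.natAbs_le α hα i j
    have := Int.natAbs_pos.2 h
    omega

section Words

variable {J : Type} [Fintype J] [DecidableEq J] (E : IntRep 𝔤 J)

/-- The product of the elements `x_α(t)` over a list of pairs `(α, t)`. -/
def IntRep.word {K : Type*} [Field K] (l : List (Root 𝔤.r × K)) : GL J K :=
  (l.map fun p => E.gx K p.1 p.2).prod

variable {K : Type*} [Field K]

theorem IntRep.word_nil : E.word ([] : List (Root 𝔤.r × K)) = 1 := rfl

theorem IntRep.word_cons (p : Root 𝔤.r × K) (l) :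
    E.word (p :: l) = E.gx K p.1 p.2 * E.word l := by
  simp [word]

theorem IntRep.word_append (l l' : List (Root 𝔤.r × K)) :
    E.word (l ++ l') = E.word l * E.word l' := by
  simp [word]

theorem IntRep.word_mem {R : Set (Root 𝔤.r)} {l : List (Root 𝔤.r × K)} (h : ∀ p ∈ l, p.1 ∈ R) :
    E.word l ∈ E.rg K R := by
  rw [word]
  refine Subgroup.list_prod_mem _ fun x hx => ?_
  obtain ⟨p, hp, rfl⟩ := List.mem_map.1 hx
  exact E.gx_mem_rg (h p hp) _

/-- The word of the inverse element. -/
def invWord (l : List (Root 𝔤.r × K)) : List (Root 𝔤.r × K) := (l.map fun p => (p.1, -p.2)).reverse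

theorem mem_invWord {R : Set (Root 𝔤.r)} {l : List (Root 𝔤.r × K)} (h : ∀ p ∈ l, p.1 ∈ R) :
    ∀ p ∈ invWord l, p.1 ∈ R := by
  intro p hp
  rw [invWord, List.mem_reverse, List.mem_map] at hp
  obtain ⟨q, hq, rfl⟩ := hp
  exact h q hq

include D in
theorem IntRep.word_invWord {l : List (Root 𝔤.r × K)} (h : ∀ p ∈ l, p.1 ∈ 𝔤.roots) :
    E.word (invWord l) = (E.word l)⁻¹ := by
  induction l with
  | nil => simp [invWord, word]
  | cons p l ih =>
    have e : invWord (p :: l) = invWord l ++ [(p.1, -p.2)] := by simp [invWord]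
    rw [e, E.word_append, ih fun q hq => h q (List.mem_cons_of_mem _ hq), E.word_cons, E.word_cons,
      E.word_nil, mul_one, E.gx_neg D (h p (List.mem_cons_self)), _root_.mul_inv_rev]

include D in
theorem IntRep.exists_word {R : Set (Root 𝔤.r)} (hR : R ⊆ 𝔤.roots) {u : GL J K}
    (hu : u ∈ E.rg K R) : ∃ l : List (Root 𝔤.r × K), (∀ p ∈ l, p.1 ∈ R) ∧ u = E.word l := by
  rw [rg] at hu
  induction hu using Subgroup.closure_induction with
  | mem x hx =>
    obtain ⟨α, hα, t, rfl⟩ := hx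
    exact ⟨[(α, t)], by simpa using hα, by simp [word]⟩
  | one => exact ⟨[], by simp, rfl⟩
  | mul x y _ _ hx hy =>
    obtain ⟨l, hl, rfl⟩ := hx
    obtain ⟨l', hl', rfl⟩ := hy
    refine ⟨l ++ l', fun p hp => ?_, (E.word_append l l').symm⟩
    rcases List.mem_append.1 hp with h | h
    exacts [hl p h, hl' p h]
  | inv x _ hx =>
    obtain ⟨l, hl, rfl⟩ := hx
    exact ⟨invWord l, mem_invWord hl, (E.word_invWord D fun p hp => hR (hl p hp)).symm⟩

end Words

/-! ### The graded pieces -/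

/-- The roots of height congruent to `c` modulo `d`. -/
abbrev Piece (𝔤 : RootedLieAlgebra) (d : ℕ) (c : ℤ) : Type :=
  {α : Root 𝔤.r // α ∈ 𝔤.roots ∧ 𝔤.ht α ≡ c [ZMOD d]}

instance (d : ℕ) (c : ℤ) : Fintype (Piece 𝔤 d c) := Fintype.ofFinite _

instance (d : ℕ) (c : ℤ) : DecidableEq (Piece 𝔤 d c) := Classical.decEq _

/-- The positive roots of height divisible by `d`. -/
def psi (𝔤 : RootedLieAlgebra) (d : ℕ) : Set (Root 𝔤.r) :=
  {γ | γ ∈ 𝔤.posRoots ∧ 𝔤.ht γ ≡ 0 [ZMOD d]}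

include D in
theorem psi_subset (d : ℕ) : psi 𝔤 d ⊆ 𝔤.roots := fun γ hγ => ((D.mem_pos γ).1 hγ.1).1

/-- The matrix with given coordinates with respect to the root vectors in a graded piece. -/
def IntRep.comb {J : Type} [Fintype J] [DecidableEq J] (E : IntRep 𝔤 J) {K : Type*} [Field K]
    {d : ℕ} {c : ℤ} : (Piece 𝔤 d c → K) →ₗ[K] Matrix J J K :=
  Fintype.linearCombination K fun α : Piece 𝔤 d c => E.e K α.1

section Intertwine

variable {K : Type*} [Field K] {d : ℕ} {c : ℤ}

theorem comb_apply {J : Type} [Fintype J] [DecidableEq J] (E : IntRep 𝔤 J)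
    (a : Piece 𝔤 d c → K) : E.comb a = ∑ α, a α • E.e K α.1 := rfl

theorem comb_single {J : Type} [Fintype J] [DecidableEq J] (E : IntRep 𝔤 J)
    (α : Piece 𝔤 d c) (s : K) : E.comb (Pi.single α s) = s • E.e K α.1 := by
  rw [IntRep.comb, Fintype.linearCombination_apply_single]

-- Since c is not 0 modulo d, γ and δ are never opposite and the string formula applies; its roots γ
-- + δ and 2γ + δ have the same residue as δ. The coefficients come from the defining
-- representation, so `v` can be chosen before E.
include D in
theorem exists_gx_conj (hc : ¬ c ≡ 0 [ZMOD d]) {γ : Root 𝔤.r} (hγ : γ ∈ psi 𝔤 d) (t : K)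
    (δ : Piece 𝔤 d c) : ∃ v : Piece 𝔤 d c → K,
      ∀ (J : Type) [Fintype J] [DecidableEq J] (E : IntRep 𝔤 J),
        E.x K γ t * E.e K δ.1 = E.comb v * E.x K γ t := by
  have rγ := psi_subset D d hγ
  obtain ⟨δ, rδ, hδ⟩ := δ
  have h0 : γ.vec + δ.vec ≠ 0 := by
    intro h
    have h1 := D.two_mul_ht γ rγ
    have h2 := D.two_mul_ht δ rδ
    have h3 : 𝔤.twoRho ⬝ᵥ (γ.vec + δ.vec) = 0 := by rw [h, dotProduct_zero]
    rw [dotProduct_add] at h3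
    have h4 : 𝔤.ht δ = - 𝔤.ht γ := by omega
    refine hc (hδ.symm.trans ?_)
    rw [h4]
    simpa using hγ.2.neg
  obtain ⟨β₁, β₂, c₁, c₂, s⟩ := D.exists_string rγ rδ h0
  have hmem : ∀ (β : Root 𝔤.r) (k : ℤ), β ∈ 𝔤.roots → β.vec = StdData.comb γ δ k 1 →
      𝔤.ht β ≡ c [ZMOD d] := by
    intro β k rβ hv
    rw [D.ht_of_vec rγ rδ rβ hv, one_mul]
    simpa using (hγ.2.mul_left k).add hδ
  have hex : ∀ (β : Root 𝔤.r) (k z : ℤ) (q : K), β ∈ 𝔤.roots →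
      (z ≠ 0 → β.vec = StdData.comb γ δ k 1) → ∃ v : Piece 𝔤 d c → K,
      ∀ (J : Type) [Fintype J] [DecidableEq J] (E : IntRep 𝔤 J),
        (z * q) • E.e K β = E.comb v := by
    intro β k z q rβ hv
    by_cases hz : z = 0
    · exact ⟨0, fun J _ _ E => by rw [hz, Int.cast_zero, zero_mul, zero_smul, map_zero]⟩
    · exact ⟨Pi.single ⟨β, rβ, hmem β k rβ (hv hz)⟩ (z * q), fun J _ _ E => by rw [comb_single]⟩
  obtain ⟨v₁, hv₁⟩ := hex β₁ 1 c₁ t s.mem₁ s.vec₁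
  obtain ⟨v₂, hv₂⟩ := hex β₂ 2 c₂ (t ^ 2) s.mem₂ s.vec₂
  refine ⟨Pi.single ⟨δ, rδ, hδ⟩ 1 + v₁ + v₂, fun J _ _ E => ?_⟩
  rw [E.x_mul_e D rγ rδ s t, map_add, map_add, comb_single, one_smul, hv₁, hv₂]

include D in
/-- The adjoint action of a word on a graded piece is given by the same matrix in all
representations. -/
theorem exists_word_conj (hc : ¬ c ≡ 0 [ZMOD d]) (l : List (Root 𝔤.r × K))
    (hl : ∀ p ∈ l, p.1 ∈ psi 𝔤 d) : ∃ A : (Piece 𝔤 d c → K) →ₗ[K] (Piece 𝔤 d c → K),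
      ∀ (J : Type) [Fintype J] [DecidableEq J] (E : IntRep 𝔤 J) (a : Piece 𝔤 d c → K),
        (E.word l : Matrix J J K) * E.comb a = E.comb (A a) * (E.word l : Matrix J J K) := by
  induction l with
  | nil => exact ⟨LinearMap.id, fun J _ _ E a => by simp [IntRep.word]⟩
  | cons p l ih =>
    obtain ⟨A, hA⟩ := ih fun q hq => hl q (List.mem_cons_of_mem _ hq)
    have hp := hl p List.mem_cons_self
    choose v hv using exists_gx_conj D (c := c) hc hp p.2
    refine ⟨(Fintype.linearCombination K v) ∘ₗ A, fun J _ _ E a => ?_⟩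
    have h1 : ∀ b : Piece 𝔤 d c → K, E.x K p.1 p.2 * E.comb b =
        E.comb (Fintype.linearCombination K v b) * E.x K p.1 p.2 := by
      intro b
      rw [comb_apply, Fintype.linearCombination_apply, map_sum, Finset.mul_sum, Finset.sum_mul]
      refine Finset.sum_congr rfl fun δ _ => ?_
      rw [mul_smul_comm, hv δ J E, map_smul, smul_mul_assoc]
    rw [E.word_cons, Units.val_mul, E.coe_gx D (psi_subset D d hp), mul_assoc, hA, ← mul_assoc, h1,
      LinearMap.comp_apply, mul_assoc]

end Intertwine
end ToricPairs

/-! ### Inner and outer weights of an admissible Levi subgroup. -/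

namespace ToricPairs
open Matrix

attribute [local instance 100] LieRing.ofAssociativeRing

/-- A weight is inner if its outer coordinates vanish. -/
def StdData.Inner {𝔤 : RootedLieAlgebra} (D : StdData 𝔤) (m : ℕ) (i : 𝔤.I) : Prop :=
  ∀ c : Fin 𝔤.r, (c : ℕ) < 𝔤.n - m → D.wt i c = 0

/-- The combinatorial facts about the admissible Levi subgroup with `m` simple roots that are needed
for toricity. A coordinate `c` is called outer if `c < n - m`, and a weight is called inner if its
outer coordinates vanish. -/
structure LeviData {𝔤 : RootedLieAlgebra} (D : StdData 𝔤) (m d : ℕ) : Prop where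
  two_le : 2 ≤ d
  wt_cases : ∀ i, D.wt i = 0 ∨ (∃ c, D.wt i = Pi.single c 1) ∨ ∃ c, D.wt i = -Pi.single c 1
  wt_surj : ∀ c, ∃ i, D.wt i = Pi.single c 1
  wt_neg : ∀ i c, D.wt i = -Pi.single c 1 → ∀ k, ∃ k', D.wt k' = -D.wt k
  inner_span : ∀ i j, D.Inner m i →
    D.Inner m j →
    D.wt i - D.wt j ∈ Submodule.span ℤ ((fun k => (𝔤.simple k).vec) '' admissible 𝔤 m)
  simple_outer : ∀ k ∈ admissible 𝔤 m, ∀ c : Fin 𝔤.r, (c : ℕ) < 𝔤.n - m → (𝔤.simple k).vec c = 0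
  simple_mem : ∀ k, 𝔤.simple k ∈ 𝔤.roots ∧ 𝔤.ht (𝔤.simple k) = 1
  -- Pairing with 2ρ^∨ doubles heights, so heights modulo d become pairings modulo 2d, and a shift
  -- of the height by 1 becomes a shift by 2.
  exists_congr : ∀ i, ∃ j, D.Inner m j ∧
    𝔤.twoRho ⬝ᵥ D.wt i ≡ 𝔤.twoRho ⬝ᵥ D.wt j [ZMOD (2 * d : ℕ)]
  exists_succ : ∀ i, ∃ j, D.Inner m j ∧
    𝔤.twoRho ⬝ᵥ D.wt j ≡ 𝔤.twoRho ⬝ᵥ D.wt i + 2 [ZMOD (2 * d : ℕ)]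
  -- Two inner weights may share a residue in types B and D. What is needed is that of two
  -- consecutive residues at least one belongs to a single inner weight.
  unique : ∀ j j' k k', D.Inner m j →
    D.Inner m j' → D.Inner m k →
    D.Inner m k' →
    𝔤.twoRho ⬝ᵥ D.wt j ≡ 𝔤.twoRho ⬝ᵥ D.wt j' [ZMOD (2 * d : ℕ)] →
    𝔤.twoRho ⬝ᵥ D.wt k ≡ 𝔤.twoRho ⬝ᵥ D.wt j + 2 [ZMOD (2 * d : ℕ)] →
    𝔤.twoRho ⬝ᵥ D.wt k' ≡ 𝔤.twoRho ⬝ᵥ D.wt j + 2 [ZMOD (2 * d : ℕ)] → j = j' ∨ k = k'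
  inner_root : ∀ j k, D.Inner m j →
    D.Inner m k →
    𝔤.twoRho ⬝ᵥ D.wt k ≡ 𝔤.twoRho ⬝ᵥ D.wt j + 2 [ZMOD (2 * d : ℕ)] →
    ∃ α ∈ 𝔤.roots, α.vec = D.wt k - D.wt j
  -- The subtraction is truncated: the coefficient decreases from n - m to 1 along the outer
  -- coordinates and is 0 at all inner ones.
  psi_outer : ∀ γ ∈ psi 𝔤 d, 0 < ∑ c : Fin 𝔤.r, ((𝔤.n - m - c : ℕ) : ℤ) * γ.vec c
  outer_root : ∀ i (c : Fin 𝔤.r) j, (c : ℕ) < 𝔤.n - m → D.wt i = Pi.single c 1 →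
    D.Inner m j → ∃ α ∈ 𝔤.posRoots, α.vec = D.wt i - D.wt j

variable {𝔤 : RootedLieAlgebra} {D : StdData 𝔤} {m d : ℕ}

/-- The linear form that is positive on the roots in `psi`. -/
def lam (𝔤 : RootedLieAlgebra) (m : ℕ) (v : Fin 𝔤.r → ℚ) : ℚ := ∑ c : Fin 𝔤.r, ((𝔤.n - m - c : ℕ) : ℚ) * v c

theorem lam_add (v w : Fin 𝔤.r → ℚ) : lam 𝔤 m (v + w) = lam 𝔤 m v + lam 𝔤 m w := by
  simp [lam, mul_add, Finset.sum_add_distrib]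

theorem lam_sub (v w : Fin 𝔤.r → ℚ) : lam 𝔤 m (v - w) = lam 𝔤 m v - lam 𝔤 m w := by
  simp [lam, mul_sub, Finset.sum_sub_distrib]

theorem lam_pos_add (v w : Fin 𝔤.r → ℚ) (hv : 0 < lam 𝔤 m v) (hw : 0 < lam 𝔤 m w) :
    0 < lam 𝔤 m (v + w) := by
  rw [lam_add]; exact add_pos hv hw

theorem lam_inner {i : 𝔤.I} (hi : D.Inner m i) : lam 𝔤 m (D.std.μ i) = 0 := by
  rw [lam]
  refine Finset.sum_eq_zero fun c _ => ?_
  by_cases hc : (c : ℕ) < 𝔤.n - m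
  · have : D.std.μ i c = 0 := by
      change ((D.wt i c : ℤ) : ℚ) = 0
      rw [hi c hc, Int.cast_zero]
    rw [this, mul_zero]
  · rw [show 𝔤.n - m - (c : ℕ) = 0 by omega, Nat.cast_zero, zero_mul]

theorem lam_single {i : 𝔤.I} {c : Fin 𝔤.r} {s : ℤ} (h : D.wt i = s • Pi.single c 1) :
    lam 𝔤 m (D.std.μ i) = s * ((𝔤.n - m - c : ℕ) : ℚ) := by
  rw [lam, Finset.sum_eq_single c]
  · change _ * ((D.wt i c : ℤ) : ℚ) = _
    rw [h]; simp [mul_comm]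
  · intro b _ hb
    change _ * ((D.wt i b : ℤ) : ℚ) = _
    rw [h]; simp [Pi.single_eq_of_ne hb]
  · simp

theorem lam_outer {i : 𝔤.I} {c : Fin 𝔤.r} (hc : (c : ℕ) < 𝔤.n - m) (h : D.wt i = Pi.single c 1) :
    0 < lam 𝔤 m (D.std.μ i) := by
  rw [lam_single (s := 1) (by rw [h, one_smul]), Int.cast_one, one_mul]
  exact_mod_cast Nat.sub_pos_of_lt hc

theorem lam_outer_neg {i : 𝔤.I} {c : Fin 𝔤.r} (h : D.wt i = -Pi.single c 1) :
    lam 𝔤 m (D.std.μ i) ≤ 0 := by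
  rw [lam_single (s := -1) (by rw [h, neg_smul, one_smul])]
  have : (0 : ℚ) ≤ ((𝔤.n - m - c : ℕ) : ℚ) := Nat.cast_nonneg _
  push_cast
  linarith

theorem two_ht {α : Root 𝔤.r} (hα : α ∈ 𝔤.roots) {i j : 𝔤.I} (h : α.vec = D.wt i - D.wt j) :
    2 * 𝔤.ht α = 𝔤.twoRho ⬝ᵥ D.wt i - 𝔤.twoRho ⬝ᵥ D.wt j := by
  rw [D.two_mul_ht α hα, h, dotProduct_sub]

theorem ht_modEq {α : Root 𝔤.r} (hα : α ∈ 𝔤.roots) {i j : 𝔤.I} (h : α.vec = D.wt i - D.wt j)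
    (c : ℤ) : 𝔤.ht α ≡ c [ZMOD d] ↔
      𝔤.twoRho ⬝ᵥ D.wt i ≡ 𝔤.twoRho ⬝ᵥ D.wt j + 2 * c [ZMOD (2 * d : ℕ)] := by
  have h1 := two_ht hα h
  rw [Int.modEq_iff_dvd, Int.modEq_iff_dvd]
  have h2 : 𝔤.twoRho ⬝ᵥ D.wt j + 2 * c - 𝔤.twoRho ⬝ᵥ D.wt i = 2 * (c - 𝔤.ht α) := by linarith
  rw [h2]
  push_cast
  exact (mul_dvd_mul_iff_left two_ne_zero).symm

namespace LeviData

variable (M : LeviData D m d)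
include M

theorem cases (i : 𝔤.I) : D.Inner m i ∨
    (∃ c : Fin 𝔤.r, (c : ℕ) < 𝔤.n - m ∧ D.wt i = Pi.single c 1) ∨
    (∃ c : Fin 𝔤.r, (c : ℕ) < 𝔤.n - m ∧ D.wt i = -Pi.single c 1) := by
  rcases M.wt_cases i with h | ⟨c, h⟩ | ⟨c, h⟩
  · left; intro c _; rw [h]; rfl
  · by_cases hc : (c : ℕ) < 𝔤.n - m
    · exact Or.inr (Or.inl ⟨c, hc, h⟩)
    · left
      intro b hb
      rw [h, Pi.single_eq_of_ne]
      rintro rfl; exact hc hb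
  · by_cases hc : (c : ℕ) < 𝔤.n - m
    · exact Or.inr (Or.inr ⟨c, hc, h⟩)
    · left
      intro b hb
      rw [h, Pi.neg_apply, Pi.single_eq_of_ne, neg_zero]
      rintro rfl; exact hc hb

theorem psi_lam {γ : Root 𝔤.r} (hγ : γ ∈ psi 𝔤 d) : 0 < lam 𝔤 m (IntRep.qvec γ) := by
  have := M.psi_outer γ hγ
  rw [lam]
  have h : (0 : ℚ) < ((∑ c : Fin 𝔤.r, ((𝔤.n - m - c : ℕ) : ℤ) * γ.vec c : ℤ) : ℚ) := by
    exact_mod_cast this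
  push_cast at h
  exact h

/-- Roots of the Levi subgroup have vanishing outer coordinates. -/
theorem levi_outer {α : Root 𝔤.r} (hα : α ∈ 𝔤.leviRoots (admissible 𝔤 m)) (c : Fin 𝔤.r)
    (hc : (c : ℕ) < 𝔤.n - m) : α.vec c = 0 := by
  obtain ⟨-, h⟩ := hα
  generalize α.vec = v at h
  induction h using Submodule.span_induction with
  | mem x hx =>
    obtain ⟨k, hk, rfl⟩ := hx
    exact M.simple_outer k hk c hc
  | zero => rfl
  | add x y _ _ hx hy => rw [Pi.add_apply, hx, hy, add_zero]
  | smul a x _ hx => rw [Pi.smul_apply, hx, smul_zero]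

/-- The two weights have the same outer coordinates. A weight with a nonzero outer coordinate is
some ±χ_c, determined by that coordinate, so the two weights would coincide and α would vanish. -/
theorem inner_of_levi {α : Root 𝔤.r} (hα : α ∈ 𝔤.leviRoots (admissible 𝔤 m)) {i j : 𝔤.I}
    (h : D.wt i - D.wt j = α.vec) : D.Inner m i ∧ D.Inner m j := by
  have h0 : ∀ c : Fin 𝔤.r, (c : ℕ) < 𝔤.n - m → D.wt i c = D.wt j c := by
    intro c hc
    have h1 := M.levi_outer hα c hc
    have h2 := congrFun h c
    rw [h1, Pi.sub_apply] at h2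
    omega
  have hne : D.wt i ≠ D.wt j := by
    intro e
    rw [e, sub_self] at h
    exact D.vec_ne_zero hα.1 h.symm
  suffices hi : D.Inner m i from ⟨hi, fun c hc => by rw [← h0 c hc]; exact hi c hc⟩
  rcases M.cases i with hi | ⟨c, hc, hi⟩ | ⟨c, hc, hi⟩
  · exact hi
  · exfalso
    have h1 := h0 c hc
    rw [hi, Pi.single_eq_same] at h1
    rcases M.wt_cases j with hj | ⟨b, hj⟩ | ⟨b, hj⟩
    · rw [hj] at h1; simp at h1
    · rw [hj, Pi.single_apply] at h1
      split_ifs at h1 with hb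
      · subst hb; exact hne (hi.trans hj.symm)
      · omega
    · rw [hj, Pi.neg_apply, Pi.single_apply] at h1
      split_ifs at h1; omega
  · exfalso
    have h1 := h0 c hc
    rw [hi, Pi.neg_apply, Pi.single_eq_same] at h1
    rcases M.wt_cases j with hj | ⟨b, hj⟩ | ⟨b, hj⟩
    · rw [hj] at h1; simp at h1
    · rw [hj, Pi.single_apply] at h1
      split_ifs at h1
    · rw [hj, Pi.neg_apply, Pi.single_apply] at h1
      split_ifs at h1 with hb
      subst hb; exact hne (hi.trans hj.symm)

theorem one_not_congr : ¬ (1 : ℤ) ≡ 0 [ZMOD d] := by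
  rw [Int.modEq_zero_iff_dvd]
  intro h
  have := Int.le_of_dvd one_pos h
  have := M.two_le
  omega

theorem neg_one_not_congr : ¬ (-1 : ℤ) ≡ 0 [ZMOD d] := by
  rw [Int.modEq_zero_iff_dvd, dvd_neg]
  intro h
  have := Int.le_of_dvd one_pos h
  have := M.two_le
  omega

end LeviData

/-! ### The functional as a matrix in the defining representation, and its conjugates. -/

section Core

variable {K : Type*} [Field K]

/-- The opposite root of a root in the piece of degree `1`. -/
def Piece.opp (D : StdData 𝔤) (α : Piece 𝔤 d 1) : Piece 𝔤 d (-1) :=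
  ⟨α.1.opp, D.opp_mem _ α.2.1, by
    have h : 𝔤.ht α.1.opp = -𝔤.ht α.1 := by
      have h1 := D.two_mul_ht _ α.2.1
      have h2 := D.two_mul_ht _ (D.opp_mem _ α.2.1)
      rw [Root.vec_opp, dotProduct_neg] at h2
      omega
    rw [h]; exact α.2.2.neg⟩

/-- The trace of the product of opposite root vectors. -/
def tr (D : StdData 𝔤) (K : Type*) [Field K] (α : Root 𝔤.r) : K :=
  (((D.X α * D.X α.opp).trace : ℤ) : K)

theorem tr_ne_zero (h2 : ringChar K ≠ 2) {α : Root 𝔤.r} (hα : α ∈ 𝔤.roots) : tr D K α ≠ 0 := by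
  refine intCast_ne_zero h2 ?_
  rcases D.trace_ne α hα with h | h | h
  · rw [h]; simp
  · rw [h]; simp
  · rw [Set.mem_singleton_iff] at h; rw [h]; simp

/-- A diagonal entry of the product can be nonzero only if the weights α and β cancel. Thus the
trace form pairs each root space with the opposite one alone. -/
theorem trace_e_mul_e [DecidableEq (Root 𝔤.r)] {α β : Root 𝔤.r} (hα : α ∈ 𝔤.roots)
    (hβ : β ∈ 𝔤.roots) : (D.std.e K β * D.std.e K α).trace = if β = α.opp then tr D K α else 0 := by
  split_ifs with h
  · subst h
    rw [trace_mul_comm, D.std_e, D.std_e, ← StdData.map_mul', tr, Matrix.trace, Matrix.trace,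
      Int.cast_sum]
    rfl
  · rw [Matrix.trace]
    refine Finset.sum_eq_zero fun i _ => ?_
    rw [Matrix.diag_apply, Matrix.mul_apply]
    refine Finset.sum_eq_zero fun j _ => ?_
    by_contra hne
    have h1 : D.X β i j ≠ 0 := by
      intro h0; refine left_ne_zero_of_mul hne ?_; rw [D.std_e, Matrix.map_apply, h0, Int.cast_zero]
    have h3 : D.X α j i ≠ 0 := by
      intro h0; refine right_ne_zero_of_mul hne ?_
      rw [D.std_e, Matrix.map_apply, h0, Int.cast_zero]
    have h4 := (D.supp β hβ i j).1 h1
    have h5 := (D.supp α hα j i).1 h3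
    refine h (D.vec_inj β hβ _ (D.opp_mem α hα) ?_)
    rw [Root.vec_opp, ← h4, ← h5, neg_sub]

/-- The entries of a combination of root vectors. -/
theorem comb_entry {c : ℤ} (b : Piece 𝔤 d c → K) (i j : 𝔤.I)
    (δ : Piece 𝔤 d c) (h : D.wt i - D.wt j = δ.1.vec) :
    D.std.comb b i j = b δ * D.std.e K δ.1 i j := by
  rw [comb_apply, Matrix.sum_apply, Finset.sum_eq_single δ]
  · rfl
  · intro ε _ hε
    rw [Matrix.smul_apply, smul_eq_mul]
    have : D.X ε.1 i j = 0 := by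
      by_contra h0
      have h1 := (D.supp _ ε.2.1 i j).1 h0
      exact hε (Subtype.ext (D.vec_inj _ ε.2.1 _ δ.2.1 (h1.symm.trans h)))
    rw [D.std_e, Matrix.map_apply, this, Int.cast_zero, mul_zero]
  · simp

theorem comb_entry_zero {c : ℤ} (b : Piece 𝔤 d c → K) (i j : 𝔤.I)
    (h : ∀ δ : Piece 𝔤 d c, D.wt i - D.wt j ≠ δ.1.vec) : D.std.comb b i j = 0 := by
  rw [comb_apply, Matrix.sum_apply]
  refine Finset.sum_eq_zero fun ε _ => ?_
  rw [Matrix.smul_apply, smul_eq_mul]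
  have : D.X ε.1 i j = 0 := by
    by_contra h0
    exact h ε ((D.supp _ ε.2.1 i j).1 h0)
  rw [D.std_e, Matrix.map_apply, this, Int.cast_zero, mul_zero]

theorem trace_comb_mul (b : Piece 𝔤 d (-1) → K) (δ : Piece 𝔤 d 1) :
    (D.std.comb b * D.std.e K δ.1).trace = b (δ.opp D) * tr D K δ.1 := by
  classical
  rw [comb_apply, Finset.sum_mul, Matrix.trace_sum, Finset.sum_eq_single (δ.opp D)]
  · rw [smul_mul_assoc, trace_smul, trace_e_mul_e δ.2.1 (δ.opp D).2.1,
      if_pos (show (δ.opp D).1 = δ.1.opp from rfl), smul_eq_mul]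
  · intro ε _ hε
    rw [smul_mul_assoc, trace_smul, trace_e_mul_e δ.2.1 ε.2.1, if_neg, smul_zero]
    exact fun h => hε (Subtype.ext h)
  · simp

/-- The matrix representing a functional on the piece of degree `1` through the trace form. -/
def dualMatrix (D : StdData 𝔤) (f : Piece 𝔤 d 1 → K) : Matrix 𝔤.I 𝔤.I K :=
  ∑ α : Piece 𝔤 d 1, (f α / tr D K α.1) • D.std.e K α.1.opp

theorem dualMatrix_mem (f : Piece 𝔤 d 1 → K) :
    ∃ b : Piece 𝔤 d (-1) → K, dualMatrix D f = D.std.comb b := by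
  refine ⟨∑ α, Pi.single (α.opp D) (f α / tr D K α.1), ?_⟩
  rw [map_sum, dualMatrix]
  refine Finset.sum_congr rfl fun α _ => ?_
  rw [comb_single]; rfl

theorem trace_dualMatrix (h2 : ringChar K ≠ 2) (f : Piece 𝔤 d 1 → K) (δ : Piece 𝔤 d 1) :
    (dualMatrix D f * D.std.e K δ.1).trace = f δ := by
  classical
  rw [dualMatrix, Finset.sum_mul, Matrix.trace_sum, Finset.sum_eq_single δ]
  · rw [smul_mul_assoc, trace_smul, trace_e_mul_e δ.2.1 (D.opp_mem _ δ.2.1), if_pos rfl,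
      smul_eq_mul, div_mul_cancel₀ _ (tr_ne_zero h2 δ.2.1)]
  · intro ε _ hε
    rw [smul_mul_assoc, trace_smul, trace_e_mul_e δ.2.1 (D.opp_mem _ ε.2.1), if_neg, smul_zero]
    intro h
    refine hε (Subtype.ext ?_)
    rw [← Root.opp_opp ε.1, h, Root.opp_opp]
  · simp

theorem dualMatrix_entry (f : Piece 𝔤 d 1 → K) (j k : 𝔤.I) (δ : Piece 𝔤 d 1)
    (h : δ.1.vec = D.wt k - D.wt j) :
    dualMatrix D f j k = f δ / tr D K δ.1 * D.std.e K δ.1.opp j k := by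
  rw [dualMatrix, Matrix.sum_apply, Finset.sum_eq_single δ]
  · rfl
  · intro ε _ hε
    rw [Matrix.smul_apply, smul_eq_mul]
    have : D.X ε.1.opp j k = 0 := by
      by_contra h0
      have h1 := (D.supp _ (D.opp_mem _ ε.2.1) j k).1 h0
      rw [Root.vec_opp] at h1
      exact hε (Subtype.ext (D.vec_inj _ ε.2.1 _ δ.2.1 (by rw [h, ← neg_neg ε.1.vec, ← h1, neg_sub])))
    rw [D.std_e, Matrix.map_apply, this, Int.cast_zero, mul_zero]
  · simp

theorem exists_of_dualMatrix_ne (f : Piece 𝔤 d 1 → K) {j k : 𝔤.I} (h : dualMatrix D f j k ≠ 0) :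
    ∃ δ : Piece 𝔤 d 1, δ.1.vec = D.wt k - D.wt j ∧ f δ ≠ 0 := by
  rw [dualMatrix, Matrix.sum_apply] at h
  obtain ⟨δ, -, hδ⟩ := Finset.exists_ne_zero_of_sum_ne_zero h
  rw [Matrix.smul_apply, smul_eq_mul] at hδ
  refine ⟨δ, ?_, fun h0 => hδ (by rw [h0, zero_div, zero_mul])⟩
  have : D.X δ.1.opp j k ≠ 0 := by
    intro h0; refine right_ne_zero_of_mul hδ ?_; rw [D.std_e, Matrix.map_apply, h0, Int.cast_zero]
  have h1 := (D.supp _ (D.opp_mem _ δ.2.1) j k).1 this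
  rw [Root.vec_opp] at h1
  rw [← neg_neg δ.1.vec, ← h1, neg_sub]

/-- The supports of the elements of the group of `psi` in the defining representation. -/
def congrP (𝔤 : RootedLieAlgebra) (d : ℕ) (v : Fin 𝔤.r → ℚ) : Prop :=
  ∃ z : ℤ, IntRep.qht v = 2 * d * z

theorem congrP_add (v w : Fin 𝔤.r → ℚ) (hv : congrP 𝔤 d v) (hw : congrP 𝔤 d w) :
    congrP 𝔤 d (v + w) := by
  obtain ⟨a, ha⟩ := hv
  obtain ⟨b, hb⟩ := hw
  exact ⟨a + b, by rw [IntRep.qht_add, ha, hb]; push_cast; ring⟩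

theorem congrP_root (D : StdData 𝔤) {γ : Root 𝔤.r} (hγ : γ ∈ 𝔤.roots) (h : 𝔤.ht γ ≡ 0 [ZMOD d]) :
    congrP 𝔤 d (IntRep.qvec γ) := by
  obtain ⟨z, hz⟩ := Int.modEq_zero_iff_dvd.1 h
  exact ⟨z, by rw [IntRep.qht_qvec D hγ, hz]; push_cast; ring⟩

theorem congrP_std {i j : 𝔤.I} (h : congrP 𝔤 d (D.std.μ i - D.std.μ j)) :
    𝔤.twoRho ⬝ᵥ D.wt i ≡ 𝔤.twoRho ⬝ᵥ D.wt j [ZMOD (2 * d : ℕ)] := by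
  obtain ⟨z, hz⟩ := h
  have h1 : IntRep.qht (D.std.μ i - D.std.μ j) =
      ((𝔤.twoRho ⬝ᵥ D.wt i - 𝔤.twoRho ⬝ᵥ D.wt j : ℤ) : ℚ) := by
    rw [IntRep.qht, ← dotProduct_sub, dotProduct]
    rw [Int.cast_sum]
    refine Finset.sum_congr rfl fun a _ => ?_
    change _ * (((D.wt i a : ℤ) : ℚ) - ((D.wt j a : ℤ) : ℚ)) = _
    rw [Pi.sub_apply]
    push_cast
    rfl
  rw [h1] at hz
  have hz' : 𝔤.twoRho ⬝ᵥ D.wt i - 𝔤.twoRho ⬝ᵥ D.wt j = 2 * d * z := by exact_mod_cast hz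
  symm
  rw [Int.modEq_iff_dvd, hz']
  push_cast
  exact dvd_mul_right _ _

namespace LeviData

variable (M : LeviData D m d)
include M

/-- Both conclusions hold for the generators and are stable under products: `lam` is positive on the
roots of `psi`, and their heights are divisible by d. -/
theorem supp_lam {w : GL 𝔤.I K} (hw : w ∈ D.std.rg K (psi 𝔤 d)) {i j : 𝔤.I} (hij : i ≠ j)
    (h : (w : Matrix 𝔤.I 𝔤.I K) i j ≠ 0) :
    lam 𝔤 m (D.std.μ j) < lam 𝔤 m (D.std.μ i) ∧
      𝔤.twoRho ⬝ᵥ D.wt i ≡ 𝔤.twoRho ⬝ᵥ D.wt j [ZMOD (2 * d : ℕ)] := by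
  have h1 := D.std.rg_le_suppGroup D (K := K) (lam_pos_add (𝔤 := 𝔤) (m := m)) (psi_subset D d)
    (fun γ hγ => M.psi_lam hγ) hw
  have h2 := D.std.rg_le_suppGroup D (K := K) (congrP_add (𝔤 := 𝔤) (d := d)) (psi_subset D d)
    (fun γ hγ => congrP_root D (psi_subset D d hγ) hγ.2) hw
  have h3 : ((w : Matrix 𝔤.I 𝔤.I K) - 1) i j ≠ 0 := by
    rwa [Matrix.sub_apply, Matrix.one_apply_ne hij, sub_zero]
  have h4 : 0 < lam 𝔤 m (D.std.μ i - D.std.μ j) := h1.1 i j h3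
  rw [lam_sub] at h4
  exact ⟨by linarith, congrP_std (h2.1 i j h3)⟩

theorem diag_one {w : GL 𝔤.I K} (hw : w ∈ D.std.rg K (psi 𝔤 d)) (i : 𝔤.I) :
    (w : Matrix 𝔤.I 𝔤.I K) i i = 1 := by
  have h1 := D.std.rg_le_suppGroup D (K := K) (lam_pos_add (𝔤 := 𝔤) (m := m)) (psi_subset D d)
    (fun γ hγ => M.psi_lam hγ) hw
  by_contra h
  have h3 : ((w : Matrix 𝔤.I 𝔤.I K) - 1) i i ≠ 0 := by
    rw [Matrix.sub_apply, Matrix.one_apply_eq]; exact sub_ne_zero.2 h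
  have h4 : 0 < lam 𝔤 m (D.std.μ i - D.std.μ i) := h1.1 i i h3
  rw [sub_self, lam] at h4
  simp at h4

theorem inner_one {w : GL 𝔤.I K} (hw : w ∈ D.std.rg K (psi 𝔤 d)) {i j : 𝔤.I}
    (h : lam 𝔤 m (D.std.μ i) ≤ lam 𝔤 m (D.std.μ j)) :
    (w : Matrix 𝔤.I 𝔤.I K) i j = (1 : Matrix 𝔤.I 𝔤.I K) i j := by
  by_cases hij : i = j
  · subst hij; rw [M.diag_one hw, Matrix.one_apply_eq]
  · rw [Matrix.one_apply_ne hij]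
    by_contra h0
    exact absurd (M.supp_lam hw hij h0).1 (not_lt.2 h)

/-- The degree -1 piece is stable because -1 is not 0 modulo d. Membership in this span is what
links mirror entries of the conjugate in `conj_eq_of`. -/
theorem conj_mem (f : Piece 𝔤 d 1 → K) {w : GL 𝔤.I K} (hw : w ∈ D.std.rg K (psi 𝔤 d)) :
    ∃ b : Piece 𝔤 d (-1) → K, (w : Matrix 𝔤.I 𝔤.I K) * dualMatrix D f *
      ((w⁻¹ : GL 𝔤.I K) : Matrix 𝔤.I 𝔤.I K) = D.std.comb b := by
  obtain ⟨l, hl, rfl⟩ := D.std.exists_word D (psi_subset D d) hw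
  obtain ⟨A, hA⟩ := exists_word_conj D (c := -1) M.neg_one_not_congr l hl
  obtain ⟨b, hb⟩ := dualMatrix_mem (D := D) f
  refine ⟨A b, ?_⟩
  rw [hb, hA, mul_assoc, ← Units.val_mul, mul_inv_cancel, Units.val_one, mul_one]

variable {f : Piece 𝔤 d 1 → K} (hf : ∀ α, f α ≠ 0 ↔ α.1 ∈ 𝔤.leviRoots (admissible 𝔤 m))
include hf

/-- The entry at (j, k) comes from the root wt k - wt j, which lies in 𝔪_1 because φ vanishes on the
other root spaces of 𝔤_1. -/
theorem dual_inner {j k : 𝔤.I} (h : dualMatrix D f j k ≠ 0) : D.Inner m j ∧ D.Inner m k ∧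
    𝔤.twoRho ⬝ᵥ D.wt k ≡ 𝔤.twoRho ⬝ᵥ D.wt j + 2 [ZMOD (2 * d : ℕ)] := by
  obtain ⟨δ, hδ, hne⟩ := exists_of_dualMatrix_ne f h
  have h1 := M.inner_of_levi ((hf δ).1 hne) hδ.symm
  have h2 := (ht_modEq δ.2.1 hδ 1).1 δ.2.2
  exact ⟨h1.2, h1.1, by simpa using h2⟩

/-- Genericity is used here: every root of M in degree 1 contributes, so the cyclic shift given by F
has no gap. -/
theorem dual_ne (h2 : ringChar K ≠ 2) {j k : 𝔤.I} (hj : D.Inner m j) (hk : D.Inner m k)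
    (h : 𝔤.twoRho ⬝ᵥ D.wt k ≡ 𝔤.twoRho ⬝ᵥ D.wt j + 2 [ZMOD (2 * d : ℕ)]) :
    dualMatrix D f j k ≠ 0 := by
  obtain ⟨α, hα, hv⟩ := M.inner_root j k hj hk h
  have h1 : 𝔤.ht α ≡ 1 [ZMOD d] := (ht_modEq hα hv 1).2 (by simpa using h)
  have h3 : α ∈ 𝔤.leviRoots (admissible 𝔤 m) := ⟨hα, by rw [hv]; exact M.inner_span k j hk hj⟩
  rw [dualMatrix_entry f j k ⟨α, hα, h1⟩ hv]
  refine mul_ne_zero (div_ne_zero ((hf _).2 h3) (tr_ne_zero h2 hα)) ?_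
  rw [D.std_e_ne_zero h2 (D.opp_mem α hα), Root.vec_opp, hv, neg_sub]

/-- The row of an inner or lower index of `w F w⁻¹`, in the columns of inner indices. -/
theorem conj_inner {w : GL 𝔤.I K} (hw : w ∈ D.std.rg K (psi 𝔤 d)) (i : 𝔤.I) {k : 𝔤.I}
    (hk : D.Inner m k) :
    ((w : Matrix 𝔤.I 𝔤.I K) * dualMatrix D f * ((w⁻¹ : GL 𝔤.I K) : Matrix 𝔤.I 𝔤.I K)) i k =
      ((w : Matrix 𝔤.I 𝔤.I K) * dualMatrix D f) i k := by
  rw [Matrix.mul_apply, Finset.sum_eq_single k]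
  · rw [M.diag_one (Subgroup.inv_mem _ hw), mul_one]
  · intro l _ hl
    by_cases hz : ((w : Matrix 𝔤.I 𝔤.I K) * dualMatrix D f) i l = 0
    · rw [hz, zero_mul]
    · rw [Matrix.mul_apply] at hz
      obtain ⟨j, -, hj⟩ := Finset.exists_ne_zero_of_sum_ne_zero hz
      have h1 := (M.dual_inner hf (right_ne_zero_of_mul hj)).2.1
      rw [M.inner_one (Subgroup.inv_mem _ hw) (by rw [lam_inner h1, lam_inner hk]),
        Matrix.one_apply_ne hl, mul_zero]
  · simp

/-- Column counterpart of `conj_inner`: the nonzero rows of F w⁻¹ are inner, and w is the identity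
between inner indices. -/
theorem inner_conj {w : GL 𝔤.I K} (hw : w ∈ D.std.rg K (psi 𝔤 d)) (i : 𝔤.I) {k : 𝔤.I}
    (hk : D.Inner m k) :
    ((w : Matrix 𝔤.I 𝔤.I K) * dualMatrix D f * ((w⁻¹ : GL 𝔤.I K) : Matrix 𝔤.I 𝔤.I K)) k i =
      (dualMatrix D f * ((w⁻¹ : GL 𝔤.I K) : Matrix 𝔤.I 𝔤.I K)) k i := by
  rw [mul_assoc, Matrix.mul_apply, Finset.sum_eq_single k]
  · rw [M.diag_one hw, one_mul]
  · intro l _ hl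
    by_cases hz : (dualMatrix D f * ((w⁻¹ : GL 𝔤.I K) : Matrix 𝔤.I 𝔤.I K)) l i = 0
    · rw [hz, mul_zero]
    · rw [Matrix.mul_apply] at hz
      obtain ⟨j, -, hj⟩ := Finset.exists_ne_zero_of_sum_ne_zero hz
      have h1 := (M.dual_inner hf (left_ne_zero_of_mul hj)).1
      rw [M.inner_one hw (by rw [lam_inner h1, lam_inner hk]),
        Matrix.one_apply_ne (Ne.symm hl), zero_mul]
  · simp

/-- `w F w⁻¹` is determined by few of its entries. -/
theorem conj_eq_of (h2 : ringChar K ≠ 2) {κ : 𝔤.I → 𝔤.I} (hκ : ∀ i, D.Inner m (κ i))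
    (hκ' : ∀ i, 𝔤.twoRho ⬝ᵥ D.wt (κ i) ≡ 𝔤.twoRho ⬝ᵥ D.wt i + 2 [ZMOD (2 * d : ℕ)])
    {w w' : GL 𝔤.I K} (hw : w ∈ D.std.rg K (psi 𝔤 d)) (hw' : w' ∈ D.std.rg K (psi 𝔤 d))
    (h : ∀ i, (∃ c : Fin 𝔤.r, (c : ℕ) < 𝔤.n - m ∧ D.wt i = Pi.single c 1) →
      ((w : Matrix 𝔤.I 𝔤.I K) * dualMatrix D f * ((w⁻¹ : GL 𝔤.I K) : Matrix 𝔤.I 𝔤.I K)) i (κ i) =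
      ((w' : Matrix 𝔤.I 𝔤.I K) * dualMatrix D f *
        ((w'⁻¹ : GL 𝔤.I K) : Matrix 𝔤.I 𝔤.I K)) i (κ i)) :
    (w : Matrix 𝔤.I 𝔤.I K) * dualMatrix D f * ((w⁻¹ : GL 𝔤.I K) : Matrix 𝔤.I 𝔤.I K) =
      (w' : Matrix 𝔤.I 𝔤.I K) * dualMatrix D f * ((w'⁻¹ : GL 𝔤.I K) : Matrix 𝔤.I 𝔤.I K) := by
  classical
  set F := dualMatrix D f with hF
  have hpos : ∀ i, (∃ c : Fin 𝔤.r, (c : ℕ) < 𝔤.n - m ∧ D.wt i = Pi.single c 1) → ∀ v ∈ D.std.rg K (psi 𝔤 d),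
      ∀ k, D.Inner m k → ((v : Matrix 𝔤.I 𝔤.I K) * F) i k ≠ 0 →
      𝔤.twoRho ⬝ᵥ D.wt k ≡ 𝔤.twoRho ⬝ᵥ D.wt i + 2 [ZMOD (2 * d : ℕ)] := by
    rintro i ⟨c, hc, hi⟩ v hv k hk hne
    rw [Matrix.mul_apply] at hne
    obtain ⟨j, -, hj⟩ := Finset.exists_ne_zero_of_sum_ne_zero hne
    obtain ⟨h3, -, h4⟩ := M.dual_inner hf (right_ne_zero_of_mul hj)
    have hij : i ≠ j := by
      rintro rfl
      have := h3 c hc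
      rw [hi] at this
      simp at this
    exact h4.trans ((M.supp_lam hv hij (left_ne_zero_of_mul hj)).2.symm.add_right 2)
  -- Rows of inner weights, and of weights -χ_c with c outer, see only trivial entries of w, since
  -- `lam` does not increase there. The rows of weights χ_c carry all the information.
  have hDF : (w : Matrix 𝔤.I 𝔤.I K) * F = (w' : Matrix 𝔤.I 𝔤.I K) * F := by
    ext1 i k
    by_cases hk : D.Inner m k
    · rcases M.cases i with hi | hi | ⟨c, hc, hi⟩
      · rw [Matrix.mul_apply, Matrix.mul_apply]
        refine Finset.sum_congr rfl fun j _ => ?_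
        by_cases hz : F j k = 0
        · rw [hz, mul_zero, mul_zero]
        · have h1 := (M.dual_inner hf hz).1
          rw [M.inner_one hw (by rw [lam_inner h1, lam_inner hi]),
            M.inner_one hw' (by rw [lam_inner h1, lam_inner hi])]
      · by_cases hc : 𝔤.twoRho ⬝ᵥ D.wt k ≡ 𝔤.twoRho ⬝ᵥ D.wt i + 2 [ZMOD (2 * d : ℕ)]
        · have hi' := h i hi
          rw [M.conj_inner hf hw i (hκ i), M.conj_inner hf hw' i (hκ i)] at hi'
          by_cases hkk : k = κ i
          · rw [hkk]; exact hi'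
          obtain ⟨j, hj, hji⟩ := M.exists_congr i
          -- The columns k ≠ κ i are inner with the same residue, so by `unique` the residue of i
          -- contains the single inner weight j. Row i of w F is then w_ij times row j of F, and
          -- w_ij is read off in column κ i, where F does not vanish.
          have huniq : ∀ j', D.Inner m j' →
              𝔤.twoRho ⬝ᵥ D.wt j' ≡ 𝔤.twoRho ⬝ᵥ D.wt i [ZMOD (2 * d : ℕ)] → j' = j := by
            intro j' hj' e
            refine (M.unique j' j k (κ i) hj' hj hk (hκ i) (e.trans hji)
              (hc.trans (e.symm.add_right 2)) ((hκ' i).trans (e.symm.add_right 2))).resolve_right hkk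
          have hval : ∀ v ∈ D.std.rg K (psi 𝔤 d), ∀ l, ((v : Matrix 𝔤.I 𝔤.I K) * F) i l =
              (v : Matrix 𝔤.I 𝔤.I K) i j * F j l := by
            intro v hv l
            rw [Matrix.mul_apply, Finset.sum_eq_single j]
            · intro j' _ hne
              by_contra h0
              have h1 := (M.dual_inner hf (right_ne_zero_of_mul h0)).1
              have hij : i ≠ j' := by
                rintro rfl
                obtain ⟨c, hc, hi⟩ := hi
                have := h1 c hc
                rw [hi] at this
                simp at this
              exact hne (huniq j' h1 (M.supp_lam hv hij (left_ne_zero_of_mul h0)).2.symm)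
            · simp
          rw [hval w hw, hval w' hw'] at hi' ⊢
          have hFne : F j (κ i) ≠ 0 := M.dual_ne hf h2 hj (hκ i) ((hκ' i).trans (hji.add_right 2))
          rw [mul_right_cancel₀ hFne hi']
        · have z1 : ((w : Matrix 𝔤.I 𝔤.I K) * F) i k = 0 := by
            by_contra h0; exact hc (hpos i hi w hw k hk h0)
          have z2 : ((w' : Matrix 𝔤.I 𝔤.I K) * F) i k = 0 := by
            by_contra h0; exact hc (hpos i hi w' hw' k hk h0)
          rw [z1, z2]
      · rw [Matrix.mul_apply, Matrix.mul_apply]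
        refine Finset.sum_congr rfl fun j _ => ?_
        by_cases hz : F j k = 0
        · rw [hz, mul_zero, mul_zero]
        · have h1 := (M.dual_inner hf hz).1
          have h3 := lam_outer_neg (m := m) hi
          rw [M.inner_one hw (by rw [lam_inner h1]; exact h3),
            M.inner_one hw' (by rw [lam_inner h1]; exact h3)]
    · rw [Matrix.mul_apply, Matrix.mul_apply]
      refine Finset.sum_congr rfl fun j _ => ?_
      have hz : F j k = 0 := by
        by_contra hz; exact hk (M.dual_inner hf hz).2.1
      rw [hz, mul_zero, mul_zero]
  obtain ⟨b, hb⟩ := M.conj_mem f hw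
  obtain ⟨b', hb'⟩ := M.conj_mem f hw'
  -- The information in F w⁻¹ sits in the columns of weight -χ_c with c outer, and these reflect the
  -- rows already treated.
  have hFE : F * ((w⁻¹ : GL 𝔤.I K) : Matrix 𝔤.I 𝔤.I K) =
      F * ((w'⁻¹ : GL 𝔤.I K) : Matrix 𝔤.I 𝔤.I K) := by
    have hwi := Subgroup.inv_mem _ hw
    have hwi' := Subgroup.inv_mem _ hw'
    ext1 k j
    by_cases hk : D.Inner m k
    · have hgen : 0 ≤ lam 𝔤 m (D.std.μ j) →
          (F * ((w⁻¹ : GL 𝔤.I K) : Matrix 𝔤.I 𝔤.I K)) k j =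
          (F * ((w'⁻¹ : GL 𝔤.I K) : Matrix 𝔤.I 𝔤.I K)) k j := by
        intro hj
        rw [Matrix.mul_apply, Matrix.mul_apply]
        refine Finset.sum_congr rfl fun l _ => ?_
        by_cases hz : F k l = 0
        · rw [hz, zero_mul, zero_mul]
        · have h1 := (M.dual_inner hf hz).2.1
          rw [M.inner_one hwi (by rw [lam_inner h1]; exact hj),
            M.inner_one hwi' (by rw [lam_inner h1]; exact hj)]
      rcases M.cases j with hj | ⟨c, hc, hj⟩ | ⟨c, hc, hj⟩
      · exact hgen (lam_inner hj).ge
      · exact hgen (lam_outer hc hj).le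
      · obtain ⟨i, hi⟩ := M.wt_surj c
        obtain ⟨k', hk'⟩ := M.wt_neg j c hj k
        have hink' : D.Inner m k' := fun a ha => by rw [hk', Pi.neg_apply, hk a ha, neg_zero]
        rw [← M.inner_conj hf hw j hk, ← M.inner_conj hf hw' j hk]
        -- The entries at (k, j) and at (i, k') have the same weight difference. Both conjugates lie
        -- in the span of root vectors, so the two entries are fixed multiples of one coefficient.
        have hd : D.wt k - D.wt j = D.wt i - D.wt k' := by rw [hj, hi, hk']; abel
        have hik : D.std.comb b i k' = D.std.comb b' i k' := by
          rw [← hb, ← hb', M.conj_inner hf hw i hink', M.conj_inner hf hw' i hink', hDF]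
        rw [hb, hb']
        by_cases hex : ∃ δ : Piece 𝔤 d (-1), D.wt k - D.wt j = δ.1.vec
        · obtain ⟨δ, hδ⟩ := hex
          have hδ' : D.wt i - D.wt k' = δ.1.vec := by rw [← hd, hδ]
          rw [comb_entry b k j δ hδ, comb_entry b' k j δ hδ]
          rw [comb_entry b i k' δ hδ', comb_entry b' i k' δ hδ'] at hik
          rw [mul_right_cancel₀ ((D.std_e_ne_zero h2 δ.2.1).2 hδ') hik]
        · push Not at hex
          rw [comb_entry_zero b k j hex, comb_entry_zero b' k j hex]
    · rw [Matrix.mul_apply, Matrix.mul_apply]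
      refine Finset.sum_congr rfl fun l _ => ?_
      have hz : F k l = 0 := by
        by_contra hz; exact hk (M.dual_inner hf hz).1
      rw [hz, zero_mul, zero_mul]
  -- w F w⁻¹ = w' F w⁻¹ = w' F w'⁻¹.
  rw [hDF, mul_assoc, hFE, ← mul_assoc]

/-- For every outer index there is a root element moving the corresponding entry. -/
theorem exists_conj_ne (h2 : ringChar K ≠ 2) {i k : 𝔤.I} {c : Fin 𝔤.r} (hc : (c : ℕ) < 𝔤.n - m)
    (hi : D.wt i = Pi.single c 1) (hk : D.Inner m k)
    (hik : 𝔤.twoRho ⬝ᵥ D.wt k ≡ 𝔤.twoRho ⬝ᵥ D.wt i + 2 [ZMOD (2 * d : ℕ)]) :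
    ∃ γ ∈ psi 𝔤 d, ((D.std.gx K γ 1 : Matrix 𝔤.I 𝔤.I K) * dualMatrix D f *
      (((D.std.gx K γ 1)⁻¹ : GL 𝔤.I K) : Matrix 𝔤.I 𝔤.I K)) i k ≠ 0 := by
  obtain ⟨j, hj, hji⟩ := M.exists_congr i
  obtain ⟨γ, hγ, hv⟩ := M.outer_root i c j hc hi hj
  have rγ := ((D.mem_pos γ).1 hγ).1
  have hγ' : γ ∈ psi 𝔤 d := ⟨hγ, (ht_modEq rγ hv 0).2 (by simpa using hji)⟩
  have hjc := hj c hc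
  have hμ : D.std.μ i - D.std.μ j = IntRep.qvec γ := by
    funext a
    change ((D.wt i a : ℤ) : ℚ) - ((D.wt j a : ℤ) : ℚ) = (γ.vec a : ℚ)
    rw [hv]; simp
  refine ⟨γ, hγ', ?_⟩
  -- With γ = wt i - wt j, the entry reduces to x_γ(1)_ij F_jk.
  rw [M.conj_inner hf (D.std.gx_mem_rg hγ' 1) i hk, Matrix.mul_apply, Finset.sum_eq_single j]
  · refine mul_ne_zero ?_ (M.dual_ne hf h2 hj hk (hik.trans (hji.add_right 2)))
    have h3 := D.std.x_apply_of_root D rγ (1 : K) hμ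
    have hij : i ≠ j := by
      rintro rfl; rw [hi] at hjc; simp at hjc
    rw [Matrix.sub_apply, Matrix.one_apply_ne hij, sub_zero, one_mul] at h3
    rw [D.std.coe_gx D rγ, h3, D.std_e_ne_zero h2 rγ, hv]
  · intro l _ hl
    by_contra h0
    have h1 := (M.dual_inner hf (right_ne_zero_of_mul h0)).1
    have hil : i ≠ l := by
      rintro rfl; have := h1 c hc; rw [hi] at this; simp at this
    have h3 := left_ne_zero_of_mul h0
    rw [D.std.coe_gx D rγ] at h3
    have h4 : (D.std.x K γ 1 - 1) i l ≠ 0 := by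
      rwa [Matrix.sub_apply, Matrix.one_apply_ne hil, sub_zero]
    obtain ⟨n, hn⟩ := D.std.x_sub_one_apply rγ h4
    have h5 := congrFun hn c
    have h6 : ((D.wt i c : ℤ) : ℚ) - ((D.wt l c : ℤ) : ℚ) = ((n + 1 : ℕ) : ℚ) * (γ.vec c : ℚ) := h5
    rw [h1 c hc, hv, Pi.sub_apply, hjc, hi, Pi.single_eq_same] at h6
    -- Another contributing index l would satisfy wt i - wt l = (n+1)γ. The outer coordinate c of
    -- both wt i and γ is 1, which forces n = 0 and hence l = j.
    have hn0 : n = 0 := by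
      push_cast at h6
      have : (n : ℚ) = 0 := by linarith
      exact_mod_cast this
    subst hn0
    refine hl (D.wt_inj ?_)
    funext a
    have h7 := congrFun hn a
    rw [← hμ] at h7
    have h8 : ((D.wt i a : ℤ) : ℚ) - ((D.wt l a : ℤ) : ℚ) =
      ((0 + 1 : ℕ) : ℚ) * (((D.wt i a : ℤ) : ℚ) - ((D.wt j a : ℤ) : ℚ)) := h7
    push_cast at h8
    have h9 : ((D.wt l a : ℤ) : ℚ) = ((D.wt j a : ℤ) : ℚ) := by linarith
    exact_mod_cast h9
  · simp

end LeviData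

end Core
end ToricPairs

/-! ### Chevalley modules: weights, the torus and the group U_0. -/

namespace ToricPairs
open Matrix

attribute [local instance 100] LieRing.ofAssociativeRing

namespace ChevalleyModule

variable {𝔤 : RootedLieAlgebra} (V : ChevalleyModule 𝔤) (D : StdData 𝔤)

/-- The weights of the basis vectors. -/
def weight (i : Fin V.N) (a : Fin 𝔤.r) : ℚ := V.ρ ⟨D.H a, D.H_mem a⟩ i i

theorem H_isDiag (a : Fin 𝔤.r) : (D.H a).IsDiag := by
  obtain ⟨s, hs⟩ := D.H_apply a
  rw [hs]
  exact isDiag_diagonal _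

theorem ρ_H (a : Fin 𝔤.r) :
    V.ρ ⟨D.H a, D.H_mem a⟩ = diagonal fun i => V.weight D i a := by
  exact ((V.weightBasis ⟨D.H a, D.H_mem a⟩ (H_isDiag D a)).diagonal_diag).symm

theorem lie_H (a : Fin 𝔤.r) {α : Root 𝔤.r} (hα : α ∈ 𝔤.roots) :
    D.H a * 𝔤.X α - 𝔤.X α * D.H a = (α.vec a : ℚ) • 𝔤.X α := by
  obtain ⟨s, hs⟩ := D.H_apply a
  ext i j
  rw [hs, Matrix.sub_apply, Matrix.diagonal_mul, Matrix.mul_diagonal, Matrix.smul_apply, smul_eq_mul]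
  by_cases h : D.X α i j = 0
  · rw [← D.map_X α hα, Matrix.map_apply, h]; simp
  · have h1 := congrFun ((D.supp α hα i j).1 h) a
    rw [← h1, Pi.sub_apply]
    push_cast
    ring

theorem weight_sub {α : Root 𝔤.r} (hα : α ∈ 𝔤.roots) {i j : Fin V.N} (h : V.dp α 1 i j ≠ 0) :
    V.weight D i - V.weight D j = fun a => (α.vec a : ℚ) := by
  funext a
  set Y : 𝔤.L := ⟨𝔤.X α, 𝔤.X_mem α hα⟩ with hY
  have h1 : V.ρ ⟨D.H a, D.H_mem a⟩ * V.ρ Y - V.ρ Y * V.ρ ⟨D.H a, D.H_mem a⟩ =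
      (α.vec a : ℚ) • V.ρ Y := by
    rw [← LieRing.of_associative_ring_bracket, ← LieHom.map_lie, ← map_smul]
    congr 1
    exact Subtype.ext (lie_H D a hα)
  have h2 := V.dp_spec α hα 1
  simp only [Nat.factorial_one, Nat.cast_one, inv_one, one_smul, pow_one] at h2
  have h3 : V.ρ Y i j ≠ 0 := by
    rw [hY, ← h2, Matrix.map_apply]
    exact_mod_cast h
  have h4 := congrFun (congrFun h1 i) j
  rw [V.ρ_H, Matrix.sub_apply, Matrix.diagonal_mul, Matrix.mul_diagonal, Matrix.smul_apply,
    smul_eq_mul] at h4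
  refine mul_right_cancel₀ h3 ?_
  rw [← h4, Pi.sub_apply]
  ring

/-- A Chevalley module as an integral representation. -/
def toIntRep : IntRep 𝔤 (Fin V.N) where
  ρ := V.ρ
  dp := V.dp
  dp_spec := V.dp_spec
  μ := V.weight D
  faithful := V.faithful
  supp _ hα _ _ h := V.weight_sub D hα h

variable (K : Type*) [Field K]

theorem rootMatrix_eq (α : Root 𝔤.r) (t : K) : V.rootMatrix K α t = (V.toIntRep D).x K α t := by
  rw [rootMatrix, IntRep.x, Fintype.card_fin]; rfl

theorem rootVector_eq (α : Root 𝔤.r) : V.rootVector K α = (V.toIntRep D).e K α := rfl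

theorem rootGroup_eq {R : Set (Root 𝔤.r)} (hR : R ⊆ 𝔤.roots) :
    V.rootGroup K R = (V.toIntRep D).rg K R := by
  rw [rootGroup, IntRep.rg]
  congr 1
  ext g
  refine exists_congr fun α => and_congr_right fun hα => exists_congr fun t => ?_
  rw [Units.ext_iff, V.rootMatrix_eq D, (V.toIntRep D).coe_gx D (hR hα)]

/-- Integral combinations of the weights. -/
def wsum : (Fin V.N → ℤ) →+ (Fin 𝔤.r → ℚ) where
  toFun c := ∑ i, c i • V.weight D i
  map_zero' := by simp
  map_add' c c' := by simp [add_smul, Finset.sum_add_distrib]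

theorem wsum_apply (c : Fin V.N → ℤ) : V.wsum D c = ∑ i, c i • V.weight D i := rfl

theorem wsum_single (i : Fin V.N) : V.wsum D (Pi.single i 1) = V.weight D i := by
  rw [wsum_apply, Finset.sum_eq_single i]
  · simp
  · intro j _ h; rw [Pi.single_eq_of_ne h, zero_smul]
  · simp

/-- The matrices `D.H a` span the diagonal Cartan subalgebra, so a relation may be tested on them,
that is, on the coordinates of the weights. -/
theorem weightRelation_iff (c : Fin V.N → ℤ) : V.WeightRelation c ↔ V.wsum D c = 0 := by
  have e : ∀ a, V.wsum D c a = ∑ i, (c i : ℚ) * V.ρ ⟨D.H a, D.H_mem a⟩ i i := by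
    intro a
    rw [wsum_apply, Finset.sum_apply]
    refine Finset.sum_congr rfl fun i _ => ?_
    rw [Pi.smul_apply, zsmul_eq_mul]; rfl
  constructor
  · intro h
    funext a
    rw [e]
    exact h ⟨D.H a, D.H_mem a⟩ (H_isDiag D a)
  · rintro h ⟨A, hA⟩ hd
    obtain ⟨η, hη⟩ := D.H_span A hA hd
    have h1 : (⟨A, hA⟩ : 𝔤.L) = ∑ a, η a • (⟨D.H a, D.H_mem a⟩ : 𝔤.L) := by
      apply Subtype.ext
      exact hη.trans (by simp)
    rw [h1, map_sum]
    simp only [map_smul, Matrix.sum_apply, Matrix.smul_apply, smul_eq_mul, Finset.mul_sum]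
    rw [Finset.sum_comm]
    refine Finset.sum_eq_zero fun a _ => ?_
    have h2 := e a
    rw [h] at h2
    have h3 : ∑ i, (c i : ℚ) * (η a * V.ρ ⟨D.H a, D.H_mem a⟩ i i) =
        η a * ∑ i, (c i : ℚ) * V.ρ ⟨D.H a, D.H_mem a⟩ i i := by
      rw [Finset.mul_sum]; exact Finset.sum_congr rfl fun i _ => by ring
    rw [h3, ← h2, Pi.zero_apply, mul_zero]

variable {K}

theorem mem_T {g : GL (Fin V.N) K} : g ∈ V.T K ↔
    ∃ d ∈ V.weightChars K, (g : Matrix (Fin V.N) (Fin V.N) K) = diagonal fun i => (d i : K) := by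
  rw [T, Subgroup.mem_map]
  refine exists_congr fun d => and_congr_right fun _ => ?_
  rw [Units.ext_iff, eq_comm]; rfl

theorem prod_eq_of_wsum {d : Fin V.N → Kˣ} (hd : d ∈ V.weightChars K) {c c' : Fin V.N → ℤ}
    (h : V.wsum D c = V.wsum D c') : ∏ i, d i ^ c i = ∏ i, d i ^ c' i := by
  have h1 := hd (c - c') ((V.weightRelation_iff D _).2 (by rw [map_sub, h, sub_self]))
  simp only [Pi.sub_apply, _root_.zpow_sub, Finset.prod_mul_distrib, Finset.prod_inv_distrib] at h1
  exact mul_inv_eq_one.1 h1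

/-- The value of a point `d` of the torus on a weight `v` in the lattice spanned by the weights. -/
def chr (d : Fin V.N → Kˣ) (v : Fin 𝔤.r → ℚ) : Kˣ :=
  open Classical in if h : ∃ c, V.wsum D c = v then ∏ i, d i ^ h.choose i else 1

theorem chr_wsum {d : Fin V.N → Kˣ} (hd : d ∈ V.weightChars K) (c : Fin V.N → ℤ) :
    V.chr D d (V.wsum D c) = ∏ i, d i ^ c i := by
  have h : ∃ c', V.wsum D c' = V.wsum D c := ⟨c, rfl⟩
  rw [chr, dif_pos h]
  exact V.prod_eq_of_wsum D hd h.choose_spec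

theorem chr_weight {d : Fin V.N → Kˣ} (hd : d ∈ V.weightChars K) (i : Fin V.N) :
    V.chr D d (V.weight D i) = d i := by
  rw [← V.wsum_single, V.chr_wsum D hd, Finset.prod_eq_single i]
  · simp
  · intro j _ h; rw [Pi.single_eq_of_ne h, zpow_zero]
  · simp

theorem chr_add {d : Fin V.N → Kˣ} (hd : d ∈ V.weightChars K) {v w : Fin 𝔤.r → ℚ}
    (hv : v ∈ (V.wsum D).range) (hw : w ∈ (V.wsum D).range) :
    V.chr D d (v + w) = V.chr D d v * V.chr D d w := by
  obtain ⟨c, rfl⟩ := hv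
  obtain ⟨c', rfl⟩ := hw
  rw [← map_add, V.chr_wsum D hd, V.chr_wsum D hd, V.chr_wsum D hd, ← Finset.prod_mul_distrib]
  exact Finset.prod_congr rfl fun i _ => by rw [Pi.add_apply, _root_.zpow_add]

/-- The combinations of weights on which `d` is trivial. -/
def trivialOn {d : Fin V.N → Kˣ} (hd : d ∈ V.weightChars K) : AddSubgroup (Fin 𝔤.r → ℚ) where
  carrier := {v | v ∈ (V.wsum D).range ∧ V.chr D d v = 1}
  zero_mem' := by
    refine ⟨zero_mem _, ?_⟩
    have := V.chr_wsum D hd 0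
    rw [map_zero] at this
    rw [this]; simp
  add_mem' := by
    rintro v w ⟨hv, hv'⟩ ⟨hw, hw'⟩
    exact ⟨add_mem hv hw, by rw [V.chr_add D hd hv hw, hv', hw', one_mul]⟩
  neg_mem' := by
    rintro v ⟨⟨c, rfl⟩, hv'⟩
    refine ⟨⟨-c, map_neg _ _⟩, ?_⟩
    rw [← map_neg, V.chr_wsum D hd]
    rw [V.chr_wsum D hd] at hv'
    simp [hv']

theorem weight_mem (i : Fin V.N) : V.weight D i ∈ (V.wsum D).range :=
  ⟨Pi.single i 1, V.wsum_single D i⟩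

/-- The root vector is nonzero by faithfulness, and any of its nonzero entries exhibits the root as
a difference of two weights. -/
theorem qvec_mem {α : Root 𝔤.r} (hα : α ∈ 𝔤.roots) : IntRep.qvec α ∈ (V.wsum D).range := by
  have h : ∃ i j, V.dp α 1 i j ≠ 0 := by
    by_contra! h
    exact (V.toIntRep D).dp_one_ne_zero D hα (by ext i j; exact h i j)
  obtain ⟨i, j, h⟩ := h
  rw [show IntRep.qvec α = _ from (V.weight_sub D hα h).symm]
  exact sub_mem (V.weight_mem D i) (V.weight_mem D j)

theorem apply_eq_of_sub {d : Fin V.N → Kˣ} (hd : d ∈ V.weightChars K) {α : Root 𝔤.r}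
    (hα : α ∈ 𝔤.roots) {i j : Fin V.N} {k : ℕ}
    (h : V.weight D i - V.weight D j = (k : ℚ) • IntRep.qvec α) :
    d i = V.chr D d (IntRep.qvec α) ^ k * d j := by
  have h1 : V.weight D i = (k : ℚ) • IntRep.qvec α + V.weight D j := by rw [← h]; abel
  have hk : ∀ k : ℕ, V.chr D d ((k : ℚ) • IntRep.qvec α) = V.chr D d (IntRep.qvec α) ^ k ∧
      (k : ℚ) • IntRep.qvec α ∈ (V.wsum D).range := by
    intro k
    induction k with
    | zero =>
      rw [Nat.cast_zero, zero_smul, pow_zero]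
      have := (V.trivialOn D hd).zero_mem
      exact ⟨this.2, this.1⟩
    | succ k ih =>
      rw [Nat.cast_succ, add_smul, one_smul]
      exact ⟨by rw [V.chr_add D hd ih.2 (V.qvec_mem D hα), ih.1, pow_succ],
        add_mem ih.2 (V.qvec_mem D hα)⟩
  rw [← V.chr_weight D hd i, h1, V.chr_add D hd (hk k).2 (V.weight_mem D j), (hk k).1,
    V.chr_weight D hd]

theorem torus_mul_dp {d : Fin V.N → Kˣ} (hd : d ∈ V.weightChars K) {α : Root 𝔤.r}
    (hα : α ∈ 𝔤.roots) (k : ℕ) :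
    diagonal (fun i => (d i : K)) * (V.dp α k).map (Int.cast : ℤ → K) =
      ((V.chr D d (IntRep.qvec α) : K) ^ k • (V.dp α k).map (Int.cast : ℤ → K)) *
        diagonal (fun i => (d i : K)) := by
  ext i j
  rw [Matrix.diagonal_mul, Matrix.mul_diagonal, Matrix.smul_apply, Matrix.map_apply, smul_eq_mul]
  by_cases h : V.dp α k i j = 0
  · rw [h]; simp
  · rw [V.apply_eq_of_sub D hd hα ((V.toIntRep D).supp_dp hα h)]
    push_cast
    ring

theorem torus_mul_e {d : Fin V.N → Kˣ} (hd : d ∈ V.weightChars K) {α : Root 𝔤.r}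
    (hα : α ∈ 𝔤.roots) : diagonal (fun i => (d i : K)) * V.rootVector K α =
      ((V.chr D d (IntRep.qvec α) : K) • V.rootVector K α) * diagonal (fun i => (d i : K)) := by
  have := V.torus_mul_dp D hd hα 1
  rwa [pow_one] at this

theorem torus_conj_gx {d : Fin V.N → Kˣ} (hd : d ∈ V.weightChars K) {g : GL (Fin V.N) K}
    (hg : (g : Matrix (Fin V.N) (Fin V.N) K) = diagonal fun i => (d i : K)) {α : Root 𝔤.r}
    (hα : α ∈ 𝔤.roots) (s : K) : g * (V.toIntRep D).gx K α s * g⁻¹ =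
      (V.toIntRep D).gx K α (V.chr D d (IntRep.qvec α) * s) := by
  rw [mul_inv_eq_iff_eq_mul]
  ext1
  rw [Units.val_mul, Units.val_mul, (V.toIntRep D).coe_gx D hα, (V.toIntRep D).coe_gx D hα, hg,
    IntRep.x, IntRep.x, Finset.mul_sum, Finset.sum_mul]
  refine Finset.sum_congr rfl fun k _ => ?_
  have := V.torus_mul_dp D hd hα k
  rw [mul_smul_comm]
  change s ^ k • (_ * (V.dp α k).map _) = _ • (V.dp α k).map _ * _
  rw [this, smul_mul_assoc, smul_mul_assoc, smul_smul, mul_pow, mul_comm]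

theorem torus_conj_mem {g : GL (Fin V.N) K} (hg : g ∈ V.T K) {R : Set (Root 𝔤.r)}
    (hR : R ⊆ 𝔤.roots) {u : GL (Fin V.N) K} (hu : u ∈ (V.toIntRep D).rg K R) :
    g * u * g⁻¹ ∈ (V.toIntRep D).rg K R := by
  obtain ⟨d, hd, e⟩ := V.mem_T.1 hg
  rw [IntRep.rg] at hu
  induction hu using Subgroup.closure_induction with
  | mem x hx =>
    obtain ⟨α, hα, t, rfl⟩ := hx
    rw [V.torus_conj_gx D hd e (hR hα)]
    exact IntRep.gx_mem_rg _ hα _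
  | one => rw [mul_one, mul_inv_cancel]; exact one_mem _
  | mul x y _ _ hx hy =>
    have h : g * (x * y) * g⁻¹ = (g * x * g⁻¹) * (g * y * g⁻¹) := by group
    rw [h]; exact mul_mem hx hy
  | inv x _ hx =>
    have h : g * x⁻¹ * g⁻¹ = (g * x * g⁻¹)⁻¹ := by group
    rw [h]; exact inv_mem hx

/-- Elements of G_0 only join weights whose difference has height divisible by d: the torus is
diagonal and the root elements satisfy this by construction. `mem_rg_of_supp`, applied to all
positive roots, then extracts the generators. -/
theorem U₀_eq (h2 : ringChar K ≠ 2) (d : ℕ) : V.U₀ K d = (V.toIntRep D).rg K (psi 𝔤 d) := by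
  classical
  have hpos : 𝔤.posRoots ⊆ 𝔤.roots := fun α h => ((D.mem_pos α).1 h).1
  have hcong : {α | α ∈ 𝔤.roots ∧ 𝔤.ht α ≡ 0 [ZMOD d]} ⊆ 𝔤.roots := fun α h => h.1
  rw [U₀, U, G₀, V.rootGroup_eq D K hpos, V.rootGroup_eq D K hcong]
  apply le_antisymm
  · rintro w ⟨hw, hw'⟩
    have hle : V.T K ⊔ (V.toIntRep D).rg K {α | α ∈ 𝔤.roots ∧ 𝔤.ht α ≡ 0 [ZMOD d]} ≤
        (V.toIntRep D).suppGroup (congrP_add (𝔤 := 𝔤) (d := d)) K := by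
      refine sup_le ?_ (IntRep.rg_le_suppGroup _ D _ hcong fun α h => congrP_root D h.1 h.2)
      have key : ∀ g ∈ V.T K, (V.toIntRep D).Supp (congrP 𝔤 d) (g : Matrix (Fin V.N) (Fin V.N) K) := by
        intro g hg i j hij
        obtain ⟨d, -, e⟩ := V.mem_T.1 hg
        have : i = j := by
          by_contra hne
          rw [e, Matrix.sub_apply, Matrix.diagonal_apply_ne _ hne, Matrix.one_apply_ne hne] at hij
          exact hij (sub_self _)
        rw [this, sub_self]
        exact ⟨0, by simp [IntRep.qht]⟩
      exact fun g hg => ⟨key g hg, key _ (inv_mem hg)⟩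
    have hfin : 𝔤.posRoots.Finite := Set.toFinite _
    have h := (V.toIntRep D).mem_rg_of_supp D (congrP_add (𝔤 := 𝔤) (d := d)) h2 _ hfin.toFinset rfl
      (fun α h => hfin.mem_toFinset.1 h) (fun α _ β hβ _ => hfin.mem_toFinset.2 hβ) w
      (by rwa [hfin.coe_toFinset]) (hle hw')
    refine IntRep.rg_mono _ ?_ h
    rintro γ ⟨hγ, z, hz⟩
    have hγ' := hfin.mem_toFinset.1 hγ
    refine ⟨hγ', Int.modEq_zero_iff_dvd.2 ⟨z, ?_⟩⟩
    rw [IntRep.qht_qvec D (hpos hγ')] at hz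
    have : (𝔤.ht γ : ℚ) = d * z := by linarith
    exact_mod_cast this
  · refine le_inf (IntRep.rg_mono _ fun γ h => h.1)
      (le_trans (IntRep.rg_mono _ (show psi 𝔤 d ⊆ {α | α ∈ 𝔤.roots ∧ 𝔤.ht α ≡ 0 [ZMOD d]} from
        fun γ h => ⟨hpos h.1, h.2⟩)) le_sup_right)

end ChevalleyModule
end ToricPairs

namespace ToricPairs
open Matrix

/-! ### Irreducible sets for the Zariski topology -/

section Irreducible

variable {K : Type*} [Field K] {N : ℕ}

/-- The locus where a polynomial in the matrix entries does not vanish. -/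
def nonvanishing (f : MvPolynomial (Fin N × Fin N) K) : Set (GL (Fin N) K) :=
  {g | MvPolynomial.eval (fun p => (g : Matrix (Fin N) (Fin N) K) p.1 p.2) f ≠ 0}

theorem isOpen_nonvanishing (f : MvPolynomial (Fin N × Fin N) K) :
    @IsOpen _ (zariski K N) (nonvanishing f) :=
  TopologicalSpace.isOpen_generateFrom_of_mem ⟨f, rfl⟩

theorem isTopologicalBasis_nonvanishing : @TopologicalSpace.IsTopologicalBasis _ (zariski K N)
    (Set.range (nonvanishing (K := K) (N := N))) := by
  let _ := zariski K N
  refine ⟨?_, ?_, rfl⟩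
  · rintro _ ⟨f, rfl⟩ _ ⟨g, rfl⟩ x ⟨hf, hg⟩
    refine ⟨_, ⟨f * g, rfl⟩, ?_, ?_⟩
    · change MvPolynomial.eval _ _ ≠ 0
      rw [map_mul]; exact mul_ne_zero hf hg
    · intro y hy
      change MvPolynomial.eval _ _ ≠ 0 at hy
      rw [map_mul] at hy
      exact ⟨left_ne_zero_of_mul hy, right_ne_zero_of_mul hy⟩
  · refine Set.eq_univ_of_forall fun x => ⟨_, ⟨1, rfl⟩, ?_⟩
    change MvPolynomial.eval _ _ ≠ 0
    rw [map_one]; exact one_ne_zero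

theorem isPreirreducible_of_forall {S : Set (GL (Fin N) K)}
    (h : ∀ f g : MvPolynomial (Fin N × Fin N) K, (S ∩ nonvanishing f).Nonempty →
      (S ∩ nonvanishing g).Nonempty → (S ∩ (nonvanishing f ∩ nonvanishing g)).Nonempty) :
    @IsPreirreducible _ (zariski K N) S := by
  let _ := zariski K N
  have B := isTopologicalBasis_nonvanishing (K := K) (N := N)
  rintro u v hu hv ⟨x, hxS, hxu⟩ ⟨y, hyS, hyv⟩
  obtain ⟨_, ⟨f, rfl⟩, hxf, hfu⟩ := B.exists_subset_of_mem_open hxu hu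
  obtain ⟨_, ⟨g, rfl⟩, hyg, hgv⟩ := B.exists_subset_of_mem_open hyv hv
  obtain ⟨z, hzS, hzf, hzg⟩ := h f g ⟨x, hxS, hxf⟩ ⟨y, hyS, hyg⟩
  exact ⟨z, hzS, hfu hzf, hgv hzg⟩

variable {σ : Type*}

/-- The functions on the principal open set of `q` that are regular, up to a power of `q`. -/
def regular (q : MvPolynomial σ K) : Subalgebra K ({x : σ → K // MvPolynomial.eval x q ≠ 0} → K) where
  carrier := {h | ∃ (P : MvPolynomial σ K) (n : ℕ), ∀ x,
    MvPolynomial.eval x.1 q ^ n * h x = MvPolynomial.eval x.1 P}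
  mul_mem' := by
    rintro a b ⟨P, n, hP⟩ ⟨Q, k, hQ⟩
    exact ⟨P * Q, n + k, fun x => by rw [map_mul, ← hP, ← hQ, Pi.mul_apply]; ring⟩
  add_mem' := by
    rintro a b ⟨P, n, hP⟩ ⟨Q, k, hQ⟩
    exact ⟨q ^ k * P + q ^ n * Q, n + k, fun x => by
      rw [map_add, map_mul, map_mul, ← hP, ← hQ, Pi.add_apply, map_pow, map_pow]; ring⟩
  algebraMap_mem' c := ⟨MvPolynomial.C c, 0, fun x => by simp⟩

/-- After multiplication by powers of q, two open conditions on the image become polynomials P and Q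
that are not zero. Over an infinite field some point does not annihilate P Q q. -/
theorem isPreirreducible_range [Infinite K] {q : MvPolynomial σ K} (hq : q ≠ 0)
    {c : {x : σ → K // MvPolynomial.eval x q ≠ 0} → GL (Fin N) K}
    (hc : ∀ i j, (fun x => (c x : Matrix (Fin N) (Fin N) K) i j) ∈ regular q) :
    @IsPreirreducible _ (zariski K N) (Set.range c) := by
  have key : ∀ f : MvPolynomial (Fin N × Fin N) K,
      (fun x => MvPolynomial.eval (fun p => (c x : Matrix (Fin N) (Fin N) K) p.1 p.2) f) ∈
        regular q := by
    intro f
    induction f using MvPolynomial.induction_on with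
    | C a => simp only [MvPolynomial.eval_C]; exact (regular q).algebraMap_mem a
    | add f g hf hg => simp only [map_add]; exact (regular q).add_mem hf hg
    | mul_X f p hf => simp only [map_mul, MvPolynomial.eval_X]; exact (regular q).mul_mem hf (hc p.1 p.2)
  refine isPreirreducible_of_forall ?_
  rintro f g ⟨_, ⟨x, rfl⟩, hx⟩ ⟨_, ⟨y, rfl⟩, hy⟩
  obtain ⟨P, n, hP⟩ := key f
  obtain ⟨Q, k, hQ⟩ := key g
  have hP0 : P ≠ 0 := by
    rintro rfl
    have := hP x
    rw [map_zero] at this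
    exact mul_ne_zero (pow_ne_zero _ x.2) hx this
  have hQ0 : Q ≠ 0 := by
    rintro rfl
    have := hQ y
    rw [map_zero] at this
    exact mul_ne_zero (pow_ne_zero _ y.2) hy this
  have h : ∃ z, MvPolynomial.eval z (P * Q * q) ≠ 0 := by
    by_contra! h
    exact mul_ne_zero (mul_ne_zero hP0 hQ0) hq (MvPolynomial.funext fun z => by rw [h, map_zero])
  obtain ⟨z, hz⟩ := h
  rw [map_mul, map_mul] at hz
  have hzq := right_ne_zero_of_mul hz
  have hz' := left_ne_zero_of_mul hz
  have h1 := hP ⟨z, hzq⟩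
  have h3 := hQ ⟨z, hzq⟩
  refine ⟨c ⟨z, hzq⟩, ⟨_, rfl⟩, ?_, ?_⟩
  · intro h0
    refine left_ne_zero_of_mul hz' ?_
    rw [← h1]
    exact mul_eq_zero_of_right _ h0
  · intro h0
    refine right_ne_zero_of_mul hz' ?_
    rw [← h3]
    exact mul_eq_zero_of_right _ h0

theorem mem_neutralComponent {H : Subgroup (GL (Fin N) K)} {S : Set (GL (Fin N) K)}
    (hS : @IsPreirreducible _ (zariski K N) S) (hSH : S ⊆ H) (h1 : 1 ∈ S) {g : GL (Fin N) K}
    (hg : g ∈ S) : g ∈ neutralComponent H := by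
  let _ := zariski K N
  exact hS.isPreconnected.subset_connectedComponentIn h1 hSH hg

theorem neutralComponent_le (H : Subgroup (GL (Fin N) K)) : neutralComponent H ≤ H := by
  let _ := zariski K N
  exact fun g hg => connectedComponentIn_subset _ _ hg

end Irreducible

/-! ### Irreducibility of groups generated by root subgroups -/

namespace IntRep

variable {𝔤 : RootedLieAlgebra} {N : ℕ} (E : IntRep 𝔤 (Fin N)) (D : StdData 𝔤)
  {K : Type*} [Field K]

/-- The product of root elements with given parameters. -/
def wordMap : List (Root 𝔤.r) → (ℕ → K) → GL (Fin N) K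
  | [], _ => 1
  | α :: L, x => E.gx K α (x 0) * wordMap L fun n => x (n + 1)

theorem wordMap_append (L L' : List (Root 𝔤.r)) (x : ℕ → K) :
    E.wordMap (L ++ L') x = E.wordMap L x * E.wordMap L' fun n => x (n + L.length) := by
  induction L generalizing x with
  | nil => simp [wordMap]
  | cons α L ih =>
    rw [List.cons_append, wordMap, wordMap, ih, mul_assoc]
    congr 3

theorem exists_wordMap (l : List (Root 𝔤.r × K)) : ∃ x : ℕ → K,
    E.wordMap (l.map Prod.fst) x = E.word l ∧ ∀ n, l.length ≤ n → x n = 0 := by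
  induction l with
  | nil => exact ⟨0, rfl, fun _ _ => rfl⟩
  | cons p l ih =>
    obtain ⟨x, hx, h0⟩ := ih
    refine ⟨fun n => n.casesOn p.2 x, ?_, ?_⟩
    · rw [List.map_cons, wordMap, E.word_cons, ← hx]; rfl
    · rintro (_ | n) hn
      · simp at hn
      · exact h0 n (by simpa using hn)

include D in
theorem wordMap_zero {L : List (Root 𝔤.r)} (hL : ∀ α ∈ L, α ∈ 𝔤.roots) :
    E.wordMap L (fun _ => (0 : K)) = 1 := by
  induction L with
  | nil => rfl
  | cons α L ih =>
    rw [wordMap, E.gx_zero D (hL α (List.mem_cons_self ..)), one_mul,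
      ih fun β h => hL β (List.mem_cons_of_mem _ h)]

theorem wordMap_mem {R : Set (Root 𝔤.r)} {L : List (Root 𝔤.r)} (hL : ∀ α ∈ L, α ∈ R) (x : ℕ → K) :
    E.wordMap L x ∈ E.rg K R := by
  induction L generalizing x with
  | nil => exact one_mem _
  | cons α L ih =>
    exact mul_mem (E.gx_mem_rg (hL α (List.mem_cons_self ..)) _)
      (ih (fun β h => hL β (List.mem_cons_of_mem _ h)) _)

include D in
theorem exists_poly {L : List (Root 𝔤.r)} (hL : ∀ α ∈ L, α ∈ 𝔤.roots) (i j : Fin N) :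
    ∃ P : MvPolynomial ℕ K, ∀ x : ℕ → K,
      (E.wordMap L x : Matrix (Fin N) (Fin N) K) i j = MvPolynomial.eval x P := by
  induction L generalizing i with
  | nil => exact ⟨MvPolynomial.C ((1 : Matrix (Fin N) (Fin N) K) i j), fun x => by simp [wordMap]⟩
  | cons α L ih =>
    choose P hP using fun k => ih (fun β h => hL β (List.mem_cons_of_mem _ h)) k
    refine ⟨∑ k, (∑ a ∈ Finset.range (Fintype.card (Fin N)),
      MvPolynomial.X 0 ^ a * MvPolynomial.C (((E.dp α a i k : ℤ) : K))) *
        MvPolynomial.rename Nat.succ (P k), fun x => ?_⟩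
    rw [wordMap, Units.val_mul, Matrix.mul_apply, map_sum,
      E.coe_gx D (hL α (List.mem_cons_self ..)), IntRep.x]
    refine Finset.sum_congr rfl fun k _ => ?_
    rw [map_mul, MvPolynomial.eval_rename, hP, Matrix.sum_apply, map_sum]
    congr 1
    refine Finset.sum_congr rfl fun a _ => ?_
    simp

-- Two given elements are values of one product of root elements, along the concatenated list of
-- roots, with the parameters of the other element set to 0. The image of this polynomial
-- parametrization is irreducible and lies in the group.
include D in
theorem isPreirreducible_rg [Infinite K] {R : Set (Root 𝔤.r)} (hR : R ⊆ 𝔤.roots) :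
    @IsPreirreducible _ (zariski K N) (E.rg K R : Set (GL (Fin N) K)) := by
  refine isPreirreducible_of_forall ?_
  rintro f g ⟨u, hu, hf⟩ ⟨v, hv, hg⟩
  obtain ⟨l, hl, rfl⟩ := E.exists_word D hR hu
  obtain ⟨l', hl', rfl⟩ := E.exists_word D hR hv
  obtain ⟨x, hx, hx0⟩ := E.exists_wordMap l
  obtain ⟨y, hy, -⟩ := E.exists_wordMap l'
  set L := l.map Prod.fst with hLdef
  set L' := l'.map Prod.fst with hLdef'
  have hL : ∀ α ∈ L, α ∈ R := by
    intro α h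
    obtain ⟨p, hp, rfl⟩ := List.mem_map.1 h
    exact hl p hp
  have hL' : ∀ α ∈ L', α ∈ R := by
    intro α h
    obtain ⟨p, hp, rfl⟩ := List.mem_map.1 h
    exact hl' p hp
  have hLL : ∀ α ∈ L ++ L', α ∈ R := fun α h => (List.mem_append.1 h).elim (hL α) (hL' α)
  have hlen : L.length = l.length := List.length_map ..
  let c : {x : ℕ → K // MvPolynomial.eval x (1 : MvPolynomial ℕ K) ≠ 0} → GL (Fin N) K :=
    fun x => E.wordMap (L ++ L') x.1
  have hone : ∀ x : ℕ → K, MvPolynomial.eval x (1 : MvPolynomial ℕ K) ≠ 0 := by simp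
  have hirr := isPreirreducible_range (c := c) one_ne_zero fun i j => by
    obtain ⟨P, hP⟩ := E.exists_poly D (K := K) (fun α h => hR (hLL α h)) i j
    exact ⟨P, 0, fun x => by rw [pow_zero, one_mul]; exact hP x.1⟩
  have h1 : E.word l ∈ Set.range c := by
    refine ⟨⟨x, hone _⟩, ?_⟩
    change E.wordMap _ _ = _
    rw [E.wordMap_append, hx, show (fun n => x (n + L.length)) = fun _ => 0 from
      funext fun n => hx0 _ (by omega), E.wordMap_zero D fun α h => hR (hL' α h), mul_one]
  have wordMap_congr : ∀ (L : List (Root 𝔤.r)) (x y : ℕ → K), (∀ n < L.length, x n = y n) →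
      E.wordMap L x = E.wordMap L y := by
    intro L
    induction L with
    | nil => intros; rfl
    | cons α L ih =>
      intro x y h
      rw [wordMap, wordMap, h 0 (by simp), ih _ _ fun n hn => h (n + 1) (by simpa using hn)]
  have h2 : E.word l' ∈ Set.range c := by
    -- The parameters of the first list are 0 and those of the second are shifted past them.
    refine ⟨⟨fun n => if n < L.length then 0 else y (n - L.length), hone _⟩, ?_⟩
    change E.wordMap _ _ = _
    rw [E.wordMap_append, wordMap_congr L _ (fun _ => 0) fun n hn => if_pos hn,
      E.wordMap_zero D fun α h => hR (hL α h), one_mul, ← hy]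
    congr 1
    funext n
    simp
  obtain ⟨_, ⟨z, rfl⟩, hz⟩ := hirr _ _ (isOpen_nonvanishing f) (isOpen_nonvanishing g)
    ⟨_, h1, hf⟩ ⟨_, h2, hg⟩
  exact ⟨_, E.wordMap_mem hLL _, hz⟩

end IntRep
end ToricPairs

namespace ToricPairs
open Matrix

attribute [local instance 100] LieRing.ofAssociativeRing

namespace ChevalleyModule

variable {𝔤 : RootedLieAlgebra} (V : ChevalleyModule 𝔤) (D : StdData 𝔤) {K : Type*} [Field K]

/-! ### Points of the torus -/

/-- The diagonal matrix with given entries. -/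
def toGL (e : Fin V.N → Kˣ) : GL (Fin V.N) K where
  val := diagonal fun i => (e i : K)
  inv := diagonal fun i => ((e i)⁻¹ : Kˣ)
  val_inv := by rw [diagonal_mul_diagonal]; simp
  inv_val := by rw [diagonal_mul_diagonal]; simp

theorem prod_zpow_eq {ι : Type*} [Fintype ι] (g : Kˣ) (f : ι → ℤ) :
    ∏ i, g ^ f i = g ^ ∑ i, f i := by
  classical
  induction (Finset.univ : Finset ι) using Finset.induction_on with
  | empty => simp
  | insert a s ha ih => rw [Finset.prod_insert ha, Finset.sum_insert ha, _root_.zpow_add, ih]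

theorem coe_toGL (e : Fin V.N → Kˣ) :
    (V.toGL e : Matrix (Fin V.N) (Fin V.N) K) = diagonal fun i => (e i : K) := rfl

theorem coe_inv_toGL (e : Fin V.N → Kˣ) :
    ((V.toGL e)⁻¹ : GL (Fin V.N) K) = V.toGL e⁻¹ := by
  rw [inv_eq_iff_mul_eq_one]
  ext1
  rw [Units.val_mul, coe_toGL, coe_toGL, diagonal_mul_diagonal]
  simp

theorem toGL_one : V.toGL (1 : Fin V.N → Kˣ) = 1 := by
  ext1
  rw [coe_toGL]
  simp

theorem toGL_conj_apply (e : Fin V.N → Kˣ) (u : GL (Fin V.N) K) (i j : Fin V.N) :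
    ((V.toGL e * u * (V.toGL e)⁻¹ : GL (Fin V.N) K) : Matrix (Fin V.N) (Fin V.N) K) i j =
      e i * (u : Matrix (Fin V.N) (Fin V.N) K) i j * ((e j)⁻¹ : Kˣ) := by
  rw [coe_inv_toGL, Units.val_mul, Units.val_mul, coe_toGL, coe_toGL, mul_diagonal, diagonal_mul]
  rfl

theorem mem_T' {g : GL (Fin V.N) K} : g ∈ V.T K ↔ ∃ e ∈ V.weightChars K, g = V.toGL e := by
  rw [V.mem_T]
  refine exists_congr fun e => and_congr_right fun _ => ?_
  rw [Units.ext_iff]; rfl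

/-- A common denominator of the weights. -/
theorem exists_denom : ∃ n : ℕ, 0 < n ∧ ∃ z : Fin V.N → Fin 𝔤.r → ℤ,
    ∀ i a, (z i a : ℚ) = n * V.weight D i a := by
  refine ⟨∏ i, ∏ a, (V.weight D i a).den, Finset.prod_pos fun i _ => Finset.prod_pos fun a _ =>
    Rat.den_pos _, ?_⟩
  have h : ∀ i a, ∃ z : ℤ, (z : ℚ) = ((∏ i, ∏ a, (V.weight D i a).den : ℕ) : ℚ) * V.weight D i a := by
    intro i a
    obtain ⟨k, hk⟩ : (V.weight D i a).den ∣ ∏ i, ∏ a, (V.weight D i a).den :=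
      (Finset.dvd_prod_of_mem (fun a => (V.weight D i a).den) (Finset.mem_univ a)).trans
        (Finset.dvd_prod_of_mem (fun i => ∏ a, (V.weight D i a).den) (Finset.mem_univ i))
    refine ⟨k * (V.weight D i a).num, ?_⟩
    rw [hk]
    push_cast
    have := Rat.mul_den_eq_num (V.weight D i a)
    rw [← this]
    ring
  choose z hz using h
  exact ⟨z, hz⟩

section Cochar

variable {n : ℕ} {z : Fin V.N → Fin 𝔤.r → ℤ} (hz : ∀ i a, (z i a : ℚ) = n * V.weight D i a)

/-- The point of the torus with given coordinates along (a multiple of) the standard cocharacters. -/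
def cochar (z : Fin V.N → Fin 𝔤.r → ℤ) (s : Fin 𝔤.r → Kˣ) (i : Fin V.N) : Kˣ := ∏ a, s a ^ z i a

theorem cochar_inv (z : Fin V.N → Fin 𝔤.r → ℤ) (s : Fin 𝔤.r → Kˣ) :
    V.cochar z s⁻¹ = (V.cochar z s)⁻¹ := by
  funext i
  simp [cochar]

include hz

/-- Up to the common factor n, the exponents are the coordinates of the weights, so every relation
among the weights is a relation among the exponents, coordinate by coordinate. -/
theorem cochar_mem (s : Fin 𝔤.r → Kˣ) : V.cochar z s ∈ V.weightChars K := by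
  intro c hc
  rw [V.weightRelation_iff D] at hc
  have h : ∀ a, ∑ i, z i a * c i = 0 := by
    intro a
    have h1 := congrFun hc a
    rw [wsum_apply, Finset.sum_apply] at h1
    have h2 : ((∑ i, z i a * c i : ℤ) : ℚ) = n * ∑ i, (c i • V.weight D i) a := by
      push_cast
      rw [Finset.mul_sum]
      refine Finset.sum_congr rfl fun i _ => ?_
      rw [hz, Pi.smul_apply, zsmul_eq_mul]; ring
    rw [h1, Pi.zero_apply, mul_zero] at h2
    exact_mod_cast h2
  have h3 : ∏ i, V.cochar z s i ^ c i = ∏ a, s a ^ ∑ i, z i a * c i := by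
    have : ∀ i, V.cochar z s i ^ c i = ∏ a, s a ^ (z i a * c i) := by
      intro i
      rw [cochar, ← Finset.prod_zpow]
      exact Finset.prod_congr rfl fun a _ => by rw [_root_.zpow_mul]
    rw [Finset.prod_congr rfl fun i _ => this i, Finset.prod_comm]
    refine Finset.prod_congr rfl fun a _ => ?_
    exact prod_zpow_eq _ _
  rw [h3]
  exact Finset.prod_eq_one fun a _ => by rw [h, zpow_zero]

theorem cochar_mem_T (s : Fin 𝔤.r → Kˣ) : V.toGL (V.cochar z s) ∈ V.T K :=
  V.mem_T'.2 ⟨_, V.cochar_mem D hz s, rfl⟩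

theorem chr_cochar (s : Fin 𝔤.r → Kˣ) {α : Root 𝔤.r} (hα : α ∈ 𝔤.roots) :
    V.chr D (V.cochar z s) (IntRep.qvec α) = ∏ a, s a ^ (n * α.vec a) := by
  obtain ⟨i, j, h⟩ : ∃ i j, V.dp α 1 i j ≠ 0 := by
    by_contra! h
    exact (V.toIntRep D).dp_one_ne_zero D hα (by ext i j; exact h i j)
  have h1 := V.weight_sub D hα h
  have h2 := V.apply_eq_of_sub D (V.cochar_mem D hz s) hα (i := i) (j := j) (k := 1)
    (by rw [h1, Nat.cast_one, one_smul])
  rw [pow_one] at h2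
  rw [← mul_inv_eq_iff_eq_mul.2 h2, cochar, cochar, ← Finset.prod_inv_distrib,
    ← Finset.prod_mul_distrib]
  refine Finset.prod_congr rfl fun a _ => ?_
  rw [← _root_.zpow_neg, ← _root_.zpow_add]
  congr 1
  have h3 := congrFun h1 a
  rw [Pi.sub_apply] at h3
  have h4 : ((z i a + -z j a : ℤ) : ℚ) = ((n * α.vec a : ℤ) : ℚ) := by
    push_cast
    rw [hz, hz, ← h3]; ring
  exact_mod_cast h4

end Cochar

theorem torus_conj_comb {e : Fin V.N → Kˣ} (he : e ∈ V.weightChars K) {d : ℕ} {c : ℤ}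
    (a : Piece 𝔤 d c → K) :
    (V.toGL e : Matrix (Fin V.N) (Fin V.N) K) * (V.toIntRep D).comb a *
      (((V.toGL e)⁻¹ : GL (Fin V.N) K) : Matrix (Fin V.N) (Fin V.N) K) =
    (V.toIntRep D).comb fun α => (V.chr D e (IntRep.qvec α.1) : K) * a α := by
  have h : (V.toGL e : Matrix (Fin V.N) (Fin V.N) K) * (V.toIntRep D).comb a =
      ((V.toIntRep D).comb fun α => (V.chr D e (IntRep.qvec α.1) : K) * a α) *
        (V.toGL e : Matrix (Fin V.N) (Fin V.N) K) := by
    rw [comb_apply, comb_apply, Finset.mul_sum, Finset.sum_mul]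
    refine Finset.sum_congr rfl fun α _ => ?_
    have := V.torus_mul_e D he α.2.1
    rw [V.rootVector_eq D] at this
    rw [mul_smul_comm, coe_toGL, this, smul_mul_assoc, smul_mul_assoc, smul_smul, mul_comm]
  rw [h, mul_assoc, ← Units.val_mul, mul_inv_cancel, Units.val_one, mul_one]

/-! ### The functional -/

theorem mem_g₁ {d : ℕ} {Y : Matrix (Fin V.N) (Fin V.N) K} :
    Y ∈ V.g₁ K d ↔ ∃ a : Piece 𝔤 d 1 → K, (V.toIntRep D).comb a = Y := by
  rw [g₁, Set.image_eq_range, ← LinearMap.mem_range, IntRep.comb, Fintype.range_linearCombination]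
  rfl

section Functional

variable {d : ℕ} {φ : Module.Dual K (V.g₁ K d)} {Φ : Matrix (Fin V.N) (Fin V.N) K →ₗ[K] K}
  (hΦ : ∀ Y : V.g₁ K d, Φ Y = φ Y)

-- Replacing φ by a linear form Φ on all matrices makes the conditions statements about matrices,
-- free of subtypes.
include hΦ in
theorem fixes_iff {g : GL (Fin V.N) K} : V.Fixes φ g ↔ ∀ Y ∈ V.g₁ K d,
    (g : Matrix (Fin V.N) (Fin V.N) K) * Y * ((g⁻¹ : GL (Fin V.N) K) : Matrix (Fin V.N) (Fin V.N) K)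
      ∈ V.g₁ K d ∧ Φ ((g : Matrix (Fin V.N) (Fin V.N) K) * Y *
        ((g⁻¹ : GL (Fin V.N) K) : Matrix (Fin V.N) (Fin V.N) K)) = Φ Y := by
  constructor
  · intro h Y hY
    obtain ⟨Y', h1, h2⟩ := h ⟨Y, hY⟩
    rw [← h1]
    exact ⟨Y'.2, by rw [hΦ, h2]; exact (hΦ ⟨Y, hY⟩).symm⟩
  · intro h Y
    obtain ⟨h1, h2⟩ := h Y Y.2
    exact ⟨⟨_, h1⟩, rfl, by rw [← hΦ, ← hΦ]; exact h2⟩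

/-- The coordinates of the functional. -/
def coord (Φ : Matrix (Fin V.N) (Fin V.N) K →ₗ[K] K) (d : ℕ) (α : Piece 𝔤 d 1) : K :=
  Φ (V.rootVector K α.1)

theorem map_comb (a : Piece 𝔤 d 1 → K) :
    Φ ((V.toIntRep D).comb a) = ∑ α, a α * V.coord Φ d α := by
  rw [comb_apply, map_sum]
  refine Finset.sum_congr rfl fun α _ => ?_
  rw [map_smul, smul_eq_mul]; rfl

include hΦ in
theorem toGL_mem_stab {e : Fin V.N → Kˣ} (he : e ∈ V.weightChars K)
    (h : ∀ α : Piece 𝔤 d 1, V.coord Φ d α ≠ 0 → V.chr D e (IntRep.qvec α.1) = 1)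
    (h' : ∀ α : Piece 𝔤 d 1, V.coord Φ d α ≠ 0 → V.chr D e⁻¹ (IntRep.qvec α.1) = 1) :
    V.toGL e ∈ V.stab φ := by
  have key : ∀ e ∈ V.weightChars K, (∀ α : Piece 𝔤 d 1, V.coord Φ d α ≠ 0 →
      V.chr D e (IntRep.qvec α.1) = 1) → V.Fixes φ (V.toGL e) := by
    intro e he h
    rw [V.fixes_iff hΦ]
    intro Y hY
    obtain ⟨a, rfl⟩ := (V.mem_g₁ D).1 hY
    rw [V.torus_conj_comb D he]
    refine ⟨(V.mem_g₁ D).2 ⟨_, rfl⟩, ?_⟩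
    rw [V.map_comb, V.map_comb]
    refine Finset.sum_congr rfl fun α _ => ?_
    by_cases h0 : V.coord Φ d α = 0
    · rw [h0, mul_zero, mul_zero]
    · rw [h α h0, Units.val_one, one_mul]
  refine ⟨key e he h, ?_⟩
  rw [coe_inv_toGL]
  exact key _ (inv_mem he) h'

include D in
theorem conj_mem_g₁ (hd : ¬ (1 : ℤ) ≡ 0 [ZMOD d]) {u : GL (Fin V.N) K}
    (hu : u ∈ (V.toIntRep D).rg K (psi 𝔤 d)) {Y : Matrix (Fin V.N) (Fin V.N) K}
    (hY : Y ∈ V.g₁ K d) : (u : Matrix (Fin V.N) (Fin V.N) K) * Y *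
      ((u⁻¹ : GL (Fin V.N) K) : Matrix (Fin V.N) (Fin V.N) K) ∈ V.g₁ K d := by
  obtain ⟨l, hl, rfl⟩ := (V.toIntRep D).exists_word D (psi_subset D d) hu
  obtain ⟨A, hA⟩ := exists_word_conj D hd l hl
  obtain ⟨a, rfl⟩ := (V.mem_g₁ D).1 hY
  rw [hA, mul_assoc, ← Units.val_mul, mul_inv_cancel, Units.val_one, mul_one]
  exact (V.mem_g₁ D).2 ⟨_, rfl⟩

/-- The value of `φ` on a root vector moved by `u⁻¹`. -/
def ell (Φ : Matrix (Fin V.N) (Fin V.N) K →ₗ[K] K) (Y : Matrix (Fin V.N) (Fin V.N) K)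
    (u : GL (Fin V.N) K) : K :=
  Φ (((u⁻¹ : GL (Fin V.N) K) : Matrix (Fin V.N) (Fin V.N) K) * Y *
    (u : Matrix (Fin V.N) (Fin V.N) K))

/-- Bridge to the defining representation: u⁻¹ acts on coordinates in 𝔤_1 by a matrix independent of
the representation, and φ, given there by its coordinates, is the trace against `dualMatrix`.
Cyclicity of the trace moves the conjugation from Y to F. -/
theorem ell_word (h2 : ringChar K ≠ 2) (hd : ¬ (1 : ℤ) ≡ 0 [ZMOD d]) {l : List (Root 𝔤.r × K)}
    (hl : ∀ p ∈ l, p.1 ∈ psi 𝔤 d) (a : Piece 𝔤 d 1 → K) :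
    V.ell Φ ((V.toIntRep D).comb a) ((V.toIntRep D).word l) =
      ((D.std.word l : Matrix 𝔤.I 𝔤.I K) * dualMatrix D (V.coord Φ d) *
        (((D.std.word l)⁻¹ : GL 𝔤.I K) : Matrix 𝔤.I 𝔤.I K) * D.std.comb a).trace := by
  obtain ⟨A, hA⟩ := exists_word_conj D hd (invWord l) (mem_invWord hl)
  have hl' : ∀ p ∈ l, p.1 ∈ 𝔤.roots := fun p hp => psi_subset D d (hl p hp)
  have h : ∀ {J : Type} [Fintype J] [DecidableEq J] (E : IntRep 𝔤 J),
      (((E.word l)⁻¹ : GL J K) : Matrix J J K) * E.comb a * (E.word l : Matrix J J K) =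
        E.comb (A a) := by
    intro J _ _ E
    rw [← E.word_invWord D hl', hA, mul_assoc, ← Units.val_mul, E.word_invWord D hl',
      inv_mul_cancel, Units.val_one, mul_one]
  rw [ell, h, V.map_comb, mul_assoc, mul_assoc, trace_mul_comm, mul_assoc, mul_assoc, ← mul_assoc _ (D.std.comb a), h,
    comb_apply, Finset.mul_sum, Matrix.trace_sum]
  refine Finset.sum_congr rfl fun α _ => ?_
  rw [mul_smul_comm, trace_smul, trace_dualMatrix h2, smul_eq_mul]

-- The functions `ell` separate the classes modulo the stabilizer of φ; together with `ell_mul_stab`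
-- they describe U_0 / U_φ.
include hΦ D in
theorem inv_mul_mem_stab (hd : ¬ (1 : ℤ) ≡ 0 [ZMOD d]) {u u' : GL (Fin V.N) K}
    (hu : u ∈ (V.toIntRep D).rg K (psi 𝔤 d)) (hu' : u' ∈ (V.toIntRep D).rg K (psi 𝔤 d))
    (h : ∀ Y ∈ V.g₁ K d, V.ell Φ Y u = V.ell Φ Y u') : u⁻¹ * u' ∈ V.stab φ := by
  have key : ∀ u u' : GL (Fin V.N) K, u ∈ (V.toIntRep D).rg K (psi 𝔤 d) →
      u' ∈ (V.toIntRep D).rg K (psi 𝔤 d) → (∀ Y ∈ V.g₁ K d, V.ell Φ Y u = V.ell Φ Y u') →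
      V.Fixes φ (u⁻¹ * u') := by
    intro u u' hu hu' h
    rw [V.fixes_iff hΦ]
    intro Y hY
    refine ⟨V.conj_mem_g₁ D hd (mul_mem (inv_mem hu) hu') hY, ?_⟩
    have h1 := h _ (V.conj_mem_g₁ D hd hu' hY)
    rw [ell, ell] at h1
    have e1 : ((u'⁻¹ : GL (Fin V.N) K) : Matrix (Fin V.N) (Fin V.N) K) *
        ((u' : Matrix (Fin V.N) (Fin V.N) K) * Y *
          ((u'⁻¹ : GL (Fin V.N) K) : Matrix (Fin V.N) (Fin V.N) K)) * (u' : Matrix (Fin V.N) (Fin V.N) K)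
        = Y := by
      rw [mul_assoc, mul_assoc, mul_assoc, ← Units.val_mul, inv_mul_cancel, Units.val_one, mul_one,
        ← mul_assoc, ← Units.val_mul, inv_mul_cancel, Units.val_one, one_mul]
    rw [e1] at h1
    rw [← h1]
    congr 1
    rw [_root_.mul_inv_rev, inv_inv, Units.val_mul, Units.val_mul]
    simp only [mul_assoc]
  refine ⟨key u u' hu hu' h, ?_⟩
  rw [_root_.mul_inv_rev, inv_inv]
  exact key u' u hu' hu fun Y hY => (h Y hY).symm

include hΦ D in
theorem ell_mul_stab (hd : ¬ (1 : ℤ) ≡ 0 [ZMOD d]) {u v : GL (Fin V.N) K}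
    (hu : u ∈ (V.toIntRep D).rg K (psi 𝔤 d)) (hv : v ∈ V.stab φ)
    {Y : Matrix (Fin V.N) (Fin V.N) K} (hY : Y ∈ V.g₁ K d) : V.ell Φ Y (u * v) = V.ell Φ Y u := by
  have h1 := ((V.fixes_iff hΦ).1 hv.2 _ (V.conj_mem_g₁ D hd (inv_mem hu) hY)).2
  rw [inv_inv, inv_inv] at h1
  rw [ell, ell, ← h1]
  congr 1
  rw [_root_.mul_inv_rev, Units.val_mul, Units.val_mul]
  simp only [mul_assoc]

-- As t fixes φ, φ(t u⁻¹ t⁻¹ Y t u t⁻¹) = φ(u⁻¹ (t⁻¹ Y t) u), and t⁻¹ scales the root vector by the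
-- inverse of the character.
include hΦ D in
theorem ell_conj (hd : ¬ (1 : ℤ) ≡ 0 [ZMOD d]) {e : Fin V.N → Kˣ} (he : e ∈ V.weightChars K)
    (hs : V.toGL e ∈ V.stab φ) {u : GL (Fin V.N) K} (hu : u ∈ (V.toIntRep D).rg K (psi 𝔤 d))
    (δ : Piece 𝔤 d 1) : V.ell Φ (V.rootVector K δ.1) (V.toGL e * u * (V.toGL e)⁻¹) =
      ((V.chr D e (IntRep.qvec δ.1))⁻¹ : Kˣ) * V.ell Φ (V.rootVector K δ.1) u := by
  have hY : V.rootVector K δ.1 ∈ V.g₁ K d := Submodule.subset_span ⟨δ.1, δ.2, rfl⟩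
  have h1 := ((V.fixes_iff hΦ).1 hs.1 _ (V.conj_mem_g₁ D hd (inv_mem hu) hY)).2
  rw [inv_inv] at h1
  have h3 := V.torus_mul_e D he δ.2.1
  rw [← coe_toGL] at h3
  have h4 : (((V.toGL e)⁻¹ : GL (Fin V.N) K) : Matrix (Fin V.N) (Fin V.N) K) * V.rootVector K δ.1 *
      (V.toGL e : Matrix (Fin V.N) (Fin V.N) K) =
        (((V.chr D e (IntRep.qvec δ.1))⁻¹ : Kˣ) : K) • V.rootVector K δ.1 := by
    have h5 : V.rootVector K δ.1 * (V.toGL e : Matrix (Fin V.N) (Fin V.N) K) =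
        (((V.chr D e (IntRep.qvec δ.1))⁻¹ : Kˣ) : K) •
          ((V.toGL e : Matrix (Fin V.N) (Fin V.N) K) * V.rootVector K δ.1) := by
      rw [h3, smul_mul_assoc, smul_smul, Units.inv_mul, one_smul]
    rw [mul_assoc, h5, mul_smul_comm, ← mul_assoc, ← Units.val_mul, inv_mul_cancel, Units.val_one,
      one_mul]
  rw [ell, ell, ← h1]
  refine Eq.trans ?_ (map_smul Φ _ _)
  congr 1
  rw [_root_.mul_inv_rev, _root_.mul_inv_rev, inv_inv, Units.val_mul, Units.val_mul, Units.val_mul,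
    Units.val_mul]
  calc _ = (V.toGL e : Matrix (Fin V.N) (Fin V.N) K) * (((u⁻¹ : GL (Fin V.N) K) : Matrix (Fin V.N) (Fin V.N) K) *
        ((((V.toGL e)⁻¹ : GL (Fin V.N) K) : Matrix (Fin V.N) (Fin V.N) K) * V.rootVector K δ.1 *
      (V.toGL e : Matrix (Fin V.N) (Fin V.N) K)) * (u : Matrix (Fin V.N) (Fin V.N) K)) *
        (((V.toGL e)⁻¹ : GL (Fin V.N) K) : Matrix (Fin V.N) (Fin V.N) K) := by simp only [mul_assoc]
    _ = _ := by rw [h4, mul_smul_comm, smul_mul_assoc, mul_smul_comm, smul_mul_assoc]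

/-- The inverse is replaced by the adjugate to obtain a polynomial; this multiplies `ell` by the
determinant, which is nonzero. -/
theorem exists_poly_ell (Φ : Matrix (Fin V.N) (Fin V.N) K →ₗ[K] K)
    (Y : Matrix (Fin V.N) (Fin V.N) K) : ∃ P : MvPolynomial (Fin V.N × Fin V.N) K,
      ∀ u : GL (Fin V.N) K, u ∈ nonvanishing P ↔ V.ell Φ Y u ≠ 0 := by
  let Xm : Matrix (Fin V.N) (Fin V.N) (MvPolynomial (Fin V.N × Fin V.N) K) :=
    Matrix.of fun i j => MvPolynomial.X (i, j)
  let Ym : Matrix (Fin V.N) (Fin V.N) (MvPolynomial (Fin V.N × Fin V.N) K) :=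
    Matrix.of fun i j => MvPolynomial.C (Y i j)
  refine ⟨∑ i, ∑ j, MvPolynomial.C (Φ (Matrix.single i j 1)) * (Xm.adjugate * Ym * Xm) i j,
    fun u => ?_⟩
  set ev := MvPolynomial.eval fun p : Fin V.N × Fin V.N =>
    (u : Matrix (Fin V.N) (Fin V.N) K) p.1 p.2 with hev
  have h1 : ev.mapMatrix Xm = (u : Matrix (Fin V.N) (Fin V.N) K) := by
    ext i j; simp [Xm, hev]
  have h2 : ev.mapMatrix Ym = Y := by
    ext i j; simp [Ym, hev]
  have h3 : (u : Matrix (Fin V.N) (Fin V.N) K).det ≠ 0 := (Matrix.isUnits_det_units u).ne_zero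
  have h4 : (u : Matrix (Fin V.N) (Fin V.N) K).adjugate =
      (u : Matrix (Fin V.N) (Fin V.N) K).det •
        ((u⁻¹ : GL (Fin V.N) K) : Matrix (Fin V.N) (Fin V.N) K) := by
    rw [Matrix.coe_units_inv, Matrix.inv_def, smul_smul, Ring.mul_inverse_cancel _
      (Matrix.isUnits_det_units u), one_smul]
  have h7 : ev.mapMatrix (Xm.adjugate * Ym * Xm) =
      (u : Matrix (Fin V.N) (Fin V.N) K).adjugate * Y * (u : Matrix (Fin V.N) (Fin V.N) K) := by
    rw [map_mul, map_mul, RingHom.map_adjugate, h1, h2]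
  have h5 : ∀ i j, ev ((Xm.adjugate * Ym * Xm) i j) =
        ((u : Matrix (Fin V.N) (Fin V.N) K).adjugate * Y * (u : Matrix (Fin V.N) (Fin V.N) K)) i j :=
    fun i j => congrFun (congrFun h7 i) j
  change ev _ ≠ 0 ↔ _
  have h6 : ∀ A : Matrix (Fin V.N) (Fin V.N) K, Φ A = ∑ i, ∑ j, Φ (Matrix.single i j 1) * A i j := by
    intro A
    conv_lhs => rw [Matrix.matrix_eq_sum_single A, map_sum]
    refine Finset.sum_congr rfl fun i _ => ?_
    rw [map_sum]
    refine Finset.sum_congr rfl fun j _ => ?_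
    rw [← mul_one (A i j), ← smul_eq_mul, ← Matrix.smul_single, map_smul, smul_eq_mul, smul_eq_mul,
      mul_one, mul_comm]
  have h8 : ∀ x, ev (MvPolynomial.C x) = x := fun x => MvPolynomial.eval_C _
  simp only [map_sum ev, map_mul ev, h8, h5]
  rw [← h6, h4, smul_mul_assoc, smul_mul_assoc, map_smul, smul_eq_mul, ell]
  exact mul_ne_zero_iff_left h3

end Functional

end ChevalleyModule
end ToricPairs

/-! ### The stabilizers of φ in T and in U_0. -/

namespace ToricPairs
open Matrix

attribute [local instance 100] LieRing.ofAssociativeRing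

/-- Given a choice `κ` of inner weights, the roots `wt (κ i) - wt i` for outer weights `wt i`. -/
def Selected {𝔤 : RootedLieAlgebra} (D : StdData 𝔤) (m : ℕ) {d : ℕ} (κ : 𝔤.I → 𝔤.I) :
    Set (Piece 𝔤 d 1) :=
  {δ | ∃ (i : 𝔤.I) (c : Fin 𝔤.r), (c : ℕ) < 𝔤.n - m ∧ D.wt i = Pi.single c 1 ∧
    δ.1.vec = D.wt (κ i) - D.wt i}

namespace ChevalleyModule

variable {𝔤 : RootedLieAlgebra} {V : ChevalleyModule 𝔤} {D : StdData 𝔤} {K : Type*} [Field K]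
  {m d : ℕ} (M : LeviData D m d) {φ : Module.Dual K (V.g₁ K d)}
  {Φ : Matrix (Fin V.N) (Fin V.N) K →ₗ[K] K} (hΦ : ∀ Y : V.g₁ K d, Φ Y = φ Y)
  (hf : ∀ α : Piece 𝔤 d 1, V.coord Φ d α ≠ 0 ↔ α.1 ∈ 𝔤.leviRoots (admissible 𝔤 m))
include M hΦ hf

section Cochar

variable {n : ℕ} {z : Fin V.N → Fin 𝔤.r → ℤ} (hz : ∀ i a, (z i a : ℚ) = n * V.weight D i a)
include hz

/-- The roots of M have no outer coordinates, so cocharacters along outer coordinates act trivially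
on the root spaces where φ is nonzero. -/
theorem cochar_mem_stab {s : Fin 𝔤.r → Kˣ} (hs : ∀ a : Fin 𝔤.r, ¬ (a : ℕ) < 𝔤.n - m → s a = 1) :
    V.toGL (V.cochar z s) ∈ V.stab φ := by
  have key : ∀ s : Fin 𝔤.r → Kˣ, (∀ a : Fin 𝔤.r, ¬ (a : ℕ) < 𝔤.n - m → s a = 1) →
      ∀ α : Piece 𝔤 d 1, V.coord Φ d α ≠ 0 → V.chr D (V.cochar z s) (IntRep.qvec α.1) = 1 := by
    intro s hs α hα
    rw [V.chr_cochar D hz s α.2.1]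
    refine Finset.prod_eq_one fun a _ => ?_
    by_cases ha : (a : ℕ) < 𝔤.n - m
    · rw [M.levi_outer ((hf α).1 hα) a ha, mul_zero, zpow_zero]
    · rw [hs a ha, _root_.one_zpow]
  refine V.toGL_mem_stab D hΦ (V.cochar_mem D hz s) (key s hs) ?_
  rw [← cochar_inv]
  exact key s⁻¹ fun a ha => by rw [Pi.inv_apply, hs a ha, inv_one]

/-- The outer cocharacters form an irreducible family through 1 inside the stabilizer, being the
regular image of the complement of the coordinate hyperplanes, and so lie in its neutral component.
-/
theorem cochar_mem_Tφ [Infinite K] {s : Fin 𝔤.r → Kˣ}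
    (hs : ∀ a : Fin 𝔤.r, ¬ (a : ℕ) < 𝔤.n - m → s a = 1) : V.toGL (V.cochar z s) ∈ V.Tφ φ := by
  classical
  let q : MvPolynomial (Fin 𝔤.r) K := ∏ a, MvPolynomial.X a
  have hq : q ≠ 0 := Finset.prod_ne_zero_iff.2 fun a _ => MvPolynomial.X_ne_zero a
  have hev : ∀ x : Fin 𝔤.r → K, MvPolynomial.eval x q = ∏ a, x a := fun x => by simp [q, map_prod]
  have hx : ∀ x : {x : Fin 𝔤.r → K // MvPolynomial.eval x q ≠ 0}, ∀ a, x.1 a ≠ 0 := by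
    intro x a
    have := x.2
    rw [hev, Finset.prod_ne_zero_iff] at this
    exact this a (Finset.mem_univ a)
  -- The inner parameters are kept for uniformity but replaced by 1.
  let S : {x : Fin 𝔤.r → K // MvPolynomial.eval x q ≠ 0} → Fin 𝔤.r → Kˣ := fun x a =>
    if (a : ℕ) < 𝔤.n - m then Units.mk0 (x.1 a) (hx x a) else 1
  have hreg : ∀ a, ∀ k : ℤ, (fun x => ((S x a ^ k : Kˣ) : K)) ∈ regular q := by
    intro a k
    by_cases ha : (a : ℕ) < 𝔤.n - m
    · have h1 : (fun x => ((S x a : Kˣ) : K)) ∈ regular q :=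
        ⟨MvPolynomial.X a, 0, fun x => by simp [S, ha]⟩
      have h2 : (fun x => (((S x a)⁻¹ : Kˣ) : K)) ∈ regular q := by
        refine ⟨∏ b ∈ Finset.univ.erase a, MvPolynomial.X b, 1, fun x => ?_⟩
        rw [pow_one, hev, ← Finset.prod_erase_mul _ _ (Finset.mem_univ a), map_prod]
        simp [S, ha, mul_assoc, mul_inv_cancel₀ (hx x a)]
      rcases Int.eq_nat_or_neg k with ⟨j, rfl | rfl⟩
      · simp only [zpow_natCast, Units.val_pow_eq_pow_val]
        exact (regular q).pow_mem h1 j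
      · simp only [_root_.zpow_neg, zpow_natCast, ← inv_pow, Units.val_pow_eq_pow_val]
        exact (regular q).pow_mem h2 j
    · have h1 : (fun x => ((S x a ^ k : Kˣ) : K)) = 1 := by
        funext x; simp [S, ha]
      rw [h1]
      exact (regular q).one_mem
  have hirr := isPreirreducible_range (N := V.N) (c := fun x => V.toGL (V.cochar z (S x))) hq
    fun i j => by
      by_cases hij : i = j
      · subst hij
        simp only [coe_toGL, diagonal_apply_eq, cochar, Units.coe_prod]
        have := (regular q).prod_mem (t := Finset.univ) fun a _ => hreg a (z i a)
        convert this using 1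
        ext x
        rw [Finset.prod_apply]
      · simp only [coe_toGL, diagonal_apply_ne _ hij]
        exact (regular q).zero_mem
  have hone : ∀ s : Fin 𝔤.r → Kˣ, (∀ a : Fin 𝔤.r, ¬ (a : ℕ) < 𝔤.n - m → s a = 1) →
      V.toGL (V.cochar z s) ∈ Set.range fun x => V.toGL (V.cochar z (S x)) := by
    intro s hs
    refine ⟨⟨fun a => s a, ?_⟩, ?_⟩
    · rw [hev]; exact Finset.prod_ne_zero_iff.2 fun a _ => (s a).ne_zero
    · change V.toGL (V.cochar z _) = _
      congr 2
      funext a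
      by_cases ha : (a : ℕ) < 𝔤.n - m
      · simp only [S, ha, if_true]; exact Units.ext rfl
      · simp only [S, ha, if_false]; exact (hs a ha).symm
  refine mem_neutralComponent hirr ?_ ?_ (hone s hs)
  · rintro _ ⟨x, rfl⟩
    exact ⟨V.cochar_mem_T D hz _, cochar_mem_stab M hΦ hf hz fun a ha => by simp [S, ha]⟩
  · have h := hone 1 fun _ _ => rfl
    have e : V.cochar z (1 : Fin 𝔤.r → Kˣ) = 1 := by
      funext i; simp [cochar]
    rwa [e, toGL_one] at h

end Cochar

/-- The stabilizer of `φ` in `U₀` is connected. -/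
theorem Uφ_eq [Infinite K] (h2 : ringChar K ≠ 2) : V.Uφ φ = V.U₀ K d ⊓ V.stab φ := by
  classical
  refine le_antisymm (neutralComponent_le _) fun u hu => ?_
  obtain ⟨n, hn, z, hz⟩ := V.exists_denom D
  have hψ := psi_subset D (𝔤 := 𝔤) d
  have hu' : u ∈ (V.toIntRep D).rg K (psi 𝔤 d) := by rw [← V.U₀_eq D h2]; exact hu.1
  have hsupp := (IntRep.rg_le_suppGroup _ D (lam_pos_add (𝔤 := 𝔤) (m := m)) hψ
    (fun γ hγ => M.psi_lam hγ) hu').1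
  -- The exponents of the cocharacter attached to `lam`. Off the diagonal, a nonzero entry of u
  -- raises them, so conjugation by this cocharacter contracts u to 1.
  let w : Fin V.N → ℤ := fun i => ∑ a : Fin 𝔤.r, ((𝔤.n - m - a : ℕ) : ℤ) * z i a
  have hw : ∀ i, (w i : ℚ) = n * lam 𝔤 m (V.weight D i) := by
    intro i
    simp only [w, lam, Finset.mul_sum]
    push_cast
    refine Finset.sum_congr rfl fun a _ => ?_
    rw [hz]; ring
  have hdiag : ∀ i, (u : Matrix (Fin V.N) (Fin V.N) K) i i = 1 := by
    intro i
    by_contra h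
    have h1 := hsupp i i (by rw [Matrix.sub_apply, one_apply_eq]; exact sub_ne_zero.2 h)
    rw [sub_self] at h1
    simp [lam] at h1
  have hoff : ∀ i j, i ≠ j → (u : Matrix (Fin V.N) (Fin V.N) K) i j ≠ 0 → 0 < w i - w j := by
    intro i j hij h
    have h1 : 0 < lam 𝔤 m (V.weight D i - V.weight D j) :=
      hsupp i j (by rwa [Matrix.sub_apply, one_apply_ne hij, sub_zero])
    rw [lam_sub] at h1
    have h3 : (0 : ℚ) < ((w i - w j : ℤ) : ℚ) := by
      push_cast
      rw [hw, hw, ← mul_sub]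
      exact mul_pos (by exact_mod_cast hn) h1
    exact_mod_cast h3
  let s : Kˣ → Fin 𝔤.r → Kˣ := fun t a => t ^ (𝔤.n - m - a : ℕ)
  have hs : ∀ t, ∀ a : Fin 𝔤.r, ¬ (a : ℕ) < 𝔤.n - m → s t a = 1 := by
    intro t a ha
    simp only [s]
    rw [show 𝔤.n - m - (a : ℕ) = 0 by omega, pow_zero]
  have hcw : ∀ t i, V.cochar z (s t) i = t ^ w i := by
    intro t i
    rw [cochar, ← prod_zpow_eq]
    refine Finset.prod_congr rfl fun a _ => ?_
    simp only [s]
    rw [← zpow_natCast, ← _root_.zpow_mul]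
  -- The conjugates of u by the cocharacter have entries u_ij t^(w i - w j), with positive exponents
  -- off the diagonal. They extend polynomially to t = 0 with value 1, so this irreducible curve in
  -- the stabilizer joins 1 to u, its value at t = 1.
  let c : {x : Unit → K // MvPolynomial.eval x (1 : MvPolynomial Unit K) ≠ 0} → GL (Fin V.N) K :=
    fun x => if h : x.1 () = 0 then 1 else V.toGL (V.cochar z (s (Units.mk0 _ h))) * u *
      (V.toGL (V.cochar z (s (Units.mk0 _ h))))⁻¹
  have hirr := isPreirreducible_range (N := V.N) (c := c) one_ne_zero fun i j => by
    refine ⟨if i = j then 1 else if (u : Matrix (Fin V.N) (Fin V.N) K) i j = 0 then 0 else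
      MvPolynomial.C ((u : Matrix (Fin V.N) (Fin V.N) K) i j) *
        MvPolynomial.X () ^ (w i - w j).toNat, 0, fun x => ?_⟩
    rw [pow_zero, one_mul]
    by_cases hx : x.1 () = 0
    · simp only [c, hx, dif_pos, Units.val_one]
      by_cases hij : i = j
      · subst hij; simp
      · rw [one_apply_ne hij, if_neg hij]
        split_ifs with h0
        · simp
        · have h3 := hoff i j hij h0
          have h4 : (w i - w j).toNat ≠ 0 := by omega
          simp [hx, h4]
    · simp only [c, hx, dif_neg, not_false_eq_true]
      rw [toGL_conj_apply, hcw, hcw]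
      simp only [Units.val_zpow_eq_zpow_val, Units.val_inv_eq_inv_val, Units.val_mk0]
      by_cases hij : i = j
      · subst hij
        rw [hdiag, if_pos rfl, map_one, mul_one, mul_inv_cancel₀ (zpow_ne_zero _ hx)]
      · rw [if_neg hij]
        split_ifs with h0
        · rw [h0]; simp
        · have h3 := hoff i j hij h0
          have h4 : ((w i - w j).toNat : ℤ) = w i - w j := Int.toNat_of_nonneg h3.le
          rw [map_mul, map_pow, MvPolynomial.eval_C, MvPolynomial.eval_X, ← zpow_natCast, h4,
            zpow_sub₀ hx, div_eq_mul_inv]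
          ring
  have hone : ∀ x : Unit → K, MvPolynomial.eval x (1 : MvPolynomial Unit K) ≠ 0 := by simp
  refine mem_neutralComponent hirr ?_ ⟨⟨fun _ => 0, hone _⟩, by simp [c]⟩
    ⟨⟨fun _ => 1, hone _⟩, ?_⟩
  · rintro _ ⟨x, rfl⟩
    by_cases hx : x.1 () = 0
    · simp only [c, hx, dif_pos]; exact one_mem _
    · simp only [c, hx, dif_neg, not_false_eq_true]
      have hst := cochar_mem_stab M hΦ hf hz (hs (Units.mk0 _ hx))
      refine ⟨?_, (V.stab φ).mul_mem ((V.stab φ).mul_mem hst hu.2) ((V.stab φ).inv_mem hst)⟩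
      rw [V.U₀_eq D h2]
      exact V.torus_conj_mem D (V.cochar_mem_T D hz _) hψ hu'
  · have h1 : V.cochar z (s 1) = 1 := by
      funext i
      rw [hcw, _root_.one_zpow]; rfl
    simp [c, h1, toGL_one]

end ChevalleyModule
end ToricPairs

/-! ### The selected coordinates on U_0 / U_φ. -/

namespace ToricPairs
open Matrix

attribute [local instance 100] LieRing.ofAssociativeRing

namespace ChevalleyModule

variable {𝔤 : RootedLieAlgebra} {V : ChevalleyModule 𝔤} {D : StdData 𝔤} {K : Type*} [Field K]
  {m d : ℕ} (M : LeviData D m d)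
  {Φ : Matrix (Fin V.N) (Fin V.N) K →ₗ[K] K}
  (hf : ∀ α : Piece 𝔤 d 1, V.coord Φ d α ≠ 0 ↔ α.1 ∈ 𝔤.leviRoots (admissible 𝔤 m))
  {κ : 𝔤.I → 𝔤.I} (hκ : ∀ i, D.Inner m (κ i))
  (hκ' : ∀ i, 𝔤.twoRho ⬝ᵥ D.wt (κ i) ≡ 𝔤.twoRho ⬝ᵥ D.wt i + 2 [ZMOD (2 * d : ℕ)])

-- An outer weight χ_c minus any inner weight is a root by `outer_root`; the choice of κ puts its
-- opposite in degree 1.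
include M hκ hκ' in
omit hf in
theorem exists_selected {i : 𝔤.I} {c : Fin 𝔤.r} (hc : (c : ℕ) < 𝔤.n - m)
    (hi : D.wt i = Pi.single c 1) : ∃ δ : Piece 𝔤 d 1, δ.1.vec = D.wt (κ i) - D.wt i := by
  obtain ⟨α, hα, hv⟩ := M.outer_root i c (κ i) hc hi (hκ i)
  have hα' := ((D.mem_pos α).1 hα).1
  have hv' : α.opp.vec = D.wt (κ i) - D.wt i := by rw [Root.vec_opp, hv, neg_sub]
  exact ⟨⟨α.opp, D.opp_mem α hα', (ht_modEq (D.opp_mem α hα') hv' 1).2 (by simpa using hκ' i)⟩, hv'⟩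

include M in
/-- The functions `ell` of the selected roots are matrix entries. -/
theorem ell_eq_entry (h2 : ringChar K ≠ 2) {i k : 𝔤.I} {δ : Piece 𝔤 d 1}
    (hδ : δ.1.vec = D.wt k - D.wt i) : ∃ s : K, s ≠ 0 ∧ ∀ l : List (Root 𝔤.r × K),
      (∀ p ∈ l, p.1 ∈ psi 𝔤 d) → V.ell Φ (V.rootVector K δ.1) ((V.toIntRep D).word l) =
        s * ((D.std.word l : Matrix 𝔤.I 𝔤.I K) * dualMatrix D (V.coord Φ d) *
          (((D.std.word l)⁻¹ : GL 𝔤.I K) : Matrix 𝔤.I 𝔤.I K)) i k := by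
  have hv : D.wt i - D.wt k = (δ.opp D).1.vec := by
    rw [show (δ.opp D).1 = δ.1.opp from rfl, Root.vec_opp, hδ, neg_sub]
  have he : D.std.e K (δ.opp D).1 i k ≠ 0 := (D.std_e_ne_zero h2 (δ.opp D).2.1).2 hv
  -- Both sides are multiples of the coefficient of the opposite root in w F w⁻¹: the trace
  -- multiplies it by `tr D K δ.1`, the entry at (i, k) by the entry of the root matrix.
  refine ⟨tr D K δ.1 / D.std.e K (δ.opp D).1 i k, div_ne_zero (tr_ne_zero h2 δ.2.1) he,
    fun l hl => ?_⟩
  obtain ⟨b, hb⟩ := M.conj_mem (V.coord Φ d) (D.std.word_mem hl)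
  have h1 := V.ell_word D (Φ := Φ) h2 M.one_not_congr hl (Pi.single δ 1)
  rw [comb_single, comb_single, one_smul, one_smul, hb, trace_comb_mul] at h1
  rw [V.rootVector_eq D, h1, hb, comb_entry b i k _ hv]
  field_simp

include M hf hκ hκ' in
/-- The values of `ell` on the selected roots determine the moved functional. -/
theorem ell_eq_of_selected (h2 : ringChar K ≠ 2) {u u' : GL (Fin V.N) K}
    (hu : u ∈ (V.toIntRep D).rg K (psi 𝔤 d)) (hu' : u' ∈ (V.toIntRep D).rg K (psi 𝔤 d))
    (h : ∀ δ ∈ Selected D m κ (d := d), V.ell Φ (V.rootVector K δ.1) u =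
      V.ell Φ (V.rootVector K δ.1) u') : ∀ Y ∈ V.g₁ K d, V.ell Φ Y u = V.ell Φ Y u' := by
  obtain ⟨l, hl, rfl⟩ := (V.toIntRep D).exists_word D (psi_subset D d) hu
  obtain ⟨l', hl', rfl⟩ := (V.toIntRep D).exists_word D (psi_subset D d) hu'
  intro Y hY
  obtain ⟨a, rfl⟩ := (V.mem_g₁ D).1 hY
  rw [V.ell_word D h2 M.one_not_congr hl, V.ell_word D h2 M.one_not_congr hl',
    M.conj_eq_of hf h2 hκ hκ' (D.std.word_mem hl) (D.std.word_mem hl')]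
  rintro i ⟨c, hc, hi⟩
  obtain ⟨δ, hδ⟩ := exists_selected M hκ hκ' hc hi
  obtain ⟨s, hs, he⟩ := ell_eq_entry (V := V) (Φ := Φ) M h2 hδ
  have h1 := h δ ⟨i, c, hc, hi, hδ⟩
  rw [he l hl, he l' hl'] at h1
  exact mul_left_cancel₀ hs h1

include M hf hκ hκ' in
theorem exists_ell_ne_zero (h2 : ringChar K ≠ 2) {δ : Piece 𝔤 d 1}
    (hδ : δ ∈ Selected D m κ (d := d)) : ∃ u ∈ (V.toIntRep D).rg K (psi 𝔤 d),
      V.ell Φ (V.rootVector K δ.1) u ≠ 0 := by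
  obtain ⟨i, c, hc, hi, hv⟩ := hδ
  obtain ⟨γ, hγ, hne⟩ := M.exists_conj_ne (K := K) hf h2 hc hi (hκ i) (hκ' i)
  obtain ⟨s, hs, he⟩ := ell_eq_entry (V := V) (Φ := Φ) M h2 hv
  have hl : ∀ p ∈ [(γ, (1 : K))], p.1 ∈ psi 𝔤 d := by simpa using hγ
  refine ⟨_, (V.toIntRep D).word_mem hl, ?_⟩
  rw [he _ hl]
  refine mul_ne_zero hs ?_
  rw [D.std.word_cons, D.std.word_nil, mul_one]
  exact hne

theorem isOpen_biInter_ell (Φ : Matrix (Fin V.N) (Fin V.N) K →ₗ[K] K) (S : Set (Piece 𝔤 d 1)) :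
    @IsOpen _ (zariski K V.N) {g | ∀ δ ∈ S, V.ell Φ (V.rootVector K δ.1) g ≠ 0} := by
  let _ := zariski K V.N
  have h : {g | ∀ δ ∈ S, V.ell Φ (V.rootVector K δ.1) g ≠ 0} =
      ⋂ δ ∈ S, {g | V.ell Φ (V.rootVector K δ.1) g ≠ 0} := by
    ext g; simp
  rw [h]
  refine S.toFinite.isOpen_biInter fun δ _ => ?_
  obtain ⟨P, hP⟩ := V.exists_poly_ell Φ (V.rootVector K δ.1)
  rw [show {g | V.ell Φ (V.rootVector K δ.1) g ≠ 0} = nonvanishing P from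
    Set.ext fun g => (hP g).symm]
  exact isOpen_nonvanishing P

-- Each of finitely many open conditions can be met separately in U_0; irreducibility allows them to
-- be met together.
include M hf hκ hκ' in
theorem exists_forall_ell_ne_zero [Infinite K] (h2 : ringChar K ≠ 2) :
    ∃ u ∈ (V.toIntRep D).rg K (psi 𝔤 d),
      ∀ δ ∈ Selected D m κ (d := d), V.ell Φ (V.rootVector K δ.1) u ≠ 0 := by
  classical
  let _ := zariski K V.N
  have hirr : IsIrreducible ((V.toIntRep D).rg K (psi 𝔤 d) : Set (GL (Fin V.N) K)) :=
    ⟨⟨1, one_mem _⟩, (V.toIntRep D).isPreirreducible_rg D (psi_subset D d)⟩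
  choose P hP using fun δ : Piece 𝔤 d 1 => V.exists_poly_ell Φ (V.rootVector K δ.1)
  have h := isIrreducible_iff_sInter.1 hirr
    ((Selected D m κ (d := d)).toFinite.toFinset.image fun δ => nonvanishing (P δ))
    (by
      intro o ho
      obtain ⟨δ, -, rfl⟩ := Finset.mem_image.1 ho
      exact isOpen_nonvanishing _)
    (by
      intro o ho
      obtain ⟨δ, hδ, rfl⟩ := Finset.mem_image.1 ho
      obtain ⟨u, hu, hne⟩ := exists_ell_ne_zero M hf hκ hκ' h2 ((Set.Finite.mem_toFinset _).1 hδ)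
      exact ⟨u, hu, (hP δ u).2 hne⟩)
  obtain ⟨u, hu, hu'⟩ := h
  refine ⟨u, hu, fun δ hδ => (hP δ u).1 (hu' _ ?_)⟩
  exact Finset.mem_coe.2 (Finset.mem_image_of_mem _ ((Set.Finite.mem_toFinset _).2 hδ))

/-! ### The center -/

-- The simple roots of M and the selected roots generate the root lattice: modulo their span every
-- weight of the defining representation agrees with an inner one, and inner weights agree with each
-- other. All roots are therefore trivial on e, which thus commutes with T and with the root
-- subgroups.
include M hκ in
omit hf in
theorem mem_Z_of_trivial {e : Fin V.N → Kˣ} (he : e ∈ V.weightChars K)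
    (h1 : ∀ k ∈ admissible 𝔤 m, V.chr D e (IntRep.qvec (𝔤.simple k)) = 1)
    (hsel : ∀ δ ∈ Selected D m κ (d := d), V.chr D e (IntRep.qvec δ.1) = 1)
    (hex : ∀ (i : 𝔤.I) (c : Fin 𝔤.r), (c : ℕ) < 𝔤.n - m → D.wt i = Pi.single c 1 →
      ∃ δ : Piece 𝔤 d 1, δ.1.vec = D.wt (κ i) - D.wt i) : V.toGL e ∈ V.Z K := by
  have hspan : ∀ v ∈ Submodule.span ℤ ((fun k => (𝔤.simple k).vec) '' admissible 𝔤 m),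
      (fun a => (v a : ℚ)) ∈ V.trivialOn D he := by
    intro v hv
    induction hv using Submodule.span_induction with
    | mem x hx =>
      obtain ⟨k, hk, rfl⟩ := hx
      exact ⟨V.qvec_mem D (M.simple_mem k).1, h1 k hk⟩
    | zero =>
      have := (V.trivialOn D he).zero_mem
      convert this using 1
      funext a; simp
    | add x y _ _ hx hy =>
      have := (V.trivialOn D he).add_mem hx hy
      convert this using 1
      funext a; simp
    | smul c x _ hx =>
      have := (V.trivialOn D he).zsmul_mem hx c
      convert this using 1
      funext a; simp
  have hμ : ∀ i j, (fun a => (((D.wt i - D.wt j) a : ℤ) : ℚ)) = D.std.μ i - D.std.μ j := by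
    intro i j
    funext a
    rw [Pi.sub_apply]
    push_cast
    rfl
  have hin : ∀ i j, D.Inner m i → D.Inner m j → D.std.μ i - D.std.μ j ∈ V.trivialOn D he := by
    intro i j hi hj
    rw [← hμ]
    exact hspan _ (M.inner_span i j hi hj)
  have hout : ∀ (i : 𝔤.I) (c : Fin 𝔤.r), (c : ℕ) < 𝔤.n - m → D.wt i = Pi.single c 1 →
      D.std.μ (κ i) - D.std.μ i ∈ V.trivialOn D he := by
    intro i c hc hi
    obtain ⟨δ, hδ⟩ := hex i c hc hi
    rw [← hμ, ← hδ]
    exact ⟨V.qvec_mem D δ.2.1, hsel δ ⟨i, c, hc, hi, hδ⟩⟩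
  have hall : ∀ i, ∃ k, D.Inner m k ∧ D.std.μ i - D.std.μ k ∈ V.trivialOn D he := by
    intro i
    rcases M.cases i with hi | ⟨c, hc, hi⟩ | ⟨c, hc, hi⟩
    · exact ⟨i, hi, by rw [sub_self]; exact zero_mem _⟩
    · refine ⟨κ i, hκ i, ?_⟩
      rw [← neg_sub]
      exact neg_mem (hout i c hc hi)
    -- A weight -χ_c is treated by the symmetry of the weights: its difference with -wt (κ i') is
    -- the selected difference for χ_c.
    · obtain ⟨i', hi'⟩ := M.wt_surj c
      obtain ⟨k, hk⟩ := M.wt_neg i c hi (κ i')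
      refine ⟨k, fun a ha => by rw [hk, Pi.neg_apply, hκ i' a ha, neg_zero], ?_⟩
      rw [← hμ, show D.wt i - D.wt k = D.wt (κ i') - D.wt i' by rw [hi, hk, hi']; abel, hμ]
      exact hout i' c hc hi'
  have hroot : ∀ α ∈ 𝔤.roots, V.chr D e (IntRep.qvec α) = 1 := by
    intro α hα
    obtain ⟨i, j, hij⟩ := D.unit_entry α hα
    have hv := (D.supp α hα i j).1 (by intro h0; rw [h0] at hij; simp at hij)
    obtain ⟨k, hk, hik⟩ := hall i
    obtain ⟨k', hk', hjk⟩ := hall j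
    have h3 := add_mem (sub_mem hik hjk) (hin k k' hk hk')
    have h4 : IntRep.qvec α = D.std.μ i - D.std.μ k - (D.std.μ j - D.std.μ k') +
        (D.std.μ k - D.std.μ k') := by
      rw [show D.std.μ i - D.std.μ k - (D.std.μ j - D.std.μ k') + (D.std.μ k - D.std.μ k') =
        D.std.μ i - D.std.μ j by abel, ← hμ, hv]
    rw [h4]
    exact h3.2
  refine ⟨(le_sup_left : V.T K ≤ V.G K) (V.mem_T'.2 ⟨e, he, rfl⟩), ?_⟩
  suffices hle : V.G K ≤ Subgroup.centralizer {V.toGL e} by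
    refine Subgroup.mem_centralizer_iff.2 fun g hg => ?_
    exact (Subgroup.mem_centralizer_iff.1 (hle hg) _ rfl).symm
  rw [G, V.rootGroup_eq D K subset_rfl]
  refine sup_le ?_ ?_
  · intro g hg
    obtain ⟨e', -, rfl⟩ := V.mem_T'.1 hg
    rw [Subgroup.mem_centralizer_iff]
    rintro _ rfl
    ext1
    rw [Units.val_mul, Units.val_mul, coe_toGL, coe_toGL, diagonal_mul_diagonal,
      diagonal_mul_diagonal]
    congr 1
    funext i
    exact mul_comm _ _
  · rw [IntRep.rg, Subgroup.closure_le]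
    rintro _ ⟨α, hα, t, rfl⟩
    rw [SetLike.mem_coe, Subgroup.mem_centralizer_iff]
    rintro _ rfl
    have h3 := V.torus_conj_gx D he (coe_toGL V e) hα t
    rw [hroot α hα, Units.val_one, one_mul] at h3
    exact mul_inv_eq_iff_eq_mul.1 h3

/-! ### Toricity -/

omit hf in
/-- The pair is toric if the combinatorial facts about the root system hold. -/
theorem isToric [IsAlgClosed K] (h2 : ringChar K ≠ 2)
    (M : LeviData D m (𝔤.leviCoxeter (admissible 𝔤 m))) : V.IsToric K (admissible 𝔤 m) := by
  intro φ hφ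
  have hinf : Infinite K := IsAlgClosed.instInfinite
  generalize 𝔤.leviCoxeter (admissible 𝔤 m) = d at M φ hφ ⊢
  -- Any linear extension of φ to all matrices serves.
  obtain ⟨Φ, hΦ'⟩ := LinearMap.exists_extend φ
  have hΦ : ∀ Y : V.g₁ K d, Φ Y = φ Y := fun Y => LinearMap.congr_fun hΦ' Y
  have hf : ∀ α : Piece 𝔤 d 1, V.coord Φ d α ≠ 0 ↔ α.1 ∈ 𝔤.leviRoots (admissible 𝔤 m) := by
    intro α
    rw [← hφ α.1 α.2, coord, ← hΦ]
  have hψ := psi_subset D (𝔤 := 𝔤) d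
  have hU := V.U₀_eq D (K := K) h2 d
  have hUφ := Uφ_eq M hΦ hf h2
  have h11 := M.one_not_congr
  have hT : ∀ t ∈ V.Tφ φ, ∃ e ∈ V.weightChars K, t = V.toGL e ∧ V.toGL e ∈ V.stab φ := by
    intro t ht
    have h := neutralComponent_le _ ht
    obtain ⟨e, he, rfl⟩ := V.mem_T'.1 h.1
    exact ⟨e, he, rfl, h.2⟩
  have hconj : ∀ t ∈ V.Tφ φ, ∀ u ∈ V.U₀ K d, t * u * t⁻¹ ∈ V.U₀ K d := by
    intro t ht u hu
    rw [hU] at hu ⊢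
    exact V.torus_conj_mem D (neutralComponent_le _ ht).1 hψ hu
  -- The index κ i is an inner weight one step above i modulo d, so wt (κ i) - wt i has degree 1.
  choose κ hκ hκ' using M.exists_succ
  obtain ⟨u₀, hu₀, hne₀⟩ := exists_forall_ell_ne_zero (V := V) (Φ := Φ) M hf hκ hκ' h2
  have hg₁ : ∀ δ : Piece 𝔤 d 1, V.rootVector K δ.1 ∈ V.g₁ K d := fun δ =>
    Submodule.subset_span ⟨δ.1, δ.2, rfl⟩
  refine ⟨hconj, ?_, ⟨u₀, by rw [hU]; exact hu₀⟩, ?_⟩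
  · intro t ht u hu
    rw [hUφ] at hu ⊢
    have hst := (neutralComponent_le _ ht).2
    exact ⟨hconj t ht u hu.1,
      (V.stab φ).mul_mem ((V.stab φ).mul_mem hst hu.2) ((V.stab φ).inv_mem hst)⟩
  -- The orbit of the base point is exactly the locus where no selected value vanishes. Characters
  -- are invertible, which gives one inclusion; for the other, all selected values are matched by a
  -- point of T_φ.
  have hpre : ∀ u : V.U₀ K d, (QuotientGroup.mk u : V.Quot₀ φ) ∈
      V.orbit φ ⟨u₀, by rw [hU]; exact hu₀⟩ ↔
        ∀ δ ∈ Selected D m κ (d := d), V.ell Φ (V.rootVector K δ.1) u ≠ 0 := by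
    rintro ⟨u, hu⟩
    have hu' := hu
    rw [hU] at hu'
    constructor
    · rintro ⟨t, ht, w, hw, he⟩ δ hδ
      obtain ⟨e, he', rfl, hst⟩ := hT t ht
      have h3 := (QuotientGroup.eq.1 he : _ ∈ (V.Uφ φ).subgroupOf (V.U₀ K d))
      rw [Subgroup.mem_subgroupOf, hUφ] at h3
      have h4 := V.ell_mul_stab D hΦ h11 hu' h3.2 (hg₁ δ)
      have h5 : u * ((⟨u, hu⟩⁻¹ * w : V.U₀ K d) : GL (Fin V.N) K) = w := by
        simp
      rw [h5, hw, V.ell_conj D hΦ h11 he' hst hu₀] at h4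
      rw [← h4]
      exact mul_ne_zero (Units.ne_zero _) (hne₀ δ hδ)
    · intro hne
      obtain ⟨n, hn, z, hz⟩ := V.exists_denom D
      have hs : ∀ c : Fin 𝔤.r, ∃ s : Kˣ, (¬ (c : ℕ) < 𝔤.n - m → s = 1) ∧
          ∀ (i : 𝔤.I), (c : ℕ) < 𝔤.n - m → D.wt i = Pi.single c 1 →
            ∀ δ : Piece 𝔤 d 1, δ.1.vec = D.wt (κ i) - D.wt i →
            (s : K) ^ n * V.ell Φ (V.rootVector K δ.1) u₀ = V.ell Φ (V.rootVector K δ.1) u := by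
        intro c
        by_cases hc : (c : ℕ) < 𝔤.n - m
        · obtain ⟨i, hi⟩ := M.wt_surj c
          obtain ⟨δ, hδ⟩ := exists_selected M hκ hκ' hc hi
          have hsel : δ ∈ Selected D m κ (d := d) := ⟨i, c, hc, hi, hδ⟩
          -- The cocharacters are n-th multiples of the coordinate ones, with n a common denominator
          -- of the weights, so an n-th root of the required ratio is taken.
          obtain ⟨s, hs⟩ := IsAlgClosed.exists_pow_nat_eq
            (V.ell Φ (V.rootVector K δ.1) u / V.ell Φ (V.rootVector K δ.1) u₀) hn
          have hs0 : s ≠ 0 := by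
            rintro rfl
            rw [zero_pow hn.ne'] at hs
            exact div_ne_zero (hne δ hsel) (hne₀ δ hsel) hs.symm
          refine ⟨Units.mk0 s hs0, fun h => (h hc).elim, fun i' _ hi' δ' hδ' => ?_⟩
          have hii : i' = i := D.wt_inj (hi'.trans hi.symm)
          subst hii
          have hdd : δ' = δ := Subtype.ext (D.vec_inj _ δ'.2.1 _ δ.2.1 (hδ'.trans hδ.symm))
          rw [hdd, Units.val_mk0, hs, div_mul_cancel₀ _ (hne₀ δ hsel)]
        · exact ⟨1, fun _ => rfl, fun _ h => (hc h).elim⟩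
      choose s hs1 hs2 using hs
      have ht := cochar_mem_Tφ M hΦ hf hz (s := s) fun a ha => hs1 a ha
      obtain ⟨e, he, hte, hst⟩ := hT _ ht
      have hc := V.cochar_mem D hz s
      have hst' := (neutralComponent_le _ ht).2
      set t := V.toGL (V.cochar z s) with ht_def
      have hw : t * u₀ * t⁻¹ ∈ V.U₀ K d := hconj t ht u₀ (by rw [hU]; exact hu₀)
      have hw' := hw
      rw [hU] at hw'
      refine ⟨t, ht, ⟨_, hw⟩, rfl, ?_⟩
      apply QuotientGroup.eq.2
      rw [Subgroup.mem_subgroupOf, hUφ]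
      refine ⟨SetLike.coe_mem _, ?_⟩
      change u⁻¹ * (t * u₀ * t⁻¹) ∈ V.stab φ
      refine V.inv_mul_mem_stab D hΦ h11 hu' hw' ?_
      refine ell_eq_of_selected M hf hκ hκ' h2 hu' hw' ?_
      rintro δ ⟨i, c, hc', hi, hδ⟩
      rw [ht_def, V.ell_conj D hΦ h11 hc hst' hu₀, ← hs2 c i hc' hi δ hδ, V.chr_cochar D hz s δ.2.1]
      congr 1
      -- The selected root δ has outer coordinate -1 at c and 0 at the other outer places, while s
      -- is 1 at the inner ones: the scalings are independent.
      have h6 : ∏ a, s a ^ ((n : ℤ) * δ.1.vec a) = (s c ^ n)⁻¹ := by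
        rw [Finset.prod_eq_single c]
        · rw [hδ, Pi.sub_apply, hκ i c hc', hi, Pi.single_eq_same]
          rw [show (n : ℤ) * (0 - 1) = -(n : ℤ) by ring, _root_.zpow_neg, zpow_natCast]
        · intro a _ ha
          by_cases hao : (a : ℕ) < 𝔤.n - m
          · rw [hδ, Pi.sub_apply, hκ i a hao, hi, Pi.single_eq_of_ne ha, sub_zero, mul_zero,
              zpow_zero]
          · rw [hs1 a hao, _root_.one_zpow]
        · simp
      rw [h6, inv_inv, Units.val_pow_eq_pow_val]
  let _ := zariski K V.N
  have hset : (QuotientGroup.mk : V.U₀ K d → V.Quot₀ φ) ⁻¹' V.orbit φ ⟨u₀, by rw [hU]; exact hu₀⟩ =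
      Subtype.val ⁻¹' {g | ∀ δ ∈ Selected D m κ (d := d), V.ell Φ (V.rootVector K δ.1) g ≠ 0} :=
    Set.ext fun u => hpre u
  have hopen := isOpen_biInter_ell (V := V) Φ (Selected D m κ (d := d))
  -- Finiteness modulo the center holds in the strong form that the stabilizer lies in the center.
  refine ⟨?_, ?_, {1}, Set.finite_singleton _, ?_⟩
  · refine isOpen_coinduced.2 ?_
    have h := hopen.preimage (continuous_subtype_val (p := fun g => g ∈ V.U₀ K d))
    rwa [← hset] at h
  · rw [dense_iff_inter_open]
    intro W hW hWne
    obtain ⟨x, hx⟩ := hWne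
    obtain ⟨v, rfl⟩ := QuotientGroup.mk_surjective x
    have hW' : IsOpen ((QuotientGroup.mk : V.U₀ K d → V.Quot₀ φ) ⁻¹' W) := isOpen_coinduced.1 hW
    obtain ⟨W', hW'o, hW'e⟩ := isOpen_induced_iff.1 hW'
    have hvW : (v : GL (Fin V.N) K) ∈ W' := by
      have : v ∈ Subtype.val ⁻¹' W' := by rw [hW'e]; exact hx
      exact this
    -- Density: the preimage of a nonempty open set of the quotient and the open locus both meet the
    -- irreducible group U_0, hence meet each other in it.
    have hirr := (V.toIntRep D).isPreirreducible_rg D (K := K) hψ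
    obtain ⟨y, hy, hyW, hyo⟩ := hirr W' _ hW'o hopen ⟨v, by rw [← hU]; exact v.2, hvW⟩
      ⟨u₀, hu₀, hne₀⟩
    have hy' : y ∈ V.U₀ K d := by rw [hU]; exact hy
    refine ⟨QuotientGroup.mk ⟨y, hy'⟩, ?_, (hpre ⟨y, hy'⟩).2 hyo⟩
    have : (⟨y, hy'⟩ : V.U₀ K d) ∈ Subtype.val ⁻¹' W' := hyW
    rw [hW'e] at this
    exact this
  · rintro t ⟨ht, hmem⟩
    obtain ⟨e, he, rfl, hst⟩ := hT t ht
    refine ⟨1, rfl, V.toGL e, ?_, (one_mul _).symm⟩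
    refine mem_Z_of_trivial M hκ he ?_ ?_ fun i c hc hi => exists_selected M hκ hκ' hc hi
    · intro k hk
      obtain ⟨hr, hht⟩ := M.simple_mem k
      -- A simple root of M lies in degree 1 and φ does not vanish on its root space, so an element
      -- fixing φ has trivial character there.
      let α : Piece 𝔤 d 1 := ⟨𝔤.simple k, hr, by rw [hht]⟩
      have hα : V.coord Φ d α ≠ 0 := (hf α).2 ⟨hr, Submodule.subset_span ⟨k, hk, rfl⟩⟩
      have h3 := ((V.fixes_iff hΦ).1 hst.1 _ (hg₁ α)).2
      have h4 := V.torus_conj_comb D he (Pi.single α 1)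
      rw [comb_single, one_smul, ← V.rootVector_eq D] at h4
      have h5 : (fun β : Piece 𝔤 d 1 => (V.chr D e (IntRep.qvec β.1) : K) *
          (Pi.single α 1 : Piece 𝔤 d 1 → K) β) = Pi.single α (V.chr D e (IntRep.qvec α.1) : K) := by
        funext β
        by_cases hβ : β = α
        · subst hβ; simp
        · rw [Pi.single_eq_of_ne hβ, Pi.single_eq_of_ne hβ, mul_zero]
      rw [h5, comb_single, ← V.rootVector_eq D] at h4
      rw [h4, map_smul, smul_eq_mul] at h3
      have h6 : (V.chr D e (IntRep.qvec α.1) : K) = 1 :=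
        mul_right_cancel₀ hα (h3.trans (one_mul _).symm)
      exact Units.ext h6
    · intro δ hδ
      rw [hUφ] at hmem
      -- The selected value at the base point is unchanged and also multiplied by a character; being
      -- nonzero, it forces the character to be 1.
      have h3 := V.ell_mul_stab D hΦ h11 hu₀ hmem.2 (hg₁ δ)
      rw [mul_inv_cancel_left, V.ell_conj D hΦ h11 he hst hu₀] at h3
      have h6 : (((V.chr D e (IntRep.qvec δ.1))⁻¹ : Kˣ) : K) = 1 :=
        mul_right_cancel₀ (hne₀ δ hδ) (h3.trans (one_mul _).symm)
      exact inv_eq_one.1 (Units.ext h6)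

end ChevalleyModule
end ToricPairs

/-! ### Verification of `StdData` for the classical Lie algebras. -/

namespace ToricPairs
open Matrix

attribute [local instance 100] LieRing.ofAssociativeRing

section Singles

variable {I R : Type*} [DecidableEq I]

theorem single_mul_single_ite [Fintype I] [CommRing R] (i j k l : I) (c d : R) :
    (Matrix.single i j c : Matrix I I R) * Matrix.single k l d =
      if j = k then Matrix.single i l (c * d) else 0 := by
  split_ifs with h
  · subst h; exact Matrix.single_mul_single_same ..
  · exact Matrix.single_mul_single_of_ne _ _ _ _ h _

theorem trace_single_ite [Fintype I] [CommRing R] (i j : I) (c : R) :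
    (Matrix.single i j c : Matrix I I R).trace = if i = j then c else 0 := by
  split_ifs with h
  · subst h; exact Matrix.trace_single_eq_same ..
  · exact Matrix.trace_single_eq_of_ne _ _ _ h

theorem isDiag_eq_diagonal {A : Matrix I I ℚ} (h : A.IsDiag) :
    A = Matrix.diagonal fun i => A i i := h.diagonal_diag.symm

end Singles

/-! ### Vectors of roots -/

namespace Root

variable {r : ℕ}

/-- Two labels of the same vector. -/
def Same : Root r → Root r → Prop
  | .sub a b, .sub i j => (a = i ∧ b = j) ∨ (a = b ∧ i = j)
  | .add a b, .add i j => (a = i ∧ b = j) ∨ (a = j ∧ b = i)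
  | .negAdd a b, .negAdd i j => (a = i ∧ b = j) ∨ (a = j ∧ b = i)
  | .pos a, .pos i => a = i
  | .neg a, .neg i => a = i
  | _, _ => False

/-- The sum of the coordinates of a root. -/
def total : Root r → ℤ
  | .sub _ _ => 0
  | .add _ _ => 2
  | .negAdd _ _ => -2
  | .pos _ => 1
  | .neg _ => -1

theorem sum_vec (α : Root r) : ∑ c, α.vec c = α.total := by
  cases α <;> simp [vec, total, Finset.sum_add_distrib, Finset.sum_sub_distrib]

theorem vec_sub_eq {a b i j : Fin r} (h : (Root.sub a b).vec = (Root.sub i j).vec) :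
    (a = i ∧ b = j) ∨ (a = b ∧ i = j) := by
  have h1 := congrFun h i
  have h2 := congrFun h j
  have h3 := congrFun h a
  simp only [vec, Pi.sub_apply, Pi.single_apply] at h1 h2 h3
  grind

theorem vec_add_eq {a b i j : Fin r} (h : (Root.add a b).vec = (Root.add i j).vec) :
    (a = i ∧ b = j) ∨ (a = j ∧ b = i) := by
  have h1 := congrFun h i
  have h2 := congrFun h j
  have h3 := congrFun h a
  simp only [vec, Pi.add_apply, Pi.single_apply] at h1 h2 h3
  grind

theorem vec_pos_eq {a i : Fin r} (h : (Root.pos a).vec = (Root.pos i).vec) : a = i := by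
  have h1 := congrFun h i
  simp only [vec, Pi.single_apply] at h1
  grind

/-- The sum of the coordinates separates the five shapes of labels, leaving a comparison within one
shape. -/
theorem vec_eq_iff (α β : Root r) : α.vec = β.vec ↔ α.Same β := by
  constructor
  · intro h
    have ht : α.total = β.total := by rw [← sum_vec, ← sum_vec, h]
    cases α <;> cases β <;> simp only [total] at ht <;> try omega
    · exact vec_sub_eq h
    · exact vec_add_eq h
    · refine vec_add_eq ?_
      rw [← neg_inj, ← vec_opp, ← vec_opp]
      exact h
    · exact vec_pos_eq h
    · refine vec_pos_eq ?_
      rw [← neg_inj, ← vec_opp, ← vec_opp]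
      exact h
  · cases α <;> cases β <;> simp only [Same, vec, false_imp_iff] <;> intro h
    · rcases h with ⟨rfl, rfl⟩ | ⟨rfl, rfl⟩ <;> simp
    · rcases h with ⟨rfl, rfl⟩ | ⟨rfl, rfl⟩
      · rfl
      · exact add_comm _ _
    · rcases h with ⟨rfl, rfl⟩ | ⟨rfl, rfl⟩
      · rfl
      · abel
    · rw [h]
    · rw [h]

theorem dot_vec (w : Fin r → ℤ) (α : Root r) : w ⬝ᵥ α.vec = match α with
    | .sub i j => w i - w j
    | .add i j => w i + w j
    | .negAdd i j => -w i - w j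
    | .pos i => w i
    | .neg i => -w i := by
  cases α <;> simp [vec, dotProduct, mul_sub, mul_add, Pi.single_apply, Finset.sum_add_distrib,
    Finset.sum_sub_distrib]

theorem half_dot {w : Fin r → ℤ} {α : Root r} {k : ℤ} (h : w ⬝ᵥ α.vec = 2 * k) :
    (∑ i, w i * α.vec i) / 2 = k := by
  rw [dotProduct] at h
  rw [h, Int.mul_ediv_cancel_left _ two_ne_zero]

end Root

/-! ### Type A -/

/-- The integral root matrices of type `A`. -/
def intVecA {r : ℕ} : Root r → Matrix (Fin r) (Fin r) ℤ
  | .sub i j => Matrix.single i j 1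
  | _ => 0

section A

variable {r : ℕ} {α : Root r}

theorem IsRootA.exists_eq (h : IsRootA α) : ∃ i j, i ≠ j ∧ α = .sub i j := by
  cases α with
  | sub i j => exact ⟨i, j, h, rfl⟩
  | _ => exact h.elim

/-- The weights of the defining representation in type `A`. -/
def wtA {r : ℕ} (i : Fin r) : Fin r → ℤ := Pi.single i 1

theorem wtA_sub (i j : Fin r) : wtA i - wtA j = (Root.sub i j).vec := rfl

theorem wtA_injective : Function.Injective (wtA (r := r)) := by
  intro i j h
  exact Root.vec_pos_eq h

theorem map_intVecA (h : IsRootA α) : (intVecA α).map (Int.cast : ℤ → ℚ) = rootVecA α := by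
  obtain ⟨i, j, -, rfl⟩ := h.exists_eq
  ext k l
  simp [intVecA, rootVecA, Matrix.single_apply]

theorem intVecA_ne_zero (h : IsRootA α) (i j : Fin r) :
    intVecA α i j ≠ 0 ↔ wtA i - wtA j = α.vec := by
  obtain ⟨a, b, hab, rfl⟩ := h.exists_eq
  rw [wtA_sub, Root.vec_eq_iff, Root.Same, intVecA, Matrix.single_apply]
  grind

theorem natAbs_intVecA (h : IsRootA α) (i j : Fin r) : (intVecA α i j).natAbs ≤ 2 := by
  obtain ⟨a, b, hab, rfl⟩ := h.exists_eq
  rw [intVecA, Matrix.single_apply]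
  split_ifs <;> simp

theorem exists_unit_intVecA (h : IsRootA α) : ∃ i j, (intVecA α i j).natAbs = 1 := by
  obtain ⟨a, b, hab, rfl⟩ := h.exists_eq
  exact ⟨a, b, by simp [intVecA]⟩

theorem intVecA_sq (h : IsRootA α) : intVecA α * intVecA α = (2 : ℤ) • (0 : Matrix (Fin r) (Fin r) ℤ) := by
  obtain ⟨i, j, hij, rfl⟩ := h.exists_eq
  rw [intVecA, single_mul_single_ite, if_neg hij.symm, smul_zero]

/-- A nonzero difference of two standard vectors determines both of them, so a matrix of nonzero
weight has a single entry. -/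
theorem weight_space_A (A : Matrix (Fin r) (Fin r) ℚ) {v : Fin r → ℤ} (hv : v ≠ 0)
    (h : ∀ i j, A i j ≠ 0 → wtA i - wtA j = v) :
    A = 0 ∨ ∃ α : Root r, IsRootA α ∧ α.vec = v ∧ ∃ c : ℚ, A = c • rootVecA α := by
  by_cases hA : A = 0
  · exact Or.inl hA
  obtain ⟨i, j, hij⟩ : ∃ i j, A i j ≠ 0 := by
    by_contra! h0; exact hA (by ext i j; exact h0 i j)
  have h1 := h i j hij
  have hne : i ≠ j := by
    rintro rfl; exact hv (by rw [← h1, sub_self])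
  refine Or.inr ⟨.sub i j, hne, h1, A i j, ?_⟩
  ext k l
  rw [rootVecA, Matrix.smul_apply, Matrix.single_apply]
  by_cases hkl : A k l = 0
  · rw [hkl]
    split_ifs with h2
    · rw [h2.1, h2.2, hkl, zero_smul]
    · rw [smul_zero]
  · have h3 := (h k l hkl).trans h1.symm
    rw [wtA_sub, wtA_sub, Root.vec_eq_iff, Root.Same] at h3
    have h4 : k = i ∧ l = j := by grind
    obtain ⟨rfl, rfl⟩ := h4
    simp

theorem norm_A (h : IsRootA α) : α.vec ⬝ᵥ α.vec = 2 := by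
  obtain ⟨i, j, hij, rfl⟩ := h.exists_eq
  rw [Root.dot_vec]
  simp [Root.vec, hij, hij.symm]

theorem vec_inj_A (h : IsRootA α) {β : Root r} (h' : IsRootA β) (e : α.vec = β.vec) : α = β := by
  obtain ⟨i, j, hij, rfl⟩ := h.exists_eq
  obtain ⟨k, l, hkl, rfl⟩ := h'.exists_eq
  rw [Root.vec_eq_iff, Root.Same] at e
  grind

theorem IsRootA.opp (h : IsRootA α) : IsRootA α.opp := by
  obtain ⟨i, j, hij, rfl⟩ := h.exists_eq
  exact hij.symm

/-- The sum of the positive coroots in type `A`. -/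
def rhoA (n : ℕ) (i : Fin (n + 1)) : ℤ := (n : ℤ) - 2 * (i : ℕ)

theorem rhoA_dot {n : ℕ} (i j : Fin (n + 1)) :
    rhoA n ⬝ᵥ (Root.sub i j).vec = 2 * ((j : ℤ) - (i : ℕ)) := by
  rw [Root.dot_vec]; simp only [rhoA]; ring

theorem two_mul_ht_A {n : ℕ} {α : Root (n + 1)} (h : IsRootA α) :
    2 * ((∑ k, rhoA n k * α.vec k) / 2) = rhoA n ⬝ᵥ α.vec := by
  obtain ⟨i, j, hij, rfl⟩ := h.exists_eq
  rw [Root.half_dot (rhoA_dot i j), rhoA_dot]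

theorem isPosRootA_iff {n : ℕ} (α : Root (n + 1)) :
    IsPosRootA α ↔ IsRootA α ∧ 0 < (∑ k, rhoA n k * α.vec k) / 2 := by
  constructor
  · intro h
    cases α with
    | sub i j =>
      have h' : i < j := h
      refine ⟨h'.ne, ?_⟩
      rw [Root.half_dot (rhoA_dot i j)]
      omega
    | _ => exact h.elim
  · rintro ⟨h, hp⟩
    obtain ⟨i, j, hij, rfl⟩ := h.exists_eq
    rw [Root.half_dot (rhoA_dot i j)] at hp
    change i < j
    omega

theorem trace_A (h : IsRootA α) : (intVecA α * intVecA α.opp).trace = 1 := by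
  obtain ⟨i, j, hij, rfl⟩ := h.exists_eq
  rw [Root.opp, intVecA, intVecA, single_mul_single_ite, if_pos rfl, trace_single_ite, if_pos rfl,
    mul_one]

theorem sl2_A (h : IsRootA α) : (intVecA α * intVecA α.opp - intVecA α.opp * intVecA α) * intVecA α -
    intVecA α * (intVecA α * intVecA α.opp - intVecA α.opp * intVecA α) = (2 : ℤ) • intVecA α := by
  obtain ⟨i, j, hij, rfl⟩ := h.exists_eq
  simp only [Root.opp, intVecA, sub_mul, mul_sub, single_mul_single_ite, if_true, mul_one,
    hij.symm, if_false]
  module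

theorem diag_span_A (A : Matrix (Fin r) (Fin r) ℚ) (h : A.IsDiag) :
    A = ∑ a, A a a • Matrix.diagonal fun i : Fin r => (wtA i a : ℚ) + 0 := by
  conv_lhs => rw [isDiag_eq_diagonal h]
  ext i j
  rw [Matrix.sum_apply]
  by_cases hij : i = j
  · subst hij
    simp [wtA, Pi.single_apply]
  · simp [hij]

/-- The shift by -1/(n+1) removes the trace of an elementary diagonal matrix. -/
theorem diag_mem_sl {n : ℕ} (a : Fin (n + 1)) :
    (Matrix.diagonal fun i : Fin (n + 1) => (wtA i a : ℚ) + -(n + 1 : ℚ)⁻¹) ∈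
      LieAlgebra.SpecialLinear.sl (Fin (n + 1)) ℚ := by
  refine LinearMap.mem_ker.2 ?_
  have h : ((n : ℚ) + 1) ≠ 0 := by positivity
  simp [Matrix.trace_diagonal, Finset.sum_add_distrib, wtA, Pi.single_apply, h]

theorem diag_span_sl {n : ℕ} (A : Matrix (Fin (n + 1)) (Fin (n + 1)) ℚ)
    (hA : A ∈ LieAlgebra.SpecialLinear.sl (Fin (n + 1)) ℚ) (h : A.IsDiag) :
    A = ∑ a, A a a • Matrix.diagonal fun i : Fin (n + 1) => (wtA i a : ℚ) + -(n + 1 : ℚ)⁻¹ := by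
  have h0 : ∑ a, A a a = 0 := LinearMap.mem_ker.1 hA
  conv_lhs => rw [isDiag_eq_diagonal h]
  ext i j
  rw [Matrix.sum_apply]
  by_cases hij : i = j
  · subst hij
    simp [wtA, Pi.single_apply, mul_add, Finset.sum_add_distrib, ← Finset.sum_mul, h0]
  · simp [hij]

end A

/-- The defining representation of `𝔤𝔩_{n+1}`. -/
def stdGL (n : ℕ) : StdData (lieGL n) where
  wt := wtA (r := n + 1)
  wt_inj := wtA_injective
  X := intVecA
  map_X _ h := map_intVecA h
  supp _ h := intVecA_ne_zero h
  natAbs_le _ h := natAbs_intVecA h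
  unit_entry _ h := exists_unit_intVecA h
  S _ := 0
  sq _ h := intVecA_sq h
  cube _ _ := mul_zero _
  weight_space A _ _ hv h := weight_space_A A hv h
  H a := Matrix.diagonal fun i : Fin (n + 1) => (wtA i a : ℚ) + 0
  H_mem _ := trivial
  H_apply _ := ⟨0, rfl⟩
  H_span A _ h := ⟨_, diag_span_A A h⟩
  norm := Or.inr fun _ h => Or.inl (norm_A h)
  vec_inj _ h _ h' := vec_inj_A h h'
  opp_mem _ h := IsRootA.opp h
  two_mul_ht _ h := two_mul_ht_A h
  mem_pos α := isPosRootA_iff α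
  trace_ne _ h := Or.inl (trace_A h)
  sl2 _ h := sl2_A h

/-- The defining representation of `𝔰𝔩_{n+1}`. -/
def stdA (n : ℕ) : StdData (lieA n) where
  wt := wtA (r := n + 1)
  wt_inj := wtA_injective
  X := intVecA
  map_X _ h := map_intVecA h
  supp _ h := intVecA_ne_zero h
  natAbs_le _ h := natAbs_intVecA h
  unit_entry _ h := exists_unit_intVecA h
  S _ := 0
  sq _ h := intVecA_sq h
  cube _ _ := mul_zero _
  weight_space A _ _ hv h := weight_space_A A hv h
  H a := Matrix.diagonal fun i : Fin (n + 1) => (wtA i a : ℚ) + -(n + 1 : ℚ)⁻¹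
  H_mem := diag_mem_sl
  H_apply _ := ⟨_, rfl⟩
  H_span A hA h := ⟨_, diag_span_sl A hA h⟩
  norm := Or.inr fun _ h => Or.inl (norm_A h)
  vec_inj _ h _ h' := vec_inj_A h h'
  opp_mem _ h := IsRootA.opp h
  two_mul_ht _ h := two_mul_ht_A h
  mem_pos α := isPosRootA_iff α
  trace_ne _ h := Or.inl (trace_A h)
  sl2 _ h := sl2_A h

end ToricPairs

namespace ToricPairs
open Matrix

attribute [local instance 100] LieRing.ofAssociativeRing

/-! ### Orthogonal and symplectic Lie algebras -/

section Skew

variable {I : Type*} [Fintype I] [DecidableEq I] {J : Matrix I I ℚ} {bar : I → I} {c : I → ℚ}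
  (hbar : ∀ i, bar (bar i) = i) (hJ : ∀ i j, J i j = if j = bar i then c i else 0)
include hbar hJ

theorem transpose_mul_apply (A : Matrix I I ℚ) (i j : I) :
    (Aᵀ * J) i j = A (bar j) i * c (bar j) := by
  rw [Matrix.mul_apply, Finset.sum_eq_single (bar j)]
  · rw [hJ, if_pos (hbar j).symm, Matrix.transpose_apply]
  · intro k _ hk
    rw [hJ, if_neg, mul_zero]
    rintro rfl
    exact hk (hbar k).symm
  · simp

omit hbar in
theorem mul_apply_bar (A : Matrix I I ℚ) (i j : I) : (J * A) i j = c i * A (bar i) j := by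
  rw [Matrix.mul_apply, Finset.sum_eq_single (bar i)]
  · rw [hJ, if_pos rfl]
  · intro k _ hk
    rw [hJ, if_neg hk, zero_mul]
  · simp

/-- A form with one nonzero entry per row, at (i, bar i), turns skew-adjointness into a relation
between the entries at (i, j) and (bar j, bar i). -/
theorem skew_apply {A : Matrix I I ℚ} (hA : A ∈ skewAdjointMatricesLieSubalgebra J) (i j : I) :
    A (bar j) (bar i) * c (bar j) = -(c (bar i) * A i j) := by
  rw [mem_skewAdjointMatricesLieSubalgebra, mem_skewAdjointMatricesSubmodule,
    Matrix.IsSkewAdjoint, Matrix.IsAdjointPair] at hA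
  have h := congrFun (congrFun hA (bar i)) j
  rw [transpose_mul_apply hbar hJ, mul_neg, Matrix.neg_apply, mul_apply_bar hJ, hbar] at h
  exact h

theorem diagonal_mem_skew {w : I → ℚ} (hw : ∀ i, w (bar i) = -w i) :
    Matrix.diagonal w ∈ skewAdjointMatricesLieSubalgebra J := by
  rw [mem_skewAdjointMatricesLieSubalgebra, mem_skewAdjointMatricesSubmodule,
    Matrix.IsSkewAdjoint, Matrix.IsAdjointPair]
  ext i j
  rw [transpose_mul_apply hbar hJ, mul_neg, Matrix.neg_apply, mul_apply_bar hJ,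
    Matrix.diagonal_apply, Matrix.diagonal_apply]
  by_cases h : j = bar i
  · subst h
    rw [if_pos (hbar i), if_pos rfl, hbar, hw]; ring
  · rw [if_neg (Ne.symm h), if_neg, zero_mul, mul_zero, neg_zero]
    rintro rfl
    exact h (hbar j).symm

/-- The diagonal entries at i and bar i are opposite, so those at the weights χ_a determine the
rest; an index fixed by bar has entry 0 and weight 0. -/
theorem diag_span_skew (hc : ∀ i, c i ≠ 0)
    {r : ℕ} {wt : I → Fin r → ℤ} (hwt : ∀ i, wt (bar i) = -wt i) {ι : Fin r → I}
    (hι : ∀ a, wt (ι a) = Pi.single a 1)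
    (hI : ∀ i, bar i = i ∨ (∃ a, i = ι a) ∨ ∃ a, i = bar (ι a))
    {A : Matrix I I ℚ} (hA : A ∈ skewAdjointMatricesLieSubalgebra J) (hd : A.IsDiag) :
    A = ∑ a, A (ι a) (ι a) • Matrix.diagonal fun i : I => (wt i a : ℚ) + 0 := by
  have hneg : ∀ i, A (bar i) (bar i) = -A i i := by
    intro i
    have h := skew_apply hbar hJ hA i i
    have h1 := hc (bar i)
    refine mul_right_cancel₀ h1 ?_
    rw [h]; ring
  conv_lhs => rw [isDiag_eq_diagonal hd]
  ext i j
  rw [Matrix.sum_apply]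
  by_cases hij : i = j
  · subst hij
    simp only [Matrix.smul_apply, Matrix.diagonal_apply_eq, smul_eq_mul, add_zero]
    rcases hI i with h | ⟨a, rfl⟩ | ⟨a, rfl⟩
    · have h1 := hneg i
      rw [h] at h1
      have h2 := hwt i
      rw [h] at h2
      have h3 : ∀ a, wt i a = 0 := fun a => by
        have := congrFun h2 a
        rw [Pi.neg_apply] at this
        omega
      simp only [h3, Int.cast_zero, mul_zero, Finset.sum_const_zero]
      linarith
    · rw [hι]; simp [Pi.single_apply]
    · rw [hneg, hwt, hι]; simp [Pi.single_apply]
  · simp [hij]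

/-- A nonzero weight occurs only at a position (i, j) and its mirror (bar j, bar i), and skewness
ties the two entries. The weight space is thus a line, spanned by the root matrix. -/
theorem weight_space_skew (hc : ∀ i, c i ≠ 0) {r : ℕ} {wt : I → Fin r → ℤ} {roots : Set (Root r)}
    {X : Root r → Matrix I I ℚ} (hX : ∀ α ∈ roots, X α ∈ skewAdjointMatricesLieSubalgebra J)
    (supp : ∀ α ∈ roots, ∀ i j, X α i j ≠ 0 ↔ wt i - wt j = α.vec)
    (hpair : ∀ i j k l, wt i ≠ wt j → wt k - wt l = wt i - wt j →
      (k = i ∧ l = j) ∨ (k = bar j ∧ l = bar i))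
    (hroot : ∀ A ∈ skewAdjointMatricesLieSubalgebra J, ∀ i j, A i j ≠ 0 → wt i ≠ wt j →
      ∃ α ∈ roots, α.vec = wt i - wt j)
    {A : Matrix I I ℚ} (hA : A ∈ skewAdjointMatricesLieSubalgebra J) {v : Fin r → ℤ} (hv : v ≠ 0)
    (h : ∀ i j, A i j ≠ 0 → wt i - wt j = v) :
    A = 0 ∨ ∃ α ∈ roots, α.vec = v ∧ ∃ c : ℚ, A = c • X α := by
  by_cases hA0 : A = 0
  · exact Or.inl hA0
  obtain ⟨i, j, hij⟩ : ∃ i j, A i j ≠ 0 := by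
    by_contra! h0; exact hA0 (by ext i j; exact h0 i j)
  have h1 := h i j hij
  have hne : wt i ≠ wt j := fun e => hv (by rw [← h1, e, sub_self])
  obtain ⟨α, hα, hαv⟩ := hroot A hA i j hij hne
  have hXij : X α i j ≠ 0 := (supp α hα i j).2 hαv.symm
  refine Or.inr ⟨α, hα, hαv.trans h1, A i j / X α i j, ?_⟩
  ext k l
  rw [Matrix.smul_apply, smul_eq_mul]
  by_cases hkl : wt k - wt l = v
  · rcases hpair i j k l hne (hkl.trans h1.symm) with ⟨rfl, rfl⟩ | ⟨rfl, rfl⟩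
    · rw [div_mul_cancel₀ _ hXij]
    · have e1 := skew_apply hbar hJ hA i j
      have e2 := skew_apply hbar hJ (hX α hα) i j
      refine mul_right_cancel₀ (hc (bar j)) ?_
      rw [e1, mul_assoc, e2]
      field_simp
  · have e1 : A k l = 0 := by by_contra h0; exact hkl (h k l h0)
    have e2 : X α k l = 0 := by
      by_contra h0
      exact hkl (((supp α hα k l).1 h0).trans (hαv.trans h1))
    rw [e1, e2, mul_zero]

end Skew

/-! ### Type D -/

/-- The weights of the defining representation in types `C` and `D`. -/
def wtD {n : ℕ} : Fin n ⊕ Fin n → Fin n → ℤ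
  | .inl i => Pi.single i 1
  | .inr i => -Pi.single i 1

/-- The opposite index. -/
def barD {n : ℕ} : Fin n ⊕ Fin n → Fin n ⊕ Fin n
  | .inl i => .inr i
  | .inr i => .inl i

/-- The label of the difference of two weights. -/
def labD {n : ℕ} : Fin n ⊕ Fin n → Fin n ⊕ Fin n → Root n
  | .inl i, .inl j => .sub i j
  | .inl i, .inr j => .add i j
  | .inr i, .inl j => .negAdd i j
  | .inr i, .inr j => .sub j i

/-- The integral root matrices of type `D`. -/
def intVecD {n : ℕ} : Root n → Matrix (Fin n ⊕ Fin n) (Fin n ⊕ Fin n) ℤ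
  | .sub i j => Matrix.single (.inl i) (.inl j) 1 - Matrix.single (.inr j) (.inr i) 1
  | .add i j => Matrix.single (.inl i) (.inr j) 1 - Matrix.single (.inl j) (.inr i) 1
  | .negAdd i j => Matrix.single (.inr j) (.inl i) 1 - Matrix.single (.inr i) (.inl j) 1
  | _ => 0

section CD

variable {n : ℕ}

theorem barD_barD (i : Fin n ⊕ Fin n) : barD (barD i) = i := by cases i <;> rfl

theorem wtD_bar (i : Fin n ⊕ Fin n) : wtD (barD i) = -wtD i := by cases i <;> simp [wtD, barD]

theorem wtD_bar_cast (a : Fin n) (i : Fin n ⊕ Fin n) :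
    (wtD (barD i) a : ℚ) + 0 = -((wtD i a : ℚ) + 0) := by
  rw [wtD_bar, Pi.neg_apply, Int.cast_neg, add_zero, add_zero]

theorem wtD_sub (i j : Fin n ⊕ Fin n) : wtD i - wtD j = (labD i j).vec := by
  cases i <;> cases j <;> simp [wtD, labD, Root.vec]; abel

theorem wtD_injective : Function.Injective (wtD (n := n)) := by
  intro i j h
  have h1 : wtD i - wtD j = 0 := by rw [h, sub_self]
  have h2 : (labD i j).vec = (labD i i).vec := by rw [← wtD_sub, ← wtD_sub, h1, sub_self]
  rw [Root.vec_eq_iff] at h2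
  cases i <;> cases j <;> simp only [labD, Root.Same] at h2 <;> grind

theorem pair_D (i j k l : Fin n ⊕ Fin n) (hne : wtD i ≠ wtD j)
    (h : wtD k - wtD l = wtD i - wtD j) : (k = i ∧ l = j) ∨ (k = barD j ∧ l = barD i) := by
  have hne' : i ≠ j := fun e => hne (by rw [e])
  rw [wtD_sub, wtD_sub, Root.vec_eq_iff] at h
  cases i <;> cases j <;> cases k <;> cases l <;>
    simp only [labD, Root.Same, barD, Sum.inl.injEq, Sum.inr.injEq, reduceCtorEq] at h hne' ⊢ <;> grind

theorem diag_cases_D (i : Fin n ⊕ Fin n) :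
    barD i = i ∨ (∃ a, i = .inl a) ∨ ∃ a : Fin n, i = barD (.inl a) := by
  cases i <;> simp [barD]

end CD

section D

variable {n : ℕ} {α : Root n}

theorem map_intVecD (α : Root n) : (intVecD α).map (Int.cast : ℤ → ℚ) = rootVecD α := by
  ext k l
  cases α <;> simp [intVecD, rootVecD, Matrix.single_apply]

theorem intVecD_ne_zero (h : IsRootD α) (i j : Fin n ⊕ Fin n) :
    intVecD α i j ≠ 0 ↔ wtD i - wtD j = α.vec := by
  rw [wtD_sub, Root.vec_eq_iff]
  cases α <;> cases i <;> cases j <;>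
    simp only [IsRootD, intVecD, labD, Root.Same, Matrix.sub_apply, Matrix.single_apply,
      Sum.inl.injEq, Sum.inr.injEq, reduceCtorEq, false_and, and_false, if_false] at h ⊢ <;> grind

theorem rootVecD_ne_zero (h : IsRootD α) (i j : Fin n ⊕ Fin n) :
    rootVecD α i j ≠ 0 ↔ wtD i - wtD j = α.vec := by
  rw [← intVecD_ne_zero h i j, ← map_intVecD, Matrix.map_apply, Int.cast_ne_zero]

theorem natAbs_intVecD (α : Root n) (i j : Fin n ⊕ Fin n) : (intVecD α i j).natAbs ≤ 2 := by
  cases α <;> simp only [intVecD, Matrix.sub_apply, Matrix.single_apply] <;>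
    (try split_ifs) <;> simp

theorem exists_unit_intVecD (h : IsRootD α) : ∃ i j, (intVecD α i j).natAbs = 1 := by
  cases α with
  | sub i j => exact ⟨.inl i, .inl j, by simp [intVecD]⟩
  | add i j =>
    refine ⟨.inl i, .inr j, ?_⟩
    have h' : i < j := h
    simp [intVecD, h'.ne']
  | negAdd i j =>
    refine ⟨.inr j, .inl i, ?_⟩
    have h' : i < j := h
    simp [intVecD, h'.ne]
  | _ => exact h.elim

theorem intVecD_sq (h : IsRootD α) : intVecD α * intVecD α = (2 : ℤ) • (0 : Matrix (Fin n ⊕ Fin n) (Fin n ⊕ Fin n) ℤ) := by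
  cases α with
  | sub i j =>
    have h' : i ≠ j := h
    simp [intVecD, sub_mul, mul_sub, h', h'.symm]
  | add i j => simp [intVecD, sub_mul, mul_sub]
  | negAdd i j => simp [intVecD, sub_mul, mul_sub]
  | _ => exact h.elim

theorem norm_D (h : IsRootD α) : α.vec ⬝ᵥ α.vec = 2 := by
  rw [Root.dot_vec]
  cases α with
  | sub i j =>
    have h' : i ≠ j := h
    simp [Root.vec, h', h'.symm]
  | add i j =>
    have h' : i < j := h
    simp [Root.vec, h'.ne, h'.ne']
  | negAdd i j =>
    have h' : i < j := h
    simp [Root.vec, h'.ne, h'.ne']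
  | _ => exact h.elim

theorem vec_inj_D (h : IsRootD α) {β : Root n} (h' : IsRootD β) (e : α.vec = β.vec) : α = β := by
  rw [Root.vec_eq_iff] at e
  cases α <;> cases β <;> simp only [IsRootD, Root.Same] at h h' e <;> grind

theorem IsRootD.opp (h : IsRootD α) : IsRootD α.opp := by
  cases α <;> simp only [IsRootD, Root.opp] at h ⊢ <;> grind

/-- The sum of the positive coroots in type `D`. -/
def rhoD (n : ℕ) (i : Fin n) : ℤ := 2 * ((n : ℤ) - 1 - (i : ℕ))

theorem two_mul_ht_D : 2 * ((∑ k, rhoD n k * α.vec k) / 2) = rhoD n ⬝ᵥ α.vec := by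
  have h : ∃ k, rhoD n ⬝ᵥ α.vec = 2 * k := by
    rw [Root.dot_vec]
    cases α <;> simp only [rhoD, ← mul_add, ← mul_sub, ← mul_neg, exists_apply_eq_apply']
  obtain ⟨k, hk⟩ := h
  rw [Root.half_dot hk, hk]

theorem isPosRootD_iff (α : Root n) :
    IsPosRootD α ↔ IsRootD α ∧ 0 < (∑ k, rhoD n k * α.vec k) / 2 := by
  have h := two_mul_ht_D (α := α)
  rw [Root.dot_vec] at h
  generalize (∑ k, rhoD n k * α.vec k) / 2 = x at h ⊢
  cases α with
  | sub i j => simp only [rhoD, IsPosRootD, IsRootD, ne_eq, Fin.ext_iff, Fin.lt_def] at *; omega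
  | add i j => simp only [rhoD, IsPosRootD, IsRootD, Fin.lt_def] at *; omega
  | negAdd i j => simp only [rhoD, IsPosRootD, IsRootD, Fin.lt_def, false_iff, not_and] at *; omega
  | _ => simp [IsPosRootD, IsRootD]

theorem trace_D (h : IsRootD α) : (intVecD α * intVecD α.opp).trace = 2 := by
  cases α with
  | sub i j =>
    have h' : i ≠ j := h
    simp [intVecD, Root.opp, sub_mul, mul_sub]
  | add i j =>
    have h' : i < j := h
    simp [intVecD, Root.opp, sub_mul, mul_sub, h'.ne, h'.ne']
  | negAdd i j =>
    have h' : i < j := h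
    simp [intVecD, Root.opp, sub_mul, mul_sub, h'.ne, h'.ne']
  | _ => exact h.elim

theorem sl2_D (h : IsRootD α) : (intVecD α * intVecD α.opp - intVecD α.opp * intVecD α) * intVecD α -
    intVecD α * (intVecD α * intVecD α.opp - intVecD α.opp * intVecD α) = (2 : ℤ) • intVecD α := by
  cases α with
  | sub i j =>
    have h' : i ≠ j := h
    simp only [intVecD, Root.opp, sub_mul, mul_sub, single_mul_single_ite, h', h'.symm,
      Sum.inl.injEq, Sum.inr.injEq, reduceCtorEq, if_true, if_false, mul_one]
    module
  | add i j =>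
    have h' : i < j := h
    simp only [intVecD, Root.opp, sub_mul, mul_sub, single_mul_single_ite, h'.ne, h'.ne',
      Sum.inl.injEq, Sum.inr.injEq, reduceCtorEq, if_true, if_false, mul_one]
    module
  | negAdd i j =>
    have h' : i < j := h
    simp only [intVecD, Root.opp, sub_mul, mul_sub, single_mul_single_ite, h'.ne, h'.ne',
      Sum.inl.injEq, Sum.inr.injEq, reduceCtorEq, if_true, if_false, mul_one]
    module
  | _ => exact h.elim

theorem JD_apply (i j : Fin n ⊕ Fin n) :
    LieAlgebra.Orthogonal.JD (Fin n) ℚ i j = if j = barD i then 1 else 0 := by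
  cases i <;> cases j <;> simp [LieAlgebra.Orthogonal.JD, barD, Matrix.one_apply, eq_comm]

theorem exists_root_of_ne_bar {i j : Fin n ⊕ Fin n} (h1 : j ≠ barD i) (h2 : i ≠ j) :
    ∃ α ∈ {α : Root n | IsRootD α}, α.vec = wtD i - wtD j := by
  simp only [wtD_sub, Root.vec_eq_iff]
  cases i with
  | inl i => cases j with
    | inl j => exact ⟨.sub i j, fun e => h2 (by rw [e]), Or.inl ⟨rfl, rfl⟩⟩
    | inr j =>
      have h3 : i ≠ j := fun e => h1 (by rw [e]; rfl)
      rcases lt_or_gt_of_ne h3 with h4 | h4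
      · exact ⟨.add i j, h4, Or.inl ⟨rfl, rfl⟩⟩
      · exact ⟨.add j i, h4, Or.inr ⟨rfl, rfl⟩⟩
  | inr i => cases j with
    | inl j =>
      have h3 : i ≠ j := fun e => h1 (by rw [e]; rfl)
      rcases lt_or_gt_of_ne h3 with h4 | h4
      · exact ⟨.negAdd i j, h4, Or.inl ⟨rfl, rfl⟩⟩
      · exact ⟨.negAdd j i, h4, Or.inr ⟨rfl, rfl⟩⟩
    | inr j => exact ⟨.sub j i, fun e => h2 (by rw [e]), Or.inl ⟨rfl, rfl⟩⟩

/-- The entry at (i, bar i) is its own mirror and equals its negative, so the vectors ±2χ_a do not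
occur as weights. -/
theorem exists_root_D {A : Matrix (Fin n ⊕ Fin n) (Fin n ⊕ Fin n) ℚ}
    (hA : A ∈ skewAdjointMatricesLieSubalgebra (LieAlgebra.Orthogonal.JD (Fin n) ℚ))
    {i j : Fin n ⊕ Fin n} (h : A i j ≠ 0) (hne : wtD i ≠ wtD j) :
    ∃ α ∈ {α : Root n | IsRootD α}, α.vec = wtD i - wtD j := by
  refine exists_root_of_ne_bar ?_ fun e => hne (by rw [e])
  rintro rfl
  have := skew_apply barD_barD JD_apply hA i (barD i)
  rw [barD_barD] at this
  apply h
  linarith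

end D

/-- The defining representation of `𝔰𝔬_{2n}`. -/
def stdD (n : ℕ) : StdData (lieD n) where
  wt := wtD (n := n)
  wt_inj := wtD_injective
  X := intVecD
  map_X α _ := map_intVecD α
  supp _ h := intVecD_ne_zero h
  natAbs_le α _ := natAbs_intVecD α
  unit_entry _ h := exists_unit_intVecD h
  S _ := 0
  sq _ h := intVecD_sq h
  cube _ _ := mul_zero _
  weight_space _ hA _ hv h := weight_space_skew barD_barD JD_apply (fun _ => one_ne_zero)
    (lieD n).X_mem (fun _ h => rootVecD_ne_zero h) pair_D
    (fun _ hA _ _ h hne => exists_root_D hA h hne) hA hv h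
  H a := Matrix.diagonal fun i : Fin n ⊕ Fin n => (wtD i a : ℚ) + 0
  H_mem a := diagonal_mem_skew barD_barD JD_apply (wtD_bar_cast a)
  H_apply _ := ⟨0, rfl⟩
  H_span _ hA h := ⟨_, diag_span_skew (ι := Sum.inl) barD_barD JD_apply (fun _ => one_ne_zero)
    wtD_bar (fun _ => rfl) diag_cases_D hA h⟩
  norm := Or.inr fun _ h => Or.inl (norm_D h)
  vec_inj _ h _ h' := vec_inj_D h h'
  opp_mem _ h := IsRootD.opp h
  two_mul_ht _ _ := two_mul_ht_D
  mem_pos α := isPosRootD_iff α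
  trace_ne _ h := Or.inr (Or.inl (trace_D h))
  sl2 _ h := sl2_D h

end ToricPairs

namespace ToricPairs
open Matrix

attribute [local instance 100] LieRing.ofAssociativeRing

/-! ### Type C -/

/-- The integral root matrices of type `C`. -/
def intVecC {n : ℕ} : Root n → Matrix (Fin n ⊕ Fin n) (Fin n ⊕ Fin n) ℤ
  | .sub i j => Matrix.single (.inl i) (.inl j) 1 - Matrix.single (.inr j) (.inr i) 1
  | .add i j => if i = j then Matrix.single (.inl i) (.inr i) 1
      else Matrix.single (.inl i) (.inr j) 1 + Matrix.single (.inl j) (.inr i) 1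
  | .negAdd i j => if i = j then Matrix.single (.inr i) (.inl i) 1
      else Matrix.single (.inr j) (.inl i) 1 + Matrix.single (.inr i) (.inl j) 1
  | _ => 0

/-- The nonzero entries of the symplectic form. -/
def signC {n : ℕ} : Fin n ⊕ Fin n → ℚ
  | .inl _ => -1
  | .inr _ => 1

section C

variable {n : ℕ} {α : Root n}

theorem map_intVecC (α : Root n) : (intVecC α).map (Int.cast : ℤ → ℚ) = rootVecC α := by
  ext k l
  cases α <;> simp only [intVecC, rootVecC] <;> (try split_ifs) <;> simp [Matrix.single_apply]

theorem intVecC_ne_zero (h : IsRootC α) (i j : Fin n ⊕ Fin n) :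
    intVecC α i j ≠ 0 ↔ wtD i - wtD j = α.vec := by
  rw [wtD_sub, Root.vec_eq_iff]
  cases α <;> simp only [intVecC] <;> (try split_ifs) <;> cases i <;> cases j <;>
    simp only [IsRootC, labD, Root.Same, Matrix.sub_apply, Matrix.add_apply,
      Matrix.single_apply,
      Sum.inl.injEq, Sum.inr.injEq, reduceCtorEq, false_and, and_false, if_false] at h ⊢ <;> grind

theorem rootVecC_ne_zero (h : IsRootC α) (i j : Fin n ⊕ Fin n) :
    rootVecC α i j ≠ 0 ↔ wtD i - wtD j = α.vec := by
  rw [← intVecC_ne_zero h i j, ← map_intVecC, Matrix.map_apply, Int.cast_ne_zero]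

theorem natAbs_intVecC (α : Root n) (i j : Fin n ⊕ Fin n) : (intVecC α i j).natAbs ≤ 2 := by
  cases α with
  | sub a b =>
    simp only [intVecC, Matrix.sub_apply, Matrix.single_apply]
    split_ifs <;> simp
  | add a b =>
    rw [intVecC]
    split_ifs <;> simp only [Matrix.add_apply, Matrix.single_apply] <;> split_ifs <;> simp
  | negAdd a b =>
    rw [intVecC]
    split_ifs <;> simp only [Matrix.add_apply, Matrix.single_apply] <;> split_ifs <;> simp
  | _ => exact (by decide : (0 : ℤ).natAbs ≤ 2)

theorem exists_unit_intVecC (h : IsRootC α) : ∃ i j, (intVecC α i j).natAbs = 1 := by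
  cases α with
  | sub i j => exact ⟨.inl i, .inl j, by simp [intVecC]⟩
  | add i j =>
    refine ⟨.inl i, .inr j, ?_⟩
    rw [intVecC]
    split_ifs with h'
    · simp [h']
    · simp [Ne.symm h']
  | negAdd i j =>
    refine ⟨.inr j, .inl i, ?_⟩
    rw [intVecC]
    split_ifs with h'
    · simp [h']
    · simp [h']
  | _ => exact h.elim

theorem intVecC_sq (h : IsRootC α) : intVecC α * intVecC α = (2 : ℤ) • (0 : Matrix (Fin n ⊕ Fin n) (Fin n ⊕ Fin n) ℤ) := by
  cases α with
  | sub i j =>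
    have h' : i ≠ j := h
    simp [intVecC, sub_mul, mul_sub, h', h'.symm]
  | add i j => simp only [intVecC]; split_ifs <;> simp [add_mul, mul_add]
  | negAdd i j => simp only [intVecC]; split_ifs <;> simp [add_mul, mul_add]
  | _ => exact h.elim

theorem norm_C (h : IsRootC α) : α.vec ⬝ᵥ α.vec = 2 ∨ α.vec ⬝ᵥ α.vec = 4 := by
  rw [Root.dot_vec]
  cases α with
  | sub i j =>
    have h' : i ≠ j := h
    simp [Root.vec, h', h'.symm]
  | add i j =>
    by_cases h' : i = j
    · simp [Root.vec, h']
    · simp [Root.vec, h', Ne.symm h']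
  | negAdd i j =>
    by_cases h' : i = j
    · simp [Root.vec, h']
    · simp [Root.vec, h', Ne.symm h']
  | _ => exact h.elim

theorem vec_inj_C (h : IsRootC α) {β : Root n} (h' : IsRootC β) (e : α.vec = β.vec) : α = β := by
  rw [Root.vec_eq_iff] at e
  cases α <;> cases β <;> simp only [IsRootC, Root.Same] at h h' e <;> grind

theorem IsRootC.opp (h : IsRootC α) : IsRootC α.opp := by
  cases α <;> simp only [IsRootC, Root.opp] at h ⊢ <;> grind

/-- The sum of the positive coroots in type `C`. -/
def rhoC (n : ℕ) (i : Fin n) : ℤ := 2 * ((n : ℤ) - (i : ℕ)) - 1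

theorem two_mul_ht_C (h : IsRootC α) : 2 * ((∑ k, rhoC n k * α.vec k) / 2) = rhoC n ⬝ᵥ α.vec := by
  have h : ∃ k, rhoC n ⬝ᵥ α.vec = 2 * k := by
    rw [Root.dot_vec]
    cases α with
    | sub i j => exact ⟨(j : ℤ) - (i : ℕ), by simp only [rhoC]; ring⟩
    | add i j => exact ⟨2 * n - 1 - (j : ℤ) - (i : ℕ), by simp only [rhoC]; ring⟩
    | negAdd i j => exact ⟨-(2 * n - 1 - (j : ℤ) - (i : ℕ)), by simp only [rhoC]; ring⟩
    | _ => exact h.elim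
  obtain ⟨k, hk⟩ := h
  rw [Root.half_dot hk, hk]

theorem isPosRootC_iff (α : Root n) :
    IsPosRootC α ↔ IsRootC α ∧ 0 < (∑ k, rhoC n k * α.vec k) / 2 := by
  by_cases hr : IsRootC α
  · have h := two_mul_ht_C hr
    rw [Root.dot_vec] at h
    generalize (∑ k, rhoC n k * α.vec k) / 2 = x at h ⊢
    cases α with
    | sub i j => simp only [rhoC, IsPosRootC, IsRootC, ne_eq, Fin.ext_iff, Fin.lt_def] at *; omega
    | add i j => simp only [rhoC, IsPosRootC, IsRootC, Fin.le_def] at *; omega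
    | negAdd i j => simp only [rhoC, IsPosRootC, IsRootC, Fin.le_def, false_iff, not_and] at *; omega
    | _ => simp [IsPosRootC, IsRootC]
  · refine iff_of_false (fun h => hr ?_) fun h => hr h.1
    cases α <;> simp only [IsPosRootC, IsRootC] at h ⊢ <;> grind

theorem trace_C (h : IsRootC α) :
    (intVecC α * intVecC α.opp).trace = 1 ∨ (intVecC α * intVecC α.opp).trace = 2 := by
  cases α with
  | sub i j =>
    have h' : i ≠ j := h
    simp [intVecC, Root.opp, sub_mul, mul_sub]
  | add i j =>
    by_cases h' : i = j
    · simp [intVecC, Root.opp, h']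
    · simp [intVecC, Root.opp, add_mul, mul_add, h', Ne.symm h']
  | negAdd i j =>
    by_cases h' : i = j
    · simp [intVecC, Root.opp, h']
    · simp [intVecC, Root.opp, add_mul, mul_add, h', Ne.symm h']
  | _ => exact h.elim

theorem sl2_C (h : IsRootC α) : (intVecC α * intVecC α.opp - intVecC α.opp * intVecC α) * intVecC α -
    intVecC α * (intVecC α * intVecC α.opp - intVecC α.opp * intVecC α) = (2 : ℤ) • intVecC α := by
  cases α with
  | sub i j =>
    have h' : i ≠ j := h
    simp only [intVecC, Root.opp, sub_mul, mul_sub, single_mul_single_ite, h', h'.symm,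
      Sum.inl.injEq, Sum.inr.injEq, reduceCtorEq, if_true, if_false, mul_one]
    module
  | add i j =>
    by_cases h' : i = j
    · simp only [intVecC, Root.opp, sub_mul, mul_sub, single_mul_single_ite, h',
        reduceCtorEq, if_true, if_false, mul_one]
      module
    · simp only [intVecC, Root.opp, sub_mul, mul_sub, add_mul, mul_add, single_mul_single_ite, h',
        Ne.symm h', Sum.inl.injEq, Sum.inr.injEq, reduceCtorEq, if_true, if_false, mul_one]
      module
  | negAdd i j =>
    by_cases h' : i = j
    · simp only [intVecC, Root.opp, sub_mul, mul_sub, single_mul_single_ite, h',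
        reduceCtorEq, if_true, if_false, mul_one]
      module
    · simp only [intVecC, Root.opp, sub_mul, mul_sub, add_mul, mul_add, single_mul_single_ite, h',
        Ne.symm h', Sum.inl.injEq, Sum.inr.injEq, reduceCtorEq, if_true, if_false, mul_one]
      module
  | _ => exact h.elim

theorem J_apply (i j : Fin n ⊕ Fin n) :
    Matrix.J (Fin n) ℚ i j = if j = barD i then signC i else 0 := by
  cases i <;> cases j <;> simp [Matrix.J, barD, signC, Matrix.one_apply, eq_comm]
  split_ifs <;> simp

theorem signC_ne_zero (i : Fin n ⊕ Fin n) : signC i ≠ 0 := by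
  cases i <;> simp [signC]

/-- In contrast with type D, the positions (i, bar i) are allowed and give the long roots ±2χ_a. -/
theorem exists_root_C {i j : Fin n ⊕ Fin n} (hne : wtD i ≠ wtD j) :
    ∃ α ∈ {α : Root n | IsRootC α}, α.vec = wtD i - wtD j := by
  have h2 : i ≠ j := fun e => hne (by rw [e])
  simp only [wtD_sub, Root.vec_eq_iff]
  cases i with
  | inl i => cases j with
    | inl j => exact ⟨.sub i j, fun e => h2 (by rw [e]), Or.inl ⟨rfl, rfl⟩⟩
    | inr j =>
      rcases le_total i j with h4 | h4
      · exact ⟨.add i j, h4, Or.inl ⟨rfl, rfl⟩⟩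
      · exact ⟨.add j i, h4, Or.inr ⟨rfl, rfl⟩⟩
  | inr i => cases j with
    | inl j =>
      rcases le_total i j with h4 | h4
      · exact ⟨.negAdd i j, h4, Or.inl ⟨rfl, rfl⟩⟩
      · exact ⟨.negAdd j i, h4, Or.inr ⟨rfl, rfl⟩⟩
    | inr j => exact ⟨.sub j i, fun e => h2 (by rw [e]), Or.inl ⟨rfl, rfl⟩⟩

end C

/-- The defining representation of `𝔰𝔭_{2n}`. -/
def stdC (n : ℕ) : StdData (lieC n) where
  wt := wtD (n := n)
  wt_inj := wtD_injective
  X := intVecC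
  map_X α _ := map_intVecC α
  supp _ h := intVecC_ne_zero h
  natAbs_le α _ := natAbs_intVecC α
  unit_entry _ h := exists_unit_intVecC h
  S _ := 0
  sq _ h := intVecC_sq h
  cube _ _ := mul_zero _
  weight_space _ hA _ hv h := weight_space_skew barD_barD J_apply signC_ne_zero
    (lieC n).X_mem (fun _ h => rootVecC_ne_zero h) pair_D
    (fun _ _ _ _ _ hne => exists_root_C hne) hA hv h
  H a := Matrix.diagonal fun i : Fin n ⊕ Fin n => (wtD i a : ℚ) + 0
  H_mem a := diagonal_mem_skew barD_barD J_apply (wtD_bar_cast a)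
  H_apply _ := ⟨0, rfl⟩
  H_span _ hA h := ⟨_, diag_span_skew (ι := Sum.inl) barD_barD J_apply signC_ne_zero
    wtD_bar (fun _ => rfl) diag_cases_D hA h⟩
  norm := Or.inr fun _ h => norm_C h
  vec_inj _ h _ h' := vec_inj_C h h'
  opp_mem _ h := IsRootC.opp h
  two_mul_ht _ h := two_mul_ht_C h
  mem_pos α := isPosRootC_iff α
  trace_ne _ h := (trace_C h).imp_right Or.inl
  sl2 _ h := sl2_C h

end ToricPairs

namespace ToricPairs
open Matrix

attribute [local instance 100] LieRing.ofAssociativeRing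

/-! ### Type B -/

/-- The weights of the defining representation in type `B`. -/
def wtB {n : ℕ} : Unit ⊕ (Fin n ⊕ Fin n) → Fin n → ℤ
  | .inl _ => 0
  | .inr i => wtD i

/-- The opposite index. -/
def barB {n : ℕ} : Unit ⊕ (Fin n ⊕ Fin n) → Unit ⊕ (Fin n ⊕ Fin n)
  | .inl _ => .inl ()
  | .inr i => .inr (barD i)

/-- The label of the difference of two weights. -/
def labB {n : ℕ} (z : Fin n) : Unit ⊕ (Fin n ⊕ Fin n) → Unit ⊕ (Fin n ⊕ Fin n) → Root n
  | .inl _, .inl _ => .sub z z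
  | .inr (.inl i), .inl _ => .pos i
  | .inr (.inr i), .inl _ => .neg i
  | .inl _, .inr (.inl i) => .neg i
  | .inl _, .inr (.inr i) => .pos i
  | .inr i, .inr j => labD i j

/-- The integral root matrices of type `B`. -/
def intVecB {n : ℕ} : Root n → Matrix (Unit ⊕ (Fin n ⊕ Fin n)) (Unit ⊕ (Fin n ⊕ Fin n)) ℤ
  | .sub i j => Matrix.single (.inr (.inl i)) (.inr (.inl j)) 1
      - Matrix.single (.inr (.inr j)) (.inr (.inr i)) 1
  | .add i j => Matrix.single (.inr (.inl i)) (.inr (.inr j)) 1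
      - Matrix.single (.inr (.inl j)) (.inr (.inr i)) 1
  | .negAdd i j => Matrix.single (.inr (.inr j)) (.inr (.inl i)) 1
      - Matrix.single (.inr (.inr i)) (.inr (.inl j)) 1
  | .pos i => Matrix.single (.inr (.inl i)) (.inl ()) 2
      - Matrix.single (.inl ()) (.inr (.inr i)) 1
  | .neg i => Matrix.single (.inl ()) (.inr (.inl i)) 1
      - Matrix.single (.inr (.inr i)) (.inl ()) 2

/-- The divided squares of the integral root matrices of type `B`. -/
def sqVecB {n : ℕ} : Root n → Matrix (Unit ⊕ (Fin n ⊕ Fin n)) (Unit ⊕ (Fin n ⊕ Fin n)) ℤ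
  | .pos i => -Matrix.single (.inr (.inl i)) (.inr (.inr i)) 1
  | .neg i => -Matrix.single (.inr (.inr i)) (.inr (.inl i)) 1
  | _ => 0

/-- The nonzero entries of the quadratic form. -/
def coeffB {n : ℕ} : Unit ⊕ (Fin n ⊕ Fin n) → ℚ
  | .inl _ => 2
  | .inr _ => 1

section B

variable {n : ℕ} {α : Root n}

theorem barB_barB (i : Unit ⊕ (Fin n ⊕ Fin n)) : barB (barB i) = i := by
  rcases i with _ | _ | _ <;> rfl

theorem wtB_bar (i : Unit ⊕ (Fin n ⊕ Fin n)) : wtB (barB i) = -wtB i := by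
  rcases i with _ | i
  · simp [wtB, barB]
  · exact wtD_bar i

theorem wtB_bar_cast (a : Fin n) (i : Unit ⊕ (Fin n ⊕ Fin n)) :
    (wtB (barB i) a : ℚ) + 0 = -((wtB i a : ℚ) + 0) := by
  rw [wtB_bar, Pi.neg_apply, Int.cast_neg, add_zero, add_zero]

theorem wtB_sub (z : Fin n) (i j : Unit ⊕ (Fin n ⊕ Fin n)) : wtB i - wtB j = (labB z i j).vec := by
  rcases i with _ | i <;> rcases j with _ | j
  · simp [wtB, labB, Root.vec]
  · cases j <;> simp [wtB, wtD, labB, Root.vec]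
  · cases i <;> simp [wtB, wtD, labB, Root.vec]
  · rw [labB, ← wtD_sub]; rfl

theorem wtD_ne_zero (i : Fin n ⊕ Fin n) : wtD i ≠ 0 := by
  intro h
  cases i with
  | inl i => have := congrFun h i; simp [wtD] at this
  | inr i => have := congrFun h i; simp [wtD] at this

theorem wtB_injective : Function.Injective (wtB (n := n)) := by
  intro i j h
  rcases i with _ | i <;> rcases j with _ | j
  · rfl
  · exact (wtD_ne_zero j h.symm).elim
  · exact (wtD_ne_zero i h).elim
  · rw [wtD_injective h]

theorem pair_B (i j k l : Unit ⊕ (Fin n ⊕ Fin n)) (hne : wtB i ≠ wtB j)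
    (h : wtB k - wtB l = wtB i - wtB j) : (k = i ∧ l = j) ∨ (k = barB j ∧ l = barB i) := by
  have hne' : i ≠ j := fun e => hne (by rw [e])
  -- `labB` labels the zero difference by `sub z z`, so some coordinate z is needed.
  obtain ⟨z⟩ : Nonempty (Fin n) := by
    rcases i with _ | i | i
    · rcases j with _ | j | j
      · exact (hne' rfl).elim
      · exact ⟨j⟩
      · exact ⟨j⟩
    · exact ⟨i⟩
    · exact ⟨i⟩
  rw [wtB_sub z, wtB_sub z, Root.vec_eq_iff] at h
  rcases i with _ | i | i <;> rcases j with _ | j | j <;> rcases k with _ | k | k <;>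
    rcases l with _ | l | l <;>
    simp only [labB, labD, Root.Same, barB, barD, Sum.inl.injEq, Sum.inr.injEq, reduceCtorEq] at h hne' ⊢ <;>
    grind

theorem diag_cases_B (i : Unit ⊕ (Fin n ⊕ Fin n)) :
    barB i = i ∨ (∃ a, i = .inr (.inl a)) ∨ ∃ a : Fin n, i = barB (.inr (.inl a)) := by
  rcases i with _ | i | i <;> simp [barB, barD]

theorem map_intVecB (α : Root n) : (intVecB α).map (Int.cast : ℤ → ℚ) = rootVecB α := by
  ext k l
  cases α <;> simp [intVecB, rootVecB, Matrix.single_apply]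

theorem intVecB_ne_zero (h : IsRootB α) (i j : Unit ⊕ (Fin n ⊕ Fin n)) :
    intVecB α i j ≠ 0 ↔ wtB i - wtB j = α.vec := by
  obtain ⟨z⟩ : Nonempty (Fin n) := by cases α <;> exact ⟨by assumption⟩
  rw [wtB_sub z, Root.vec_eq_iff]
  cases α <;> rcases i with _ | i | i <;> rcases j with _ | j | j <;>
    simp only [IsRootB, intVecB, labB, labD, Root.Same, Matrix.sub_apply, Matrix.single_apply,
      Sum.inl.injEq, Sum.inr.injEq, reduceCtorEq, false_and, and_false, if_false] at h ⊢ <;> grind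

theorem rootVecB_ne_zero (h : IsRootB α) (i j : Unit ⊕ (Fin n ⊕ Fin n)) :
    rootVecB α i j ≠ 0 ↔ wtB i - wtB j = α.vec := by
  rw [← intVecB_ne_zero h i j, ← map_intVecB, Matrix.map_apply, Int.cast_ne_zero]

theorem natAbs_intVecB (α : Root n) (i j : Unit ⊕ (Fin n ⊕ Fin n)) :
    (intVecB α i j).natAbs ≤ 2 := by
  cases α with
  | pos a =>
    rcases i with _ | i | i <;> rcases j with _ | j | j <;>
      simp only [intVecB, Matrix.sub_apply, Matrix.single_apply, Sum.inl.injEq, Sum.inr.injEq,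
        reduceCtorEq, false_and, and_false, if_false] <;> (try split_ifs) <;> simp
  | neg a =>
    rcases i with _ | i | i <;> rcases j with _ | j | j <;>
      simp only [intVecB, Matrix.sub_apply, Matrix.single_apply, Sum.inl.injEq, Sum.inr.injEq,
        reduceCtorEq, false_and, and_false, if_false] <;> (try split_ifs) <;> simp
  | _ =>
    simp only [intVecB, Matrix.sub_apply, Matrix.single_apply]
    split_ifs <;> simp

theorem exists_unit_intVecB (h : IsRootB α) : ∃ i j, (intVecB α i j).natAbs = 1 := by
  cases α with
  | sub i j => exact ⟨.inr (.inl i), .inr (.inl j), by simp [intVecB]⟩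
  | add i j =>
    refine ⟨.inr (.inl i), .inr (.inr j), ?_⟩
    have h' : i < j := h
    simp [intVecB, h'.ne']
  | negAdd i j =>
    refine ⟨.inr (.inr j), .inr (.inl i), ?_⟩
    have h' : i < j := h
    simp [intVecB, h'.ne]
  | pos i => exact ⟨.inl (), .inr (.inr i), by simp [intVecB]⟩
  | neg i => exact ⟨.inl (), .inr (.inl i), by simp [intVecB]⟩

theorem intVecB_sq (h : IsRootB α) : intVecB α * intVecB α = (2 : ℤ) • sqVecB α := by
  cases α with
  | sub i j =>
    have h' : i ≠ j := h
    simp [intVecB, sqVecB, sub_mul, mul_sub, h', h'.symm]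
  | add i j => simp [intVecB, sqVecB, sub_mul, mul_sub]
  | negAdd i j => simp [intVecB, sqVecB, sub_mul, mul_sub]
  | pos i => simp [intVecB, sqVecB, sub_mul, mul_sub]
  | neg i => simp [intVecB, sqVecB, sub_mul, mul_sub]

theorem intVecB_mul_sqVecB (α : Root n) : intVecB α * sqVecB α = 0 := by
  cases α <;> simp [intVecB, sqVecB, sub_mul]

theorem norm_B (h : IsRootB α) : α.vec ⬝ᵥ α.vec = 1 ∨ α.vec ⬝ᵥ α.vec = 2 := by
  rw [Root.dot_vec]
  cases α with
  | sub i j =>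
    have h' : i ≠ j := h
    simp [Root.vec, h', h'.symm]
  | add i j =>
    have h' : i < j := h
    simp [Root.vec, h'.ne, h'.ne']
  | negAdd i j =>
    have h' : i < j := h
    simp [Root.vec, h'.ne, h'.ne']
  | _ => simp [Root.vec]

theorem vec_inj_B (h : IsRootB α) {β : Root n} (h' : IsRootB β) (e : α.vec = β.vec) : α = β := by
  rw [Root.vec_eq_iff] at e
  cases α <;> cases β <;> simp only [IsRootB, Root.Same] at h h' e <;> grind

theorem IsRootB.opp (h : IsRootB α) : IsRootB α.opp := by
  cases α <;> simp only [IsRootB, Root.opp] at h ⊢ <;> grind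

/-- The sum of the positive coroots in type `B`. -/
def rhoB (n : ℕ) (i : Fin n) : ℤ := 2 * ((n : ℤ) - (i : ℕ))

theorem two_mul_ht_B : 2 * ((∑ k, rhoB n k * α.vec k) / 2) = rhoB n ⬝ᵥ α.vec := by
  have h : ∃ k, rhoB n ⬝ᵥ α.vec = 2 * k := by
    rw [Root.dot_vec]
    cases α <;> simp only [rhoB, ← mul_add, ← mul_sub, ← mul_neg, exists_apply_eq_apply']
  obtain ⟨k, hk⟩ := h
  rw [Root.half_dot hk, hk]

theorem isPosRootB_iff (α : Root n) :
    IsPosRootB α ↔ IsRootB α ∧ 0 < (∑ k, rhoB n k * α.vec k) / 2 := by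
  have h := two_mul_ht_B (α := α)
  rw [Root.dot_vec] at h
  generalize (∑ k, rhoB n k * α.vec k) / 2 = x at h ⊢
  cases α with
  | sub i j => simp only [rhoB, IsPosRootB, IsRootB, ne_eq, Fin.ext_iff, Fin.lt_def] at *; omega
  | add i j => simp only [rhoB, IsPosRootB, IsRootB, Fin.lt_def] at *; omega
  | negAdd i j => simp only [rhoB, IsPosRootB, IsRootB, Fin.lt_def, false_iff, not_and] at *; omega
  | _ => simp only [rhoB, IsPosRootB, IsRootB, true_iff, false_iff, true_and] at *; omega

theorem trace_B (h : IsRootB α) :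
    (intVecB α * intVecB α.opp).trace = 2 ∨ (intVecB α * intVecB α.opp).trace = 4 := by
  cases α with
  | sub i j =>
    have h' : i ≠ j := h
    simp [intVecB, Root.opp, sub_mul, mul_sub]
  | add i j =>
    have h' : i < j := h
    simp [intVecB, Root.opp, sub_mul, mul_sub, h'.ne, h'.ne']
  | negAdd i j =>
    have h' : i < j := h
    simp [intVecB, Root.opp, sub_mul, mul_sub, h'.ne, h'.ne']
  | pos i => simp [intVecB, Root.opp, sub_mul, mul_sub]
  | neg i => simp [intVecB, Root.opp, sub_mul, mul_sub]

theorem single_eq_smul_one {I : Type*} [DecidableEq I] (i j : I) (c : ℤ) :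
    (Matrix.single i j c : Matrix I I ℤ) = c • Matrix.single i j 1 := by
  rw [Matrix.smul_single, smul_eq_mul, mul_one]

theorem sl2_B (h : IsRootB α) : (intVecB α * intVecB α.opp - intVecB α.opp * intVecB α) * intVecB α -
    intVecB α * (intVecB α * intVecB α.opp - intVecB α.opp * intVecB α) = (2 : ℤ) • intVecB α := by
  cases α with
  | sub i j =>
    have h' : i ≠ j := h
    simp only [intVecB, Root.opp, sub_mul, mul_sub, single_mul_single_ite, h', h'.symm,
      Sum.inl.injEq, Sum.inr.injEq, reduceCtorEq, if_true, if_false, mul_one]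
    module
  | add i j =>
    have h' : i < j := h
    simp only [intVecB, Root.opp, sub_mul, mul_sub, single_mul_single_ite, h'.ne, h'.ne',
      Sum.inl.injEq, Sum.inr.injEq, reduceCtorEq, if_true, if_false, mul_one]
    module
  | negAdd i j =>
    have h' : i < j := h
    simp only [intVecB, Root.opp, sub_mul, mul_sub, single_mul_single_ite, h'.ne, h'.ne',
      Sum.inl.injEq, Sum.inr.injEq, reduceCtorEq, if_true, if_false, mul_one]
    module
  | pos i =>
    simp only [intVecB, Root.opp, single_eq_smul_one _ _ 2, sub_mul, mul_sub, smul_mul_assoc,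
      mul_smul_comm, single_mul_single_ite,
      Sum.inr.injEq, reduceCtorEq, if_true, if_false, mul_one]
    module
  | neg i =>
    simp only [intVecB, Root.opp, single_eq_smul_one _ _ 2, sub_mul, mul_sub, smul_mul_assoc,
      mul_smul_comm, single_mul_single_ite,
      Sum.inr.injEq, reduceCtorEq, if_true, if_false, mul_one]
    module

theorem JB_apply (i j : Unit ⊕ (Fin n ⊕ Fin n)) :
    LieAlgebra.Orthogonal.JB (Fin n) ℚ i j = if j = barB i then coeffB i else 0 := by
  rcases i with _ | i | i <;> rcases j with _ | j | j <;>
    simp [LieAlgebra.Orthogonal.JB, LieAlgebra.Orthogonal.JD, barB, barD, coeffB, Matrix.one_apply,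
      eq_comm]

theorem coeffB_ne_zero (i : Unit ⊕ (Fin n ⊕ Fin n)) : coeffB i ≠ 0 := by
  cases i <;> simp [coeffB]

theorem exists_root_of_ne_barB {i j : Unit ⊕ (Fin n ⊕ Fin n)} (h1 : j ≠ barB i) (h2 : i ≠ j) :
    ∃ α ∈ {α : Root n | IsRootB α}, α.vec = wtB i - wtB j := by
  rcases i with _ | i <;> rcases j with _ | j
  · exact (h2 rfl).elim
  · rcases j with j | j
    · exact ⟨.neg j, trivial, by simp [wtB, wtD, Root.vec]⟩
    · exact ⟨.pos j, trivial, by simp [wtB, wtD, Root.vec]⟩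
  · rcases i with i | i
    · exact ⟨.pos i, trivial, by simp [wtB, wtD, Root.vec]⟩
    · exact ⟨.neg i, trivial, by simp [wtB, wtD, Root.vec]⟩
  · obtain ⟨α, hα, e⟩ := exists_root_of_ne_bar (i := i) (j := j) (fun e => h1 (by rw [e]; rfl))
      fun e => h2 (by rw [e])
    refine ⟨α, ?_, e⟩
    cases α with
    | sub | add | negAdd => exact hα
    | _ => trivial

theorem exists_root_B {A : Matrix (Unit ⊕ (Fin n ⊕ Fin n)) (Unit ⊕ (Fin n ⊕ Fin n)) ℚ}
    (hA : A ∈ skewAdjointMatricesLieSubalgebra (LieAlgebra.Orthogonal.JB (Fin n) ℚ))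
    {i j : Unit ⊕ (Fin n ⊕ Fin n)} (h : A i j ≠ 0) (hne : wtB i ≠ wtB j) :
    ∃ α ∈ {α : Root n | IsRootB α}, α.vec = wtB i - wtB j := by
  refine exists_root_of_ne_barB ?_ fun e => hne (by rw [e])
  rintro rfl
  have := skew_apply barB_barB JB_apply hA i (barB i)
  rw [barB_barB] at this
  apply h
  rcases i with _ | i
  · exact (hne rfl).elim
  · simp only [coeffB, barB] at this ⊢
    linarith

end B

/-- The defining representation of `𝔰𝔬_{2n+1}`. -/
def stdB (n : ℕ) : StdData (lieB n) where
  wt := wtB (n := n)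
  wt_inj := wtB_injective
  X := intVecB
  map_X α _ := map_intVecB α
  supp _ h := intVecB_ne_zero h
  natAbs_le α _ := natAbs_intVecB α
  unit_entry _ h := exists_unit_intVecB h
  S := sqVecB
  sq _ h := intVecB_sq h
  cube α _ := intVecB_mul_sqVecB α
  weight_space _ hA _ hv h := weight_space_skew barB_barB JB_apply coeffB_ne_zero
    (lieB n).X_mem (fun _ h => rootVecB_ne_zero h) pair_B
    (fun _ hA _ _ h hne => exists_root_B hA h hne) hA hv h
  H a := Matrix.diagonal fun i : Unit ⊕ (Fin n ⊕ Fin n) => (wtB i a : ℚ) + 0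
  H_mem a := diagonal_mem_skew barB_barB JB_apply (wtB_bar_cast a)
  H_apply _ := ⟨0, rfl⟩
  H_span _ hA h := ⟨_, diag_span_skew (ι := fun a => Sum.inr (Sum.inl a)) barB_barB JB_apply
    coeffB_ne_zero wtB_bar (fun _ => rfl) diag_cases_B hA h⟩
  norm := Or.inl fun _ h => norm_B h
  vec_inj _ h _ h' := vec_inj_B h h'
  opp_mem _ h := IsRootB.opp h
  two_mul_ht _ _ := two_mul_ht_B
  mem_pos α := isPosRootB_iff α
  trace_ne _ h := Or.inr (trace_B h)
  sl2 _ h := sl2_B h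

end ToricPairs

namespace ToricPairs
open Matrix

attribute [local instance 100] LieRing.ofAssociativeRing

/-! ### Coxeter numbers of Levi subgroups -/

section Coxeter

variable {𝔤 : RootedLieAlgebra} {m : ℕ}

theorem vec_eq_zero_of_mem_span {p : ℕ}
    (ho : ∀ k ∈ admissible 𝔤 m, ∀ c : Fin 𝔤.r, (c : ℕ) < p → (𝔤.simple k).vec c = 0)
    {v : Fin 𝔤.r → ℤ}
    (hv : v ∈ Submodule.span ℤ ((fun k => (𝔤.simple k).vec) '' admissible 𝔤 m))
    (c : Fin 𝔤.r) (hc : (c : ℕ) < p) : v c = 0 := by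
  have h : Submodule.span ℤ ((fun k => (𝔤.simple k).vec) '' admissible 𝔤 m) ≤
      LinearMap.ker (LinearMap.proj c : (Fin 𝔤.r → ℤ) →ₗ[ℤ] ℤ) := by
    rw [Submodule.span_le]
    rintro _ ⟨k, hk, rfl⟩
    exact LinearMap.mem_ker.2 (ho k hk c hc)
  exact LinearMap.mem_ker.1 (h hv)

theorem coxeter_eq {R : Set (Root 𝔤.r)} {h : ℕ} (hub : ∀ α ∈ R, 𝔤.ht α ≤ h)
    (hex : ∃ α ∈ R, 𝔤.ht α = h) : 𝔤.coxeter R = h + 1 := by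
  rw [RootedLieAlgebra.coxeter]
  congr 1
  refine IsGreatest.csSup_eq ⟨?_, ?_⟩
  · obtain ⟨α, hα, e⟩ := hex
    exact ⟨α, hα, by simp only [e, Int.toNat_natCast]⟩
  · rintro _ ⟨α, hα, rfl⟩
    have := hub α hα
    simp only
    omega

/-- The roots of the Levi need not be listed: heights are bounded on the possibly larger set of
roots without outer coordinates, and one root in the span attains the bound. -/
theorem leviCoxeter_eq {h : ℕ}
    (ho : ∀ k ∈ admissible 𝔤 m, ∀ c : Fin 𝔤.r, (c : ℕ) < 𝔤.n - m → (𝔤.simple k).vec c = 0)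
    (hub : ∀ α ∈ 𝔤.roots, (∀ c : Fin 𝔤.r, (c : ℕ) < 𝔤.n - m → α.vec c = 0) → 𝔤.ht α ≤ h)
    (hex : ∃ α ∈ 𝔤.roots, 𝔤.ht α = h ∧
      α.vec ∈ Submodule.span ℤ ((fun k => (𝔤.simple k).vec) '' admissible 𝔤 m)) :
    𝔤.leviCoxeter (admissible 𝔤 m) = h + 1 := by
  refine coxeter_eq (fun α hα => hub α hα.1 (vec_eq_zero_of_mem_span ho hα.2)) ?_
  obtain ⟨α, hα, e, hs⟩ := hex
  exact ⟨α, ⟨hα, hs⟩, e⟩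

theorem two_le_coxeter_roots [Finite 𝔤.roots]
    (h : ∃ α ∈ 𝔤.roots, 𝔤.ht α = 1) : 2 ≤ 𝔤.coxeter 𝔤.roots := by
  obtain ⟨α, hα, e⟩ := h
  have h1 : 1 ≤ sSup ((fun α => (𝔤.ht α).toNat) '' 𝔤.roots) :=
    le_csSup ((Set.toFinite _).image _).bddAbove ⟨α, hα, by simp [e]⟩
  rw [RootedLieAlgebra.coxeter]
  omega

/-- The quotient of the difference by N lies strictly between -2 and 2. Pairings of inner weights,
even after a shift by 2, fall in this range. -/
theorem modEq_cases {N a b : ℤ} (h : a ≡ b [ZMOD N]) (h1 : a - b < 2 * N) (h2 : b - a < 2 * N) :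
    a = b ∨ a = b + N ∨ b = a + N := by
  obtain ⟨k, hk⟩ := h.dvd
  have hN : 0 < N := by omega
  have h3 : k < 2 := by
    by_contra! h0
    nlinarith
  have h4 : -2 < k := by
    by_contra! h0
    nlinarith
  have h5 : k = -1 ∨ k = 0 ∨ k = 1 := by omega
  rcases h5 with rfl | rfl | rfl <;> omega

/-- Telescoping sum of simple roots along consecutive coordinates. -/
theorem single_sub_single_mem {r p : ℕ} (S : Submodule ℤ (Fin r → ℤ))
    (h : ∀ a b : Fin r, p ≤ (a : ℕ) → (b : ℕ) = a + 1 →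
      (Pi.single a 1 - Pi.single b 1 : Fin r → ℤ) ∈ S) (a b : Fin r) (ha : p ≤ (a : ℕ))
    (hb : p ≤ (b : ℕ)) : (Pi.single a 1 - Pi.single b 1 : Fin r → ℤ) ∈ S := by
  have key : ∀ k : ℕ, ∀ a b : Fin r, p ≤ (a : ℕ) → (b : ℕ) = a + k →
      (Pi.single a 1 - Pi.single b 1 : Fin r → ℤ) ∈ S := by
    intro k
    induction k with
    | zero =>
      intro a b _ hab
      rw [Fin.ext (a := b) (b := a) (by omega), sub_self]
      exact S.zero_mem
    | succ k ih =>
      intro a b ha hab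
      have hlt : (a : ℕ) + k < r := by omega
      have h1 := ih a ⟨a + k, hlt⟩ ha rfl
      have h2 := h ⟨a + k, hlt⟩ b (by simp only; omega) (by simp only; omega)
      have h3 := S.add_mem h1 h2
      rwa [sub_add_sub_cancel] at h3
  rcases le_total (a : ℕ) b with hab | hab
  · exact key (b - a) a b ha (by omega)
  · rw [← neg_sub]
    exact S.neg_mem (key (a - b) b a hb (by omega))

theorem single_add_single_mem {r p : ℕ} (S : Submodule ℤ (Fin r → ℤ))
    (h : ∀ a b : Fin r, p ≤ (a : ℕ) → (b : ℕ) = a + 1 →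
      (Pi.single a 1 - Pi.single b 1 : Fin r → ℤ) ∈ S)
    (h' : ∃ a b : Fin r, p ≤ (a : ℕ) ∧ p ≤ (b : ℕ) ∧ (Pi.single a 1 + Pi.single b 1 : Fin r → ℤ) ∈ S)
    (a b : Fin r) (ha : p ≤ (a : ℕ))
    (hb : p ≤ (b : ℕ)) : (Pi.single a 1 + Pi.single b 1 : Fin r → ℤ) ∈ S := by
  obtain ⟨a', b', ha', hb', hs⟩ := h'
  have h1 := single_sub_single_mem S h a a' ha ha'
  have h2 := single_sub_single_mem S h b b' hb hb'
  have h3 := S.add_mem (S.add_mem h1 h2) hs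
  convert h3 using 1
  abel

theorem vec_mem_span {S : Set (Fin 𝔤.n)} {k : Fin 𝔤.n} (hk : k ∈ S) :
    (𝔤.simple k).vec ∈ Submodule.span ℤ ((fun k => (𝔤.simple k).vec) '' S) :=
  Submodule.subset_span ⟨k, hk, rfl⟩

end Coxeter

instance {r : ℕ} : Finite (Root r) := by
  have : Function.Injective (fun α : Root r => match α with
    | .sub i j => (Sum.inl (0, i, j) : Fin 3 × Fin r × Fin r ⊕ Fin 2 × Fin r)
    | .add i j => Sum.inl (1, i, j)
    | .negAdd i j => Sum.inl (2, i, j)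
    | .pos i => Sum.inr (0, i)
    | .neg i => Sum.inr (1, i)) := by
    intro α β h
    cases α <;> cases β <;> simp_all
  exact Finite.of_injective _ this

/-! ### Levi subgroups in type A -/

section A

variable {n m : ℕ}

theorem inner_A_iff {p : ℕ} {i : Fin (n + 1)} :
    (∀ c : Fin (n + 1), (c : ℕ) < p → wtA i c = 0) ↔ p ≤ (i : ℕ) := by
  constructor
  · intro h
    by_contra! h0
    have := h i h0
    simp [wtA] at this
  · intro h c hc
    have : c ≠ i := by rintro rfl; omega
    simp [wtA, this]

theorem rhoA_wt (i : Fin (n + 1)) : rhoA n ⬝ᵥ wtA i = n - 2 * (i : ℤ) := by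
  simp [wtA, rhoA]

theorem simpleA_outer (k : Fin n) (hk : n ≤ (k : ℕ) + m) (c : Fin (n + 1)) (hc : (c : ℕ) < n - m) :
    (simpleA n k).vec c = 0 := by
  have h1 : c ≠ k.castSucc := fun h => by rw [h, Fin.val_castSucc] at hc; omega
  have h2 : c ≠ k.succ := fun h => by rw [h, Fin.val_succ] at hc; omega
  simp [simpleA, Root.vec, h1, h2]

theorem wtA_sub_mem (S : Submodule ℤ (Fin (n + 1) → ℤ))
    (hS : ∀ k : Fin n, n ≤ (k : ℕ) + m → (simpleA n k).vec ∈ S) (i j : Fin (n + 1))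
    (hi : n - m ≤ (i : ℕ)) (hj : n - m ≤ (j : ℕ)) : wtA i - wtA j ∈ S := by
  refine single_sub_single_mem S (fun a b ha hab => ?_) i j hi hj
  have hlt : (a : ℕ) < n := by omega
  have h := hS ⟨a, hlt⟩ (by simp only; omega)
  rwa [simpleA, show (⟨a, hlt⟩ : Fin n).castSucc = a from Fin.ext rfl,
    show (⟨a, hlt⟩ : Fin n).succ = b from Fin.ext hab.symm] at h

theorem ht_A (i j : Fin (n + 1)) :
    (∑ k, rhoA n k * (Root.sub i j).vec k) / 2 = (j : ℤ) - (i : ℕ) := Root.half_dot (rhoA_dot i j)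

theorem simpleA_mem (k : Fin n) :
    IsRootA (simpleA n k) ∧ (∑ c, rhoA n c * (simpleA n k).vec c) / 2 = 1 := by
  refine ⟨fun h => ?_, ?_⟩
  · have := congrArg Fin.val h
    simp at this
  · rw [simpleA, ht_A, Fin.val_succ, Fin.val_castSucc]
    omega

/-- The m + 1 inner indices n - m, …, n run once through the residues modulo d = m + 1; the witness
is n minus the residue of n - x. -/
theorem exists_residue_A (hm : m ≤ n) (x : ℤ) :
    ∃ j : Fin (n + 1), n - m ≤ (j : ℕ) ∧ (n : ℤ) - 2 * x ≡ rhoA n ⬝ᵥ wtA j [ZMOD (2 * (m + 1) : ℕ)] := by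
  have h0 : (0 : ℤ) < (m : ℤ) + 1 := by omega
  have h1 := Int.emod_nonneg (n - x) h0.ne'
  have h2 := Int.emod_lt_of_pos (n - x) h0
  have h3 := Int.mul_ediv_add_emod (n - x) (m + 1)
  generalize (n - x) % (m + 1) = y at *
  generalize (n - x) / (m + 1) = q at *
  refine ⟨⟨n - y.toNat, by omega⟩, by simp only; omega, ?_⟩
  rw [rhoA_wt, Int.modEq_iff_dvd]
  refine ⟨-q, ?_⟩
  have h4 : ((n - y.toNat : ℕ) : ℤ) = n - y := by omega
  simp only [h4]
  push_cast
  linear_combination 2 * h3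

theorem inner_A_eq (hm : m ≤ n) {j k : Fin (n + 1)} {t : ℤ} (hj : n - m ≤ (j : ℕ))
    (hk : n - m ≤ (k : ℕ)) (ht : -2 ≤ t) (ht' : t ≤ 2)
    (h : rhoA n ⬝ᵥ wtA k ≡ rhoA n ⬝ᵥ wtA j + t [ZMOD (2 * (m + 1) : ℕ)]) :
    -2 * (k : ℤ) = -2 * (j : ℤ) + t ∨ -2 * (k : ℤ) = -2 * (j : ℤ) + t + 2 * (m + 1) ∨
      -2 * (j : ℤ) + t = -2 * (k : ℤ) + 2 * (m + 1) := by
  rw [rhoA_wt, rhoA_wt] at h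
  have := modEq_cases h (by push_cast; omega) (by push_cast; omega)
  push_cast at this
  omega

theorem unique_A (hm : m ≤ n) {j j' : Fin (n + 1)} (hj : n - m ≤ (j : ℕ))
    (hj' : n - m ≤ (j' : ℕ))
    (h : rhoA n ⬝ᵥ wtA j ≡ rhoA n ⬝ᵥ wtA j' [ZMOD (2 * (m + 1) : ℕ)]) : j = j' := by
  rw [← add_zero (rhoA n ⬝ᵥ wtA j')] at h
  have := inner_A_eq hm hj' hj (by omega) (by omega) h
  exact Fin.ext (by omega)

theorem inner_root_A (hm : 1 ≤ m) {j k : Fin (n + 1)}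
    (h : rhoA n ⬝ᵥ wtA k ≡ rhoA n ⬝ᵥ wtA j + 2 [ZMOD (2 * (m + 1) : ℕ)]) :
    ∃ α : Root (n + 1), IsRootA α ∧ α.vec = wtA k - wtA j := by
  refine ⟨.sub k j, ?_, rfl⟩
  rintro rfl
  have h1 := (Int.modEq_iff_dvd.1 h)
  rw [add_sub_cancel_left] at h1
  have := Int.le_of_dvd (by norm_num) h1
  push_cast at this
  omega

/-- A positive height divisible by m + 1 gives j - i ≥ m + 1, so i is outer, and the truncated
coefficients strictly decrease from i to j. -/
theorem psi_outer_A {γ : Root (n + 1)} (hγ : IsPosRootA γ)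
    (h : (∑ k, rhoA n k * γ.vec k) / 2 ≡ 0 [ZMOD ((m + 1 : ℕ) : ℤ)]) :
    0 < ∑ c : Fin (n + 1), ((n - m - c : ℕ) : ℤ) * γ.vec c := by
  change 0 < (fun c : Fin (n + 1) => ((n - m - c : ℕ) : ℤ)) ⬝ᵥ γ.vec
  rw [Root.dot_vec]
  cases γ with
  | sub i j =>
    have hij : (i : ℕ) < j := hγ
    rw [ht_A] at h
    have h1 := Int.le_of_dvd (by omega) (Int.modEq_zero_iff_dvd.1 h)
    push_cast at h1
    simp only
    omega
  | _ => exact hγ.elim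

theorem ht_le_A {α : Root (n + 1)} (hα : IsRootA α)
    (h : ∀ c : Fin (n + 1), (c : ℕ) < n - m → α.vec c = 0) :
    (∑ k, rhoA n k * α.vec k) / 2 ≤ (m : ℤ) := by
  obtain ⟨i, j, hij, rfl⟩ := hα.exists_eq
  rw [ht_A]
  have : ¬ (i : ℕ) < n - m := fun h0 => by
    have := h i h0
    simp [Root.vec, hij] at this
  omega

theorem exists_highest_A (hm : 1 ≤ m) (hmn : m ≤ n) (S : Submodule ℤ (Fin (n + 1) → ℤ))
    (hS : ∀ k : Fin n, n ≤ (k : ℕ) + m → (simpleA n k).vec ∈ S) :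
    ∃ α : Root (n + 1), IsRootA α ∧ (∑ k, rhoA n k * α.vec k) / 2 = (m : ℤ) ∧ α.vec ∈ S := by
  refine ⟨.sub ⟨n - m, by omega⟩ ⟨n, by omega⟩, fun h => ?_, ?_, ?_⟩
  · have := congrArg Fin.val h
    simp only at this
    omega
  · rw [ht_A]; simp only; omega
  · exact wtA_sub_mem S hS _ _ (by simp) (by simp)

theorem wtA_ne_neg (i c : Fin (n + 1)) : wtA i ≠ -Pi.single c 1 := by
  intro h
  have h1 := congrFun h c
  simp only [wtA, Pi.single_apply, Pi.neg_apply] at h1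
  grind

theorem outer_root_A {i c j : Fin (n + 1)} (hc : (c : ℕ) < n - m) (hi : wtA i = Pi.single c 1)
    (hj : n - m ≤ (j : ℕ)) : ∃ α : Root (n + 1), IsPosRootA α ∧ α.vec = wtA i - wtA j := by
  have h : i = c := Root.vec_pos_eq hi
  subst h
  exact ⟨.sub i j, (by omega : (i : ℕ) < j), rfl⟩

end A

theorem leviCoxeter_GL {n m : ℕ} (hm : 1 ≤ m) (hmn : m ≤ n) :
    (lieGL n).leviCoxeter (admissible (lieGL n) m) = m + 1 :=
  leviCoxeter_eq (𝔤 := lieGL n) simpleA_outer (fun _ hα h => ht_le_A hα h)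
    (exists_highest_A hm hmn _ fun _ hk => vec_mem_span (𝔤 := lieGL n) hk)

theorem leviCoxeter_A {n m : ℕ} (hm : 1 ≤ m) (hmn : m ≤ n) :
    (lieA n).leviCoxeter (admissible (lieA n) m) = m + 1 :=
  leviCoxeter_eq (𝔤 := lieA n) simpleA_outer (fun _ hα h => ht_le_A hα h)
    (exists_highest_A hm hmn _ fun _ hk => vec_mem_span (𝔤 := lieA n) hk)

theorem exists_congr_A {n m : ℕ} (hm : m ≤ n) (i : Fin (n + 1)) :
    ∃ j : Fin (n + 1), (∀ c : Fin (n + 1), (c : ℕ) < n - m → wtA j c = 0) ∧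
      rhoA n ⬝ᵥ wtA i ≡ rhoA n ⬝ᵥ wtA j [ZMOD (2 * (m + 1) : ℕ)] := by
  obtain ⟨j, hj, h⟩ := exists_residue_A hm (i : ℤ)
  exact ⟨j, inner_A_iff.2 hj, by rwa [rhoA_wt i]⟩

theorem exists_succ_A {n m : ℕ} (hm : m ≤ n) (i : Fin (n + 1)) :
    ∃ j : Fin (n + 1), (∀ c : Fin (n + 1), (c : ℕ) < n - m → wtA j c = 0) ∧
      rhoA n ⬝ᵥ wtA j ≡ rhoA n ⬝ᵥ wtA i + 2 [ZMOD (2 * (m + 1) : ℕ)] := by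
  obtain ⟨j, hj, h⟩ := exists_residue_A hm ((i : ℤ) - 1)
  refine ⟨j, inner_A_iff.2 hj, ?_⟩
  rw [rhoA_wt i, show (n : ℤ) - 2 * (i : ℤ) + 2 = n - 2 * (i - 1) by ring]
  exact h.symm

theorem leviData_GL {n m : ℕ} (hm : 1 ≤ m) (hmn : m ≤ n) : LeviData (stdGL n) m (m + 1) where
  two_le := Nat.succ_le_succ hm
  wt_cases i := Or.inr (Or.inl ⟨i, rfl⟩)
  wt_surj c := ⟨c, rfl⟩
  wt_neg i c h := (wtA_ne_neg i c h).elim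
  inner_span i j hi hj := wtA_sub_mem _ (fun _ hk => vec_mem_span (𝔤 := lieGL n) hk) i j
    (inner_A_iff.1 hi) (inner_A_iff.1 hj)
  simple_outer := simpleA_outer
  simple_mem := simpleA_mem
  exists_congr := exists_congr_A hmn
  exists_succ := exists_succ_A hmn
  unique _ _ _ _ hj hj' _ _ h _ _ := Or.inl (unique_A hmn (inner_A_iff.1 hj) (inner_A_iff.1 hj') h)
  inner_root _ _ _ _ h := inner_root_A hm h
  psi_outer _ hγ := psi_outer_A hγ.1 hγ.2
  outer_root _ _ _ hc hi hj := outer_root_A hc hi (inner_A_iff.1 hj)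

theorem leviData_A {n m : ℕ} (hm : 1 ≤ m) (hmn : m ≤ n) : LeviData (stdA n) m (m + 1) where
  two_le := Nat.succ_le_succ hm
  wt_cases i := Or.inr (Or.inl ⟨i, rfl⟩)
  wt_surj c := ⟨c, rfl⟩
  wt_neg i c h := (wtA_ne_neg i c h).elim
  inner_span i j hi hj := wtA_sub_mem _ (fun _ hk => vec_mem_span (𝔤 := lieA n) hk) i j
    (inner_A_iff.1 hi) (inner_A_iff.1 hj)
  simple_outer := simpleA_outer
  simple_mem := simpleA_mem
  exists_congr := exists_congr_A hmn
  exists_succ := exists_succ_A hmn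
  unique _ _ _ _ hj hj' _ _ h _ _ := Or.inl (unique_A hmn (inner_A_iff.1 hj) (inner_A_iff.1 hj') h)
  inner_root _ _ _ _ h := inner_root_A hm h
  psi_outer _ hγ := psi_outer_A hγ.1 hγ.2
  outer_root _ _ _ hc hi hj := outer_root_A hc hi (inner_A_iff.1 hj)

end ToricPairs

namespace ToricPairs
open Matrix

attribute [local instance 100] LieRing.ofAssociativeRing

/-! ### Levi subgroups in types C and D -/

/-- The coordinate of a weight. -/
def idxD {n : ℕ} : Fin n ⊕ Fin n → Fin n := Sum.elim id id

section CD

variable {n : ℕ}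

theorem inner_D_iff {p : ℕ} {i : Fin n ⊕ Fin n} :
    (∀ c : Fin n, (c : ℕ) < p → wtD i c = 0) ↔ p ≤ (idxD i : ℕ) := by
  constructor
  · intro h
    by_contra! h0
    have := h _ h0
    cases i <;> simp [wtD, idxD] at this
  · intro h c hc
    have : c ≠ idxD i := by rintro rfl; omega
    cases i <;> simp_all [wtD, idxD]

theorem dot_wtD (w : Fin n → ℤ) (i : Fin n ⊕ Fin n) :
    w ⬝ᵥ wtD i = match i with
      | .inl i => w i
      | .inr i => -w i := by
  cases i <;> simp [wtD]

theorem wtD_cases (i : Fin n ⊕ Fin n) :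
    wtD i = 0 ∨ (∃ c, wtD i = Pi.single c 1) ∨ ∃ c, wtD i = -Pi.single c 1 := by
  cases i with
  | inl i => exact Or.inr (Or.inl ⟨i, rfl⟩)
  | inr i => exact Or.inr (Or.inr ⟨i, rfl⟩)

theorem wtD_eq_single {i : Fin n ⊕ Fin n} {c : Fin n} (h : wtD i = Pi.single c 1) : i = .inl c :=
  wtD_injective (h.trans rfl)

theorem wtD_sub_mem {p : ℕ} (S : Submodule ℤ (Fin n → ℤ))
    (h : ∀ a b : Fin n, p ≤ (a : ℕ) → (b : ℕ) = a + 1 →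
      (Pi.single a 1 - Pi.single b 1 : Fin n → ℤ) ∈ S)
    (h' : ∃ a b : Fin n, p ≤ (a : ℕ) ∧ p ≤ (b : ℕ) ∧ (Pi.single a 1 + Pi.single b 1 : Fin n → ℤ) ∈ S)
    (i j : Fin n ⊕ Fin n) (hi : p ≤ (idxD i : ℕ)) (hj : p ≤ (idxD j : ℕ)) :
    wtD i - wtD j ∈ S := by
  cases i with
  | inl i => cases j with
    | inl j => exact single_sub_single_mem S h i j hi hj
    | inr j =>
      rw [wtD, wtD, sub_neg_eq_add]
      exact single_add_single_mem S h h' i j hi hj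
  | inr i => cases j with
    | inl j =>
      rw [wtD, wtD, ← neg_add']
      exact S.neg_mem (single_add_single_mem S h h' i j hi hj)
    | inr j =>
      rw [wtD, wtD, neg_sub_neg]
      exact single_sub_single_mem S h j i hj hi

end CD

section C

variable {n m : ℕ}

theorem simpleC_of_lt (k : Fin n) (h : (k : ℕ) + 1 < n) : simpleC n k = .sub k ⟨k + 1, h⟩ :=
  dif_pos h

theorem simpleC_last (k : Fin n) (h : ¬ (k : ℕ) + 1 < n) : simpleC n k = .add k k := dif_neg h

theorem simpleC_outer (k : Fin n) (hk : n ≤ (k : ℕ) + m) (c : Fin n) (hc : (c : ℕ) < n - m) :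
    (simpleC n k).vec c = 0 := by
  have h1 : c ≠ k := fun h => by rw [h] at hc; omega
  by_cases h : (k : ℕ) + 1 < n
  · have h2 : c ≠ ⟨k + 1, h⟩ := fun h => by rw [h] at hc; simp only at hc; omega
    simp [simpleC_of_lt k h, Root.vec, h1, h2]
  · simp [simpleC_last k h, Root.vec, h1]

theorem span_C (hm : 1 ≤ m) (hmn : m ≤ n) (S : Submodule ℤ (Fin n → ℤ))
    (hS : ∀ k : Fin n, n ≤ (k : ℕ) + m → (simpleC n k).vec ∈ S) (i j : Fin n ⊕ Fin n)
    (hi : n - m ≤ (idxD i : ℕ)) (hj : n - m ≤ (idxD j : ℕ)) : wtD i - wtD j ∈ S := by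
  refine wtD_sub_mem S (fun a b ha hab => ?_) ?_ i j hi hj
  · have h := hS a (by omega)
    rw [simpleC_of_lt a (by omega)] at h
    rwa [Fin.ext (a := b) (b := ⟨a + 1, by omega⟩) hab]
  · refine ⟨⟨n - 1, by omega⟩, ⟨n - 1, by omega⟩, by simp only; omega, by simp only; omega, ?_⟩
    have h := hS ⟨n - 1, by omega⟩ (by simp only; omega)
    rwa [simpleC_last _ (by simp only; omega)] at h

theorem simpleC_mem (k : Fin n) :
    IsRootC (simpleC n k) ∧ (∑ c, rhoC n c * (simpleC n k).vec c) / 2 = 1 := by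
  by_cases h : (k : ℕ) + 1 < n
  · rw [simpleC_of_lt k h]
    refine ⟨fun e => ?_, Root.half_dot ?_⟩
    · have := congrArg Fin.val e
      simp at this
    · rw [Root.dot_vec]
      simp only [rhoC]
      push_cast
      ring
  · rw [simpleC_last k h]
    refine ⟨le_refl k, Root.half_dot ?_⟩
    rw [Root.dot_vec]
    simp only [rhoC]
    omega

/-- The inner weights pair with 2ρ^∨ to the odd numbers from -(2m - 1) to 2m - 1, each odd residue
modulo 4m occurring exactly once. -/
theorem exists_residue_C (hm : 1 ≤ m) (hmn : m ≤ n) (x : ℤ) :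
    ∃ j : Fin n ⊕ Fin n, (∀ c : Fin n, (c : ℕ) < n - m → wtD j c = 0) ∧
      2 * x + 1 ≡ rhoC n ⬝ᵥ wtD j [ZMOD (2 * (2 * m) : ℕ)] := by
  have h0 : (0 : ℤ) < 2 * (m : ℤ) := by omega
  have h1 := Int.emod_nonneg x h0.ne'
  have h2 := Int.emod_lt_of_pos x h0
  have h3 := Int.mul_ediv_add_emod x (2 * m)
  generalize x % (2 * m) = y at *
  generalize x / (2 * m) = q at *
  lift y to ℕ using h1
  by_cases hy : y < m
  · refine ⟨.inl ⟨n - 1 - y, by omega⟩, inner_D_iff.2 (by simp [idxD]; omega), ?_⟩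
    rw [dot_wtD, Int.modEq_iff_dvd]
    refine ⟨-q, ?_⟩
    have h4 : ((n - 1 - y : ℕ) : ℤ) = n - 1 - y := by omega
    simp only [rhoC, h4]
    push_cast
    linear_combination 2 * h3
  · refine ⟨.inr ⟨n - (2 * m - y), by omega⟩, inner_D_iff.2 (by simp [idxD]; omega), ?_⟩
    rw [dot_wtD, Int.modEq_iff_dvd]
    refine ⟨-q - 1, ?_⟩
    have h4 : ((n - (2 * m - y) : ℕ) : ℤ) = n - 2 * m + y := by omega
    simp only [rhoC, h4]
    push_cast
    linear_combination 2 * h3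

theorem odd_rhoC_wtD (i : Fin n ⊕ Fin n) : ∃ x, rhoC n ⬝ᵥ wtD i = 2 * x + 1 := by
  rw [dot_wtD]
  cases i with
  | inl i => exact ⟨n - (i : ℕ) - 1, by simp only [rhoC]; ring⟩
  | inr i => exact ⟨-(n - (i : ℕ)), by simp only [rhoC]; ring⟩

theorem exists_congr_C (hm : 1 ≤ m) (hmn : m ≤ n) (i : Fin n ⊕ Fin n) :
    ∃ j : Fin n ⊕ Fin n, (∀ c : Fin n, (c : ℕ) < n - m → wtD j c = 0) ∧
      rhoC n ⬝ᵥ wtD i ≡ rhoC n ⬝ᵥ wtD j [ZMOD (2 * (2 * m) : ℕ)] := by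
  obtain ⟨x, hx⟩ := odd_rhoC_wtD i
  rw [hx]
  exact exists_residue_C hm hmn x

theorem exists_succ_C (hm : 1 ≤ m) (hmn : m ≤ n) (i : Fin n ⊕ Fin n) :
    ∃ j : Fin n ⊕ Fin n, (∀ c : Fin n, (c : ℕ) < n - m → wtD j c = 0) ∧
      rhoC n ⬝ᵥ wtD j ≡ rhoC n ⬝ᵥ wtD i + 2 [ZMOD (2 * (2 * m) : ℕ)] := by
  obtain ⟨x, hx⟩ := odd_rhoC_wtD i
  obtain ⟨j, hj, h⟩ := exists_residue_C hm hmn (x + 1)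
  refine ⟨j, hj, ?_⟩
  rw [hx, show 2 * x + 1 + 2 = 2 * (x + 1) + 1 by ring]
  exact h.symm

theorem unique_C (hmn : m ≤ n) {j j' : Fin n ⊕ Fin n} (hj : n - m ≤ (idxD j : ℕ))
    (hj' : n - m ≤ (idxD j' : ℕ))
    (h : rhoC n ⬝ᵥ wtD j ≡ rhoC n ⬝ᵥ wtD j' [ZMOD (2 * (2 * m) : ℕ)]) : j = j' := by
  rw [dot_wtD, dot_wtD] at h
  cases j with
  | inl j => cases j' with
    | inl j' =>
      simp only [idxD, Sum.elim_inl, id, rhoC] at hj hj' h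
      have := modEq_cases h (by push_cast; omega) (by push_cast; omega)
      push_cast at this
      rw [Fin.ext (a := j) (b := j') (by omega)]
    | inr j' =>
      simp only [idxD, Sum.elim_inl, Sum.elim_inr, id, rhoC] at hj hj' h
      have := modEq_cases h (by push_cast; omega) (by push_cast; omega)
      push_cast at this
      omega
  | inr j => cases j' with
    | inl j' =>
      simp only [idxD, Sum.elim_inl, Sum.elim_inr, id, rhoC] at hj hj' h
      have := modEq_cases h (by push_cast; omega) (by push_cast; omega)
      push_cast at this
      omega
    | inr j' =>
      simp only [idxD, Sum.elim_inr, id, rhoC] at hj hj' h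
      have := modEq_cases h (by push_cast; omega) (by push_cast; omega)
      push_cast at this
      rw [Fin.ext (a := j) (b := j') (by omega)]

theorem inner_root_C (hm : 1 ≤ m) {j k : Fin n ⊕ Fin n}
    (h : rhoC n ⬝ᵥ wtD k ≡ rhoC n ⬝ᵥ wtD j + 2 [ZMOD (2 * (2 * m) : ℕ)]) :
    ∃ α : Root n, IsRootC α ∧ α.vec = wtD k - wtD j := by
  refine exists_root_C fun e => ?_
  rw [e] at h
  have h1 := (Int.modEq_iff_dvd.1 h)
  rw [add_sub_cancel_left] at h1
  have := Int.le_of_dvd (by norm_num) h1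
  push_cast at this
  omega

/-- For a root χ_i + χ_j with i ≤ j, height at least 2m means i + j ≤ 2n - 2m - 1, so i is outer;
for χ_i - χ_j the gap j - i ≥ 2m gives the same. -/
theorem psi_outer_C (hm : 1 ≤ m) {γ : Root n} (hγ : IsPosRootC γ)
    (h : (∑ k, rhoC n k * γ.vec k) / 2 ≡ 0 [ZMOD ((2 * m : ℕ) : ℤ)]) :
    0 < ∑ c : Fin n, ((n - m - c : ℕ) : ℤ) * γ.vec c := by
  change 0 < (fun c : Fin n => ((n - m - c : ℕ) : ℤ)) ⬝ᵥ γ.vec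
  obtain ⟨hr, hp⟩ := (isPosRootC_iff γ).1 hγ
  have h1 := Int.le_of_dvd hp (Int.modEq_zero_iff_dvd.1 h)
  have h2 := two_mul_ht_C hr
  generalize (∑ k, rhoC n k * γ.vec k) / 2 = x at h1 h2
  rw [Root.dot_vec] at h2 ⊢
  cases γ with
  | sub i j =>
    simp only [rhoC] at h2 ⊢
    push_cast at h1
    omega
  | add i j =>
    have hij : (i : ℕ) ≤ j := hγ
    simp only [rhoC] at h2 ⊢
    push_cast at h1
    omega
  | _ => exact hγ.elim

theorem ht_le_C (hm : 1 ≤ m) {α : Root n} (hα : IsRootC α)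
    (h : ∀ c : Fin n, (c : ℕ) < n - m → α.vec c = 0) :
    (∑ k, rhoC n k * α.vec k) / 2 ≤ ((2 * m - 1 : ℕ) : ℤ) := by
  have h2 := two_mul_ht_C hα
  generalize (∑ k, rhoC n k * α.vec k) / 2 = x at h2
  rw [Root.dot_vec] at h2
  cases α with
  | sub i j =>
    have hij : i ≠ j := hα
    have : ¬ (i : ℕ) < n - m := fun h0 => by
      have := h i h0
      simp [Root.vec, hij] at this
    simp only [rhoC] at h2
    omega
  | add i j =>
    have : ¬ (i : ℕ) < n - m := fun h0 => by
      have := h i h0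
      simp only [Root.vec, Pi.add_apply, Pi.single_apply] at this
      grind
    have hij : (i : ℕ) ≤ j := hα
    simp only [rhoC] at h2
    omega
  | negAdd i j =>
    simp only [rhoC] at h2
    omega
  | _ => exact hα.elim

theorem exists_highest_C (hm : 1 ≤ m) (hmn : m ≤ n) (S : Submodule ℤ (Fin n → ℤ))
    (hS : ∀ k : Fin n, n ≤ (k : ℕ) + m → (simpleC n k).vec ∈ S) :
    ∃ α : Root n, IsRootC α ∧ (∑ k, rhoC n k * α.vec k) / 2 = ((2 * m - 1 : ℕ) : ℤ) ∧ α.vec ∈ S := by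
  refine ⟨.add ⟨n - m, by omega⟩ ⟨n - m, by omega⟩, le_refl _, Root.half_dot ?_, ?_⟩
  · rw [Root.dot_vec]
    simp only [rhoC]
    omega
  · have := span_C hm hmn S hS (.inl ⟨n - m, by omega⟩) (.inr ⟨n - m, by omega⟩)
      (by simp [idxD]) (by simp [idxD])
    rwa [wtD_sub] at this

theorem outer_root_C {i : Fin n ⊕ Fin n} {c : Fin n} {j : Fin n ⊕ Fin n} (hc : (c : ℕ) < n - m)
    (hi : wtD i = Pi.single c 1) (hj : n - m ≤ (idxD j : ℕ)) :
    ∃ α : Root n, IsPosRootC α ∧ α.vec = wtD i - wtD j := by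
  rw [wtD_eq_single hi]
  cases j with
  | inl j => exact ⟨.sub c j, (by simp [idxD] at hj; omega : (c : ℕ) < j), rfl⟩
  | inr j => exact ⟨.add c j, (by simp [idxD] at hj; omega : (c : ℕ) ≤ j), (wtD_sub (.inl c) (.inr j)).symm⟩

end C

theorem leviCoxeter_C {n m : ℕ} (hm : 1 ≤ m) (hmn : m ≤ n) :
    (lieC n).leviCoxeter (admissible (lieC n) m) = 2 * m :=
  (leviCoxeter_eq (𝔤 := lieC n) simpleC_outer (fun _ hα h => ht_le_C hm hα h)
    (exists_highest_C hm hmn _ fun _ hk => vec_mem_span (𝔤 := lieC n) hk)).trans (by omega)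

theorem leviData_C {n m : ℕ} (hm : 1 ≤ m) (hmn : m ≤ n) : LeviData (stdC n) m (2 * m) where
  two_le := by omega
  wt_cases := wtD_cases
  wt_surj c := ⟨.inl c, rfl⟩
  wt_neg _ _ _ k := ⟨barD k, wtD_bar k⟩
  inner_span i j hi hj := span_C hm hmn _ (fun _ hk => vec_mem_span (𝔤 := lieC n) hk) i j
    (inner_D_iff.1 hi) (inner_D_iff.1 hj)
  simple_outer := simpleC_outer
  simple_mem := simpleC_mem
  exists_congr := exists_congr_C hm hmn
  exists_succ := exists_succ_C hm hmn
  unique _ _ _ _ hj hj' _ _ h _ _ := Or.inl (unique_C hmn (inner_D_iff.1 hj) (inner_D_iff.1 hj') h)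
  inner_root _ _ _ _ h := inner_root_C hm h
  psi_outer _ hγ := psi_outer_C hm hγ.1 hγ.2
  outer_root _ _ _ hc hi hj := outer_root_C hc hi (inner_D_iff.1 hj)

end ToricPairs

namespace ToricPairs
open Matrix

attribute [local instance 100] LieRing.ofAssociativeRing

/-! ### Levi subgroups in type D -/

section D

variable {n m : ℕ}

theorem simpleD_of_lt (k : Fin n) (h : (k : ℕ) + 1 < n) : simpleD n k = .sub k ⟨k + 1, h⟩ :=
  dif_pos h

theorem simpleD_last (k : Fin n) (h : ¬ (k : ℕ) + 1 < n) : simpleD n k =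
    .add ⟨(k : ℕ) - 1, lt_of_le_of_lt (Nat.sub_le _ _) k.2⟩ k := dif_neg h

theorem simpleD_outer (hm : 3 ≤ m) (k : Fin n) (hk : n ≤ (k : ℕ) + m) (c : Fin n)
    (hc : (c : ℕ) < n - m) : (simpleD n k).vec c = 0 := by
  have h1 : c ≠ k := fun h => by rw [h] at hc; omega
  by_cases h : (k : ℕ) + 1 < n
  · have h2 : c ≠ ⟨k + 1, h⟩ := fun h => by rw [h] at hc; simp only at hc; omega
    simp [simpleD_of_lt k h, Root.vec, h1, h2]
  · have h2 : c ≠ ⟨(k : ℕ) - 1, lt_of_le_of_lt (Nat.sub_le _ _) k.2⟩ := fun h => by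
      rw [h] at hc; simp only at hc; omega
    simp [simpleD_last k h, Root.vec, h1, h2]

theorem span_D (hm : 3 ≤ m) (hmn : m ≤ n) (S : Submodule ℤ (Fin n → ℤ))
    (hS : ∀ k : Fin n, n ≤ (k : ℕ) + m → (simpleD n k).vec ∈ S) (i j : Fin n ⊕ Fin n)
    (hi : n - m ≤ (idxD i : ℕ)) (hj : n - m ≤ (idxD j : ℕ)) : wtD i - wtD j ∈ S := by
  refine wtD_sub_mem S (fun a b ha hab => ?_) ?_ i j hi hj
  · have h := hS a (by omega)
    rw [simpleD_of_lt a (by omega)] at h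
    rwa [Fin.ext (a := b) (b := ⟨a + 1, by omega⟩) hab]
  · refine ⟨⟨n - 1 - 1, by omega⟩, ⟨n - 1, by omega⟩, by simp only; omega, by simp only; omega, ?_⟩
    have h := hS ⟨n - 1, by omega⟩ (by simp only; omega)
    rwa [simpleD_last _ (by simp only; omega)] at h

theorem simpleD_mem (hn : 2 ≤ n) (k : Fin n) :
    IsRootD (simpleD n k) ∧ (∑ c, rhoD n c * (simpleD n k).vec c) / 2 = 1 := by
  by_cases h : (k : ℕ) + 1 < n
  · rw [simpleD_of_lt k h]
    refine ⟨fun e => ?_, Root.half_dot ?_⟩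
    · have := congrArg Fin.val e
      simp at this
    · rw [Root.dot_vec]
      simp only [rhoD]
      push_cast
      ring
  · rw [simpleD_last k h]
    refine ⟨(by omega : (k : ℕ) - 1 < k), Root.half_dot ?_⟩
    rw [Root.dot_vec]
    simp only [rhoD]
    omega

/-- The inner pairings are the even numbers from -(2m - 2) to 2m - 2. Modulo 4m - 4 the two extremes
coincide, and 0 is attained by both ±χ_n. -/
theorem exists_residue_D (hm : 3 ≤ m) (hmn : m ≤ n) (x : ℤ) :
    ∃ j : Fin n ⊕ Fin n, (∀ c : Fin n, (c : ℕ) < n - m → wtD j c = 0) ∧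
      2 * x ≡ rhoD n ⬝ᵥ wtD j [ZMOD (2 * (2 * m - 2) : ℕ)] := by
  -- Replacing m by m + 1 turns d = 2m - 2 into 2m, without truncated subtraction.
  obtain ⟨m, rfl⟩ : ∃ k, m = k + 1 := ⟨m - 1, by omega⟩
  have h0 : (0 : ℤ) < 2 * (m : ℤ) := by omega
  have h1 := Int.emod_nonneg x h0.ne'
  have h2 := Int.emod_lt_of_pos x h0
  have h3 := Int.mul_ediv_add_emod x (2 * m)
  generalize x % (2 * m) = y at *
  generalize x / (2 * m) = q at *
  lift y to ℕ using h1
  have h5 : ((2 * (2 * (m + 1) - 2) : ℕ) : ℤ) = 2 * (2 * m) := by omega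
  rw [h5]
  by_cases hy : y ≤ m
  · refine ⟨.inl ⟨n - 1 - y, by omega⟩, inner_D_iff.2 (by simp [idxD]; omega), ?_⟩
    rw [dot_wtD, Int.modEq_iff_dvd]
    refine ⟨-q, ?_⟩
    have h4 : ((n - 1 - y : ℕ) : ℤ) = n - 1 - y := by omega
    simp only [rhoD, h4]
    linear_combination 2 * h3
  · refine ⟨.inr ⟨n - 1 - (2 * m - y), by omega⟩, inner_D_iff.2 (by simp [idxD]; omega), ?_⟩
    rw [dot_wtD, Int.modEq_iff_dvd]
    refine ⟨-q - 1, ?_⟩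
    have h4 : ((n - 1 - (2 * m - y) : ℕ) : ℤ) = n - 1 - (2 * m - y) := by omega
    simp only [rhoD, h4]
    linear_combination 2 * h3

theorem even_rhoD_wtD (i : Fin n ⊕ Fin n) : ∃ x, rhoD n ⬝ᵥ wtD i = 2 * x := by
  rw [dot_wtD]
  cases i with
  | inl i => exact ⟨n - 1 - (i : ℕ), by simp only [rhoD]⟩
  | inr i => exact ⟨-(n - 1 - (i : ℕ)), by simp only [rhoD]; ring⟩

theorem exists_congr_D (hm : 3 ≤ m) (hmn : m ≤ n) (i : Fin n ⊕ Fin n) :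
    ∃ j : Fin n ⊕ Fin n, (∀ c : Fin n, (c : ℕ) < n - m → wtD j c = 0) ∧
      rhoD n ⬝ᵥ wtD i ≡ rhoD n ⬝ᵥ wtD j [ZMOD (2 * (2 * m - 2) : ℕ)] := by
  obtain ⟨x, hx⟩ := even_rhoD_wtD i
  rw [hx]
  exact exists_residue_D hm hmn x

theorem exists_succ_D (hm : 3 ≤ m) (hmn : m ≤ n) (i : Fin n ⊕ Fin n) :
    ∃ j : Fin n ⊕ Fin n, (∀ c : Fin n, (c : ℕ) < n - m → wtD j c = 0) ∧
      rhoD n ⬝ᵥ wtD j ≡ rhoD n ⬝ᵥ wtD i + 2 [ZMOD (2 * (2 * m - 2) : ℕ)] := by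
  obtain ⟨x, hx⟩ := even_rhoD_wtD i
  obtain ⟨j, hj, h⟩ := exists_residue_D hm hmn (x + 1)
  refine ⟨j, hj, ?_⟩
  rw [hx, show 2 * x + 2 = 2 * (x + 1) by ring]
  exact h.symm

theorem eq_of_rhoD_wtD {j j' : Fin n ⊕ Fin n} (h : rhoD n ⬝ᵥ wtD j = rhoD n ⬝ᵥ wtD j')
    (h0 : rhoD n ⬝ᵥ wtD j ≠ 0) : j = j' := by
  rw [dot_wtD] at h h0
  rw [dot_wtD] at h
  cases j with
  | inl j => cases j' with
    | inl j' =>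
      simp only [rhoD] at h
      rw [Fin.ext (a := j) (b := j') (by omega)]
    | inr j' =>
      simp only [rhoD] at h h0
      omega
  | inr j => cases j' with
    | inl j' =>
      simp only [rhoD] at h h0
      omega
    | inr j' =>
      simp only [rhoD] at h
      rw [Fin.ext (a := j) (b := j') (by omega)]

theorem rhoD_wtD_le (hmn : m ≤ n) {j : Fin n ⊕ Fin n} (hj : n - m ≤ (idxD j : ℕ)) :
    rhoD n ⬝ᵥ wtD j ≤ 2 * m - 2 ∧ -(2 * m - 2) ≤ rhoD n ⬝ᵥ wtD j := by
  rw [dot_wtD]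
  cases j <;> simp only [idxD, Sum.elim_inl, Sum.elim_inr, id, rhoD] at hj ⊢ <;> omega

theorem unique_D (hm : 3 ≤ m) (hmn : m ≤ n) {j j' k k' : Fin n ⊕ Fin n}
    (hj : n - m ≤ (idxD j : ℕ)) (hj' : n - m ≤ (idxD j' : ℕ))
    (hk : n - m ≤ (idxD k : ℕ)) (hk' : n - m ≤ (idxD k' : ℕ))
    (h : rhoD n ⬝ᵥ wtD j ≡ rhoD n ⬝ᵥ wtD j' [ZMOD (2 * (2 * m - 2) : ℕ)])
    (h1 : rhoD n ⬝ᵥ wtD k ≡ rhoD n ⬝ᵥ wtD j + 2 [ZMOD (2 * (2 * m - 2) : ℕ)])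
    (h2 : rhoD n ⬝ᵥ wtD k' ≡ rhoD n ⬝ᵥ wtD j + 2 [ZMOD (2 * (2 * m - 2) : ℕ)]) :
    j = j' ∨ k = k' := by
  have e1 := eq_of_rhoD_wtD (j := j) (j' := j')
  have e2 := eq_of_rhoD_wtD (j := k) (j' := k')
  have b1 := rhoD_wtD_le hmn hj
  have b2 := rhoD_wtD_le hmn hj'
  have b3 := rhoD_wtD_le hmn hk
  have b4 := rhoD_wtD_le hmn hk'
  have h5 : ((2 * (2 * m - 2) : ℕ) : ℤ) = 2 * (2 * m - 2) := by omega
  rw [h5] at h h1 h2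
  have c0 := modEq_cases h (by omega) (by omega)
  have c1 := modEq_cases h1 (by omega) (by omega)
  have c2 := modEq_cases h2 (by omega) (by omega)
  -- The doubled residues are 0 and 2m - 2, which differ by more than one step of 2 since m ≥ 3. If
  -- the class of j is not seen to be a singleton, it is one of these, and the next class is a
  -- singleton.
  by_cases e : rhoD n ⬝ᵥ wtD j = rhoD n ⬝ᵥ wtD j' ∧ rhoD n ⬝ᵥ wtD j ≠ 0
  · exact Or.inl (e1 e.1 e.2)
  · exact Or.inr (e2 (by omega) (by omega))

/-- The pairings are even and 2d is divisible by 4. If wt j = ± wt k, the congruence would give 2 ≡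
0 modulo 4, so wt k - wt j is neither 0 nor twice a weight. -/
theorem inner_root_D (hm : 3 ≤ m) {j k : Fin n ⊕ Fin n}
    (h : rhoD n ⬝ᵥ wtD k ≡ rhoD n ⬝ᵥ wtD j + 2 [ZMOD (2 * (2 * m - 2) : ℕ)]) :
    ∃ α : Root n, IsRootD α ∧ α.vec = wtD k - wtD j := by
  obtain ⟨x, hx⟩ := even_rhoD_wtD k
  have h1 := (Int.modEq_iff_dvd.1 h)
  have h5 : ((2 * (2 * m - 2) : ℕ) : ℤ) = 4 * (m - 1) := by omega
  rw [h5] at h1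
  obtain ⟨q, hq⟩ := h1
  rw [mul_assoc] at hq
  refine exists_root_of_ne_bar ?_ ?_
  · rintro rfl
    rw [wtD_bar, dotProduct_neg] at hq
    omega
  · rintro rfl
    omega

theorem psi_outer_D (hm : 3 ≤ m) {γ : Root n} (hγ : IsPosRootD γ)
    (h : (∑ k, rhoD n k * γ.vec k) / 2 ≡ 0 [ZMOD ((2 * m - 2 : ℕ) : ℤ)]) :
    0 < ∑ c : Fin n, ((n - m - c : ℕ) : ℤ) * γ.vec c := by
  change 0 < (fun c : Fin n => ((n - m - c : ℕ) : ℤ)) ⬝ᵥ γ.vec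
  obtain ⟨hr, hp⟩ := (isPosRootD_iff γ).1 hγ
  have h1 := Int.le_of_dvd hp (Int.modEq_zero_iff_dvd.1 h)
  have h2 := two_mul_ht_D (α := γ)
  generalize (∑ k, rhoD n k * γ.vec k) / 2 = x at h1 h2
  rw [Root.dot_vec] at h2 ⊢
  cases γ with
  | sub i j =>
    simp only [rhoD] at h2 ⊢
    omega
  | add i j =>
    have hij : (i : ℕ) < j := hγ
    simp only [rhoD] at h2 ⊢
    omega
  | _ => exact hγ.elim

theorem ht_le_D (hm : 3 ≤ m) {α : Root n} (hα : IsRootD α)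
    (h : ∀ c : Fin n, (c : ℕ) < n - m → α.vec c = 0) :
    (∑ k, rhoD n k * α.vec k) / 2 ≤ ((2 * m - 3 : ℕ) : ℤ) := by
  have h2 := two_mul_ht_D (α := α)
  generalize (∑ k, rhoD n k * α.vec k) / 2 = x at h2
  rw [Root.dot_vec] at h2
  cases α with
  | sub i j =>
    have hij : i ≠ j := hα
    have : ¬ (i : ℕ) < n - m := fun h0 => by
      have := h i h0
      simp [Root.vec, hij] at this
    simp only [rhoD] at h2
    omega
  | add i j =>
    have : ¬ (i : ℕ) < n - m := fun h0 => by
      have := h i h0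
      simp only [Root.vec, Pi.add_apply, Pi.single_apply] at this
      grind
    have hij : (i : ℕ) < j := hα
    simp only [rhoD] at h2
    omega
  | negAdd i j =>
    simp only [rhoD] at h2
    omega
  | _ => exact hα.elim

theorem exists_highest_D (hm : 3 ≤ m) (hmn : m ≤ n) (S : Submodule ℤ (Fin n → ℤ))
    (hS : ∀ k : Fin n, n ≤ (k : ℕ) + m → (simpleD n k).vec ∈ S) :
    ∃ α : Root n, IsRootD α ∧ (∑ k, rhoD n k * α.vec k) / 2 = ((2 * m - 3 : ℕ) : ℤ) ∧ α.vec ∈ S := by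
  refine ⟨.add ⟨n - m, by omega⟩ ⟨n - m + 1, by omega⟩, Nat.lt_succ_self _, Root.half_dot ?_, ?_⟩
  · rw [Root.dot_vec]
    simp only [rhoD]
    omega
  · have := span_D hm hmn S hS (.inl ⟨n - m, by omega⟩) (.inr ⟨n - m + 1, by omega⟩)
      (by simp [idxD]) (by simp [idxD])
    rwa [wtD_sub] at this

theorem outer_root_D {i : Fin n ⊕ Fin n} {c : Fin n} {j : Fin n ⊕ Fin n} (hc : (c : ℕ) < n - m)
    (hi : wtD i = Pi.single c 1) (hj : n - m ≤ (idxD j : ℕ)) :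
    ∃ α : Root n, IsPosRootD α ∧ α.vec = wtD i - wtD j := by
  rw [wtD_eq_single hi]
  cases j with
  | inl j => exact ⟨.sub c j, (by simp [idxD] at hj; omega : (c : ℕ) < j), rfl⟩
  | inr j => exact ⟨.add c j, (by simp [idxD] at hj; omega : (c : ℕ) < j), (wtD_sub (.inl c) (.inr j)).symm⟩

end D

theorem leviCoxeter_D {n m : ℕ} (hm : 3 ≤ m) (hmn : m ≤ n) :
    (lieD n).leviCoxeter (admissible (lieD n) m) = 2 * m - 2 :=
  (leviCoxeter_eq (𝔤 := lieD n) (simpleD_outer hm) (fun _ hα h => ht_le_D hm hα h)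
    (exists_highest_D hm hmn _ fun _ hk => vec_mem_span (𝔤 := lieD n) hk)).trans (by omega)

theorem leviData_D {n m : ℕ} (hm : 3 ≤ m) (hmn : m ≤ n) : LeviData (stdD n) m (2 * m - 2) where
  two_le := by omega
  wt_cases := wtD_cases
  wt_surj c := ⟨.inl c, rfl⟩
  wt_neg _ _ _ k := ⟨barD k, wtD_bar k⟩
  inner_span i j hi hj := span_D hm hmn _ (fun _ hk => vec_mem_span (𝔤 := lieD n) hk) i j
    (inner_D_iff.1 hi) (inner_D_iff.1 hj)
  simple_outer := simpleD_outer hm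
  simple_mem := simpleD_mem (by omega : 2 ≤ n)
  exists_congr := exists_congr_D hm hmn
  exists_succ := exists_succ_D hm hmn
  unique _ _ _ _ hj hj' hk hk' := unique_D hm hmn (inner_D_iff.1 hj) (inner_D_iff.1 hj')
    (inner_D_iff.1 hk) (inner_D_iff.1 hk')
  inner_root _ _ _ _ h := inner_root_D hm h
  psi_outer _ hγ := psi_outer_D hm hγ.1 hγ.2
  outer_root _ _ _ hc hi hj := outer_root_D hc hi (inner_D_iff.1 hj)

end ToricPairs

namespace ToricPairs
open Matrix

attribute [local instance 100] LieRing.ofAssociativeRing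

/-! ### Levi subgroups in type B -/

section B

variable {n m : ℕ}

theorem wtB_cases (i : Unit ⊕ (Fin n ⊕ Fin n)) :
    wtB i = 0 ∨ (∃ c, wtB i = Pi.single c 1) ∨ ∃ c, wtB i = -Pi.single c 1 := by
  rcases i with _ | i
  · exact Or.inl rfl
  · exact wtD_cases i

theorem wtB_eq_single {i : Unit ⊕ (Fin n ⊕ Fin n)} {c : Fin n} (h : wtB i = Pi.single c 1) :
    i = .inr (.inl c) :=
  wtB_injective (h.trans rfl)

theorem dot_wtB (w : Fin n → ℤ) (i : Unit ⊕ (Fin n ⊕ Fin n)) :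
    w ⬝ᵥ wtB i = match i with
      | .inl _ => 0
      | .inr (.inl i) => w i
      | .inr (.inr i) => -w i := by
  rcases i with _ | i | i <;> simp [wtB, wtD]

theorem simpleB_of_lt (k : Fin n) (h : (k : ℕ) + 1 < n) : simpleB n k = .sub k ⟨k + 1, h⟩ :=
  dif_pos h

theorem simpleB_last (k : Fin n) (h : ¬ (k : ℕ) + 1 < n) : simpleB n k = .pos k := dif_neg h

theorem simpleB_outer (k : Fin n) (hk : n ≤ (k : ℕ) + m) (c : Fin n) (hc : (c : ℕ) < n - m) :
    (simpleB n k).vec c = 0 := by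
  have h1 : c ≠ k := fun h => by rw [h] at hc; omega
  by_cases h : (k : ℕ) + 1 < n
  · have h2 : c ≠ ⟨k + 1, h⟩ := fun h => by rw [h] at hc; simp only at hc; omega
    simp [simpleB_of_lt k h, Root.vec, h1, h2]
  · simp [simpleB_last k h, Root.vec, h1]

theorem inner_B_iff {p : ℕ} {i : Fin n ⊕ Fin n} :
    (∀ c : Fin n, (c : ℕ) < p → wtB (.inr i) c = 0) ↔ p ≤ (idxD i : ℕ) := inner_D_iff

/-- In type B the last simple root is itself the weight χ_n, so inner weights, and not only their
differences, lie in the span. -/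
theorem wtB_mem (hm : 1 ≤ m) (hmn : m ≤ n) (S : Submodule ℤ (Fin n → ℤ))
    (hS : ∀ k : Fin n, n ≤ (k : ℕ) + m → (simpleB n k).vec ∈ S) (i : Unit ⊕ (Fin n ⊕ Fin n))
    (hi : ∀ c : Fin n, (c : ℕ) < n - m → wtB i c = 0) : wtB i ∈ S := by
  rcases i with _ | i
  · exact S.zero_mem
  · have hl : (Pi.single ⟨n - 1, by omega⟩ 1 : Fin n → ℤ) ∈ S := by
      have h := hS ⟨n - 1, by omega⟩ (by simp only; omega)
      rwa [simpleB_last _ (by simp only; omega)] at h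
    have h : wtD i - wtD (.inl ⟨n - 1, by omega⟩) ∈ S := by
      refine wtD_sub_mem S (fun a b ha hab => ?_)
        ⟨⟨n - 1, by omega⟩, ⟨n - 1, by omega⟩, by simp only; omega, by simp only; omega,
          S.add_mem hl hl⟩ i _ (inner_B_iff.1 hi) (by simp [idxD]; omega)
      have h := hS a (by omega)
      rw [simpleB_of_lt a (by omega)] at h
      rwa [Fin.ext (a := b) (b := ⟨a + 1, by omega⟩) hab]
    exact (S.sub_mem_iff_left hl).1 h

theorem simpleB_mem (k : Fin n) :
    IsRootB (simpleB n k) ∧ (∑ c, rhoB n c * (simpleB n k).vec c) / 2 = 1 := by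
  by_cases h : (k : ℕ) + 1 < n
  · rw [simpleB_of_lt k h]
    refine ⟨fun e => ?_, Root.half_dot ?_⟩
    · have := congrArg Fin.val e
      simp at this
    · rw [Root.dot_vec]
      simp only [rhoB]
      push_cast
      ring
  · rw [simpleB_last k h]
    refine ⟨trivial, Root.half_dot ?_⟩
    rw [Root.dot_vec]
    simp only [rhoB]
    omega

/-- The inner pairings are the even numbers from -2m to 2m; modulo 4m only the two extremes
coincide. The zero weight represents the residue 0. -/
theorem exists_residue_B (hm : 1 ≤ m) (hmn : m ≤ n) (x : ℤ) :
    ∃ j : Unit ⊕ (Fin n ⊕ Fin n), (∀ c : Fin n, (c : ℕ) < n - m → wtB j c = 0) ∧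
      2 * x ≡ rhoB n ⬝ᵥ wtB j [ZMOD (2 * (2 * m) : ℕ)] := by
  have h0 : (0 : ℤ) < 2 * (m : ℤ) := by omega
  have h1 := Int.emod_nonneg x h0.ne'
  have h2 := Int.emod_lt_of_pos x h0
  have h3 := Int.mul_ediv_add_emod x (2 * m)
  generalize x % (2 * m) = y at *
  generalize x / (2 * m) = q at *
  lift y to ℕ using h1
  rcases Nat.eq_zero_or_pos y with rfl | hpos
  · refine ⟨.inl (), fun _ _ => rfl, ?_⟩
    rw [dot_wtB, Int.modEq_iff_dvd]
    refine ⟨-q, ?_⟩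
    push_cast
    linear_combination 2 * h3
  by_cases hy : y ≤ m
  · refine ⟨.inr (.inl ⟨n - y, by omega⟩), inner_B_iff.2 (by simp [idxD]; omega), ?_⟩
    rw [dot_wtB, Int.modEq_iff_dvd]
    refine ⟨-q, ?_⟩
    have h4 : ((n - y : ℕ) : ℤ) = n - y := by omega
    simp only [rhoB, h4]
    push_cast
    linear_combination 2 * h3
  · refine ⟨.inr (.inr ⟨n - (2 * m - y), by omega⟩), inner_B_iff.2 (by simp [idxD]; omega), ?_⟩
    rw [dot_wtB, Int.modEq_iff_dvd]
    refine ⟨-q - 1, ?_⟩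
    have h4 : ((n - (2 * m - y) : ℕ) : ℤ) = n - (2 * m - y) := by omega
    simp only [rhoB, h4]
    push_cast
    linear_combination 2 * h3

theorem even_rhoB_wtB (i : Unit ⊕ (Fin n ⊕ Fin n)) : ∃ x, rhoB n ⬝ᵥ wtB i = 2 * x := by
  rw [dot_wtB]
  rcases i with _ | i | i
  · exact ⟨0, rfl⟩
  · exact ⟨n - (i : ℕ), by simp only [rhoB]⟩
  · exact ⟨-(n - (i : ℕ)), by simp only [rhoB]; ring⟩

theorem exists_congr_B (hm : 1 ≤ m) (hmn : m ≤ n) (i : Unit ⊕ (Fin n ⊕ Fin n)) :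
    ∃ j : Unit ⊕ (Fin n ⊕ Fin n), (∀ c : Fin n, (c : ℕ) < n - m → wtB j c = 0) ∧
      rhoB n ⬝ᵥ wtB i ≡ rhoB n ⬝ᵥ wtB j [ZMOD (2 * (2 * m) : ℕ)] := by
  obtain ⟨x, hx⟩ := even_rhoB_wtB i
  rw [hx]
  exact exists_residue_B hm hmn x

theorem exists_succ_B (hm : 1 ≤ m) (hmn : m ≤ n) (i : Unit ⊕ (Fin n ⊕ Fin n)) :
    ∃ j : Unit ⊕ (Fin n ⊕ Fin n), (∀ c : Fin n, (c : ℕ) < n - m → wtB j c = 0) ∧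
      rhoB n ⬝ᵥ wtB j ≡ rhoB n ⬝ᵥ wtB i + 2 [ZMOD (2 * (2 * m) : ℕ)] := by
  obtain ⟨x, hx⟩ := even_rhoB_wtB i
  obtain ⟨j, hj, h⟩ := exists_residue_B hm hmn (x + 1)
  refine ⟨j, hj, ?_⟩
  rw [hx, show 2 * x + 2 = 2 * (x + 1) by ring]
  exact h.symm

theorem eq_of_rhoB_wtB {j j' : Unit ⊕ (Fin n ⊕ Fin n)}
    (h : rhoB n ⬝ᵥ wtB j = rhoB n ⬝ᵥ wtB j') : j = j' := by
  rw [dot_wtB, dot_wtB] at h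
  rcases j with _ | j | j <;> rcases j' with _ | j' | j' <;> simp only [rhoB] at h <;>
    first
      | rfl
      | omega
      | rw [Fin.ext (a := j) (b := j') (by omega)]

theorem rhoB_wtB_le (hmn : m ≤ n) {j : Unit ⊕ (Fin n ⊕ Fin n)}
    (hj : ∀ c : Fin n, (c : ℕ) < n - m → wtB j c = 0) :
    rhoB n ⬝ᵥ wtB j ≤ 2 * m ∧ -(2 * m) ≤ rhoB n ⬝ᵥ wtB j := by
  rw [dot_wtB]
  rcases j with _ | j | j
  · simp
  · rw [inner_B_iff] at hj
    simp only [idxD, Sum.elim_inl, id, rhoB] at hj ⊢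
    omega
  · rw [inner_B_iff] at hj
    simp only [idxD, Sum.elim_inr, id, rhoB] at hj ⊢
    omega

theorem unique_B (hm : 1 ≤ m) (hmn : m ≤ n) (j j' k k' : Unit ⊕ (Fin n ⊕ Fin n))
    (hj : ∀ c : Fin n, (c : ℕ) < n - m → wtB j c = 0)
    (hj' : ∀ c : Fin n, (c : ℕ) < n - m → wtB j' c = 0)
    (hk : ∀ c : Fin n, (c : ℕ) < n - m → wtB k c = 0)
    (hk' : ∀ c : Fin n, (c : ℕ) < n - m → wtB k' c = 0)
    (h : rhoB n ⬝ᵥ wtB j ≡ rhoB n ⬝ᵥ wtB j' [ZMOD (2 * (2 * m) : ℕ)])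
    (h1 : rhoB n ⬝ᵥ wtB k ≡ rhoB n ⬝ᵥ wtB j + 2 [ZMOD (2 * (2 * m) : ℕ)])
    (h2 : rhoB n ⬝ᵥ wtB k' ≡ rhoB n ⬝ᵥ wtB j + 2 [ZMOD (2 * (2 * m) : ℕ)]) :
    j = j' ∨ k = k' := by
  have e1 := eq_of_rhoB_wtB (j := j) (j' := j')
  have e2 := eq_of_rhoB_wtB (j := k) (j' := k')
  have b1 := rhoB_wtB_le hmn hj
  have b2 := rhoB_wtB_le hmn hj'
  have b3 := rhoB_wtB_le hmn hk
  have b4 := rhoB_wtB_le hmn hk'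
  have h5 : ((2 * (2 * m) : ℕ) : ℤ) = 2 * (2 * m) := by omega
  rw [h5] at h h1 h2
  have c0 := modEq_cases h (by omega) (by omega)
  have c1 := modEq_cases h1 (by omega) (by omega)
  have c2 := modEq_cases h2 (by omega) (by omega)
  -- If j and j' have different pairings these are ±2m, and the next residue, that of 2 - 2m,
  -- belongs to a single inner weight.
  by_cases e : rhoB n ⬝ᵥ wtB j = rhoB n ⬝ᵥ wtB j'
  · exact Or.inl (e1 e)
  · exact Or.inr (e2 (by omega))

theorem inner_root_B {j k : Unit ⊕ (Fin n ⊕ Fin n)}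
    (h : rhoB n ⬝ᵥ wtB k ≡ rhoB n ⬝ᵥ wtB j + 2 [ZMOD (2 * (2 * m) : ℕ)]) :
    ∃ α : Root n, IsRootB α ∧ α.vec = wtB k - wtB j := by
  obtain ⟨x, hx⟩ := even_rhoB_wtB k
  have h1 := (Int.modEq_iff_dvd.1 h)
  have h5 : ((2 * (2 * m) : ℕ) : ℤ) = 4 * m := by omega
  rw [h5] at h1
  obtain ⟨q, hq⟩ := h1
  rw [mul_assoc] at hq
  refine exists_root_of_ne_barB ?_ ?_
  · rintro rfl
    rw [wtB_bar, dotProduct_neg] at hq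
    omega
  · rintro rfl
    omega

theorem psi_outer_B (hm : 1 ≤ m) {γ : Root n} (hγ : IsPosRootB γ)
    (h : (∑ k, rhoB n k * γ.vec k) / 2 ≡ 0 [ZMOD ((2 * m : ℕ) : ℤ)]) :
    0 < ∑ c : Fin n, ((n - m - c : ℕ) : ℤ) * γ.vec c := by
  change 0 < (fun c : Fin n => ((n - m - c : ℕ) : ℤ)) ⬝ᵥ γ.vec
  obtain ⟨hr, hp⟩ := (isPosRootB_iff γ).1 hγ
  have h1 := Int.le_of_dvd hp (Int.modEq_zero_iff_dvd.1 h)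
  have h2 := two_mul_ht_B (α := γ)
  generalize (∑ k, rhoB n k * γ.vec k) / 2 = x at h1 h2
  rw [Root.dot_vec] at h2 ⊢
  cases γ with
  | sub i j =>
    simp only [rhoB] at h2 ⊢
    omega
  | add i j =>
    have hij : (i : ℕ) < j := hγ
    simp only [rhoB] at h2 ⊢
    omega
  | pos i =>
    simp only [rhoB] at h2 ⊢
    omega
  | _ => exact hγ.elim

theorem ht_le_B (hm : 1 ≤ m) {α : Root n} (hα : IsRootB α)
    (h : ∀ c : Fin n, (c : ℕ) < n - m → α.vec c = 0) :
    (∑ k, rhoB n k * α.vec k) / 2 ≤ ((2 * m - 1 : ℕ) : ℤ) := by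
  have h2 := two_mul_ht_B (α := α)
  generalize (∑ k, rhoB n k * α.vec k) / 2 = x at h2
  rw [Root.dot_vec] at h2
  cases α with
  | sub i j =>
    have hij : i ≠ j := hα
    have : ¬ (i : ℕ) < n - m := fun h0 => by
      have := h i h0
      simp [Root.vec, hij] at this
    simp only [rhoB] at h2
    omega
  | add i j =>
    have : ¬ (i : ℕ) < n - m := fun h0 => by
      have := h i h0
      simp only [Root.vec, Pi.add_apply, Pi.single_apply] at this
      grind
    have hij : (i : ℕ) < j := hα
    simp only [rhoB] at h2
    omega
  | pos i =>
    have : ¬ (i : ℕ) < n - m := fun h0 => by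
      have := h i h0
      simp [Root.vec] at this
    simp only [rhoB] at h2
    omega
  | _ =>
    simp only [rhoB] at h2
    omega

theorem exists_highest_B (hm : 1 ≤ m) (hmn : m ≤ n) (S : Submodule ℤ (Fin n → ℤ))
    (hS : ∀ k : Fin n, n ≤ (k : ℕ) + m → (simpleB n k).vec ∈ S) :
    ∃ α : Root n, IsRootB α ∧ (∑ k, rhoB n k * α.vec k) / 2 = ((2 * m - 1 : ℕ) : ℤ) ∧ α.vec ∈ S := by
  have hf := wtB_mem hm hmn S hS (.inr (.inl ⟨n - m, by omega⟩))
    (inner_B_iff.2 (by simp [idxD]))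
  -- The highest root is the sum of the first two inner coordinate vectors; for m = 1 there is only
  -- one, and the short root χ_n takes its place.
  rcases eq_or_lt_of_le hm with rfl | hm'
  · refine ⟨.pos ⟨n - 1, by omega⟩, trivial, Root.half_dot ?_, hf⟩
    rw [Root.dot_vec]
    simp only [rhoB]
    omega
  · refine ⟨.add ⟨n - m, by omega⟩ ⟨n - m + 1, by omega⟩, Nat.lt_succ_self _, Root.half_dot ?_, ?_⟩
    · rw [Root.dot_vec]
      simp only [rhoB]
      omega
    · exact S.add_mem hf (wtB_mem hm hmn S hS (.inr (.inl ⟨n - m + 1, by omega⟩))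
        (inner_B_iff.2 (by simp [idxD])))

theorem outer_root_B {i : Unit ⊕ (Fin n ⊕ Fin n)} {c : Fin n} {j : Unit ⊕ (Fin n ⊕ Fin n)}
    (hc : (c : ℕ) < n - m)
    (hi : wtB i = Pi.single c 1) (hj : ∀ c : Fin n, (c : ℕ) < n - m → wtB j c = 0) :
    ∃ α : Root n, IsPosRootB α ∧ α.vec = wtB i - wtB j := by
  rw [wtB_eq_single hi]
  rcases j with _ | j | j
  · exact ⟨.pos c, trivial, (wtB_sub c (.inr (.inl c)) (.inl ())).symm⟩
  · rw [inner_B_iff] at hj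
    exact ⟨.sub c j, (by simp [idxD] at hj; omega : (c : ℕ) < j), rfl⟩
  · rw [inner_B_iff] at hj
    exact ⟨.add c j, (by simp [idxD] at hj; omega : (c : ℕ) < j), (wtD_sub (.inl c) (.inr j)).symm⟩

end B

theorem leviCoxeter_B {n m : ℕ} (hm : 1 ≤ m) (hmn : m ≤ n) :
    (lieB n).leviCoxeter (admissible (lieB n) m) = 2 * m :=
  (leviCoxeter_eq (𝔤 := lieB n) simpleB_outer (fun _ hα h => ht_le_B hm hα h)
    (exists_highest_B hm hmn _ fun _ hk => vec_mem_span (𝔤 := lieB n) hk)).trans (by omega)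

theorem leviData_B {n m : ℕ} (hm : 1 ≤ m) (hmn : m ≤ n) : LeviData (stdB n) m (2 * m) where
  two_le := by omega
  wt_cases := wtB_cases
  wt_surj c := ⟨.inr (.inl c), rfl⟩
  wt_neg _ _ _ k := ⟨barB k, wtB_bar k⟩
  inner_span i j hi hj := Submodule.sub_mem _
    (wtB_mem hm hmn _ (fun _ hk => vec_mem_span (𝔤 := lieB n) hk) i hi)
    (wtB_mem hm hmn _ (fun _ hk => vec_mem_span (𝔤 := lieB n) hk) j hj)
  simple_outer := simpleB_outer
  simple_mem := simpleB_mem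
  exists_congr := exists_congr_B hm hmn
  exists_succ := exists_succ_B hm hmn
  unique := unique_B hm hmn
  inner_root _ _ _ _ h := inner_root_B h
  psi_outer _ hγ := psi_outer_B hm hγ.1 hγ.2
  outer_root _ _ _ hc hi hj := outer_root_B hc hi hj

/-! ### The characteristic -/

/-- The Coxeter number is at least 2, as a simple root has height 1, so a positive characteristic
above it is odd. This is the form in which the hypothesis on the characteristic enters. -/
theorem ringChar_ne_two {𝔤 : RootedLieAlgebra} {K : Type*} [Field K]
    (h : ∃ α ∈ 𝔤.roots, 𝔤.ht α = 1)
    (hK : ringChar K = 0 ∨ 𝔤.coxeter 𝔤.roots < ringChar K) : ringChar K ≠ 2 := by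
  have h2 := two_le_coxeter_roots h
  omega

theorem ChevalleyModule.isToric_of_leviData {𝔤 : RootedLieAlgebra} {D : StdData 𝔤} {m d : ℕ}
    (M : LeviData D m d) (hd : 𝔤.leviCoxeter (admissible 𝔤 m) = d) (hn : 0 < 𝔤.n) {K : Type*}
    [Field K] [IsAlgClosed K] (hK : ringChar K = 0 ∨ 𝔤.coxeter 𝔤.roots < ringChar K)
    (V : ChevalleyModule 𝔤) : V.IsToric K (admissible 𝔤 m) := by
  subst hd
  exact V.isToric (ringChar_ne_two ⟨_, M.simple_mem ⟨0, hn⟩⟩ hK) M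

end ToricPairs

end

theorem theoremt (K : Type*) [Field K] [IsAlgClosed K] (t : ToricPairs.Kind) (n m : ℕ)
    (hm : t.IsAdmissible n m)
    (hK : ringChar K = 0 ∨ (t.lie n).coxeter (t.lie n).roots < ringChar K)
    (V : ToricPairs.ChevalleyModule (t.lie n)) :
    V.IsToric K (ToricPairs.admissible (t.lie n) m) := by
  have hm' : 1 ≤ m ∧ m ≤ n := by
    cases t with
    | D => exact ⟨le_trans (by norm_num) hm.1, hm.2⟩
    | _ => exact hm
  have hn : 0 < n := lt_of_lt_of_le hm'.1 hm'.2
  rcases t with _ | _ | _ | _ | _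
  · exact ToricPairs.ChevalleyModule.isToric_of_leviData
      (ToricPairs.leviData_GL hm'.1 hm'.2) (ToricPairs.leviCoxeter_GL hm'.1 hm'.2) hn hK V
  · exact ToricPairs.ChevalleyModule.isToric_of_leviData
      (ToricPairs.leviData_A hm'.1 hm'.2) (ToricPairs.leviCoxeter_A hm'.1 hm'.2) hn hK V
  · exact ToricPairs.ChevalleyModule.isToric_of_leviData
      (ToricPairs.leviData_B hm'.1 hm'.2) (ToricPairs.leviCoxeter_B hm'.1 hm'.2) hn hK V
  · exact ToricPairs.ChevalleyModule.isToric_of_leviData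
      (ToricPairs.leviData_C hm'.1 hm'.2) (ToricPairs.leviCoxeter_C hm'.1 hm'.2) hn hK V
  · exact ToricPairs.ChevalleyModule.isToric_of_leviData
      (ToricPairs.leviData_D hm.1 hm.2) (ToricPairs.leviCoxeter_D hm.1 hm.2) hn hK V
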